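/- Let $N\ge 2$, $a,\eta>0$, let $B$ be the ball of radius $a$ centred at $0$ in $\mathbb R^3$, $\sigma$ the surface measure and $n$ the unit normal of $\partial B$, and let $$G(r)=\frac1{8\pi\eta}\Big(\frac{\mathrm{Id}}{|r|}+\frac{r\otimes r}{|r|^3}\Big).$$ Write $H^{1/2}=H^{1/2}(\partial B,\mathbb R^3)$, let $H^{-1/2}$ be its dual, $H^{\pm1/2}_N=(H^{\pm1/2})^N$, and let $\langle f,\mathrm{Id}\rangle=\int_{\partial B}f\,d\sigma\in\mathbb R^3$ for $f\in H^{-1/2}$. For $x=(x_1,\dots,x_N)\in(\mathbb R^3)^N$ put $\delta(x)=\min_{i<j}|x_i-x_j|$, $S_N=\{x:\delta(x)>2a\}$, $r_{ij}=|x_i-x_j|$, $e_{ij}=(x_i-x_j)/r_{ij}$, $S_{ij}=\frac1{r_{ij}}(\mathrm{Id}+e_{ij}\otimes e_{ij})$. For $x\in S_N$ define $$(T_xf)_i(r)=\sum_{j=1}^N\langle f_j,G(x_i-x_j+r-\cdot)\rangle_{\partial B},\qquad (\overline T f)(r)=\int_{\partial B}G(r-s)f(s)\,d\sigma(s),\qquad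 r\in\partial B,$$ where the integral operators $f\mapsto\int_{\partial B}G(z+r-s)f(s)\,d\sigma(s)$ ($z=0$ or $|z|>2a$) are extended by continuity from $L^2(\partial B)$ to continuous operators $H^{-1/2}\to H^{1/2}$; these extensions exist. All constants $O(\cdot)$ below depend only on $N,a,\eta$, and the estimates hold for all $x\in S_N$ with $\delta(x)$ large enough. 1. For every $f\in H^{-1/2}_N$ and every $i$, $$(T_xf)_i=\overline T f_i+\frac1{8\pi\eta}\sum_{j\ne i}S_{ij}\langle f_j,\mathrm{Id}\rangle+O(\delta^{-2})\|f\|_{H^{-1/2}_N}\quad\text{in }H^{1/2}.$$ 2. The kernel of $\overline T$ is $\mathbb R n$, and $\overline T$ is a bijection from $\{f\in H^{-1/2}:\langle f,n\rangle=0\}$ onto $\{g\in H^{1/2}:\int_{\partial B}g\cdot n\,d\sigma=0\}$. If $\delta(x)$ is large enough, the kernel of $T_x$ is $(\mathbb R n)^N$, and $T_x$ is a bijection from $\{f\in H^{-1/2}_N:\langle f_i,n\rangle=0\ \forall i\}$ onto $\{g\in H^{1/2}_N:\int_{\partial B}g_i\cdot n\,d\sigma=0\ \forall i\}$. Denote by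 $\overline T^{-1}$ and $T_x^{-1}$ the inverses of these bijections. For every $g\in H^{1/2}_N$ with $\int_{\partial B}g_i\cdot n\,d\sigma=0$ for all $i$, and every $i$, $$(T_x^{-1}g)_i=\overline T^{-1}\Big\{g_i-\frac1{8\pi\eta}\sum_{j\ne i}S_{ij}\langle\overline T^{-1}g_j,\mathrm{Id}\rangle\Big\}+O(\delta^{-2})\|g\|_{H^{1/2}_N}\quad\text{in }H^{-1/2}.$$ 3. Let $u_i,\omega_i\in\mathbb R^3$, let $v_i(r)=u_i+\omega_i\times r$ be rigid velocities on the spheres, $f=T_x^{-1}v$, $\|(u,\omega)\|=\max_i|u_i|+\max_i|\omega_i|$. The total force $F=\sum_i\int_{\partial B}f_i\,d\sigma$ and the total torque $\mathbf T=\sum_i\int_{\partial B}(x_i+r)\times f_i(r)\,d\sigma(r)$ with respect to the origin satisfy $$F=6\pi\eta a\sum_{i}u_i-\frac{9\pi\eta a^2}{2}\sum_{i}\sum_{j\ne i}S_{ij}u_j+O(\delta^{-2})\|(u,\omega)\|,$$ $$\mathbf T=6\pi\eta a\sum_{i}x_i\times u_i+O\Big(1+\frac{\max_i|x_i|}{\delta}\Big)\|(u,\omega)\|;$$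 in particular the error of the torque is $O(1)\|(u,\omega)\|$ for configurations with $\max_i|x_i|=O(\delta)$. -/

import Mathlib

namespace StokesBalls

open MeasureTheory Set Filter Topology

/-- The Euclidean space `ℝ³`. -/
abbrev E3 := EuclideanSpace ℝ (Fin 3)

lemma lintegral_ball_translate (y : E3) :
    ∫⁻ w in Metric.ball y 2, ENNReal.ofReal ((‖w - y‖ ^ 2)⁻¹) =
      ∫⁻ w in Metric.ball (0 : E3) 2, ENNReal.ofReal ((‖w‖ ^ 2)⁻¹) := by
  rw [← lintegral_indicator measurableSet_ball, ← lintegral_indicator measurableSet_ball]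
  have := lintegral_sub_right_eq_self (μ := (volume : Measure E3))
    (fun w => (Metric.ball (0 : E3) 2).indicator (fun w => ENNReal.ofReal ((‖w‖ ^ 2)⁻¹)) w) y
  rw [← this]
  refine lintegral_congr fun w => ?_
  by_cases h : ‖w - y‖ < 2
  · rw [indicator_of_mem (by simpa [dist_eq_norm] using h), indicator_of_mem (by simpa using h)]
  · rw [indicator_of_notMem (by simpa [dist_eq_norm] using h),
      indicator_of_notMem (by simpa using h)]

lemma lintegral_inv_sq_ball_lt_top (y : E3) :
    ∫⁻ w in Metric.ball y 2, ENNReal.ofReal ((‖w - y‖ ^ 2)⁻¹) < ⊤ := by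
  have h0 : IntegrableOn (fun x : E3 => (‖x‖ ^ 2)⁻¹) (Metric.ball 0 2) volume := by
    rw [integrableOn_fun_norm_addHaar (μ := (volume : Measure E3)) (f := fun y : ℝ => (y ^ 2)⁻¹)]
    have : Module.finrank ℝ E3 = 3 := by simp
    rw [this]
    refine (integrableOn_congr_fun (g := fun _ => (1 : ℝ)) ?_ measurableSet_Ioo).2 ?_
    · intro x hx
      have : x ≠ 0 := hx.1.ne'
      simp [this]
    · simp
  have h1 : ∫⁻ w in Metric.ball (0 : E3) 2, ENNReal.ofReal ((‖w‖ ^ 2)⁻¹) < ⊤ := by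
    have := h0.2
    rw [hasFiniteIntegral_iff_ofReal] at this
    · exact this
    · exact Filter.Eventually.of_forall fun x => by positivity
  rw [lintegral_ball_translate]
  exact h1

lemma lintegral_sphere_inv_norm_le (y : E3) (hy : ‖y‖ = 1) :
    ∫⁻ ω, ENNReal.ofReal (‖(ω : E3) - y‖⁻¹) ∂(volume : Measure E3).toSphere ≤
      25 * ∫⁻ w in Metric.ball y 2, ENNReal.ofReal ((‖w - y‖ ^ 2)⁻¹) := by
  set F : E3 → ENNReal := (Metric.ball y 2).indicator
    (fun w => ENNReal.ofReal ((‖w - y‖ ^ 2)⁻¹)) with hF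
  have hFm : Measurable F := by
    apply Measurable.indicator _ measurableSet_ball
    fun_prop
  have hpol : ∫⁻ ω, ∫⁻ ρ, F ((ρ : ℝ) • (ω : E3)) ∂(Measure.volumeIoiPow 2)
      ∂(volume : Measure E3).toSphere ≤ ∫⁻ w, F w := by
    have hfr : Module.finrank ℝ E3 - 1 = 2 := by simp
    have hm := (volume : Measure E3).measurePreserving_homeomorphUnitSphereProd
    rw [hfr] at hm
    have h2 := hm.lintegral_comp_emb (Homeomorph.measurableEmbedding _)
      (fun p : Metric.sphere (0 : E3) 1 × Ioi (0 : ℝ) => F ((p.2 : ℝ) • (p.1 : E3)))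
    rw [lintegral_prod _ (by fun_prop)] at h2
    rw [← h2]
    have h3 : ∀ a : ({0}ᶜ : Set E3), F (((homeomorphUnitSphereProd E3 a).2 : ℝ) •
        ((homeomorphUnitSphereProd E3 a).1 : E3)) = F a := by
      intro a
      have : (a : E3) ≠ 0 := a.2
      simp [this]
    simp only [h3]
    rw [lintegral_subtype_comap (measurableSet_singleton _).compl F]
    exact setLIntegral_le_lintegral _ _
  rw [← lintegral_indicator measurableSet_ball]
  refine le_trans ?_ (mul_le_mul_right hpol _)
  rw [← lintegral_const_mul]
  swap
  · apply Measurable.lintegral_prod_right' (f := fun p : Metric.sphere (0 : E3) 1 × Ioi (0 : ℝ) => F ((p.2 : ℝ) • (p.1 : E3)))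
    fun_prop
  refine lintegral_mono fun ω => ?_
  have hω : ‖(ω : E3)‖ = 1 := by simp
  rcases eq_or_ne (ω : E3) y with h | h
  · simp [h]
  set d := ‖(ω : E3) - y‖ with hd
  have hd0 : 0 < d := norm_pos_iff.2 (sub_ne_zero.2 h)
  have hd2 : d ≤ 2 := by
    have := norm_sub_le (ω : E3) y
    linarith
  have key : ENNReal.ofReal (16 / (25 * d ^ 2)) * ENNReal.ofReal (1 / 4) * ENNReal.ofReal (d / 4)
      ≤ ∫⁻ ρ, F ((ρ : ℝ) • (ω : E3)) ∂(Measure.volumeIoiPow 2) := by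
    rw [Measure.volumeIoiPow, lintegral_withDensity_eq_lintegral_mul _ (by fun_prop) (by fun_prop)]
    have e := lintegral_subtype_comap (μ := (volume : Measure ℝ)) measurableSet_Ioi
      (fun r : ℝ => ENNReal.ofReal (r ^ 2) * F (r • (ω : E3))) (s := Ioi (0 : ℝ))
    simp only [Pi.mul_apply]
    rw [e]
    calc _ = ∫⁻ r in Ioo (1 - d / 4) 1, ENNReal.ofReal (1 / 4) * ENNReal.ofReal (16 / (25 * d ^ 2)) := by
            rw [setLIntegral_const, Real.volume_Ioo]
            rw [show (1 : ℝ) - (1 - d / 4) = d / 4 by ring]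
            ring
      _ ≤ ∫⁻ r in Ioo (1 - d / 4) 1, ENNReal.ofReal (r ^ 2) * F (r • (ω : E3)) := by
            refine setLIntegral_mono (by fun_prop) fun r hr => ?_
            have hr0 : 1 / 2 < r := by linarith [hr.1]
            have hn : ‖r • (ω : E3) - y‖ ≤ 5 * d / 4 := by
              have e1 : r • (ω : E3) - y = ((ω : E3) - y) - (1 - r) • (ω : E3) := by
                rw [sub_smul, one_smul]; abel
              have := norm_sub_le ((ω : E3) - y) ((1 - r) • (ω : E3))
              rw [← e1, norm_smul, hω, Real.norm_eq_abs, abs_of_nonneg (by linarith [hr.2])] at this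
              linarith [hr.1]
            have hpos : 0 < ‖r • (ω : E3) - y‖ := by
              rw [norm_pos_iff, sub_ne_zero]
              intro h'
              have : ‖r • (ω : E3)‖ = 1 := by rw [h', hy]
              rw [norm_smul, hω, Real.norm_eq_abs, abs_of_pos (by linarith)] at this
              linarith [hr.2]
            have hb : ‖r • (ω : E3) - y‖ < 2 := by
              calc _ ≤ ‖r • (ω : E3)‖ + ‖y‖ := norm_sub_le _ _
                _ < 2 := by
                  rw [norm_smul, hω, Real.norm_eq_abs, abs_of_pos (by linarith), hy]
                  linarith [hr.2]
            rw [hF, indicator_of_mem (by simpa [dist_eq_norm] using hb)]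
            gcongr
            · nlinarith
            · rw [div_eq_mul_inv, show (25 * d ^ 2 : ℝ) = 16 * (5 * d / 4) ^ 2 by ring, mul_inv,
                ← mul_assoc]
              norm_num
              rw [← inv_pow, ← inv_pow]
              gcongr
      _ ≤ _ := lintegral_mono_set fun r hr => by
            have : 0 < r := by linarith [hr.1]
            exact this
  calc _ = 25 * (ENNReal.ofReal (16 / (25 * d ^ 2)) * ENNReal.ofReal (1 / 4) * ENNReal.ofReal (d / 4)) := by
        rw [← ENNReal.ofReal_mul (by positivity), ← ENNReal.ofReal_mul (by positivity),
          show (25 : ENNReal) = ENNReal.ofReal 25 by simp, ← ENNReal.ofReal_mul (by positivity)]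
        congr 1
        field_simp
        norm_num
    _ ≤ _ := by gcongr

noncomputable section

/-- The surface measure of the sphere `∂B` of radius `a` centred at the origin, as a measure on
`ℝ³`: the surface measure of the unit sphere, pushed forward by `ω ↦ a ω` and multiplied by `a²`. -/
def sphereMeasure (a : ℝ) : Measure E3 :=
  ENNReal.ofReal (a ^ 2) •
    (volume : Measure E3).toSphere.map (fun ω : Metric.sphere (0 : E3) 1 => a • (ω : E3))

instance (a : ℝ) : IsFiniteMeasure (sphereMeasure a) := by
  unfold sphereMeasure
  exact Measure.smul_finite _ ENNReal.ofReal_ne_top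

/-- The measure `dσ(x) dσ(y) / |x - y|³` on `∂B × ∂B`; the exponent is `2 + 2 s` for `s = 1 / 2` on
a surface of dimension `2`. (The diagonal is a null set of `σ × σ`.) -/
def gagliardoMeasure (a : ℝ) : Measure (E3 × E3) :=
  ((sphereMeasure a).prod (sphereMeasure a)).withDensity
    (fun z => ENNReal.ofReal ((‖z.1 - z.2‖ ^ 3)⁻¹))

lemma gagliardoMeasure_ac (a : ℝ) :
    gagliardoMeasure a ≪ (sphereMeasure a).prod (sphereMeasure a) :=
  withDensity_absolutelyContinuous _ _

lemma qmp_fst (a : ℝ) : Measure.QuasiMeasurePreserving Prod.fst (gagliardoMeasure a) (sphereMeasure a) :=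
  Measure.quasiMeasurePreserving_fst.mono_left (gagliardoMeasure_ac a)

lemma qmp_snd (a : ℝ) : Measure.QuasiMeasurePreserving Prod.snd (gagliardoMeasure a) (sphereMeasure a) :=
  Measure.quasiMeasurePreserving_snd.mono_left (gagliardoMeasure_ac a)

lemma lintegral_inv_norm_lt_top (a : ℝ) :
    ∫⁻ z, ENNReal.ofReal (‖z.1 - z.2‖⁻¹) ∂((sphereMeasure a).prod (sphereMeasure a)) < ⊤ := by
  obtain ⟨C, hC, hb⟩ : ∃ C : ENNReal, C < ⊤ ∧ ∀ y : E3, ‖y‖ = 1 →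
      ∫⁻ ω, ENNReal.ofReal (‖(ω : E3) - y‖⁻¹) ∂(volume : Measure E3).toSphere ≤ C := by
    refine ⟨25 * ∫⁻ w in Metric.ball (0 : E3) 2, ENNReal.ofReal ((‖w - 0‖ ^ 2)⁻¹),
      ENNReal.mul_lt_top (by simp) (lintegral_inv_sq_ball_lt_top 0), fun y hy => ?_⟩
    refine (lintegral_sphere_inv_norm_le y hy).trans (le_of_eq ?_)
    rw [lintegral_ball_translate, lintegral_ball_translate]
  have hm : Measurable (fun ω : Metric.sphere (0 : E3) 1 => a • (ω : E3)) := by fun_prop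
  rw [lintegral_prod _ (by fun_prop)]
  unfold sphereMeasure
  simp only [lintegral_smul_measure, smul_eq_mul]
  refine ENNReal.mul_lt_top (by simp) ?_
  rw [lintegral_map (by fun_prop) hm]
  have hin : ∀ ω : Metric.sphere (0 : E3) 1,
      ∫⁻ y, ENNReal.ofReal (‖a • (ω : E3) - y‖⁻¹)
        ∂((volume : Measure E3).toSphere.map (fun ω : Metric.sphere (0 : E3) 1 => a • (ω : E3)))
      ≤ ENNReal.ofReal |a|⁻¹ * C := by
    intro ω
    rw [lintegral_map (by fun_prop) hm]
    have : ∀ ω' : Metric.sphere (0 : E3) 1, ENNReal.ofReal (‖a • (ω : E3) - a • (ω' : E3)‖⁻¹)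
        = ENNReal.ofReal |a|⁻¹ * ENNReal.ofReal (‖(ω' : E3) - ω‖⁻¹) := by
      intro ω'
      rw [← smul_sub, norm_smul, mul_inv, ENNReal.ofReal_mul (by positivity), norm_sub_rev,
        Real.norm_eq_abs]
    simp only [this]
    rw [lintegral_const_mul _ (by fun_prop)]
    gcongr
    exact hb _ (by simp)
  calc _ ≤ ∫⁻ ω, ENNReal.ofReal (a ^ 2) * (ENNReal.ofReal |a|⁻¹ * C) ∂(volume : Measure E3).toSphere := by
        gcongr with ω
        exact hin ω
    _ < ⊤ := by
        rw [lintegral_const]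
        exact ENNReal.mul_lt_top (ENNReal.mul_lt_top (by simp) (ENNReal.mul_lt_top (by simp) hC))
          (measure_lt_top _ _)

/-- The Sobolev space `H^{1/2}(∂B, ℝ³)`: the vector fields `g ∈ L²(∂B)` for which
`∬ |g(x) - g(y)|² / |x - y|³ dσ dσ` is finite, with the norm
`‖g‖² = ∫ |g|² dσ + ∬ |g(x) - g(y)|² / |x - y|³ dσ dσ`.
A field `g` is represented by the pair `(g, (x, y) ↦ g(x) - g(y))`, an element of the Hilbert sum of
two `L²` spaces. -/
def sobolevHalf (a : ℝ) : Submodule ℝ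
    (WithLp 2 (Lp E3 2 (sphereMeasure a) × Lp E3 2 (gagliardoMeasure a))) where
  carrier := {p | p.snd =ᵐ[gagliardoMeasure a] fun z => p.fst z.1 - p.fst z.2}
  zero_mem' := by
    have h := Lp.coeFn_zero E3 2 (sphereMeasure a)
    filter_upwards [Lp.coeFn_zero E3 2 (gagliardoMeasure a), (qmp_fst a).ae_eq_comp h, (qmp_snd a).ae_eq_comp h]
      with z h1 h2 h3
    simp only [Function.comp_apply] at h2 h3
    rw [WithLp.zero_snd, WithLp.zero_fst, h1, h2, h3]
    simp
  add_mem' := by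
    intro p q hp hq
    have h := Lp.coeFn_add p.fst q.fst
    simp only [mem_ofPred_eq] at hp hq
    filter_upwards [Lp.coeFn_add p.snd q.snd, (qmp_fst a).ae_eq_comp h, (qmp_snd a).ae_eq_comp h, hp, hq]
      with z h1 h2 h3 h4 h5
    simp only [Function.comp_apply, Pi.add_apply] at h1 h2 h3
    rw [WithLp.add_snd, WithLp.add_fst, h1, h2, h3, h4, h5]
    abel
  smul_mem' := by
    intro c p hp
    have h := Lp.coeFn_smul c p.fst
    simp only [mem_ofPred_eq] at hp
    filter_upwards [Lp.coeFn_smul c p.snd, (qmp_fst a).ae_eq_comp h, (qmp_snd a).ae_eq_comp h, hp]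
      with z h1 h2 h3 h4
    simp only [Function.comp_apply, Pi.smul_apply] at h1 h2 h3
    rw [WithLp.smul_snd, WithLp.smul_fst, h1, h2, h3, h4, smul_sub]


lemma isClosed_sobolevHalf (a : ℝ) : IsClosed (sobolevHalf a : Set
    (WithLp 2 (Lp E3 2 (sphereMeasure a) × Lp E3 2 (gagliardoMeasure a)))) := by
  refine IsSeqClosed.isClosed fun p q hp hq => ?_
  have h1 : Tendsto (fun n => (p n).fst) atTop (𝓝 q.fst) :=
    ((WithLp.fstL 2 ℝ (Lp E3 2 (sphereMeasure a)) (Lp E3 2 (gagliardoMeasure a))).continuous.tendsto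
      q).comp hq
  have h2 : Tendsto (fun n => (p n).snd) atTop (𝓝 q.snd) :=
    ((WithLp.sndL 2 ℝ (Lp E3 2 (sphereMeasure a)) (Lp E3 2 (gagliardoMeasure a))).continuous.tendsto
      q).comp hq
  obtain ⟨ns, hns, hns'⟩ := (tendstoInMeasure_of_tendsto_Lp h1).exists_seq_tendsto_ae
  have h3 := h2.comp hns.tendsto_atTop
  obtain ⟨ms, hms, hms'⟩ := (tendstoInMeasure_of_tendsto_Lp h3).exists_seq_tendsto_ae
  have hmem : ∀ᵐ z ∂gagliardoMeasure a, ∀ n, (p n).snd z = (p n).fst z.1 - (p n).fst z.2 :=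
    ae_all_iff.2 fun n => hp n
  show q.snd =ᵐ[gagliardoMeasure a] fun z => q.fst z.1 - q.fst z.2
  filter_upwards [hms', hmem, (qmp_fst a).ae hns', (qmp_snd a).ae hns'] with z e1 e2 e3 e4
  refine tendsto_nhds_unique e1 ?_
  have := (e3.sub e4).comp hms.tendsto_atTop
  refine this.congr fun n => ?_
  simp only [Function.comp_apply]
  rw [e2]

instance (a : ℝ) : CompleteSpace (sobolevHalf a) :=
  (isClosed_sobolevHalf a).completeSpace_coe

/-- The space `H^{-1/2}(∂B, ℝ³)`: the dual of `H^{1/2}(∂B, ℝ³)`, with the dual norm.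
For `f` in it and `φ` in `H^{1/2}`, `f φ` is the duality pairing `⟨f, φ⟩`. -/
abbrev SobolevNegHalf (a : ℝ) := StrongDual ℝ (sobolevHalf a)

/-- The inclusion of `H^{1/2}(∂B, ℝ³)` into `L²(∂B, ℝ³)`. -/
def toL2 (a : ℝ) : sobolevHalf a →L[ℝ] Lp E3 2 (sphereMeasure a) :=
  (WithLp.fstL 2 ℝ _ _).comp (sobolevHalf a).subtypeL

lemma ae_norm_eq (a : ℝ) : ∀ᵐ r ∂sphereMeasure a, ‖r‖ = |a| := by
  refine Measure.ae_smul_measure ?_ _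
  rw [ae_map_iff (by fun_prop) (measurableSet_eq_fun (by fun_prop) (by fun_prop))]
  refine .of_forall fun ω => ?_
  simp [norm_smul]

lemma memLp_sphere {φ : E3 → E3} (h : ∃ K, LipschitzWith K φ) (a : ℝ) :
    MemLp φ 2 (sphereMeasure a) := by
  obtain ⟨K, hK⟩ := h
  refine MemLp.of_bound hK.continuous.aestronglyMeasurable (‖φ 0‖ + K * |a|) ?_
  filter_upwards [ae_norm_eq a] with r hr
  have := hK.norm_sub_le r 0
  have h2 := norm_add_le (φ 0) (φ r - φ 0)
  rw [sub_zero, hr] at this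
  rw [add_sub_cancel] at h2
  linarith

lemma memLp_gagliardo {φ : E3 → E3} (h : ∃ K, LipschitzWith K φ) (a : ℝ) :
    MemLp (fun z : E3 × E3 => φ z.1 - φ z.2) 2 (gagliardoMeasure a) := by
  obtain ⟨K, hK⟩ := h
  have hc := hK.continuous
  refine ⟨by fun_prop, ?_⟩
  rw [eLpNorm_lt_top_iff_lintegral_rpow_enorm_lt_top (by simp) (by simp), gagliardoMeasure,
    lintegral_withDensity_eq_lintegral_mul _ (by fun_prop) (by fun_prop)]
  refine lt_of_le_of_lt (lintegral_mono (g := fun z => ENNReal.ofReal (K ^ 2) *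
    ENNReal.ofReal (‖z.1 - z.2‖⁻¹)) fun z => ?_) ?_
  · simp only [Pi.mul_apply, ENNReal.toReal_ofNat, ENNReal.rpow_ofNat]
    rw [← ofReal_norm, ← ENNReal.ofReal_pow (norm_nonneg _),
      ← ENNReal.ofReal_mul (by positivity), ← ENNReal.ofReal_mul (by positivity)]
    refine ENNReal.ofReal_le_ofReal ?_
    have hl := hK.norm_sub_le z.1 z.2
    rcases eq_or_ne z.1 z.2 with e | e
    · simp [e]
    have hp : 0 < ‖z.1 - z.2‖ := norm_pos_iff.2 (sub_ne_zero.2 e)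
    calc (‖z.1 - z.2‖ ^ 3)⁻¹ * ‖φ z.1 - φ z.2‖ ^ 2
        ≤ (‖z.1 - z.2‖ ^ 3)⁻¹ * (K * ‖z.1 - z.2‖) ^ 2 := by gcongr
      _ = _ := by field_simp
  · rw [lintegral_const_mul _ (by fun_prop)]
    exact ENNReal.mul_lt_top (by simp) (lintegral_inv_norm_lt_top a)

/-- The element of `H^{1/2}(∂B, ℝ³)` given by the restriction to `∂B` of a Lipschitz field. -/
def lipField (a : ℝ) (φ : E3 → E3) (h : ∃ K, LipschitzWith K φ) : sobolevHalf a :=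
  ⟨WithLp.toLp 2 ((memLp_sphere h a).toLp φ, (memLp_gagliardo h a).toLp _), by
    have h1 := (memLp_sphere h a).coeFn_toLp
    show _ =ᵐ[gagliardoMeasure a] _
    filter_upwards [(memLp_gagliardo h a).coeFn_toLp, (qmp_fst a).ae h1, (qmp_snd a).ae h1]
      with z e1 e2 e3
    show ((memLp_gagliardo h a).toLp _ : E3 × E3 → E3) z
      = ((memLp_sphere h a).toLp φ : E3 → E3) z.1 - ((memLp_sphere h a).toLp φ : E3 → E3) z.2
    rw [e1, e2, e3]⟩

/-- The inclusion of `L²(∂B, ℝ³)` into `H^{-1/2}(∂B, ℝ³)`: `⟨ψ, φ⟩ = ∫ ψ · φ dσ`. -/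
def densityDual (a : ℝ) (ψ : Lp E3 2 (sphereMeasure a)) : SobolevNegHalf a :=
  (innerSL ℝ ψ).comp (toL2 a)

/-- The stokeslet `G(r) v = (1 / (8 π η)) (v / |r| + (r · v) r / |r|³)`. -/
def oseen (η : ℝ) (r v : E3) : E3 :=
  (1 / (8 * Real.pi * η)) • (‖r‖⁻¹ • v + ((‖r‖ ^ 3)⁻¹ * inner ℝ r v) • r)

/-- `A` is the continuous extension to `H^{-1/2}(∂B)` of the integral operator
`f ↦ (r ↦ ∫_{∂B} G(z + r - s) f(s) dσ(s))`, with values in `H^{1/2}(∂B)`. -/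
def IsSingleLayer (a η : ℝ) (z : E3) (A : SobolevNegHalf a →L[ℝ] sobolevHalf a) : Prop :=
  ∀ ψ : Lp E3 2 (sphereMeasure a), toL2 a (A (densityDual a ψ)) =ᵐ[sphereMeasure a]
    fun r => ∫ s, oseen η (z + r - s) (ψ s) ∂sphereMeasure a

lemma toL2_injective (a : ℝ) : Function.Injective (toL2 a) := by
  refine (injective_iff_map_eq_zero (toL2 a)).2 fun g hg => ?_
  have h1 : (g : WithLp 2 (Lp E3 2 (sphereMeasure a) × Lp E3 2 (gagliardoMeasure a))).fst = 0 := hg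
  have h2 : (g : WithLp 2 (Lp E3 2 (sphereMeasure a) × Lp E3 2 (gagliardoMeasure a))).snd = 0 := by
    have h0 := Lp.coeFn_zero E3 2 (sphereMeasure a)
    have hm : (g : WithLp 2 (Lp E3 2 (sphereMeasure a) × Lp E3 2 (gagliardoMeasure a))).snd
      =ᵐ[gagliardoMeasure a] _ := g.2
    rw [h1] at hm
    refine Lp.ext ?_
    filter_upwards [hm, (qmp_fst a).ae h0, (qmp_snd a).ae h0,
      Lp.coeFn_zero E3 2 (gagliardoMeasure a)] with z e1 e2 e3 e4
    rw [e1, e2, e3, e4]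
    simp
  apply Subtype.ext
  apply (WithLp.equiv 2 _).injective
  exact Prod.ext h1 h2

/-- There is at most one such extension. -/
theorem IsSingleLayer.unique {a η : ℝ} {z : E3} {A A' : SobolevNegHalf a →L[ℝ] sobolevHalf a}
    (hA : IsSingleLayer a η z A) (hA' : IsSingleLayer a η z A') : A = A' := by
  let J : Lp E3 2 (sphereMeasure a) →L[ℝ] sobolevHalf a := ContinuousLinearMap.adjoint (toL2 a)
  have hJ : ∀ ψ, InnerProductSpace.toDual ℝ (sobolevHalf a) (J ψ) = densityDual a ψ := by
    intro ψ
    ext g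
    simp only [InnerProductSpace.toDual_apply_apply, J, ContinuousLinearMap.adjoint_inner_left,
      densityDual, ContinuousLinearMap.comp_apply, innerSL_apply_apply]
  have hd : (J.range).topologicalClosure = ⊤ := by
    rw [Submodule.topologicalClosure_eq_top_iff, Submodule.eq_bot_iff]
    intro g hg
    apply toL2_injective a
    rw [map_zero, ← inner_self_eq_zero (𝕜 := ℝ)]
    have := (Submodule.mem_orthogonal _ _).1 hg (J (toL2 a g)) ⟨_, rfl⟩
    rwa [ContinuousLinearMap.adjoint_inner_left] at this
  have hdense : DenseRange J := by
    have := (Submodule.dense_iff_topologicalClosure_eq_top).2 hd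
    exact this
  have heq : (fun h => A (InnerProductSpace.toDual ℝ (sobolevHalf a) h)) =
      fun h => A' (InnerProductSpace.toDual ℝ (sobolevHalf a) h) := by
    refine hdense.equalizer (by fun_prop) (by fun_prop) ?_
    funext ψ
    simp only [Function.comp_apply, hJ]
    apply toL2_injective a
    exact Lp.ext ((hA ψ).trans (hA' ψ).symm)
  ext1 f
  have := congrFun heq ((InnerProductSpace.toDual ℝ (sobolevHalf a)).symm f)
  simpa using this

open Classical in
/-- The operator `f ↦ ⟨f, G(z + r - ·)⟩` from `H^{-1/2}(∂B)` to `H^{1/2}(∂B)`. For `z = 0` it is the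
operator of a single ball. -/
def singleLayer (a η : ℝ) (z : E3) : SobolevNegHalf a →L[ℝ] sobolevHalf a :=
  if h : ∃ A, IsSingleLayer a η z A then h.choose else 0

/-- The operator `T_x` of the configuration `x`:
`(T_x f)_i (r) = ∑_j ⟨f_j, G(x_i - x_j + r - ·)⟩`, `r ∈ ∂B`. -/
def stokesOperator (a η : ℝ) {N : ℕ} (x : Fin N → E3) :
    (Fin N → SobolevNegHalf a) →L[ℝ] (Fin N → sobolevHalf a) :=
  ContinuousLinearMap.pi fun i =>
    ∑ j, (singleLayer a η (x i - x j)).comp (ContinuousLinearMap.proj j)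

/-- The cross product of `ℝ³`. -/
def cross (v w : E3) : E3 := WithLp.toLp 2 (crossProduct v.ofLp w.ofLp)

lemma lipschitz_cross_field (u v c : E3) :
    ∃ K, LipschitzWith K (fun r : E3 => u + cross v (c + r)) := by
  let L : E3 →L[ℝ] E3 := LinearMap.toContinuousLinearMap
    { toFun := cross v
      map_add' := fun r s => by simp [cross]
      map_smul' := fun t r => by simp [cross] }
  refine ⟨‖L‖₊, LipschitzWith.of_dist_le_mul fun r s => ?_⟩
  have h : u + cross v (c + r) - (u + cross v (c + s)) = L (r - s) := by
    show u + L (c + r) - (u + L (c + s)) = L (r - s)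
    rw [map_add, map_add, map_sub]
    abel
  rw [dist_eq_norm, dist_eq_norm, h]
  exact L.le_opNorm _

/-- The constant field `v`. -/
def constField (a : ℝ) (v : E3) : sobolevHalf a :=
  lipField a (fun _ => v) ⟨0, LipschitzWith.const v⟩

/-- The rigid velocity field `r ↦ u + ω × r`. -/
def rigidField (a : ℝ) (u ω : E3) : sobolevHalf a :=
  lipField a (fun r => u + cross ω r) (by simpa using lipschitz_cross_field u ω 0)

/-- The unit normal field `r ↦ r / a` of `∂B`. -/
def normalField (a : ℝ) : sobolevHalf a :=
  lipField a (fun r => a⁻¹ • r) ⟨‖a⁻¹‖₊, lipschitzWith_smul a⁻¹⟩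

/-- The unit normal field as an element of `H^{-1/2}(∂B)`: `⟨n, φ⟩ = ∫ n · φ dσ`. -/
def normalDensity (a : ℝ) : SobolevNegHalf a :=
  densityDual a (toL2 a (normalField a))

/-- The fields `g ∈ H^{1/2}(∂B)` without flux through `∂B`: `∫ g · n dσ = 0`. -/
def fluxFree (a : ℝ) : Set (sobolevHalf a) :=
  {g | normalDensity a g = 0}

/-- The densities `f ∈ H^{-1/2}(∂B)` with `⟨f, n⟩ = 0`. -/
def normalized (a : ℝ) : Set (SobolevNegHalf a) :=
  {f | f (normalField a) = 0}

/-- The inverse of the operator of a single ball, from fields without flux to densities `f` with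
`⟨f, n⟩ = 0`. -/
def singleLayerInv (a η : ℝ) : sobolevHalf a → SobolevNegHalf a :=
  Function.invFunOn (singleLayer a η 0) (normalized a)

/-- The inverse `T_x⁻¹`, from fields without flux through any of the spheres to densities with
`⟨f_i, n⟩ = 0` for all `i`. -/
def stokesOperatorInv (a η : ℝ) {N : ℕ} (x : Fin N → E3) :
    (Fin N → sobolevHalf a) → (Fin N → SobolevNegHalf a) :=
  Function.invFunOn (stokesOperator a η x) {f | ∀ i, f i ∈ normalized a}

/-- The minimal distance `δ(x) = min_{i<j} |x_i - x_j|` (for at least two points). -/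
def minDist {N : ℕ} (x : Fin N → E3) : ℝ :=
  ⨅ p : {p : Fin N × Fin N // p.1 < p.2}, ‖x p.1.1 - x p.1.2‖

/-- The set `S_N` of the centres of `N` disjoint balls of radius `a`. -/
def configurations (a : ℝ) (N : ℕ) : Set (Fin N → E3) :=
  {x | 2 * a < minDist x}

/-- `S(z) v = (1 / |z|) (Id + e ⊗ e) v`, where `e = z / |z|`. -/
def pairTensor (z v : E3) : E3 :=
  (1 / ‖z‖) • (v + inner ℝ (‖z‖⁻¹ • z) v • (‖z‖⁻¹ • z))

/-- The vector `⟨f, Id⟩ = ∫_{∂B} f dσ`, the total force of the density `f`. -/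
def force {a : ℝ} (f : SobolevNegHalf a) : E3 :=
  WithLp.toLp 2 fun k => f (constField a (EuclideanSpace.single k 1))

/-- The torque `∫_{∂B} (c + r) × f(r) dσ(r)` with respect to the origin of the density `f` on the
sphere centred at `c`; its component along `e_k` is `∫ f(r) · (e_k × (c + r)) dσ(r)`. -/
def torque {a : ℝ} (c : E3) (f : SobolevNegHalf a) : E3 :=
  WithLp.toLp 2 fun k => f (lipField a (fun r => cross (EuclideanSpace.single k 1) (c + r))
    (by simpa using lipschitz_cross_field 0 (EuclideanSpace.single k 1) c))

end

end StokesBalls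

open StokesBalls

/-!
The operator `V` of a single ball (`singleLayer a η 0`) is diagonalized by vector valued solid
harmonics. A polynomial `p` in the generalized eigenspace `solid c` of the Euler operator, harmonic and
homogeneous of degree `c`, has the Newton potential `4 π a / (2 c + 1) p` on the sphere
(`potential_solid`, by Green's identity and the Poisson kernel), and differentiating this
identity gives the action of the stokeslet on triples of such polynomials (`integral_oseen_vecEv`).
The Gagliardo norm acts on the same harmonics by the factors `1 + 4 π l / a` (`inner_polyField`), and
finite sums of harmonics are dense (`dense_harmonicSum`). Hence on `L²` the quadratic form of `V` is
bounded by the squared norm of `H^{-1/2}`, and bounds it from below up to the component along the unit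
normal (`stokesL2_le`, `le_stokesL2`). An operator with these two properties extends to a bounded
operator from `H^{-1/2}` to `H^{1/2}` (`exists_factorization`), which is the content of
`singleLayer_zero_spec`; adding a multiple of `n ⊗ n` makes it coercive, and the Lax–Milgram theorem
inverts it between the normalized densities and the fields without flux (`exists_inverse_mod_normal`,
`IsBallInverse`).

The interaction of two balls has a smooth kernel (`exists_kernelOperator`). The stokeslet is homogeneous
of degree `-1`, so replacing its values by the value at the difference of the centres costs a term of
the order `|z|⁻²` (`exists_kernelBound_oseen_sub`, `exists_norm_singleLayer_sub_le`). As the stokeslet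
has no divergence, the interaction annihilates the normal and produces no flux
(`singleLayer_normalDensity`, `normalDensity_singleLayer`).

The operator of `N` distant balls is therefore a small perturbation of the diagonal operator, which is
treated abstractly in `WeakCoupling`: the equation is solved by Banach's fixed point theorem, and one
iteration gives the expansion of the inverse (`WeakCoupling.norm_solution_sub_le`). The forces follow
from the symmetry of `V` and from `V 1 = 2 a / (3 η)` on constant densities: the force of `V⁻¹ g` is
`3 η / (2 a)` times the integral of `g` (`IsBallInverse.force_eq`). In particular a rotation exerts no
force, and the torque about the origin is the moment of the forces up to a bounded term (`torque_eq`).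
-/

namespace StokesBalls

open MeasureTheory Set Filter Topology
open scoped Pointwise

noncomputable section ShortcutInstances

/-! ### Shortcuts for instances, which speed up the elaboration -/

local instance : NormedAddCommGroup E3 := inferInstance
local instance : SeminormedAddCommGroup E3 := inferInstance
local instance : NormedSpace ℝ E3 := inferInstance
local instance : InnerProductSpace ℝ E3 := inferInstance
local instance : Module ℝ E3 := inferInstance
local instance : AddCommGroup E3 := inferInstance
local instance : AddCommMonoid E3 := inferInstance
local instance : TopologicalSpace E3 := inferInstance
local instance : ContinuousSMul ℝ E3 := inferInstance
local instance : IsTopologicalAddGroup E3 := inferInstance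
local instance : MeasurableSpace E3 := inferInstance
local instance : BorelSpace E3 := inferInstance
local instance : SecondCountableTopology E3 := inferInstance
local instance (a : ℝ) : NormedAddCommGroup (sobolevHalf a) := inferInstance
local instance (a : ℝ) : SeminormedAddCommGroup (sobolevHalf a) := inferInstance
local instance (a : ℝ) : AddCommGroup (sobolevHalf a) := inferInstance
local instance (a : ℝ) : AddCommMonoid (sobolevHalf a) := inferInstance
local instance (a : ℝ) : InnerProductSpace ℝ (sobolevHalf a) := inferInstance
local instance (a : ℝ) : NormedSpace ℝ (sobolevHalf a) := inferInstance
local instance (a : ℝ) : Module ℝ (sobolevHalf a) := inferInstance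
local instance (a : ℝ) : TopologicalSpace (sobolevHalf a) := inferInstance
local instance (a : ℝ) : NormedAddCommGroup (SobolevNegHalf a) := inferInstance
local instance (a : ℝ) : NormedSpace ℝ (SobolevNegHalf a) := inferInstance
local instance (a : ℝ) : AddCommGroup (SobolevNegHalf a) := inferInstance
local instance (a : ℝ) : AddCommMonoid (SobolevNegHalf a) := inferInstance
local instance (a : ℝ) : Module ℝ (SobolevNegHalf a) := inferInstance
local instance (a : ℝ) : TopologicalSpace (SobolevNegHalf a) := inferInstance

noncomputable section

/-! ### The surface measure of the sphere -/

lemma ae_mem_sphere {a : ℝ} (ha : 0 < a) : ∀ᵐ r ∂sphereMeasure a, r ∈ Metric.sphere (0 : E3) a := by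
  filter_upwards [ae_norm_eq a] with r hr
  simpa [abs_of_pos ha] using hr

lemma restrict_sphereMeasure {a : ℝ} (ha : 0 < a) :
    (sphereMeasure a).restrict (Metric.sphere (0 : E3) a) = sphereMeasure a :=
  Measure.restrict_eq_self_of_ae_mem (ae_mem_sphere ha)

section Continuous

variable {F : Type*} [NormedAddCommGroup F] {a : ℝ}

lemma aestronglyMeasurable_sphere (ha : 0 < a) {f : E3 → F}
    (hf : ContinuousOn f (Metric.sphere (0 : E3) a)) :
    AEStronglyMeasurable f (sphereMeasure a) := by
  have := (hf.aestronglyMeasurable_of_isCompact (μ := sphereMeasure a) (isCompact_sphere _ _)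
    Metric.isClosed_sphere.measurableSet)
  rwa [restrict_sphereMeasure ha] at this

lemma exists_bound_sphere {f : E3 → F}
    (hf : ContinuousOn f (Metric.sphere (0 : E3) a)) :
    ∃ C, 0 ≤ C ∧ ∀ r ∈ Metric.sphere (0 : E3) a, ‖f r‖ ≤ C := by
  obtain ⟨C, hC⟩ := (isCompact_sphere (0 : E3) a).exists_bound_of_continuousOn hf
  exact ⟨max C 0, le_max_right _ _, fun r hr => (hC r hr).trans (le_max_left _ _)⟩

lemma memLp_sphereMeasure (ha : 0 < a) {f : E3 → F}
    (hf : ContinuousOn f (Metric.sphere (0 : E3) a)) (p : ENNReal) :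
    MemLp f p (sphereMeasure a) := by
  obtain ⟨C, -, hC⟩ := exists_bound_sphere hf
  refine MemLp.of_bound (aestronglyMeasurable_sphere ha hf) C ?_
  filter_upwards [ae_mem_sphere ha] with r hr using hC r hr

lemma integrable_sphereMeasure (ha : 0 < a) {f : E3 → F}
    (hf : ContinuousOn f (Metric.sphere (0 : E3) a)) :
    Integrable f (sphereMeasure a) :=
  memLp_one_iff_integrable.1 (memLp_sphereMeasure ha hf 1)

end Continuous

lemma integral_sphereMeasure_congr {F : Type*} [NormedAddCommGroup F] [NormedSpace ℝ F] {a : ℝ}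
    (ha : 0 < a) {f g : E3 → F} (h : ∀ r, ‖r‖ = a → f r = g r) :
    ∫ r, f r ∂sphereMeasure a = ∫ r, g r ∂sphereMeasure a := by
  refine integral_congr_ae ?_
  filter_upwards [ae_mem_sphere ha] with r hr
  exact h r (by simpa using hr)

lemma sphereMeasure_real_univ {a : ℝ} : (sphereMeasure a).real univ = 4 * Real.pi * a ^ 2 := by
  have h : (volume : Measure E3).real (Metric.ball 0 1) = Real.pi * 4 / 3 := by
    have := EuclideanSpace.volume_ball_fin_three (0 : E3) 1
    rw [Measure.real, this]
    simp
    positivity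
  have h2 : ((volume : Measure E3).toSphere.map
      (fun ω : Metric.sphere (0 : E3) 1 => a • (ω : E3))).real univ = 4 * Real.pi := by
    rw [measureReal_def, Measure.map_apply (by fun_prop) MeasurableSet.univ, preimage_univ,
      ← measureReal_def, Measure.toSphere_real_apply_univ, h]
    simp
    ring
  unfold sphereMeasure
  rw [measureReal_ennreal_smul_apply, h2, ENNReal.toReal_ofReal (by positivity)]
  ring

lemma map_toSphere_apply (s : Set E3) (hs : MeasurableSet s) :
    (volume : Measure E3).toSphere.map (fun ω : Metric.sphere (0 : E3) 1 => (ω : E3)) s =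
      3 * volume (Ioo (0 : ℝ) 1 • (s ∩ Metric.sphere (0 : E3) 1)) := by
  rw [Measure.map_apply (by fun_prop) hs, Measure.toSphere_apply' _ (hs.preimage (by fun_prop))]
  congr 2
  · simp
  · rw [Subtype.image_preimage_coe, inter_comm]

lemma sphereMeasure_map_isometry (a : ℝ) (L : E3 ≃ₗᵢ[ℝ] E3) :
    (sphereMeasure a).map L = sphereMeasure a := by
  set τ := (volume : Measure E3).toSphere.map (fun ω : Metric.sphere (0 : E3) 1 => (ω : E3)) with hτ
  have h1 : τ.map L = τ := by
    ext s hs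
    have hpre : (L ⁻¹' s) ∩ Metric.sphere (0 : E3) 1 = L ⁻¹' (s ∩ Metric.sphere (0 : E3) 1) := by
      ext x; simp
    have hsm : Ioo (0 : ℝ) 1 • (L ⁻¹' (s ∩ Metric.sphere (0 : E3) 1)) =
        L ⁻¹' (Ioo (0 : ℝ) 1 • (s ∩ Metric.sphere (0 : E3) 1)) := by
      ext x
      simp only [Set.mem_smul, mem_preimage]
      constructor
      · rintro ⟨t, ht, y, hy, rfl⟩
        exact ⟨t, ht, L y, hy, by simp⟩
      · rintro ⟨t, ht, y, hy, h⟩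
        refine ⟨t, ht, L.symm y, by simpa using hy, ?_⟩
        rw [← map_smul, h, L.symm_apply_apply]
    rw [Measure.map_apply L.continuous.measurable hs, hτ,
      map_toSphere_apply _ (L.continuous.measurable hs), map_toSphere_apply _ hs, hpre, hsm]
    congr 1
    have hm := L.measurePreserving
    exact hm.measure_preimage_emb L.toHomeomorph.measurableEmbedding _
  have h2 : sphereMeasure a = ENNReal.ofReal (a ^ 2) • τ.map (fun x => a • x) := by
    rw [sphereMeasure, hτ, Measure.map_map (by fun_prop) (by fun_prop)]
    rfl
  have hL := L.continuous.measurable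
  rw [h2, Measure.map_smul]
  rw [Measure.map_map hL (by fun_prop)]
  congr 1
  conv_rhs => rw [← h1]
  rw [Measure.map_map (by fun_prop) hL]
  congr 1
  ext x
  simp

/-- The `i`-th vector of the standard basis. -/
abbrev stdVec (i : Fin 3) : E3 := EuclideanSpace.single i 1

lemma sum_smul_stdVec (x : E3) : ∑ i, x i • stdVec i = x := by
  ext j
  fin_cases j <;> simp [Fin.sum_univ_three]

/-- The rotation by the angle `t` in the plane of the `i`-th and the `j`-th axis. -/
def planeRotation (i j : Fin 3) (t : ℝ) : E3 →ₗ[ℝ] E3 where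
  toFun x := x + ((Real.cos t - 1) * x i - Real.sin t * x j) • stdVec i +
    (Real.sin t * x i + (Real.cos t - 1) * x j) • stdVec j
  map_add' x y := by simp only [PiLp.add_apply]; module
  map_smul' c x := by simp only [PiLp.smul_apply, smul_eq_mul, RingHom.id_apply]; module

lemma planeRotation_apply (i j : Fin 3) (t : ℝ) (x : E3) : planeRotation i j t x =
    x + ((Real.cos t - 1) * x i - Real.sin t * x j) • stdVec i +
    (Real.sin t * x i + (Real.cos t - 1) * x j) • stdVec j := rfl

lemma norm_planeRotation {i j : Fin 3} (hij : i ≠ j) (t : ℝ) (x : E3) :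
    ‖planeRotation i j t x‖ = ‖x‖ := by
  rw [← sq_eq_sq₀ (norm_nonneg _) (norm_nonneg _), EuclideanSpace.real_norm_sq_eq,
    EuclideanSpace.real_norm_sq_eq, planeRotation_apply]
  have := Real.sin_sq_add_cos_sq t
  fin_cases i <;> fin_cases j <;>
    first
    | exact absurd rfl hij
    | (simp [Fin.sum_univ_three]; linear_combination (x 0 ^ 2 + x 1 ^ 2) * this)
    | (simp [Fin.sum_univ_three]; linear_combination (x 0 ^ 2 + x 2 ^ 2) * this)
    | (simp [Fin.sum_univ_three]; linear_combination (x 1 ^ 2 + x 2 ^ 2) * this)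

/-- `planeRotation` as an isometry of `ℝ³`. -/
def planeIsometry {i j : Fin 3} (hij : i ≠ j) (t : ℝ) : E3 ≃ₗᵢ[ℝ] E3 :=
  LinearIsometry.toLinearIsometryEquiv ⟨planeRotation i j t, norm_planeRotation hij t⟩ rfl

lemma integral_comp_planeRotation (a : ℝ) {i j : Fin 3} (hij : i ≠ j) (t : ℝ) (g : E3 → ℝ) :
    ∫ y, g (planeRotation i j t y) ∂sphereMeasure a = ∫ y, g y ∂sphereMeasure a := by
  conv_rhs => rw [← sphereMeasure_map_isometry a (planeIsometry hij t)]
  exact ((planeIsometry hij t).toHomeomorph.measurableEmbedding.integral_map _).symm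

lemma hasDerivAt_planeRotation (i j : Fin 3) (t : ℝ) (x : E3) :
    HasDerivAt (fun t => planeRotation i j t x)
      ((-Real.sin t * x i - Real.cos t * x j) • stdVec i +
        (Real.cos t * x i - Real.sin t * x j) • stdVec j) t := by
  simp only [planeRotation_apply]
  have h1 : HasDerivAt (fun t => (Real.cos t - 1) * x i - Real.sin t * x j)
      (-Real.sin t * x i - Real.cos t * x j) t :=
    (((Real.hasDerivAt_cos t).sub_const 1).mul_const _).sub ((Real.hasDerivAt_sin t).mul_const _)
  have h2 : HasDerivAt (fun t => Real.sin t * x i + (Real.cos t - 1) * x j)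
      (Real.cos t * x i - Real.sin t * x j) t := by
    exact (((Real.hasDerivAt_sin t).mul_const (x i)).add
      (((Real.hasDerivAt_cos t).sub_const 1).mul_const (x j))).congr_deriv (by ring)
  exact ((h1.smul_const (stdVec i)).const_add x).add (h2.smul_const (stdVec j))

/-- The angular derivatives `x_i ∂_j - x_j ∂_i` have mean zero over the sphere, because the surface
measure is invariant under rotations. -/
lemma integral_angular_deriv_eq_zero {a R : ℝ} (ha : 0 < a) (haR : a < R) {g : E3 → ℝ}
    (hg : ContDiffOn ℝ 1 g (Metric.ball 0 R)) {i j : Fin 3} (hij : i ≠ j) :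
    ∫ y, (y i * fderiv ℝ g y (stdVec j) - y j * fderiv ℝ g y (stdVec i)) ∂sphereMeasure a = 0 := by
  have hsub : Metric.sphere (0 : E3) a ⊆ Metric.ball 0 R := fun y hy => by
    rw [mem_sphere_zero_iff_norm] at hy; simpa [hy] using haR
  have hd : ∀ y ∈ Metric.ball (0 : E3) R, HasFDerivAt g (fderiv ℝ g y) y := fun y hy =>
    ((hg.differentiableOn (by simp)) y hy |>.differentiableAt (Metric.isOpen_ball.mem_nhds hy)).hasFDerivAt
  have hc : ContinuousOn (fderiv ℝ g) (Metric.ball 0 R) :=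
    hg.continuousOn_fderiv_of_isOpen Metric.isOpen_ball (by simp)
  obtain ⟨C, hC0, hC⟩ := exists_bound_sphere (hc.mono hsub)
  set g' : ℝ → E3 → ℝ := fun t y => fderiv ℝ g (planeRotation i j t y)
    ((-Real.sin t * y i - Real.cos t * y j) • stdVec i +
        (Real.cos t * y i - Real.sin t * y j) • stdVec j) with hg'
  have hrot : ∀ t y, ‖y‖ = a → planeRotation i j t y ∈ Metric.sphere (0 : E3) a := fun t y hy => by
    simpa [norm_planeRotation hij] using hy
  have hcont : ∀ t, Continuous (planeRotation i j t) := fun t =>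
    (planeRotation i j t).continuous_of_finiteDimensional
  have key : HasDerivAt (fun t => ∫ y, g (planeRotation i j t y) ∂sphereMeasure a)
      (∫ y, g' 0 y ∂sphereMeasure a) 0 := by
    refine (hasDerivAt_integral_of_dominated_loc_of_deriv_le (s := univ) (F' := g')
      (bound := fun _ => C * (4 * a)) univ_mem ?_ ?_ ?_ ?_ (integrable_const _) ?_).2
    · refine .of_forall fun t => aestronglyMeasurable_sphere ha ?_
      exact (hg.continuousOn.mono hsub).comp (hcont t).continuousOn
        fun y hy => hrot t y (by simpa using hy)
    · refine integrable_sphereMeasure ha ?_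
      exact (hg.continuousOn.mono hsub).comp (hcont 0).continuousOn
        fun y hy => hrot 0 y (by simpa using hy)
    · refine aestronglyMeasurable_sphere ha ?_
      refine ContinuousOn.clm_apply ((hc.mono hsub).comp (hcont 0).continuousOn
        fun y hy => hrot 0 y (by simpa using hy)) ?_
      fun_prop
    · filter_upwards [ae_mem_sphere ha] with y hy t _
      have hy' : ‖y‖ = a := by simpa using hy
      refine (ContinuousLinearMap.le_opNorm _ _).trans ?_
      refine mul_le_mul (hC _ (hrot t y hy')) ?_ (norm_nonneg _) hC0
      refine (norm_add_le _ _).trans ?_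
      rw [norm_smul, norm_smul]
      simp only [PiLp.norm_single, norm_one, mul_one]
      have hyi := PiLp.norm_apply_le y i
      have hyj := PiLp.norm_apply_le y j
      rw [hy', Real.norm_eq_abs] at hyi hyj
      have hs := Real.abs_sin_le_one t
      have hco := Real.abs_cos_le_one t
      have p1 : |Real.sin t * y i| ≤ a := by rw [abs_mul]; nlinarith [abs_nonneg (y i), abs_nonneg (Real.sin t)]
      have p2 : |Real.sin t * y j| ≤ a := by rw [abs_mul]; nlinarith [abs_nonneg (y j), abs_nonneg (Real.sin t)]
      have p3 : |Real.cos t * y i| ≤ a := by rw [abs_mul]; nlinarith [abs_nonneg (y i), abs_nonneg (Real.cos t)]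
      have p4 : |Real.cos t * y j| ≤ a := by rw [abs_mul]; nlinarith [abs_nonneg (y j), abs_nonneg (Real.cos t)]
      rw [abs_le] at p1 p2 p3 p4
      have q1 : ‖-Real.sin t * y i - Real.cos t * y j‖ ≤ 2 * a := by
        rw [Real.norm_eq_abs, abs_le]; constructor <;> linarith
      have q2 : ‖Real.cos t * y i - Real.sin t * y j‖ ≤ 2 * a := by
        rw [Real.norm_eq_abs, abs_le]; constructor <;> linarith
      linarith
    · filter_upwards [ae_mem_sphere ha] with y hy t _
      have hy' : ‖y‖ = a := by simpa using hy
      exact (hd _ (hsub (hrot t y hy'))).comp_hasDerivAt t (hasDerivAt_planeRotation i j t y)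
  simp only [integral_comp_planeRotation a hij] at key
  have h0 := key.unique (hasDerivAt_const _ _)
  rw [← h0]
  refine integral_congr_ae (.of_forall fun y => ?_)
  simp [hg', planeRotation_apply]
  ring

/-- The `j`-th coordinate as a continuous linear form. -/
abbrev coord (j : Fin 3) : E3 →L[ℝ] ℝ := EuclideanSpace.proj j

/-- The divergence of a vector field on `ℝ³`. -/
def divergence (F : E3 → E3) (x : E3) : ℝ := ∑ i, fderiv ℝ F x (stdVec i) i

/-- The divergence theorem on the sphere. The integrand is the sum over `j, i` of the derivatives of
`y j * F y i` along the rotation in the `(j, i)` plane, each of which has integral zero. -/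
lemma integral_tangential_divergence {a R : ℝ} (ha : 0 < a) (haR : a < R) {F : E3 → E3}
    (hF : ContDiffOn ℝ 1 F (Metric.ball 0 R)) :
    ∫ y, (a ^ 2 * divergence F y - 2 * inner ℝ (F y) y - inner ℝ (fderiv ℝ F y y) y)
      ∂sphereMeasure a = 0 := by
  have hsub : Metric.sphere (0 : E3) a ⊆ Metric.ball 0 R := fun y hy => by
    rw [mem_sphere_zero_iff_norm] at hy; simpa [hy] using haR
  have hd : ∀ y ∈ Metric.ball (0 : E3) R, HasFDerivAt F (fderiv ℝ F y) y := fun y hy =>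
    ((hF.differentiableOn (by simp)) y hy |>.differentiableAt (Metric.isOpen_ball.mem_nhds hy)).hasFDerivAt
  set g : Fin 3 → Fin 3 → E3 → ℝ := fun j i y => y j * F y i with hg
  have hgC : ∀ j i, ContDiffOn ℝ 1 (g j i) (Metric.ball 0 R) := by
    intro j i
    have h1 : ContDiffOn ℝ 1 (fun y : E3 => y j) (Metric.ball 0 R) :=
      (coord j).contDiff.contDiffOn
    have h2 : ContDiffOn ℝ 1 (fun y : E3 => F y i) (Metric.ball 0 R) :=
      (coord i).contDiff.comp_contDiffOn hF
    exact h1.mul h2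
  have hgd : ∀ j i, ∀ y ∈ Metric.ball (0 : E3) R, ∀ v, fderiv ℝ (g j i) y v =
      v j * F y i + y j * fderiv ℝ F y v i := by
    intro j i y hy v
    have h1 : HasFDerivAt (fun y : E3 => y j) (coord j) y :=
      (coord j).hasFDerivAt
    have h2 : HasFDerivAt (fun y : E3 => F y i) _ y :=
      (coord i).hasFDerivAt.comp y (hd y hy)
    have h3 : fderiv ℝ (g j i) y = _ := (h1.mul h2).fderiv
    rw [h3]
    simp
    ring
  have hc : ContinuousOn (fderiv ℝ F) (Metric.sphere 0 a) :=
    (hF.continuousOn_fderiv_of_isOpen Metric.isOpen_ball (by simp)).mono hsub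
  have hzero : ∀ j i, ∫ y, (y j * fderiv ℝ (g j i) y (stdVec i) - y i * fderiv ℝ (g j i) y (stdVec j))
      ∂sphereMeasure a = 0 := by
    intro j i
    rcases eq_or_ne j i with rfl | hij
    · simp
    · exact integral_angular_deriv_eq_zero ha haR (hgC j i) hij
  have hint : ∀ j i, Integrable (fun y => (y j * fderiv ℝ (g j i) y (stdVec i)
      - y i * fderiv ℝ (g j i) y (stdVec j))) (sphereMeasure a) := by
    intro j i
    refine integrable_sphereMeasure ha ?_
    have hcg : ContinuousOn (fderiv ℝ (g j i)) (Metric.sphere 0 a) :=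
      ((hgC j i).continuousOn_fderiv_of_isOpen Metric.isOpen_ball (by simp)).mono hsub
    have e1 := hcg.clm_apply (continuousOn_const (c := stdVec i))
    have e2 := hcg.clm_apply (continuousOn_const (c := stdVec j))
    fun_prop
  have hsum : ∑ j, ∑ i, ∫ y, (y j * fderiv ℝ (g j i) y (stdVec i)
      - y i * fderiv ℝ (g j i) y (stdVec j)) ∂sphereMeasure a = 0 := by
    simp only [hzero, Finset.sum_const_zero]
  have e : ∀ j, ∑ i, ∫ y, (y j * fderiv ℝ (g j i) y (stdVec i)
      - y i * fderiv ℝ (g j i) y (stdVec j)) ∂sphereMeasure a = ∫ y, ∑ i, (y j * fderiv ℝ (g j i) y (stdVec i)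
      - y i * fderiv ℝ (g j i) y (stdVec j)) ∂sphereMeasure a := fun j =>
    (integral_finsetSum _ fun i _ => hint j i).symm
  simp only [e] at hsum
  rw [← integral_finsetSum _ fun j _ => integrable_finsetSum _ fun i _ => hint j i] at hsum
  rw [← hsum]
  refine integral_sphereMeasure_congr ha fun y hy => ?_
  have hyb : y ∈ Metric.ball (0 : E3) R := by simpa [hy] using haR
  have hya : a ^ 2 = y 0 ^ 2 + y 1 ^ 2 + y 2 ^ 2 := by
    rw [← hy, EuclideanSpace.real_norm_sq_eq, Fin.sum_univ_three]
  simp only [hgd _ _ y hyb, divergence]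
  have hlin : fderiv ℝ F y y = ∑ i, y i • fderiv ℝ F y (stdVec i) := by
    conv_lhs => rw [← sum_smul_stdVec y]
    rw [map_sum]
    simp only [map_smul]
    rw [sum_smul_stdVec]
  rw [hlin, PiLp.inner_apply, PiLp.inner_apply]
  simp only [Fin.sum_univ_three, hya]
  simp
  ring

/-- The divergence theorem for the ball of radius `a` and a field without divergence. The flux
`ρ ↦ ρ² ∫ F(ρ y) · y dσ(y)` through the spheres of radius `ρ a` has zero derivative, and it vanishes
at `ρ = 0`. -/
theorem integral_flux_eq_zero {a R : ℝ} (ha : 0 < a) (haR : a < R) {F : E3 → E3}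
    (hF : ContDiffOn ℝ 1 F (Metric.ball 0 R)) (hdiv : ∀ x ∈ Metric.ball (0 : E3) R, divergence F x = 0) :
    ∫ y, inner ℝ (F y) y ∂sphereMeasure a = 0 := by
  have hd : ∀ y ∈ Metric.ball (0 : E3) R, HasFDerivAt F (fderiv ℝ F y) y := fun y hy =>
    ((hF.differentiableOn (by simp)) y hy |>.differentiableAt (Metric.isOpen_ball.mem_nhds hy)).hasFDerivAt
  have hc : ContinuousOn (fderiv ℝ F) (Metric.ball 0 R) :=
    hF.continuousOn_fderiv_of_isOpen Metric.isOpen_ball (by simp)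
  set Q := R / a with hQ
  have hQ1 : 1 < Q := by rw [hQ, lt_div_iff₀ ha]; linarith
  have hmem : ∀ ρ ∈ Icc (0 : ℝ) 1, ∀ y : E3, ‖y‖ = a → ρ • y ∈ Metric.closedBall (0 : E3) a := by
    intro ρ hρ y hy
    rw [mem_closedBall_zero_iff, norm_smul, hy, Real.norm_eq_abs, abs_of_nonneg hρ.1]
    nlinarith [hρ.2]
  have hsubR : Metric.closedBall (0 : E3) a ⊆ Metric.ball 0 R := Metric.closedBall_subset_ball haR
  obtain ⟨C, hC⟩ := (isCompact_closedBall (0 : E3) a).exists_bound_of_continuousOn (hc.mono hsubR)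
  obtain ⟨C₀, hC₀⟩ := (isCompact_closedBall (0 : E3) a).exists_bound_of_continuousOn
    (hF.continuousOn.mono hsubR)
  set φ : ℝ → ℝ := fun ρ => ∫ y, inner ℝ (F (ρ • y)) y ∂sphereMeasure a with hφ
  have hcomp : ∀ ρ ∈ Icc (0 : ℝ) 1, ContinuousOn (fun y => F (ρ • y)) (Metric.sphere (0 : E3) a) := by
    intro ρ hρ
    refine (hF.continuousOn.mono hsubR).comp (by fun_prop) fun y hy => hmem ρ hρ y (by simpa using hy)
  have hcomp' : ∀ ρ ∈ Icc (0 : ℝ) 1, ContinuousOn (fun y => fderiv ℝ F (ρ • y)) (Metric.sphere (0 : E3) a) := by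
    intro ρ hρ
    refine (hc.mono hsubR).comp (by fun_prop) fun y hy => hmem ρ hρ y (by simpa using hy)
  have hφd : ∀ ρ ∈ Ioo (0 : ℝ) 1, HasDerivAt φ
      (∫ y, inner ℝ (fderiv ℝ F (ρ • y) y) y ∂sphereMeasure a) ρ := by
    intro ρ hρ
    refine (hasDerivAt_integral_of_dominated_loc_of_deriv_le (s := Ioo 0 1)
      (F' := fun ρ y => inner ℝ (fderiv ℝ F (ρ • y) y) y)
      (bound := fun _ => (C * a) * a) (Ioo_mem_nhds hρ.1 hρ.2) ?_ ?_ ?_ ?_ (integrable_const _) ?_).2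
    · filter_upwards [Ioo_mem_nhds hρ.1 hρ.2] with t ht
      exact aestronglyMeasurable_sphere ha ((hcomp t (Ioo_subset_Icc_self ht)).inner continuousOn_id)
    · exact integrable_sphereMeasure ha ((hcomp ρ (Ioo_subset_Icc_self hρ)).inner continuousOn_id)
    · exact aestronglyMeasurable_sphere ha (((hcomp' ρ (Ioo_subset_Icc_self hρ)).clm_apply
        continuousOn_id).inner continuousOn_id)
    · filter_upwards [ae_mem_sphere ha] with y hy t ht
      have hy' : ‖y‖ = a := by simpa using hy
      refine (norm_inner_le_norm _ _).trans ?_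
      rw [hy']
      refine mul_le_mul_of_nonneg_right ?_ ha.le
      refine (ContinuousLinearMap.le_opNorm _ _).trans ?_
      rw [hy']
      exact mul_le_mul_of_nonneg_right (hC _ (hmem t (Ioo_subset_Icc_self ht) y hy')) ha.le
    · filter_upwards [ae_mem_sphere ha] with y hy t ht
      have hy' : ‖y‖ = a := by simpa using hy
      have h1 : HasDerivAt (fun ρ : ℝ => ρ • y) y t := by
        simpa using (hasDerivAt_id t).smul_const y
      have h2 := (hd _ (hsubR (hmem t (Ioo_subset_Icc_self ht) y hy'))).comp_hasDerivAt t h1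
      have h3 := h2.inner ℝ (hasDerivAt_const t y)
      simpa using h3
  have hzero : ∀ ρ ∈ Ioo (0 : ℝ) 1, 2 * φ ρ + ρ * ∫ y, inner ℝ (fderiv ℝ F (ρ • y) y) y ∂sphereMeasure a = 0 := by
    intro ρ hρ
    have hρm : ∀ x ∈ Metric.ball (0 : E3) R, ρ • x ∈ Metric.ball (0 : E3) R := by
      intro x hx
      rw [mem_ball_zero_iff] at hx ⊢
      rw [norm_smul, Real.norm_eq_abs, abs_of_pos hρ.1]
      nlinarith [hρ.2, norm_nonneg x]
    have hFρ : ContDiffOn ℝ 1 (fun x => F (ρ • x)) (Metric.ball 0 R) :=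
      hF.comp (by fun_prop) hρm
    have hfd : ∀ x ∈ Metric.ball (0 : E3) R, ∀ v, fderiv ℝ (fun x => F (ρ • x)) x v
        = ρ • fderiv ℝ F (ρ • x) v := by
      intro x hx v
      have h1 : HasFDerivAt (fun x : E3 => ρ • x) (ρ • ContinuousLinearMap.id ℝ E3) x :=
        (hasFDerivAt_id x).const_smul ρ
      have h2 := (hd _ (hρm x hx)).comp x h1
      have h3 := h2.fderiv
      rw [Function.comp_def] at h3
      rw [h3]
      simp
    have ht := integral_tangential_divergence ha haR hFρ
    have hi1 : Integrable (fun y => inner ℝ (F (ρ • y)) y) (sphereMeasure a) :=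
      integrable_sphereMeasure ha ((hcomp ρ (Ioo_subset_Icc_self hρ)).inner continuousOn_id)
    have hi2 : Integrable (fun y => inner ℝ (fderiv ℝ F (ρ • y) y) y) (sphereMeasure a) :=
      integrable_sphereMeasure ha (((hcomp' ρ (Ioo_subset_Icc_self hρ)).clm_apply
        continuousOn_id).inner continuousOn_id)
    rw [hφ, ← integral_const_mul, ← integral_const_mul, ← integral_add (hi1.const_mul _)
      (hi2.const_mul _), ← neg_eq_zero, ← integral_neg, ← ht]
    refine integral_sphereMeasure_congr ha fun y hy => ?_
    have hyb : y ∈ Metric.ball (0 : E3) R := by simpa [hy] using haR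
    have hdz : divergence (fun x => F (ρ • x)) y = 0 := by
      have := hdiv (ρ • y) (hρm y hyb)
      simp only [divergence] at this ⊢
      simp only [hfd y hyb, PiLp.smul_apply, smul_eq_mul]
      rw [← Finset.mul_sum, this, mul_zero]
    rw [hdz, hfd y hyb, inner_smul_left]
    simp
    ring
  set u : ℝ → ℝ := fun ρ => ρ ^ 2 * φ ρ with hu
  have hud : ∀ ρ ∈ Ioo (0 : ℝ) 1, HasDerivAt u 0 ρ := by
    intro ρ hρ
    have h0 := hzero ρ hρ
    refine ((hasDerivAt_pow 2 ρ).mul (hφd ρ hρ)).congr_deriv ?_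
    simp only [Nat.cast_ofNat, Nat.add_one_sub_one, pow_one]
    linear_combination ρ * h0
  have hφc : ContinuousOn φ (Icc 0 1) := by
    refine continuousOn_of_dominated (bound := fun _ => C₀ * a) ?_ ?_ (integrable_const _) ?_
    · exact fun ρ hρ => aestronglyMeasurable_sphere ha ((hcomp ρ hρ).inner continuousOn_id)
    · intro ρ hρ
      filter_upwards [ae_mem_sphere ha] with y hy
      have hy' : ‖y‖ = a := by simpa using hy
      refine (norm_inner_le_norm _ _).trans ?_
      rw [hy']
      exact mul_le_mul_of_nonneg_right (hC₀ _ (hmem ρ hρ y hy')) ha.le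
    · filter_upwards [ae_mem_sphere ha] with y hy
      have hy' : ‖y‖ = a := by simpa using hy
      refine ContinuousOn.inner ?_ continuousOn_const
      exact (hF.continuousOn.mono hsubR).comp (by fun_prop) fun ρ hρ => hmem ρ hρ y hy'
  have huc : ContinuousOn u (Icc 0 1) := (by fun_prop : ContinuousOn (fun ρ : ℝ => ρ ^ 2) (Icc 0 1)).mul hφc
  obtain ⟨c, hc1, hc2⟩ := exists_hasDerivAt_eq_slope u (fun _ => 0) one_pos huc hud
  have : u 1 = u 0 := by simp at hc2; linarith
  simpa [hu, hφ] using this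

end

noncomputable section

/-! ### Solid harmonics -/

open MvPolynomial in
/-- The value of a polynomial at a point of `ℝ³`. -/
def ev (p : MvPolynomial (Fin 3) ℝ) (x : E3) : ℝ := eval x.ofLp p

section Eval

open MvPolynomial

variable (p q : MvPolynomial (Fin 3) ℝ) (x : E3)

@[simp] lemma ev_add : ev (p + q) x = ev p x + ev q x := by simp [ev]
@[simp] lemma ev_sub : ev (p - q) x = ev p x - ev q x := by simp [ev]
@[simp] lemma ev_mul : ev (p * q) x = ev p x * ev q x := by simp [ev]
@[simp] lemma ev_smul (c : ℝ) : ev (c • p) x = c * ev p x := by simp [ev]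
@[simp] lemma ev_zero : ev 0 x = 0 := by simp [ev]
@[simp] lemma ev_one : ev 1 x = 1 := by simp [ev]
@[simp] lemma ev_C (c : ℝ) : ev (C c) x = c := by simp [ev]
@[simp] lemma ev_X (i : Fin 3) : ev (X i) x = x i := by simp [ev]
@[simp] lemma ev_sum {ι : Type*} (s : Finset ι) (f : ι → MvPolynomial (Fin 3) ℝ) :
    ev (∑ i ∈ s, f i) x = ∑ i ∈ s, ev (f i) x := by simp [ev]

lemma contDiff_ev : ContDiff ℝ ⊤ (ev p) := by
  induction p using MvPolynomial.induction_on with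
  | C c =>
    have : ev (C c) = fun _ => c := by ext x; simp
    rw [this]
    exact contDiff_const
  | add p q hp hq =>
    have : ev (p + q) = fun x => ev p x + ev q x := by ext x; simp
    rw [this]
    exact hp.add hq
  | mul_X p i hp =>
    have h : ContDiff ℝ ⊤ (fun x : E3 => x i) := (coord i).contDiff
    have : ev (p * X i) = fun x => ev p x * x i := by ext x; simp
    rw [this]
    exact hp.mul h

lemma continuous_ev : Continuous (ev p) := (contDiff_ev p).continuous

lemma hasFDerivAt_ev : HasFDerivAt (ev p) (∑ i, ev (pderiv i p) x • coord i) x := by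
  induction p using MvPolynomial.induction_on with
  | C c =>
    have : ev (C c) = fun _ => c := by ext x; simp
    rw [this]
    simpa using hasFDerivAt_const c x
  | add p q hp hq =>
    have : ev (p + q) = fun x => ev p x + ev q x := by ext x; simp
    rw [this]
    refine (hp.add hq).congr_fderiv ?_
    simp only [map_add, ev_add, add_smul, Finset.sum_add_distrib]
  | mul_X p i hp =>
    have h : HasFDerivAt (fun x : E3 => x i) (coord i) x := (coord i).hasFDerivAt
    have : ev (p * X i) = fun x => ev p x * x i := by ext x; simp
    rw [this]
    refine (hp.mul h).congr_fderiv ?_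
    ext v
    fin_cases i <;> simp [Fin.sum_univ_three, pderiv_X] <;> ring

lemma hasDerivAt_ev_smul (t : ℝ) :
    HasDerivAt (fun t : ℝ => ev p (t • x)) (∑ i, ev (pderiv i p) (t • x) * x i) t := by
  have h1 : HasDerivAt (fun t : ℝ => t • x) x t := by simpa using (hasDerivAt_id t).smul_const x
  refine ((hasFDerivAt_ev p (t • x)).comp_hasDerivAt t h1).congr_deriv ?_
  simp

end Eval

open MvPolynomial

/-- The polynomial `|x|²`. -/
def rsq : MvPolynomial (Fin 3) ℝ := ∑ i, X i * X i

lemma ev_rsq (x : E3) : ev rsq x = ‖x‖ ^ 2 := by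
  simp only [rsq, ev_sum, ev_mul, ev_X]
  rw [EuclideanSpace.real_norm_sq_eq]
  exact Finset.sum_congr rfl fun i _ => by ring

/-- The Euler operator `∑ x_i ∂_i`. -/
def euler : MvPolynomial (Fin 3) ℝ →ₗ[ℝ] MvPolynomial (Fin 3) ℝ :=
  ∑ i, LinearMap.mulLeft ℝ (X i) ∘ₗ (pderiv i).toLinearMap

/-- The Laplace operator on polynomials. -/
def polyLaplacian : MvPolynomial (Fin 3) ℝ →ₗ[ℝ] MvPolynomial (Fin 3) ℝ :=
  ∑ i, (pderiv i).toLinearMap ∘ₗ (pderiv i).toLinearMap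

lemma euler_apply (p : MvPolynomial (Fin 3) ℝ) : euler p = ∑ i, X i * pderiv i p := by simp [euler]

lemma polyLaplacian_apply (p : MvPolynomial (Fin 3) ℝ) :
    polyLaplacian p = ∑ i, pderiv i (pderiv i p) := by simp [polyLaplacian]

lemma pderiv_comm (i j : Fin 3) (p : MvPolynomial (Fin 3) ℝ) :
    pderiv i (pderiv j p) = pderiv j (pderiv i p) := by
  have : ⁅(pderiv i : Derivation ℝ (MvPolynomial (Fin 3) ℝ) (MvPolynomial (Fin 3) ℝ)),
      (pderiv j : Derivation ℝ (MvPolynomial (Fin 3) ℝ) (MvPolynomial (Fin 3) ℝ))⁆ = 0 := by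
    refine MvPolynomial.derivation_ext fun k => ?_
    rw [Derivation.commutator_apply]
    simp only [pderiv_X, Derivation.coe_zero, Pi.zero_apply]
    have h : ∀ a b : Fin 3, (Pi.single (M := fun _ => MvPolynomial (Fin 3) ℝ) a 1 b) = C (if b = a then 1 else 0) := by
      intro a b; by_cases h : b = a <;> simp [h]
    rw [h, h, pderiv_C, pderiv_C, sub_zero]
  have h2 := congrArg (fun D => D p) this
  simp only [Derivation.commutator_apply] at h2
  simpa [sub_eq_zero] using h2

/-- The solid harmonics of degree `c`: the harmonic polynomials which are eigenvectors of the Euler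
operator with eigenvalue `c`. The degree is a real number, so that differentiation lowers it by one
without exception: for negative `c` the space is `0`. -/
def solid (c : ℝ) : Submodule ℝ (MvPolynomial (Fin 3) ℝ) :=
  LinearMap.ker (euler - c • LinearMap.id) ⊓ LinearMap.ker polyLaplacian

lemma mem_solid {c : ℝ} {p : MvPolynomial (Fin 3) ℝ} :
    p ∈ solid c ↔ euler p = c • p ∧ polyLaplacian p = 0 := by
  simp [solid, sub_eq_zero]

lemma C_mem_solid (r : ℝ) : C r ∈ solid 0 := by
  rw [mem_solid, euler_apply, polyLaplacian_apply]; simp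

lemma X_mem_solid (i : Fin 3) : (X i : MvPolynomial (Fin 3) ℝ) ∈ solid 1 := by
  rw [mem_solid, euler_apply, polyLaplacian_apply]
  fin_cases i <;> simp [Fin.sum_univ_three, pderiv_X]

lemma euler_pderiv (i : Fin 3) (p : MvPolynomial (Fin 3) ℝ) :
    euler (pderiv i p) = pderiv i (euler p) - pderiv i p := by
  rw [euler_apply, euler_apply, map_sum]
  simp only [pderiv_mul]
  rw [Finset.sum_add_distrib]
  simp only [pderiv_comm i]
  fin_cases i <;> simp [Fin.sum_univ_three, pderiv_X]

lemma pderiv_mem_solid {c : ℝ} {p : MvPolynomial (Fin 3) ℝ} (hp : p ∈ solid c) (i : Fin 3) :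
    pderiv i p ∈ solid (c - 1) := by
  rw [mem_solid] at hp ⊢
  constructor
  · rw [euler_pderiv, hp.1, Derivation.map_smul, sub_smul, one_smul]
  · have : polyLaplacian (pderiv i p) = pderiv i (polyLaplacian p) := by
      simp only [polyLaplacian_apply, map_sum]
      exact Finset.sum_congr rfl fun j _ => by rw [pderiv_comm j i, pderiv_comm j i]
    rw [this, hp.2, map_zero]

lemma pderiv_rsq (i : Fin 3) : pderiv i rsq = 2 * X i := by
  fin_cases i <;> simp [rsq, Fin.sum_univ_three, pderiv_X] <;> ring

/-- The harmonic part `x_i p - |x|² ∂_i p / (2 c + 1)` of `x_i p`, for a solid harmonic `p` of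
degree `c`. -/
def raise (c : ℝ) (i : Fin 3) (p : MvPolynomial (Fin 3) ℝ) : MvPolynomial (Fin 3) ℝ :=
  X i * p - (2 * c + 1)⁻¹ • (rsq * pderiv i p)

lemma X_mul_eq (c : ℝ) (i : Fin 3) (p : MvPolynomial (Fin 3) ℝ) :
    X i * p = raise c i p + (2 * c + 1)⁻¹ • (rsq * pderiv i p) := by
  rw [raise]; ring

lemma euler_mul (p q : MvPolynomial (Fin 3) ℝ) : euler (p * q) = euler p * q + p * euler q := by
  simp only [euler_apply, pderiv_mul, mul_add, Finset.sum_add_distrib, Finset.sum_mul, Finset.mul_sum]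
  congr 1
  · exact Finset.sum_congr rfl fun i _ => by ring
  · exact Finset.sum_congr rfl fun i _ => by ring

lemma euler_rsq : euler rsq = 2 * rsq := by
  simp only [euler_apply, pderiv_rsq]
  rw [rsq, Finset.mul_sum]
  exact Finset.sum_congr rfl fun i _ => by ring

lemma polyLaplacian_X_mul (i : Fin 3) (p : MvPolynomial (Fin 3) ℝ) :
    polyLaplacian (X i * p) = 2 * pderiv i p + X i * polyLaplacian p := by
  simp only [polyLaplacian_apply, Fin.sum_univ_three]
  fin_cases i <;> simp [pderiv_X] <;> ring

lemma polyLaplacian_rsq_mul (p : MvPolynomial (Fin 3) ℝ) :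
    polyLaplacian (rsq * p) = 6 * p + 4 * euler p + rsq * polyLaplacian p := by
  have h : ∀ i, pderiv i (pderiv i (rsq * p)) = 2 * p + 4 * (X i * pderiv i p) + rsq * pderiv i (pderiv i p) := by
    intro i
    have h2 : pderiv i (2 : MvPolynomial (Fin 3) ℝ) = 0 := by
      have : (2 : MvPolynomial (Fin 3) ℝ) = C 2 := (map_ofNat C 2).symm
      rw [this, pderiv_C]
    simp only [pderiv_mul, pderiv_rsq, map_add, pderiv_X_self, h2]
    ring
  simp only [polyLaplacian_apply, euler_apply, h, Fin.sum_univ_three]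
  ring

lemma raise_mem_solid {c : ℝ} (hc : 2 * c + 1 ≠ 0) {p : MvPolynomial (Fin 3) ℝ} (hp : p ∈ solid c)
    (i : Fin 3) : raise c i p ∈ solid (c + 1) := by
  have hq := pderiv_mem_solid hp i
  have hX := X_mem_solid i
  rw [mem_solid] at hp hq hX ⊢
  constructor
  · rw [raise, map_sub, map_smul, euler_mul, euler_mul, hX.1, hp.1, hq.1, euler_rsq]
    simp only [smul_eq_C_mul, map_add, map_sub, C_1]
    ring
  · rw [raise, map_sub, map_smul, polyLaplacian_X_mul, polyLaplacian_rsq_mul, hp.2, hq.1, hq.2]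
    have : (2 * c + 1)⁻¹ • (6 * pderiv i p + 4 * ((c - 1) • pderiv i p) + rsq * 0)
        = (2 : ℝ) • pderiv i p := by
      have h6 : (6 : MvPolynomial (Fin 3) ℝ) = C 6 := (map_ofNat C 6).symm
      have h4 : (4 : MvPolynomial (Fin 3) ℝ) = C 4 := (map_ofNat C 4).symm
      rw [h6, h4, mul_zero, add_zero, ← smul_eq_C_mul, ← smul_eq_C_mul, smul_smul, ← add_smul, smul_smul]
      congr 1
      field_simp
      ring
    rw [this, mul_zero, add_zero, smul_eq_C_mul, map_ofNat, sub_self]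

/-! ### Integrals of polynomials over the sphere -/

/-- The vector field with polynomial components. -/
def vecEv (P : Fin 3 → MvPolynomial (Fin 3) ℝ) (x : E3) : E3 := WithLp.toLp 2 fun i => ev (P i) x

@[simp] lemma vecEv_apply (P : Fin 3 → MvPolynomial (Fin 3) ℝ) (x : E3) (i : Fin 3) :
    vecEv P x i = ev (P i) x := rfl

lemma contDiff_vecEv (P : Fin 3 → MvPolynomial (Fin 3) ℝ) : ContDiff ℝ ⊤ (vecEv P) := by
  rw [contDiff_euclidean]
  exact fun i => contDiff_ev (P i)

lemma continuous_vecEv (P : Fin 3 → MvPolynomial (Fin 3) ℝ) : Continuous (vecEv P) :=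
  (contDiff_vecEv P).continuous

lemma fderiv_apply_coord {F : E3 → E3} {x : E3} (h : DifferentiableAt ℝ F x) (v : E3) (i : Fin 3) :
    fderiv ℝ F x v i = fderiv ℝ (fun y => F y i) x v := by
  have : HasFDerivAt (fun y => F y i) _ x := (coord i).hasFDerivAt.comp x h.hasFDerivAt
  rw [this.fderiv]
  rfl

lemma divergence_vecEv (P : Fin 3 → MvPolynomial (Fin 3) ℝ) (x : E3) :
    divergence (vecEv P) x = ev (∑ i, pderiv i (P i)) x := by
  have hd : DifferentiableAt ℝ (vecEv P) x := (contDiff_vecEv P).differentiable (by simp) x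
  simp only [divergence, fderiv_apply_coord hd, vecEv_apply, ev_sum]
  refine Finset.sum_congr rfl fun i _ => ?_
  rw [(hasFDerivAt_ev (P i) x).fderiv]
  simp

/-- The integral of a polynomial over the sphere. -/
def sphInt (a : ℝ) (p : MvPolynomial (Fin 3) ℝ) : ℝ := ∫ y, ev p y ∂sphereMeasure a

section SphInt

variable {a : ℝ} (ha : 0 < a)
include ha

lemma integrable_ev (p : MvPolynomial (Fin 3) ℝ) : Integrable (ev p) (sphereMeasure a) :=
  integrable_sphereMeasure ha (continuous_ev p).continuousOn

lemma sphInt_add (p q : MvPolynomial (Fin 3) ℝ) : sphInt a (p + q) = sphInt a p + sphInt a q := by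
  simp only [sphInt, ev_add]
  exact integral_add (integrable_ev ha p) (integrable_ev ha q)

lemma sphInt_sub (p q : MvPolynomial (Fin 3) ℝ) : sphInt a (p - q) = sphInt a p - sphInt a q := by
  simp only [sphInt, ev_sub]
  exact integral_sub (integrable_ev ha p) (integrable_ev ha q)

omit ha in
lemma sphInt_smul (c : ℝ) (p : MvPolynomial (Fin 3) ℝ) : sphInt a (c • p) = c * sphInt a p := by
  simp only [sphInt, ev_smul]
  exact integral_const_mul _ _

lemma sphInt_sum {ι : Type*} (s : Finset ι) (f : ι → MvPolynomial (Fin 3) ℝ) :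
    sphInt a (∑ i ∈ s, f i) = ∑ i ∈ s, sphInt a (f i) := by
  simp only [sphInt, ev_sum]
  exact integral_finsetSum _ fun i _ => integrable_ev ha (f i)

lemma sphInt_rsq_mul (p : MvPolynomial (Fin 3) ℝ) : sphInt a (rsq * p) = a ^ 2 * sphInt a p := by
  rw [sphInt, sphInt, ← integral_const_mul]
  refine integral_sphereMeasure_congr ha fun r hr => ?_
  rw [ev_mul, ev_rsq, hr]

/-- Solid harmonics of different degrees are orthogonal on the sphere: Green's formula. -/
lemma sphInt_mul_eq_zero {c d : ℝ} (hcd : c ≠ d) {p q : MvPolynomial (Fin 3) ℝ} (hp : p ∈ solid c)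
    (hq : q ∈ solid d) : sphInt a (p * q) = 0 := by
  rw [mem_solid] at hp hq
  have hdiv : ∀ x ∈ Metric.ball (0 : E3) (a + 1),
      divergence (vecEv fun i => p * pderiv i q - q * pderiv i p) x = 0 := by
    intro x _
    rw [divergence_vecEv]
    have : ∑ i, pderiv i (p * pderiv i q - q * pderiv i p) = p * polyLaplacian q - q * polyLaplacian p := by
      simp only [polyLaplacian_apply, map_sub, pderiv_mul, Fin.sum_univ_three]
      ring
    rw [this, hp.2, hq.2]
    simp
  have h := integral_flux_eq_zero ha (lt_add_one a)
    ((contDiff_vecEv fun i => p * pderiv i q - q * pderiv i p).of_le (by simp)).contDiffOn hdiv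
  have h2 : ∫ y, inner ℝ (vecEv (fun i => p * pderiv i q - q * pderiv i p) y) y ∂sphereMeasure a
      = (d - c) * sphInt a (p * q) := by
    rw [sphInt, ← integral_const_mul]
    refine integral_sphereMeasure_congr ha fun r hr => ?_
    have e1 := congrArg (fun s => ev s r) hp.1
    have e2 := congrArg (fun s => ev s r) hq.1
    simp only [euler_apply, ev_mul, ev_X, ev_smul, Fin.sum_univ_three, ev_add] at e1 e2
    rw [PiLp.inner_apply]
    simp only [Fin.sum_univ_three, vecEv_apply, ev_sub, ev_mul]
    simp
    linear_combination ev p r * e2 - ev q r * e1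
  rw [h2] at h
  exact (mul_eq_zero.1 h).resolve_left (sub_ne_zero.2 hcd.symm)

/-- Multiplication by a coordinate is adjoint to differentiation, up to a factor. -/
lemma sphInt_X_mul_mul {c : ℝ} (hc : 2 * c + 1 ≠ 0) {p q : MvPolynomial (Fin 3) ℝ} (hp : p ∈ solid c)
    (hq : q ∈ solid (c - 1)) (i : Fin 3) :
    sphInt a (X i * p * q) = (2 * c + 1)⁻¹ * a ^ 2 * sphInt a (pderiv i p * q) := by
  rw [X_mul_eq c i p, add_mul, sphInt_add ha,
    sphInt_mul_eq_zero ha (by linarith) (raise_mem_solid hc hp i) hq, zero_add, smul_mul_assoc,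
    sphInt_smul, mul_assoc rsq, sphInt_rsq_mul ha, mul_assoc]

end SphInt

/-- A solid harmonic of degree `0` is constant. -/
lemma ev_eq_of_mem_solid_zero {p : MvPolynomial (Fin 3) ℝ} (hp : p ∈ solid 0) (x : E3) :
    ev p x = ev p 0 := by
  rw [mem_solid, zero_smul] at hp
  have hc : ContinuousOn (fun t : ℝ => ev p (t • x)) (Icc 0 1) :=
    ((continuous_ev p).comp (by fun_prop)).continuousOn
  obtain ⟨c, hc1, hc2⟩ := exists_hasDerivAt_eq_slope _ _ one_pos hc
    fun t _ => hasDerivAt_ev_smul p x t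
  have e := congrArg (fun s => ev s (c • x)) hp.1
  simp only [euler_apply, ev_sum, ev_mul, ev_X, ev_zero, PiLp.smul_apply, smul_eq_mul] at e
  have e2 : ∑ i, ev (pderiv i p) (c • x) * x i = 0 := by
    have : c * ∑ i, ev (pderiv i p) (c • x) * x i = 0 := by
      rw [← e, Finset.mul_sum]
      exact Finset.sum_congr rfl fun i _ => by ring
    exact (mul_eq_zero.1 this).resolve_left hc1.1.ne'
  rw [e2] at hc2
  simp at hc2
  linarith

end

noncomputable section

/-! ### The Newton potential of a solid harmonic on the sphere -/

lemma hasFDerivAt_inv_norm_pow (n : ℕ) {w : E3} (hw : w ≠ 0) :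
    HasFDerivAt (fun w : E3 => (‖w‖ ^ n)⁻¹) (-(n * (‖w‖ ^ (n + 2))⁻¹) • innerSL ℝ w) w := by
  have hw0 : ‖w‖ ≠ 0 := norm_ne_zero_iff.2 hw
  have h1 : HasFDerivAt (fun w : E3 => ‖w‖ ^ 2) (2 • innerSL ℝ w) w :=
    (hasStrictFDerivAt_norm_sq w).hasFDerivAt
  have h2 : HasFDerivAt (fun w : E3 => ‖w‖) (‖w‖⁻¹ • innerSL ℝ w) w := by
    have := h1.sqrt (pow_ne_zero 2 hw0)
    simp only [Real.sqrt_sq (norm_nonneg _)] at this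
    refine this.congr_fderiv ?_
    ext v
    simp
    field_simp
  have h3 : HasDerivAt (fun t : ℝ => (t ^ n)⁻¹) (-(n * (‖w‖ ^ (n + 1))⁻¹)) ‖w‖ := by
    refine ((hasDerivAt_pow n ‖w‖).fun_inv (pow_ne_zero n hw0)).congr_deriv ?_
    rcases n with _ | n
    · simp
    · simp only [Nat.add_sub_cancel]
      field_simp
      ring
  refine (h3.comp_hasFDerivAt w h2).congr_fderiv ?_
  rw [smul_smul]
  congr 1
  field_simp
  ring

lemma norm_smul_sub_eq {x y : E3} (h : ‖x‖ = ‖y‖) (ρ : ℝ) : ‖ρ • x - y‖ = ‖x - ρ • y‖ := by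
  rw [← sq_eq_sq₀ (norm_nonneg _) (norm_nonneg _), norm_sub_sq_real, norm_sub_sq_real, norm_smul,
    norm_smul, inner_smul_left, inner_smul_right, h]
  simp
  ring

section Potential

variable {a : ℝ} (ha : 0 < a)

/-- The Newton potential `∫ f(y) / |z - y| dσ(y)` of the density `f` on the sphere. -/
def potential (a : ℝ) (f : E3 → ℝ) (z : E3) : ℝ := ∫ y, f y * ‖z - y‖⁻¹ ∂sphereMeasure a

lemma sub_ne_zero_of_norm_lt {z y : E3} (hz : ‖z‖ < a) (hy : ‖y‖ = a) : z - y ≠ 0 := by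
  intro h
  rw [sub_eq_zero] at h
  rw [h, hy] at hz
  exact lt_irrefl _ hz

lemma sub_le_norm_sub {z y : E3} (hy : ‖y‖ = a) : a - ‖z‖ ≤ ‖z - y‖ := by
  have := norm_sub_norm_le y z
  rw [hy, norm_sub_rev] at this
  exact this

lemma continuousOn_inv_norm_sub {z : E3} (hz : ‖z‖ < a) (n : ℕ) :
    ContinuousOn (fun y => (‖z - y‖ ^ n)⁻¹) (Metric.sphere (0 : E3) a) := by
  refine ContinuousOn.inv₀ (by fun_prop) fun y hy => ?_
  exact pow_ne_zero _ (norm_ne_zero_iff.2 (sub_ne_zero_of_norm_lt hz (by simpa using hy)))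

include ha

lemma integrable_mul_inv_norm_sub {f : E3 → ℝ} (hf : ContinuousOn f (Metric.sphere (0 : E3) a)) {z : E3}
    (hz : ‖z‖ < a) : Integrable (fun y => f y * ‖z - y‖⁻¹) (sphereMeasure a) := by
  refine integrable_sphereMeasure ha (hf.mul ?_)
  simpa using continuousOn_inv_norm_sub hz 1

/-- The potential may be differentiated under the integral sign inside the ball. -/
lemma hasFDerivAt_potential {f : E3 → ℝ} (hf : ContinuousOn f (Metric.sphere (0 : E3) a)) {z : E3}
    (hz : ‖z‖ < a) :
    HasFDerivAt (potential a f)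
      (∫ y, (f y * -(‖z - y‖ ^ 3)⁻¹) • innerSL ℝ (z - y) ∂sphereMeasure a) z := by
  obtain ⟨C, hC0, hC⟩ := exists_bound_sphere hf
  set ε := (a - ‖z‖) / 2 with hε
  have hε0 : 0 < ε := by rw [hε]; linarith
  have hball : ∀ w ∈ Metric.ball z ε, ‖w‖ < a - ε := by
    intro w hw
    rw [mem_ball_iff_norm] at hw
    have := norm_le_norm_add_norm_sub' w z
    linarith
  refine hasFDerivAt_integral_of_dominated_of_fderiv_le (s := Metric.ball z ε)
    (F' := fun w y => (f y * -(‖w - y‖ ^ 3)⁻¹) • innerSL ℝ (w - y))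
    (bound := fun _ => C * (ε ^ 2)⁻¹) (Metric.ball_mem_nhds z hε0) ?_ ?_ ?_ ?_ (integrable_const _) ?_
  · filter_upwards [Metric.ball_mem_nhds z hε0] with w hw
    refine aestronglyMeasurable_sphere ha (hf.mul ?_)
    simpa using continuousOn_inv_norm_sub (z := w) (by linarith [hball w hw]) 1
  · refine integrable_sphereMeasure ha (hf.mul ?_)
    simpa using continuousOn_inv_norm_sub hz 1
  · refine aestronglyMeasurable_sphere ha ?_
    refine (hf.mul (continuousOn_inv_norm_sub hz 3).neg).smul ?_
    fun_prop
  · filter_upwards [ae_mem_sphere ha] with y hy w hw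
    have hy' : ‖y‖ = a := by simpa using hy
    have h1 : ε ≤ ‖w - y‖ := by
      have := sub_le_norm_sub (z := w) hy'
      linarith [hball w hw]
    have h2 : 0 < ‖w - y‖ := by linarith
    rw [norm_smul, innerSL_apply_norm, norm_mul, norm_neg, norm_inv, norm_pow, norm_norm, mul_assoc]
    refine mul_le_mul (hC y hy) ?_ (by positivity) hC0
    calc (‖w - y‖ ^ 3)⁻¹ * ‖w - y‖ = (‖w - y‖ ^ 2)⁻¹ := by field_simp
      _ ≤ _ := by gcongr
  · filter_upwards [ae_mem_sphere ha] with y hy w hw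
    have hy' : ‖y‖ = a := by simpa using hy
    have hne : w - y ≠ 0 := sub_ne_zero_of_norm_lt (by linarith [hball w hw]) hy'
    have h := (hasFDerivAt_inv_norm_pow 1 hne).comp w ((hasFDerivAt_id w).sub_const y)
    have h' := h.const_mul (f y)
    simp only [Function.comp_def, pow_one, id] at h'
    refine h'.congr_fderiv ?_
    ext v
    simp
    ring

lemma fderiv_potential_apply {f : E3 → ℝ} (hf : ContinuousOn f (Metric.sphere (0 : E3) a)) {z : E3}
    (hz : ‖z‖ < a) (v : E3) : fderiv ℝ (potential a f) z v =
      ∫ y, f y * -(‖z - y‖ ^ 3)⁻¹ * inner ℝ (z - y) v ∂sphereMeasure a := by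
  rw [(hasFDerivAt_potential ha hf hz).fderiv, ContinuousLinearMap.integral_apply]
  · rfl
  · refine integrable_sphereMeasure ha ?_
    refine (hf.mul (continuousOn_inv_norm_sub hz 3).neg).smul ?_
    fun_prop

open MvPolynomial in
/-- Green's formula in the ball for a solid harmonic `p` and the function `y ↦ 1 / |x - ρ y|`. -/
lemma integral_green_solid {c : ℝ} {p : MvPolynomial (Fin 3) ℝ} (hp : p ∈ solid c) {x : E3}
    (hx : ‖x‖ = a) {ρ : ℝ} (hρ : ρ ∈ Ioo (0 : ℝ) 1) :
    ∫ y, (ρ * (ev p y * (‖x - ρ • y‖ ^ 3)⁻¹ * inner ℝ (x - ρ • y) y) - c * (ev p y * ‖x - ρ • y‖⁻¹))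
      ∂sphereMeasure a = 0 := by
  rw [mem_solid] at hp
  have haR : a < a / ρ := by rw [lt_div_iff₀ hρ.1]; nlinarith [hρ.2]
  have hne : ∀ y ∈ Metric.ball (0 : E3) (a / ρ), x - ρ • y ≠ 0 := by
    intro y hy h
    rw [mem_ball_zero_iff, lt_div_iff₀ hρ.1] at hy
    rw [sub_eq_zero] at h
    rw [h, norm_smul, Real.norm_eq_abs, abs_of_pos hρ.1] at hx
    linarith
  set F : E3 → E3 := fun y => WithLp.toLp 2 fun i =>
    ev p y * (ρ * (‖x - ρ • y‖ ^ 3)⁻¹ * (x i - ρ * y i)) - (‖x - ρ • y‖ ^ 1)⁻¹ * ev (pderiv i p) y with hF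
  have hFC : ContDiffOn ℝ 1 F (Metric.ball 0 (a / ρ)) := by
    rw [contDiffOn_euclidean]
    intro i
    have hN : ∀ n : ℕ, ContDiffOn ℝ 1 (fun y : E3 => (‖x - ρ • y‖ ^ n)⁻¹) (Metric.ball 0 (a / ρ)) := by
      intro n
      have hl : ContDiffOn ℝ 1 (fun y : E3 => x - ρ • y) (Metric.ball 0 (a / ρ)) := by fun_prop
      exact ((hl.norm ℝ hne).pow n).inv fun y hy => pow_ne_zero _ (norm_ne_zero_iff.2 (hne y hy))
    have h1 : ContDiffOn ℝ 1 (fun y : E3 => y i) (Metric.ball 0 (a / ρ)) := (coord i).contDiff.contDiffOn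
    have h2 : ∀ q, ContDiffOn ℝ 1 (ev q) (Metric.ball 0 (a / ρ)) := fun q =>
      ((contDiff_ev q).of_le (by simp)).contDiffOn
    exact ((h2 p).mul ((contDiffOn_const.mul (hN 3)).mul (contDiffOn_const.sub (contDiffOn_const.mul h1)))).sub
      ((hN 1).mul (h2 _))
  have hdiv : ∀ y ∈ Metric.ball (0 : E3) (a / ρ), divergence F y = 0 := by
    intro y hy
    have hd : DifferentiableAt ℝ F y :=
      (hFC.differentiableOn (by simp) y hy).differentiableAt (Metric.isOpen_ball.mem_nhds hy)
    have hN : ∀ n : ℕ, HasFDerivAt (fun y : E3 => (‖x - ρ • y‖ ^ n)⁻¹)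
        ((ρ * (n * (‖x - ρ • y‖ ^ (n + 2))⁻¹)) • innerSL ℝ (x - ρ • y)) y := by
      intro n
      have hl : HasFDerivAt (fun y : E3 => x - ρ • y) (-(ρ • ContinuousLinearMap.id ℝ E3)) y := by
        simpa using ((hasFDerivAt_id y).const_smul ρ).const_sub x
      refine ((hasFDerivAt_inv_norm_pow n (hne y hy)).comp y hl).congr_fderiv ?_
      ext v
      simp
      ring
    have hcomp : ∀ i, fderiv ℝ F y (stdVec i) i =
        ev (pderiv i p) y * (ρ * (‖x - ρ • y‖ ^ 3)⁻¹ * (x i - ρ * y i)) +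
        ev p y * (ρ * (ρ * (3 * (‖x - ρ • y‖ ^ 5)⁻¹ * (x i - ρ * y i)) * (x i - ρ * y i)
          - (‖x - ρ • y‖ ^ 3)⁻¹ * ρ)) -
        ρ * (‖x - ρ • y‖ ^ 3)⁻¹ * (x i - ρ * y i) * ev (pderiv i p) y -
        (‖x - ρ • y‖ ^ 1)⁻¹ * ev (pderiv i (pderiv i p)) y := by
      intro i
      rw [fderiv_apply_coord hd]
      have h1 : HasFDerivAt (fun y : E3 => x i - ρ * y i) (-(ρ • coord i)) y :=
        ((coord i).hasFDerivAt.const_mul ρ).const_sub (x i)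
      have h : HasFDerivAt (fun y => F y i) _ y := ((hasFDerivAt_ev p y).mul (((hN 3).const_mul ρ).mul h1)).sub
        ((hN 1).mul (hasFDerivAt_ev (pderiv i p) y))
      rw [h.fderiv]
      fin_cases i <;> simp [Fin.sum_univ_three, PiLp.inner_apply] <;> ring
    have hpos : ‖x - ρ • y‖ ≠ 0 := norm_ne_zero_iff.2 (hne y hy)
    have hns : ‖x - ρ • y‖ ^ 2 = (x 0 - ρ * y 0) ^ 2 + (x 1 - ρ * y 1) ^ 2 + (x 2 - ρ * y 2) ^ 2 := by
      rw [EuclideanSpace.real_norm_sq_eq, Fin.sum_univ_three]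
      simp
    have hl := congrArg (fun q => ev q y) hp.2
    simp only [polyLaplacian_apply, Fin.sum_univ_three, ev_add, ev_zero] at hl
    have h5 : (‖x - ρ • y‖ ^ 5)⁻¹ * ‖x - ρ • y‖ ^ 2 = (‖x - ρ • y‖ ^ 3)⁻¹ := by field_simp
    rw [hns] at h5
    simp only [divergence, Fin.sum_univ_three, hcomp]
    linear_combination (3 * ρ ^ 2 * ev p y) * h5 - (‖x - ρ • y‖ ^ 1)⁻¹ * hl
  rw [← integral_flux_eq_zero ha haR hFC hdiv]
  refine integral_sphereMeasure_congr ha fun y hy => ?_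
  have he := congrArg (fun q => ev q y) hp.1
  simp only [euler_apply, Fin.sum_univ_three, ev_add, ev_mul, ev_X, ev_smul] at he
  rw [PiLp.inner_apply, PiLp.inner_apply]
  simp [hF, Fin.sum_univ_three]
  linear_combination (‖x - ρ • y‖)⁻¹ * he

omit ha in
lemma norm_smul_lt (ha : 0 < a) {x : E3} (hx : ‖x‖ = a) {ρ : ℝ} (hρ : ρ ∈ Ioo (0 : ℝ) 1) : ‖ρ • x‖ < a := by
  rw [norm_smul, hx, Real.norm_eq_abs, abs_of_pos hρ.1]
  nlinarith [hρ.2]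

/-- Along rays, the potential of a solid harmonic of degree `c` is homogeneous of degree `c`. -/
lemma hasDerivAt_potential_ray {c : ℝ} {p : MvPolynomial (Fin 3) ℝ} (hp : p ∈ solid c) {x : E3}
    (hx : ‖x‖ = a) {ρ : ℝ} (hρ : ρ ∈ Ioo (0 : ℝ) 1) :
    HasDerivAt (fun ρ : ℝ => potential a (ev p) (ρ • x)) (c * potential a (ev p) (ρ • x) / ρ) ρ := by
  have hz : ‖ρ • x‖ < a := norm_smul_lt ha hx hρ
  have hc := (continuous_ev p).continuousOn (s := Metric.sphere (0 : E3) a)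
  have h1 : HasDerivAt (fun t : ℝ => t • x) x ρ := by simpa using (hasDerivAt_id ρ).smul_const x
  have h2 := (hasFDerivAt_potential ha hc hz).differentiableAt.hasFDerivAt.comp_hasDerivAt ρ h1
  refine h2.congr_deriv ?_
  rw [eq_div_iff hρ.1.ne', fderiv_potential_apply ha hc hz, potential]
  have hi1 : Integrable (fun y => ev p y * ‖ρ • x - y‖⁻¹) (sphereMeasure a) :=
    integrable_mul_inv_norm_sub ha hc hz
  have hi2 : Integrable (fun y => ev p y * -(‖ρ • x - y‖ ^ 3)⁻¹ * inner ℝ (ρ • x - y) x)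
      (sphereMeasure a) := by
    refine integrable_sphereMeasure ha ((hc.mul (continuousOn_inv_norm_sub hz 3).neg).mul ?_)
    fun_prop
  rw [← sub_eq_zero, ← integral_mul_const, ← integral_const_mul,
    ← integral_sub (hi2.mul_const _) (hi1.const_mul _), ← integral_green_solid ha hp hx hρ]
  refine integral_sphereMeasure_congr ha fun y hy => ?_
  rw [norm_smul_sub_eq (hx.trans hy.symm)]
  have : inner ℝ (ρ • x - y) x = - inner ℝ (x - ρ • y) y := by
    rw [inner_sub_left, inner_sub_left, inner_smul_left, inner_smul_left, real_inner_self_eq_norm_sq,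
      real_inner_self_eq_norm_sq, hx, hy, real_inner_comm]
    simp
  rw [this]
  ring

/-- The Poisson integral of a solid harmonic in terms of its Newton potential, from
`(2 ρ ∂_ρ + 1) |ρ x - y|⁻¹ = (a² - ρ² a²) / |ρ x - y|³`. -/
lemma integral_poisson_eq_potential {c : ℝ} {p : MvPolynomial (Fin 3) ℝ} (hp : p ∈ solid c) {x : E3}
    (hx : ‖x‖ = a) {ρ : ℝ} (hρ : ρ ∈ Ioo (0 : ℝ) 1) :
    ∫ y, ev p y * (‖ρ • x - y‖ ^ 3)⁻¹ * (a ^ 2 - ρ ^ 2 * a ^ 2) ∂sphereMeasure a =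
      (2 * c + 1) * potential a (ev p) (ρ • x) := by
  have hz : ‖ρ • x‖ < a := norm_smul_lt ha hx hρ
  have hc := (continuous_ev p).continuousOn (s := Metric.sphere (0 : E3) a)
  have h1 : HasDerivAt (fun t : ℝ => t • x) x ρ := by simpa using (hasDerivAt_id ρ).smul_const x
  have hcomp := (hasFDerivAt_potential ha hc hz).differentiableAt.hasFDerivAt.comp_hasDerivAt ρ h1
  rw [Function.comp_def] at hcomp
  have h2 := hcomp.unique (hasDerivAt_potential_ray ha hp hx hρ)
  rw [eq_div_iff hρ.1.ne', fderiv_potential_apply ha hc hz] at h2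
  have hi1 : Integrable (fun y => ev p y * ‖ρ • x - y‖⁻¹) (sphereMeasure a) :=
    integrable_mul_inv_norm_sub ha hc hz
  have hi2 : Integrable (fun y => ev p y * -(‖ρ • x - y‖ ^ 3)⁻¹ * inner ℝ (ρ • x - y) x)
      (sphereMeasure a) := by
    refine integrable_sphereMeasure ha ((hc.mul (continuousOn_inv_norm_sub hz 3).neg).mul ?_)
    fun_prop
  have h3 : (2 * c + 1) * potential a (ev p) (ρ • x) = 2 * (c * potential a (ev p) (ρ • x)) +
    potential a (ev p) (ρ • x) := by ring
  rw [h3, ← h2, potential, ← integral_mul_const, ← integral_const_mul,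
    ← integral_add ((hi2.mul_const _).const_mul _) hi1]
  refine integral_sphereMeasure_congr ha fun y hy => ?_
  have hpos : ‖ρ • x - y‖ ≠ 0 := norm_ne_zero_iff.2 (sub_ne_zero_of_norm_lt hz hy)
  have e1 : ‖ρ • x - y‖ ^ 2 = ρ ^ 2 * a ^ 2 - 2 * (ρ * inner ℝ x y) + a ^ 2 := by
    rw [norm_sub_sq_real, norm_smul, inner_smul_left, hx, hy, mul_pow, Real.norm_eq_abs, sq_abs]
    simp
  have e2 : inner ℝ (ρ • x - y) x = ρ * a ^ 2 - inner ℝ x y := by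
    rw [inner_sub_left, inner_smul_left, real_inner_self_eq_norm_sq, hx, real_inner_comm]
    simp
  have e3 : ‖ρ • x - y‖⁻¹ = (‖ρ • x - y‖ ^ 3)⁻¹ * ‖ρ • x - y‖ ^ 2 := by field_simp
  rw [e3, e1, e2]
  ring

lemma potential_one {x : E3} (hx : ‖x‖ = a) {ρ : ℝ} (hρ : ρ ∈ Ioo (0 : ℝ) 1) :
    potential a (ev 1) (ρ • x) = 4 * Real.pi * a := by
  have h0 : potential a (ev 1) ((0 : ℝ) • x) = 4 * Real.pi * a := by
    rw [potential]
    have : ∫ y, ev 1 y * ‖(0 : ℝ) • x - y‖⁻¹ ∂sphereMeasure a = ∫ y, a⁻¹ ∂sphereMeasure a :=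
      integral_sphereMeasure_congr ha fun y hy => by simp [hy]
    rw [this, integral_const, sphereMeasure_real_univ, smul_eq_mul]
    field_simp
  have hd : ∀ t ∈ Icc 0 ρ, DifferentiableAt ℝ (potential a (ev 1)) (t • x) := fun t ht => by
    refine (hasFDerivAt_potential ha (continuous_ev _).continuousOn ?_).differentiableAt
    rw [norm_smul, hx, Real.norm_eq_abs, abs_of_nonneg ht.1]
    nlinarith [ht.2, hρ.2]
  have hcont : ContinuousOn (fun t : ℝ => potential a (ev 1) (t • x)) (Icc 0 ρ) := fun t ht =>
    ((hd t ht).continuousAt.comp (f := fun t : ℝ => t • x) (by fun_prop)).continuousWithinAt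
  have h1 : (1 : MvPolynomial (Fin 3) ℝ) ∈ solid 0 := by simpa using C_mem_solid 1
  obtain ⟨s, hs1, hs2⟩ := exists_hasDerivAt_eq_slope (fun t : ℝ => potential a (ev 1) (t • x)) _ hρ.1 hcont
    fun t ht => hasDerivAt_potential_ray ha h1 hx ⟨ht.1, ht.2.trans hρ.2⟩
  rw [zero_mul, zero_div, eq_comm, div_eq_zero_iff] at hs2
  rcases hs2 with h | h
  · linarith
  · linarith [hρ.1]

lemma integral_poisson_one {x : E3} (hx : ‖x‖ = a) {ρ : ℝ} (hρ : ρ ∈ Ioo (0 : ℝ) 1) :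
    ∫ y, (‖ρ • x - y‖ ^ 3)⁻¹ * (a ^ 2 - ρ ^ 2 * a ^ 2) ∂sphereMeasure a = 4 * Real.pi * a := by
  have h1 : (1 : MvPolynomial (Fin 3) ℝ) ∈ solid 0 := by simpa using C_mem_solid 1
  have := integral_poisson_eq_potential ha h1 hx hρ
  rw [potential_one ha hx hρ] at this
  simpa using this

omit ha in
lemma norm_sub_le_two_mul {x y : E3} (h : ‖x‖ = ‖y‖) {ρ : ℝ} (hρ : ρ ∈ Ioo (0 : ℝ) 1) :
    ‖x - y‖ ≤ 2 * ‖ρ • x - y‖ := by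
  have h1 := sub_le_norm_sub (z := ρ • x) h.symm
  rw [norm_smul, Real.norm_eq_abs, abs_of_pos hρ.1] at h1
  have h2 : x - y = (1 - ρ) • x + (ρ • x - y) := by module
  have h3 := norm_add_le ((1 - ρ) • x) (ρ • x - y)
  rw [← h2, norm_smul, Real.norm_eq_abs, abs_of_pos (by linarith [hρ.2])] at h3
  linarith

omit ha in
lemma tendsto_ray (x : E3) : Tendsto (fun ρ : ℝ => ρ • x) (𝓝[<] 1) (𝓝 x) := by
  have h : Continuous fun ρ : ℝ => ρ • x := by fun_prop
  have := (h.tendsto 1).mono_left (nhdsWithin_le_nhds (s := Iio (1 : ℝ)))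
  simpa using this

omit ha in
lemma eventually_mem_Ioo : ∀ᶠ ρ in 𝓝[<] (1 : ℝ), ρ ∈ Ioo (0 : ℝ) 1 :=
  Ioo_mem_nhdsLT one_pos

/-- Points of the sphere have surface measure zero: the potential of the sphere is bounded. -/
lemma sphereMeasure_singleton {x : E3} (hx : ‖x‖ = a) : sphereMeasure a {x} = 0 := by
  have h : ∀ ρ ∈ Ioo (0 : ℝ) 1, (sphereMeasure a).real {x} ≤ 4 * Real.pi * a * (a * (1 - ρ)) := by
    intro ρ hρ
    have hz : ‖ρ • x‖ < a := norm_smul_lt ha hx hρ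
    have hi : Integrable (fun y => ev 1 y * ‖ρ • x - y‖⁻¹) (sphereMeasure a) :=
      integrable_mul_inv_norm_sub ha (continuous_ev 1).continuousOn hz
    have h1 : ∫ y in {x}, ev 1 y * ‖ρ • x - y‖⁻¹ ∂sphereMeasure a ≤ 4 * Real.pi * a := by
      rw [← potential_one ha hx hρ]
      exact setIntegral_le_integral hi (.of_forall fun y => by simp)
    rw [integral_singleton] at h1
    have h2 : ‖ρ • x - x‖ = a * (1 - ρ) := by
      have : ρ • x - x = (-(1 - ρ)) • x := by module
      rw [this, norm_smul, hx, norm_neg, Real.norm_eq_abs, abs_of_pos (by linarith [hρ.2]), mul_comm]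
    rw [h2] at h1
    have h3 : 0 < a * (1 - ρ) := mul_pos ha (by linarith [hρ.2])
    simp only [ev_one, one_mul, smul_eq_mul] at h1
    rwa [← div_eq_mul_inv, div_le_iff₀ h3] at h1
  have h2 : Tendsto (fun ρ : ℝ => 4 * Real.pi * a * (a * (1 - ρ))) (𝓝[<] 1) (𝓝 0) := by
    have hc : Continuous fun ρ : ℝ => 4 * Real.pi * a * (a * (1 - ρ)) := by fun_prop
    have := (hc.tendsto 1).mono_left (nhdsWithin_le_nhds (s := Iio (1 : ℝ)))
    simpa using this
  have h3 := ge_of_tendsto h2 (eventually_mem_Ioo.mono h)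
  have h4 : (sphereMeasure a).real {x} = 0 := le_antisymm h3 measureReal_nonneg
  rwa [measureReal_eq_zero_iff] at h4

lemma ae_ne {x : E3} (hx : ‖x‖ = a) : ∀ᵐ y ∂sphereMeasure a, y ≠ x := by
  rw [ae_iff]
  simpa using sphereMeasure_singleton ha hx

/-- The singular kernel `1 / |x - y|` has integral at most `4 π a` over the sphere. -/
lemma lintegral_inv_norm_sub_le {x : E3} (hx : ‖x‖ = a) :
    ∫⁻ y, ENNReal.ofReal (‖x - y‖⁻¹) ∂sphereMeasure a ≤ ENNReal.ofReal (4 * Real.pi * a) := by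
  set ρ : ℕ → ℝ := fun n => 1 - 1 / ((n : ℝ) + 2) with hρdef
  have hρ : ∀ n, ρ n ∈ Ioo (0 : ℝ) 1 := by
    intro n
    have hn : (0 : ℝ) ≤ n := Nat.cast_nonneg n
    have h1 : 1 / ((n : ℝ) + 2) < 1 := by rw [div_lt_one (by linarith)]; linarith
    have h2 : 0 < 1 / ((n : ℝ) + 2) := by positivity
    exact ⟨by simp only [hρdef]; linarith, by simp only [hρdef]; linarith⟩
  have hlim : Tendsto ρ atTop (𝓝 1) := by
    have h := (tendsto_one_div_add_atTop_nhds_zero_nat (𝕜 := ℝ)).comp (tendsto_add_atTop_nat 1)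
    have h' := (tendsto_const_nhds (x := (1 : ℝ))).sub h
    rw [sub_zero] at h'
    refine h'.congr fun n => ?_
    simp only [hρdef, Function.comp_apply, Nat.cast_add, Nat.cast_one]
    ring
  calc ∫⁻ y, ENNReal.ofReal (‖x - y‖⁻¹) ∂sphereMeasure a
      ≤ ∫⁻ y, liminf (fun n => ENNReal.ofReal (‖ρ n • x - y‖⁻¹)) atTop ∂sphereMeasure a := by
        refine lintegral_mono_ae ?_
        filter_upwards [ae_ne ha hx] with y hy
        refine le_of_eq (Tendsto.liminf_eq ?_).symm
        refine (ENNReal.continuous_ofReal.tendsto _).comp ?_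
        refine Tendsto.inv₀ ?_ (norm_ne_zero_iff.2 (sub_ne_zero.2 hy.symm))
        have : Tendsto (fun n => ρ n • x) atTop (𝓝 ((1 : ℝ) • x)) := hlim.smul_const x
        rw [one_smul] at this
        exact (this.sub_const y).norm
    _ ≤ liminf (fun n => ∫⁻ y, ENNReal.ofReal (‖ρ n • x - y‖⁻¹) ∂sphereMeasure a) atTop :=
        lintegral_liminf_le fun n => by fun_prop
    _ = liminf (fun _ : ℕ => ENNReal.ofReal (4 * Real.pi * a)) atTop := by
        congr 1
        ext n
        have hi : Integrable (fun y => ‖ρ n • x - y‖⁻¹) (sphereMeasure a) := by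
          simpa using integrable_sphereMeasure ha
            (continuousOn_inv_norm_sub (norm_smul_lt ha hx (hρ n)) 1)
        rw [← ofReal_integral_eq_lintegral_ofReal hi (.of_forall fun y => by positivity),
          ← potential_one ha hx (hρ n)]
        simp [potential]
    _ = _ := by simp

lemma integrable_inv_norm_sub {x : E3} (hx : ‖x‖ = a) :
    Integrable (fun y => ‖x - y‖⁻¹) (sphereMeasure a) := by
  refine ⟨by fun_prop, ?_⟩
  rw [hasFiniteIntegral_iff_ofReal (.of_forall fun y => by positivity)]
  exact (lintegral_inv_norm_sub_le ha hx).trans_lt ENNReal.ofReal_lt_top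

omit ha in
lemma exists_lipschitzOnWith_vecEv (P : Fin 3 → MvPolynomial (Fin 3) ℝ) (R : ℝ) :
    ∃ K, LipschitzOnWith K (vecEv P) (Metric.closedBall 0 R) :=
  ((contDiff_vecEv P).of_le (by simp)).contDiffOn.exists_lipschitzOnWith one_ne_zero
    (convex_closedBall _ _) (isCompact_closedBall _ _)

omit ha in
lemma exists_lipschitz_ev (p : MvPolynomial (Fin 3) ℝ) (a : ℝ) :
    ∃ K : ℝ, 0 ≤ K ∧ ∀ x y : E3, ‖x‖ = a → ‖y‖ = a → |ev p x - ev p y| ≤ K * ‖x - y‖ := by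
  obtain ⟨K, hK⟩ := ((contDiff_ev p).of_le (by simp : (1 : WithTop ℕ∞) ≤ ⊤)).contDiffOn.exists_lipschitzOnWith one_ne_zero
    (convex_closedBall (0 : E3) a) (isCompact_closedBall _ _)
  refine ⟨K, K.2, fun x y hx hy => ?_⟩
  have := hK.norm_sub_le (by simp [hx] : x ∈ Metric.closedBall (0 : E3) a) (by simp [hy] : y ∈ Metric.closedBall (0 : E3) a)
  simpa using this

/-- The Poisson kernel is an approximate identity. -/
lemma tendsto_integral_poisson (p : MvPolynomial (Fin 3) ℝ) {x : E3} (hx : ‖x‖ = a) :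
    Tendsto (fun ρ : ℝ => ∫ y, ev p y * (‖ρ • x - y‖ ^ 3)⁻¹ * (a ^ 2 - ρ ^ 2 * a ^ 2) ∂sphereMeasure a)
      (𝓝[<] 1) (𝓝 (4 * Real.pi * a * ev p x)) := by
  obtain ⟨K, hK0, hK⟩ := exists_lipschitz_ev p a
  have key : Tendsto (fun ρ : ℝ => ∫ y, (ev p y - ev p x) * (‖ρ • x - y‖ ^ 3)⁻¹ * (a ^ 2 - ρ ^ 2 * a ^ 2)
      ∂sphereMeasure a) (𝓝[<] 1) (𝓝 (∫ y, 0 ∂sphereMeasure a)) := by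
    refine tendsto_integral_filter_of_dominated_convergence (fun y => 8 * a * K * ‖x - y‖⁻¹) ?_ ?_
      ((integrable_inv_norm_sub ha hx).const_mul _) ?_
    · refine .of_forall fun ρ => ?_
      have := (continuous_ev p).measurable
      exact Measurable.aestronglyMeasurable (by fun_prop)
    · filter_upwards [eventually_mem_Ioo] with ρ hρ
      filter_upwards [ae_mem_sphere ha, ae_ne ha hx] with y hy hyx
      have hy' : ‖y‖ = a := by simpa using hy
      have h0 : 0 < ‖x - y‖ := norm_pos_iff.2 (sub_ne_zero.2 hyx.symm)
      have h1 := norm_sub_le_two_mul (hx.trans hy'.symm) hρ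
      have h2 : 0 < ‖ρ • x - y‖ := by linarith
      have h3 := sub_le_norm_sub (z := ρ • x) hy'
      rw [norm_smul, hx, Real.norm_eq_abs, abs_of_pos hρ.1] at h3
      have h4 := hK y x hy' hx
      rw [norm_sub_rev y x] at h4
      have h5 : |a ^ 2 - ρ ^ 2 * a ^ 2| ≤ 2 * a * ‖ρ • x - y‖ := by
        have e : a ^ 2 - ρ ^ 2 * a ^ 2 = (a - ρ * a) * (a + ρ * a) := by ring
        have e1 : 0 ≤ a - ρ * a := by nlinarith [hρ.2]
        have e2 : 0 ≤ a + ρ * a := by nlinarith [hρ.1]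
        rw [e, abs_of_nonneg (mul_nonneg e1 e2), mul_comm]
        exact mul_le_mul (by nlinarith [hρ.2]) h3 e1 (by linarith)
      rw [norm_mul, norm_mul, norm_inv, norm_pow, norm_norm, Real.norm_eq_abs, Real.norm_eq_abs]
      calc |ev p y - ev p x| * (‖ρ • x - y‖ ^ 3)⁻¹ * |a ^ 2 - ρ ^ 2 * a ^ 2|
          ≤ (K * (2 * ‖ρ • x - y‖)) * (‖ρ • x - y‖ ^ 3)⁻¹ * (2 * a * ‖ρ • x - y‖) := by
            gcongr
            exact h4.trans (by gcongr)
        _ = 4 * a * K * ‖ρ • x - y‖⁻¹ := by field_simp; ring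
        _ ≤ 4 * a * K * (2 * ‖x - y‖⁻¹) := by
            gcongr
            rw [← div_eq_mul_inv, le_div_iff₀ h0, inv_mul_le_iff₀ h2]
            linarith
        _ = _ := by ring
    · filter_upwards [ae_ne ha hx] with y hyx
      have h1 : Tendsto (fun ρ : ℝ => a ^ 2 - ρ ^ 2 * a ^ 2) (𝓝[<] 1) (𝓝 0) := by
        have hc : Continuous fun ρ : ℝ => a ^ 2 - ρ ^ 2 * a ^ 2 := by fun_prop
        simpa using (hc.tendsto 1).mono_left (nhdsWithin_le_nhds (s := Iio (1 : ℝ)))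
      have h2 : Tendsto (fun ρ : ℝ => (‖ρ • x - y‖ ^ 3)⁻¹) (𝓝[<] 1) (𝓝 ((‖x - y‖ ^ 3)⁻¹)) :=
        ((((tendsto_ray x).sub_const y).norm).pow 3).inv₀
          (pow_ne_zero _ (norm_ne_zero_iff.2 (sub_ne_zero.2 hyx.symm)))
      simpa using (h2.const_mul (ev p y - ev p x)).mul h1
  rw [integral_zero] at key
  have := key.add_const (4 * Real.pi * a * ev p x)
  rw [zero_add] at this
  refine this.congr' ?_
  filter_upwards [eventually_mem_Ioo] with ρ hρ
  have hz : ‖ρ • x‖ < a := norm_smul_lt ha hx hρ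
  have hc := continuousOn_inv_norm_sub hz 3
  have hi1 : Integrable (fun y => (ev p y - ev p x) * (‖ρ • x - y‖ ^ 3)⁻¹ * (a ^ 2 - ρ ^ 2 * a ^ 2))
      (sphereMeasure a) := integrable_sphereMeasure ha
        ((((continuous_ev p).continuousOn.sub continuousOn_const).mul hc).mul continuousOn_const)
  have hi2 : Integrable (fun y => (‖ρ • x - y‖ ^ 3)⁻¹ * (a ^ 2 - ρ ^ 2 * a ^ 2))
      (sphereMeasure a) := integrable_sphereMeasure ha (hc.mul continuousOn_const)
  rw [← integral_poisson_one ha hx hρ, ← integral_mul_const, ← integral_add hi1 (hi2.mul_const _)]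
  refine integral_congr_ae (.of_forall fun y => ?_)
  simp only
  ring

/-- The Newton potential of a solid harmonic inside the ball. -/
theorem potential_solid_ray {c : ℝ} (hc : 2 * c + 1 ≠ 0) {p : MvPolynomial (Fin 3) ℝ}
    (hp : p ∈ solid c) {x : E3} (hx : ‖x‖ = a) {ρ : ℝ} (hρ : ρ ∈ Ioo (0 : ℝ) 1) :
    potential a (ev p) (ρ • x) = 4 * Real.pi * a / (2 * c + 1) * ev p (ρ • x) := by
  set d : ℝ → ℝ := fun ρ => potential a (ev p) (ρ • x) - 4 * Real.pi * a / (2 * c + 1) * ev p (ρ • x) with hd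
  have hdd : ∀ t ∈ Ioo (0 : ℝ) 1, HasDerivAt d (c * d t / t) t := by
    intro t ht
    have he := congrArg (fun q => ev q (t • x)) (mem_solid.1 hp).1
    simp only [euler_apply, ev_sum, ev_mul, ev_X, ev_smul, PiLp.smul_apply, smul_eq_mul] at he
    have he2 : ∑ i, ev (MvPolynomial.pderiv i p) (t • x) * x i = c * ev p (t • x) / t := by
      rw [eq_div_iff ht.1.ne', ← he, Finset.sum_mul]
      exact Finset.sum_congr rfl fun i _ => by ring
    refine ((hasDerivAt_potential_ray ha hp hx ht).sub
      ((hasDerivAt_ev_smul p x t).const_mul (4 * Real.pi * a / (2 * c + 1)))).congr_deriv ?_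
    rw [he2]
    simp only [hd]
    ring
  have hlim : Tendsto d (𝓝[<] 1) (𝓝 0) := by
    have h1 : Tendsto (fun ρ : ℝ => (2 * c + 1) * potential a (ev p) (ρ • x)) (𝓝[<] 1)
        (𝓝 (4 * Real.pi * a * ev p x)) := by
      refine (tendsto_integral_poisson ha p hx).congr' ?_
      filter_upwards [eventually_mem_Ioo] with ρ hρ using integral_poisson_eq_potential ha hp hx hρ
    have h2 := ((continuous_ev p).tendsto x).comp (tendsto_ray x)
    have h3 := (h1.const_mul (2 * c + 1)⁻¹).sub (h2.const_mul (4 * Real.pi * a / (2 * c + 1)))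
    have h4 : (2 * c + 1)⁻¹ * (4 * Real.pi * a * ev p x) - 4 * Real.pi * a / (2 * c + 1) * ev p x = 0 := by
      ring
    rw [h4] at h3
    refine h3.congr fun ρ => ?_
    simp only [hd, Function.comp_apply]
    field_simp
  -- `ρ ↦ d(ρ) ρ^{-c}` is constant on `(0, 1)` and tends to zero at `1`
  set k : ℝ → ℝ := fun t => d t * t ^ (-c) with hk
  have hkd : ∀ t ∈ Ioo (0 : ℝ) 1, HasDerivAt k 0 t := by
    intro t ht
    refine ((hdd t ht).mul (Real.hasDerivAt_rpow_const (p := -c) (Or.inl ht.1.ne'))).congr_deriv ?_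
    rw [Real.rpow_sub_one ht.1.ne']
    ring
  have hkc : ∀ t ∈ Ioo (0 : ℝ) 1, k t = k ρ := by
    intro t ht
    refine IsOpen.is_const_of_deriv_eq_zero isOpen_Ioo isPreconnected_Ioo
      (fun s hs => (hkd s hs).differentiableAt.differentiableWithinAt) (fun s hs => (hkd s hs).deriv) ht hρ
  have hk0 : Tendsto k (𝓝[<] 1) (𝓝 0) := by
    have hr : Tendsto (fun t : ℝ => t ^ (-c)) (𝓝[<] 1) (𝓝 ((1 : ℝ) ^ (-c))) :=
      ((Real.continuousAt_rpow_const 1 (-c) (Or.inl one_ne_zero)).tendsto).mono_left nhdsWithin_le_nhds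
    simpa using hlim.mul hr
  have hk1 : k ρ = 0 := by
    refine tendsto_nhds_unique ?_ hk0
    refine tendsto_const_nhds.congr' ?_
    filter_upwards [eventually_mem_Ioo] with t ht using (hkc t ht).symm
  have hd0 : d ρ = 0 := (mul_eq_zero.1 hk1).resolve_right (Real.rpow_pos_of_pos hρ.1 _).ne'
  exact sub_eq_zero.1 hd0

omit ha in
lemma exists_ray {z : E3} (hz0 : z ≠ 0) (hz : ‖z‖ < a) :
    ∃ x : E3, ‖x‖ = a ∧ ∃ ρ ∈ Ioo (0 : ℝ) 1, z = ρ • x := by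
  have h0 : 0 < ‖z‖ := norm_pos_iff.2 hz0
  have ha : 0 < a := h0.trans hz
  refine ⟨(a / ‖z‖) • z, ?_, ‖z‖ / a, ⟨by positivity, by rwa [div_lt_one ha]⟩, ?_⟩
  · rw [norm_smul, Real.norm_eq_abs, abs_of_pos (by positivity)]
    field_simp
  · rw [smul_smul]
    have : ‖z‖ / a * (a / ‖z‖) = 1 := by field_simp
    rw [this, one_smul]

/-- Inside the sphere the Newtonian potential of a solid harmonic of degree `c` is
`4 π a / (2 c + 1)` times that harmonic. -/
theorem potential_solid {c : ℝ} (hc : 2 * c + 1 ≠ 0) {p : MvPolynomial (Fin 3) ℝ}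
    (hp : p ∈ solid c) {z : E3} (hz0 : z ≠ 0) (hz : ‖z‖ < a) :
    potential a (ev p) z = 4 * Real.pi * a / (2 * c + 1) * ev p z := by
  obtain ⟨x, hx, ρ, hρ, rfl⟩ := exists_ray hz0 hz
  exact potential_solid_ray ha hc hp hx hρ

/-- Poisson's formula for solid harmonics. -/
theorem integral_poisson_solid {c : ℝ} (hc : 2 * c + 1 ≠ 0) {p : MvPolynomial (Fin 3) ℝ}
    (hp : p ∈ solid c) {x : E3} (hx : ‖x‖ = a) {ρ : ℝ} (hρ : ρ ∈ Ioo (0 : ℝ) 1) :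
    ∫ y, ev p y * (‖ρ • x - y‖ ^ 3)⁻¹ * (a ^ 2 - ρ ^ 2 * a ^ 2) ∂sphereMeasure a =
      4 * Real.pi * a * ev p (ρ • x) := by
  rw [integral_poisson_eq_potential ha hp hx hρ, potential_solid_ray ha hc hp hx hρ]
  field_simp

end Potential

end

noncomputable section

/-! ### Fields in `H^{1/2}` -/

/-- The function `(x, y) ↦ g(x) - g(y)` of a field `g ∈ H^{1/2}`, as an element of `L²`. -/
def sobolevDiff {a : ℝ} (g : sobolevHalf a) : Lp E3 2 (gagliardoMeasure a) :=
  (g : WithLp 2 (Lp E3 2 (sphereMeasure a) × Lp E3 2 (gagliardoMeasure a))).snd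

lemma sobolevDiff_ae {a : ℝ} (g : sobolevHalf a) :
    sobolevDiff g =ᵐ[gagliardoMeasure a] fun z => toL2 a g z.1 - toL2 a g z.2 := g.2

lemma sobolev_inner {a : ℝ} (g h : sobolevHalf a) :
    inner ℝ g h = inner ℝ (toL2 a g) (toL2 a h) + inner ℝ (sobolevDiff g) (sobolevDiff h) := by
  rw [Submodule.coe_inner, WithLp.prod_inner_apply]
  rfl

lemma sobolev_norm_sq {a : ℝ} (g : sobolevHalf a) :
    ‖g‖ ^ 2 = ‖toL2 a g‖ ^ 2 + ‖sobolevDiff g‖ ^ 2 := by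
  rw [← real_inner_self_eq_norm_sq, sobolev_inner, real_inner_self_eq_norm_sq, real_inner_self_eq_norm_sq]

lemma toL2_lipField {a : ℝ} {φ : E3 → E3} (h : ∃ K, LipschitzWith K φ) :
    toL2 a (lipField a φ h) =ᵐ[sphereMeasure a] φ := (memLp_sphere h a).coeFn_toLp

lemma sobolev_ext {a : ℝ} {g h : sobolevHalf a} (H : toL2 a g =ᵐ[sphereMeasure a] toL2 a h) : g = h :=
  toL2_injective a (Lp.ext H)

lemma gagliardo_ae_mem {a : ℝ} (ha : 0 < a) :
    ∀ᵐ z ∂gagliardoMeasure a, ‖z.1‖ = a ∧ ‖z.2‖ = a := by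
  have h : ∀ᵐ r ∂sphereMeasure a, ‖r‖ = a := by
    filter_upwards [ae_mem_sphere ha] with r hr using by simpa using hr
  filter_upwards [(qmp_fst a).ae h, (qmp_snd a).ae h] with z h1 h2 using ⟨h1, h2⟩

/-- The norm in `H^{1/2}` of a field with bound `M` and Lipschitz constant `K` on the sphere is at
most a constant times `M + K`. -/
lemma exists_sobolev_norm_le {a : ℝ} (ha : 0 < a) : ∃ C, 0 < C ∧ ∀ (g : sobolevHalf a) (φ : E3 → E3)
    (M K : ℝ), toL2 a g =ᵐ[sphereMeasure a] φ → 0 ≤ M → 0 ≤ K → (∀ r, ‖r‖ = a → ‖φ r‖ ≤ M) →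
    (∀ r s, ‖r‖ = a → ‖s‖ = a → ‖φ r - φ s‖ ≤ K * ‖r - s‖) → ‖g‖ ≤ C * (M + K) := by
  set D := sobolevDiff (lipField a id ⟨1, LipschitzWith.id⟩) with hD
  set C₁ : ℝ := (measureUnivNNReal (sphereMeasure a) : ℝ) ^ (ENNReal.toReal 2)⁻¹ with hC₁
  have hC₁0 : 0 ≤ C₁ := by positivity
  refine ⟨C₁ + ‖D‖ + 1, by positivity, fun g φ M K hg hM hK hφM hφK => ?_⟩
  have h1 : ‖toL2 a g‖ ≤ C₁ * M := by
    refine Lp.norm_le_of_ae_bound hM ?_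
    filter_upwards [hg, ae_mem_sphere ha] with r hr hr2
    rw [hr]
    exact hφM r (by simpa using hr2)
  have h2 : ‖sobolevDiff g‖ ≤ K * ‖D‖ := by
    refine Lp.norm_le_mul_norm_of_ae_le_mul ?_
    have hid := toL2_lipField (a := a) (φ := id) ⟨1, LipschitzWith.id⟩
    filter_upwards [sobolevDiff_ae g, sobolevDiff_ae (lipField a id ⟨1, LipschitzWith.id⟩),
      (qmp_fst a).ae hg, (qmp_snd a).ae hg, (qmp_fst a).ae hid, (qmp_snd a).ae hid, gagliardo_ae_mem ha]
      with z e1 e2 e3 e4 e5 e6 e7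
    rw [hD, e1, e2, e3, e4, e5, e6]
    exact hφK _ _ e7.1 e7.2
  have h3 : ‖g‖ ^ 2 ≤ (‖toL2 a g‖ + ‖sobolevDiff g‖) ^ 2 := by
    rw [sobolev_norm_sq]
    nlinarith [norm_nonneg (toL2 a g), norm_nonneg (sobolevDiff g)]
  have h4 := abs_le_of_sq_le_sq' h3 (by positivity)
  nlinarith [norm_nonneg D, mul_nonneg hC₁0 hK, mul_nonneg (norm_nonneg D) hM]

section SphereField

variable {a : ℝ} {φ : E3 → E3}

/-- The element of `H^{1/2}` given by a field which is Lipschitz on the sphere. -/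
def sphereField (a : ℝ) (φ : E3 → E3) (h : ∃ K, LipschitzOnWith K φ (Metric.sphere 0 a)) : sobolevHalf a :=
  lipField a h.choose_spec.extend_finite_dimension.choose
    ⟨_, h.choose_spec.extend_finite_dimension.choose_spec.1⟩

lemma toL2_sphereField (ha : 0 < a) (h : ∃ K, LipschitzOnWith K φ (Metric.sphere 0 a)) :
    toL2 a (sphereField a φ h) =ᵐ[sphereMeasure a] φ := by
  filter_upwards [toL2_lipField (a := a) ⟨_, h.choose_spec.extend_finite_dimension.choose_spec.1⟩,
    ae_mem_sphere ha] with r h1 h2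
  rw [sphereField, h1]
  exact (h.choose_spec.extend_finite_dimension.choose_spec.2 h2).symm

end SphereField

/-- The element of `H^{1/2}` given by a polynomial vector field. -/
def polyField (a : ℝ) (P : Fin 3 → MvPolynomial (Fin 3) ℝ) : sobolevHalf a :=
  sphereField a (vecEv P) (by
    obtain ⟨K, hK⟩ := exists_lipschitzOnWith_vecEv P a
    exact ⟨K, hK.mono Metric.sphere_subset_closedBall⟩)

lemma toL2_polyField {a : ℝ} (ha : 0 < a) (P : Fin 3 → MvPolynomial (Fin 3) ℝ) :
    toL2 a (polyField a P) =ᵐ[sphereMeasure a] vecEv P := toL2_sphereField ha _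

lemma inner_toL2_polyField {a : ℝ} (ha : 0 < a) (P : Fin 3 → MvPolynomial (Fin 3) ℝ)
    (φ : Lp E3 2 (sphereMeasure a)) :
    inner ℝ (toL2 a (polyField a P)) φ = ∫ x, inner ℝ (vecEv P x) (φ x) ∂sphereMeasure a := by
  rw [L2.inner_def]
  refine integral_congr_ae ?_
  filter_upwards [toL2_polyField ha P] with x hx
  rw [hx]

/-! ### The Gagliardo form of solid harmonics -/

/-- The truncated kernel `1 / |ρ x - y|³`, which increases to `1 / |x - y|³` up to a factor. -/
def truncKernel (ρ : ℝ) (x y : E3) : ℝ := (‖ρ • x - y‖ ^ 3)⁻¹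

lemma measurable_truncKernel (ρ : ℝ) : Measurable fun z : E3 × E3 => truncKernel ρ z.1 z.2 := by
  unfold truncKernel
  fun_prop

lemma truncKernel_comm {x y : E3} (h : ‖x‖ = ‖y‖) (ρ : ℝ) : truncKernel ρ x y = truncKernel ρ y x := by
  rw [truncKernel, truncKernel, norm_smul_sub_eq h, norm_sub_rev]

lemma truncKernel_nonneg (ρ : ℝ) (x y : E3) : 0 ≤ truncKernel ρ x y := by
  unfold truncKernel; positivity

lemma prod_ae_mem {a : ℝ} (ha : 0 < a) :
    ∀ᵐ z ∂(sphereMeasure a).prod (sphereMeasure a), ‖z.1‖ = a ∧ ‖z.2‖ = a := by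
  have h : ∀ᵐ r ∂sphereMeasure a, ‖r‖ = a := by
    filter_upwards [ae_mem_sphere ha] with r hr using by simpa using hr
  filter_upwards [Measure.quasiMeasurePreserving_fst.ae h, Measure.quasiMeasurePreserving_snd.ae h]
    with z h1 h2 using ⟨h1, h2⟩

lemma truncKernel_le {a : ℝ} (ha : 0 < a) {ρ : ℝ} (hρ : ρ ∈ Ioo (0 : ℝ) 1) {x y : E3} (hx : ‖x‖ = a)
    (hy : ‖y‖ = a) : truncKernel ρ x y ≤ ((a * (1 - ρ)) ^ 3)⁻¹ := by
  have h1 := sub_le_norm_sub (z := ρ • x) hy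
  rw [norm_smul, hx, Real.norm_eq_abs, abs_of_pos hρ.1] at h1
  have h2 : 0 < a * (1 - ρ) := mul_pos ha (by linarith [hρ.2])
  unfold truncKernel
  gcongr
  linarith

lemma truncKernel_le_eight {x y : E3} (h : ‖x‖ = ‖y‖) (hxy : x ≠ y) {ρ : ℝ} (hρ : ρ ∈ Ioo (0 : ℝ) 1) :
    truncKernel ρ x y ≤ 8 * (‖x - y‖ ^ 3)⁻¹ := by
  have h1 := norm_sub_le_two_mul h hρ
  have h0 : 0 < ‖x - y‖ := norm_pos_iff.2 (sub_ne_zero.2 hxy)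
  have h2 : ‖x - y‖ / 2 ≤ ‖ρ • x - y‖ := by linarith
  unfold truncKernel
  calc (‖ρ • x - y‖ ^ 3)⁻¹ ≤ ((‖x - y‖ / 2) ^ 3)⁻¹ := by gcongr
    _ = _ := by field_simp; norm_num

lemma ev_smul_solid {c : ℝ} {p : MvPolynomial (Fin 3) ℝ} (hp : p ∈ solid c) (x : E3) {ρ : ℝ}
    (hρ : 0 < ρ) : ev p (ρ • x) = ρ ^ c * ev p x := by
  have hd : ∀ t ∈ Ioi (0 : ℝ), HasDerivAt (fun t : ℝ => ev p (t • x) * t ^ (-c)) 0 t := by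
    intro t ht
    have ht' : (0 : ℝ) < t := ht
    have he := congrArg (fun q => ev q (t • x)) (mem_solid.1 hp).1
    simp only [euler_apply, ev_sum, ev_mul, ev_X, ev_smul, PiLp.smul_apply, smul_eq_mul] at he
    have he2 : ∑ i, ev (MvPolynomial.pderiv i p) (t • x) * x i = c * ev p (t • x) / t := by
      rw [eq_div_iff ht'.ne', ← he, Finset.sum_mul]
      exact Finset.sum_congr rfl fun i _ => by ring
    refine ((hasDerivAt_ev_smul p x t).mul
      (Real.hasDerivAt_rpow_const (p := -c) (Or.inl ht'.ne'))).congr_deriv ?_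
    rw [Real.rpow_sub_one ht'.ne', he2]
    ring
  have := IsOpen.is_const_of_deriv_eq_zero isOpen_Ioi isPreconnected_Ioi
      (fun s hs => (hd s hs).differentiableAt.differentiableWithinAt) (fun s hs => (hd s hs).deriv)
      (mem_Ioi.2 hρ) (mem_Ioi.2 one_pos)
  simp only [one_smul, Real.one_rpow, mul_one] at this
  rw [← this, Real.rpow_neg hρ.le]
  have := Real.rpow_pos_of_pos hρ c
  field_simp

/-- The operator `p ↦ ∫ (p(x) - p(y)) / |ρ x - y|³ dσ(y)` acts on solid harmonics as a scalar. -/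
lemma integral_truncKernel {a : ℝ} (ha : 0 < a) {c : ℝ} (hc : 2 * c + 1 ≠ 0)
    {p : MvPolynomial (Fin 3) ℝ} (hp : p ∈ solid c) {x : E3} (hx : ‖x‖ = a) {ρ : ℝ}
    (hρ : ρ ∈ Ioo (0 : ℝ) 1) :
    ∫ y, (ev p x - ev p y) * truncKernel ρ x y ∂sphereMeasure a =
      4 * Real.pi / a * ((1 - ρ ^ c) / (1 - ρ ^ 2)) * ev p x := by
  have hz : ‖ρ • x‖ < a := norm_smul_lt ha hx hρ
  have hk := continuousOn_inv_norm_sub hz 3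
  have h1 := integral_poisson_solid ha hc hp hx hρ
  have h2 := integral_poisson_one ha hx hρ
  have hne : 1 - ρ ^ 2 ≠ 0 := by nlinarith [hρ.1, hρ.2]
  rw [integral_mul_const] at h1 h2
  have e1 : Integrable (fun y => ev p y * (‖ρ • x - y‖ ^ 3)⁻¹) (sphereMeasure a) :=
    integrable_sphereMeasure ha ((continuous_ev p).continuousOn.mul hk)
  have e2 : Integrable (fun y => (‖ρ • x - y‖ ^ 3)⁻¹) (sphereMeasure a) :=
    integrable_sphereMeasure ha hk
  have h3 : ∫ y, (ev p x - ev p y) * truncKernel ρ x y ∂sphereMeasure a =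
      ev p x * ∫ y, (‖ρ • x - y‖ ^ 3)⁻¹ ∂sphereMeasure a -
        ∫ y, ev p y * (‖ρ • x - y‖ ^ 3)⁻¹ ∂sphereMeasure a := by
    rw [← integral_const_mul, ← integral_sub (e2.const_mul _) e1]
    simp only [truncKernel, sub_mul]
  rw [ev_smul_solid hp x hρ.1] at h1
  rw [h3]
  have h4 : (a ^ 2 - ρ ^ 2 * a ^ 2) = a ^ 2 * (1 - ρ ^ 2) := by ring
  rw [h4] at h1 h2
  rw [eq_div_of_mul_eq (by positivity) h1, eq_div_of_mul_eq (by positivity) h2]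
  field_simp

lemma tendsto_one_sub_rpow_div (c : ℝ) :
    Tendsto (fun ρ : ℝ => (1 - ρ ^ c) / (1 - ρ ^ 2)) (𝓝[<] 1) (𝓝 (c / 2)) := by
  have h1 : HasDerivAt (fun ρ : ℝ => ρ ^ c) c 1 := by
    simpa using Real.hasDerivAt_rpow_const (x := 1) (p := c) (Or.inl one_ne_zero)
  have h2 : Tendsto (fun ρ : ℝ => (ρ - 1)⁻¹ * (ρ ^ c - 1)) (𝓝[<] 1) (𝓝 c) := by
    have := (hasDerivAt_iff_tendsto_slope.1 h1).mono_left
      (nhdsWithin_mono 1 fun x (hx : x ∈ Iio (1 : ℝ)) => (ne_of_lt hx : x ≠ 1))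
    simpa [slope_fun_def] using this
  have h3 : Tendsto (fun ρ : ℝ => (1 + ρ)⁻¹) (𝓝[<] 1) (𝓝 (2⁻¹)) := by
    have hc : ContinuousAt (fun ρ : ℝ => (1 + ρ)⁻¹) 1 :=
      ContinuousAt.inv₀ (by fun_prop) (by norm_num)
    have := hc.tendsto.mono_left (nhdsWithin_le_nhds (s := Iio (1 : ℝ)))
    norm_num at this ⊢
    exact this
  refine (h2.mul h3).congr' ?_
  filter_upwards [eventually_mem_Ioo] with ρ hρ
  have e1 : ρ - 1 ≠ 0 := by linarith [hρ.2]
  have e2 : 1 + ρ ≠ 0 := by linarith [hρ.1]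
  have e3 : (1 - ρ ^ 2) ≠ 0 := by nlinarith [hρ.1, hρ.2]
  field_simp
  ring

/-- The truncated Gagliardo form of a field of solid harmonics `p` and an integrable field `f`. By
the symmetry of the kernel it is twice the integral of `k_ρ(x, y) (p(x) - p(y)) · f(x)`. -/
lemma integral_truncated_gagliardo {a : ℝ} (ha : 0 < a) {c : ℝ} (hc : 2 * c + 1 ≠ 0)
    {P : Fin 3 → MvPolynomial (Fin 3) ℝ} (hP : ∀ i, P i ∈ solid c) {f : E3 → E3}
    (hfm : StronglyMeasurable f) (hfi : Integrable f (sphereMeasure a)) {ρ : ℝ} (hρ : ρ ∈ Ioo (0 : ℝ) 1) :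
    ∫ z, truncKernel ρ z.1 z.2 * inner ℝ (vecEv P z.1 - vecEv P z.2) (f z.1 - f z.2)
      ∂((sphereMeasure a).prod (sphereMeasure a)) =
      2 * (4 * Real.pi / a * ((1 - ρ ^ c) / (1 - ρ ^ 2)) *
        ∫ x, inner ℝ (vecEv P x) (f x) ∂sphereMeasure a) := by
  have hpc : Continuous (vecEv P) := continuous_vecEv P
  obtain ⟨M, hM0, hM⟩ := exists_bound_sphere (a := a) hpc.continuousOn
  set A : E3 × E3 → ℝ := fun z => truncKernel ρ z.1 z.2 * inner ℝ (vecEv P z.1 - vecEv P z.2) (f z.1) with hA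
  have hmf1 : StronglyMeasurable fun z : E3 × E3 => f z.1 := hfm.comp_measurable measurable_fst
  have hmp : StronglyMeasurable fun z : E3 × E3 => vecEv P z.1 - vecEv P z.2 := by
    have : Continuous fun z : E3 × E3 => vecEv P z.1 - vecEv P z.2 := by fun_prop
    exact this.stronglyMeasurable
  have hAi : Integrable A ((sphereMeasure a).prod (sphereMeasure a)) := by
    refine Integrable.mono' (((hfi.comp_fst (sphereMeasure a)).norm).const_mul (((a * (1 - ρ)) ^ 3)⁻¹ * (2 * M)))
      (((measurable_truncKernel ρ).stronglyMeasurable).mul (hmp.inner hmf1)).aestronglyMeasurable ?_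
    filter_upwards [prod_ae_mem ha] with z hz
    have h1 := truncKernel_le ha hρ hz.1 hz.2
    have h0 := truncKernel_nonneg ρ z.1 z.2
    have h2 : ‖vecEv P z.1 - vecEv P z.2‖ ≤ 2 * M := by
      have := norm_sub_le (vecEv P z.1) (vecEv P z.2)
      have e1 := hM z.1 (by simpa using hz.1)
      have e2 := hM z.2 (by simpa using hz.2)
      linarith
    rw [hA, norm_mul, Real.norm_eq_abs, abs_of_nonneg h0, mul_assoc]
    refine mul_le_mul h1 ?_ (norm_nonneg _) (h0.trans h1)
    exact (norm_inner_le_norm _ _).trans (mul_le_mul_of_nonneg_right h2 (norm_nonneg _))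
  have hVA : ∀ᵐ z ∂(sphereMeasure a).prod (sphereMeasure a),
      truncKernel ρ z.1 z.2 * inner ℝ (vecEv P z.1 - vecEv P z.2) (f z.1 - f z.2) = A z + A z.swap := by
    filter_upwards [prod_ae_mem ha] with z hz
    simp only [hA, Prod.fst_swap, Prod.snd_swap]
    rw [truncKernel_comm (hz.2.trans hz.1.symm) ρ, inner_sub_right, ← neg_sub (vecEv P z.1) (vecEv P z.2),
      inner_neg_left]
    ring
  have hsw : Integrable (fun z => A z.swap) ((sphereMeasure a).prod (sphereMeasure a)) := hAi.swap
  rw [integral_congr_ae hVA, integral_add hAi hsw, integral_prod_swap A,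
    integral_prod _ hAi, ← two_mul,
    ← integral_const_mul (4 * Real.pi / a * ((1 - ρ ^ c) / (1 - ρ ^ 2)))]
  congr 1
  refine integral_sphereMeasure_congr ha fun x hx => ?_
  have hk := continuousOn_inv_norm_sub (norm_smul_lt ha hx hρ) 3
  have e : ∀ y, A (x, y) = ∑ i, f x i * ((ev (P i) x - ev (P i) y) * truncKernel ρ x y) := by
    intro y
    simp only [hA]
    rw [PiLp.inner_apply, Finset.mul_sum]
    refine Finset.sum_congr rfl fun i _ => ?_
    simp
    ring
  simp only [e]
  rw [integral_finsetSum]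
  · simp only [integral_const_mul, integral_truncKernel ha hc (hP _) hx hρ]
    rw [PiLp.inner_apply, Finset.mul_sum]
    refine Finset.sum_congr rfl fun i _ => ?_
    simp
    ring
  · intro i _
    refine Integrable.const_mul (integrable_sphereMeasure ha ?_) _
    exact (continuousOn_const.sub (continuous_ev _).continuousOn).mul hk

/-- A vector field of solid harmonics of degree `c` is an eigenvector of the Gagliardo form. -/
theorem inner_sobolevDiff_polyField {a : ℝ} (ha : 0 < a) {c : ℝ} (hc : 2 * c + 1 ≠ 0)
    {P : Fin 3 → MvPolynomial (Fin 3) ℝ} (hP : ∀ i, P i ∈ solid c) (g : sobolevHalf a) :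
    inner ℝ (sobolevDiff (polyField a P)) (sobolevDiff g) =
      4 * Real.pi * c / a * inner ℝ (toL2 a (polyField a P)) (toL2 a g) := by
  have hfm : StronglyMeasurable (toL2 a g) := Lp.stronglyMeasurable _
  have hfi : Integrable (toL2 a g) (sphereMeasure a) := (Lp.memLp (toL2 a g)).integrable (by norm_num)
  generalize hφ : toL2 a g = φ at *
  have hpc : Continuous (vecEv P) := continuous_vecEv P
  set μ := (sphereMeasure a).prod (sphereMeasure a) with hμ
  set W : E3 × E3 → ℝ := fun z =>
    (‖z.1 - z.2‖ ^ 3)⁻¹ * inner ℝ (vecEv P z.1 - vecEv P z.2) (φ z.1 - φ z.2) with hW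
  have hae : ∀ᵐ z ∂gagliardoMeasure a, inner ℝ (sobolevDiff (polyField a P) z) (sobolevDiff g z) =
      inner ℝ (vecEv P z.1 - vecEv P z.2) (φ z.1 - φ z.2) := by
    have h := toL2_polyField ha P
    filter_upwards [sobolevDiff_ae (polyField a P), sobolevDiff_ae g, (qmp_fst a).ae h, (qmp_snd a).ae h]
      with z e1 e2 e3 e4
    rw [e1, e2, e3, e4, hφ]
  have hdm : Measurable fun z : E3 × E3 => ENNReal.ofReal ((‖z.1 - z.2‖ ^ 3)⁻¹) := by fun_prop
  have hleft : inner ℝ (sobolevDiff (polyField a P)) (sobolevDiff g) = ∫ z, W z ∂μ := by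
    rw [L2.inner_def, integral_congr_ae hae, gagliardoMeasure,
      integral_withDensity_eq_integral_toReal_smul hdm (.of_forall fun z => ENNReal.ofReal_lt_top)]
    refine integral_congr_ae (.of_forall fun z => ?_)
    simp only [smul_eq_mul, hW]
    rw [ENNReal.toReal_ofReal (by positivity)]
  have hWi : Integrable W μ := by
    have h := (L2.integrable_inner (𝕜 := ℝ) (sobolevDiff (polyField a P)) (sobolevDiff g)).congr hae
    rw [gagliardoMeasure, integrable_withDensity_iff_integrable_smul₀' hdm.aemeasurable
      (.of_forall fun z => ENNReal.ofReal_lt_top)] at h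
    refine h.congr (.of_forall fun z => ?_)
    simp only [smul_eq_mul, hW]
    rw [ENNReal.toReal_ofReal (by positivity)]
  have hmf : StronglyMeasurable fun z : E3 × E3 => φ z.1 - φ z.2 :=
    (hfm.comp_measurable measurable_fst).sub (hfm.comp_measurable measurable_snd)
  have hmp : StronglyMeasurable fun z : E3 × E3 => vecEv P z.1 - vecEv P z.2 := by
    have : Continuous fun z : E3 × E3 => vecEv P z.1 - vecEv P z.2 := by fun_prop
    exact this.stronglyMeasurable
  have hlim : Tendsto (fun ρ => ∫ z, truncKernel ρ z.1 z.2 * inner ℝ (vecEv P z.1 - vecEv P z.2) (φ z.1 - φ z.2) ∂μ)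
      (𝓝[<] 1) (𝓝 (∫ z, W z ∂μ)) := by
    refine tendsto_integral_filter_of_dominated_convergence (fun z => 8 * ‖W z‖) ?_ ?_
      (hWi.norm.const_mul 8) ?_
    · exact .of_forall fun ρ =>
        ((measurable_truncKernel ρ).stronglyMeasurable.mul (hmp.inner hmf)).aestronglyMeasurable
    · filter_upwards [eventually_mem_Ioo] with ρ hρ
      filter_upwards [prod_ae_mem ha] with z hz
      simp only [hW]
      rcases eq_or_ne z.1 z.2 with h | h
      · simp [h]
      · rw [norm_mul, norm_mul, ← mul_assoc]
        refine mul_le_mul_of_nonneg_right ?_ (norm_nonneg _)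
        rw [Real.norm_eq_abs, Real.norm_eq_abs, abs_of_nonneg (truncKernel_nonneg _ _ _),
          abs_of_nonneg (by positivity)]
        exact truncKernel_le_eight (hz.1.trans hz.2.symm) h hρ
    · refine .of_forall fun z => ?_
      simp only [hW]
      rcases eq_or_ne z.1 z.2 with h | h
      · simp [h]
      · refine Tendsto.mul_const _ ?_
        exact ((((tendsto_ray z.1).sub_const z.2).norm).pow 3).inv₀
          (pow_ne_zero _ (norm_ne_zero_iff.2 (sub_ne_zero.2 h)))
  rw [hleft, inner_toL2_polyField ha P φ]
  refine tendsto_nhds_unique hlim ?_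
  have h2 := (((tendsto_one_sub_rpow_div c).const_mul (4 * Real.pi / a)).mul_const
    (∫ x, inner ℝ (vecEv P x) (φ x) ∂sphereMeasure a)).const_mul 2
  have h3 : 2 * (4 * Real.pi / a * (c / 2) * ∫ x, inner ℝ (vecEv P x) (φ x) ∂sphereMeasure a) =
    4 * Real.pi * c / a * ∫ x, inner ℝ (vecEv P x) (φ x) ∂sphereMeasure a := by ring
  rw [h3] at h2
  refine h2.congr' ?_
  filter_upwards [eventually_mem_Ioo] with ρ hρ
  exact (integral_truncated_gagliardo ha hc hP hfm hfi hρ).symm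

/-- A field of solid harmonics of degree `c` is an eigenvector of the operator that represents the
`H^{1/2}` product in `L²`, with eigenvalue `1 + 4 π c / a`. -/
theorem inner_polyField {a : ℝ} (ha : 0 < a) {c : ℝ} (hc : 2 * c + 1 ≠ 0)
    {P : Fin 3 → MvPolynomial (Fin 3) ℝ} (hP : ∀ i, P i ∈ solid c) (g : sobolevHalf a) :
    inner ℝ (polyField a P) g =
      (1 + 4 * Real.pi * c / a) * inner ℝ (toL2 a (polyField a P)) (toL2 a g) := by
  rw [sobolev_inner, inner_sobolevDiff_polyField ha hc hP]
  ring

end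

noncomputable section

/-! ### The single layer operator on `L²` -/

lemma norm_oseen_le {η : ℝ} (hη : 0 < η) (w v : E3) :
    ‖oseen η w v‖ ≤ 1 / (4 * Real.pi * η) * (‖w‖⁻¹ * ‖v‖) := by
  have hpi := Real.pi_pos
  have h : ‖‖w‖⁻¹ • v + ((‖w‖ ^ 3)⁻¹ * inner ℝ w v) • w‖ ≤ 2 * (‖w‖⁻¹ * ‖v‖) := by
    refine (norm_add_le _ _).trans ?_
    rw [norm_smul, norm_smul, norm_mul, norm_inv, norm_inv, norm_pow, norm_norm]
    rcases eq_or_ne w 0 with rfl | hw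
    · simp
    have hw0 : 0 < ‖w‖ := norm_pos_iff.2 hw
    have h1 : (‖w‖ ^ 3)⁻¹ * ‖(inner ℝ w v : ℝ)‖ * ‖w‖ ≤ (‖w‖ ^ 3)⁻¹ * (‖w‖ * ‖v‖) * ‖w‖ := by
      gcongr
      exact norm_inner_le_norm _ _
    have h2 : (‖w‖ ^ 3)⁻¹ * (‖w‖ * ‖v‖) * ‖w‖ = ‖w‖⁻¹ * ‖v‖ := by field_simp
    linarith
  rw [oseen, norm_smul, Real.norm_eq_abs, abs_of_pos (by positivity)]
  calc 1 / (8 * Real.pi * η) * ‖‖w‖⁻¹ • v + ((‖w‖ ^ 3)⁻¹ * inner ℝ w v) • w‖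
      ≤ 1 / (8 * Real.pi * η) * (2 * (‖w‖⁻¹ * ‖v‖)) := by gcongr
    _ = _ := by field_simp; ring

lemma measurable_oseen (η : ℝ) : Measurable fun z : E3 × E3 => oseen η z.1 z.2 := by
  unfold oseen
  fun_prop

lemma oseen_add (η : ℝ) (w v v' : E3) : oseen η w (v + v') = oseen η w v + oseen η w v' := by
  simp only [oseen, inner_add_right]
  module

lemma oseen_smul (η : ℝ) (w v : E3) (c : ℝ) : oseen η w (c • v) = c • oseen η w v := by
  simp only [oseen, inner_smul_right]
  module

lemma eLpNorm_two_sq {α : Type*} [MeasurableSpace α] {μ : Measure α} (f : α → E3) :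
    eLpNorm f 2 μ ^ 2 = ∫⁻ x, ‖f x‖ₑ ^ 2 ∂μ := by
  have := eLpNorm_nnreal_pow_eq_lintegral (f := f) (μ := μ) (p := 2) (by norm_num)
  simpa using this

section Schur

variable {a : ℝ} (ha : 0 < a)
include ha

/-- The Schur test for the kernel `1 / |r - s|`: the Cauchy–Schwarz inequality. -/
lemma lintegral_inv_norm_mul_sq_le {f : E3 → ENNReal} (hf : Measurable f) {r : E3} (hr : ‖r‖ = a) :
    (∫⁻ s, ENNReal.ofReal (‖r - s‖⁻¹) * f s ∂sphereMeasure a) ^ 2 ≤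
      ENNReal.ofReal (4 * Real.pi * a) *
        ∫⁻ s, ENNReal.ofReal (‖r - s‖⁻¹) * f s ^ 2 ∂sphereMeasure a := by
  set k : E3 → ENNReal := fun s => ENNReal.ofReal (‖r - s‖⁻¹) with hk
  have hkm : Measurable k := by fun_prop
  have hsq : ∀ t : ENNReal, (t ^ (1 / 2 : ℝ)) ^ 2 = t := fun t => by
    rw [← ENNReal.rpow_natCast, ← ENNReal.rpow_mul]; norm_num
  have h := ENNReal.lintegral_mul_le_Lp_mul_Lq (sphereMeasure a) Real.HolderConjugate.two_two
    (f := fun s => k s ^ (1 / 2 : ℝ)) (g := fun s => k s ^ (1 / 2 : ℝ) * f s)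
    (by fun_prop) (by fun_prop)
  have e1 : ∫⁻ s, ((fun s => k s ^ (1 / 2 : ℝ)) * fun s => k s ^ (1 / 2 : ℝ) * f s) s ∂sphereMeasure a
      = ∫⁻ s, k s * f s ∂sphereMeasure a := by
    refine lintegral_congr fun s => ?_
    simp only [Pi.mul_apply]
    rw [← mul_assoc, ← pow_two, hsq]
  have e2 : ∀ s, (k s ^ (1 / 2 : ℝ)) ^ (2 : ℝ) = k s := fun s => by
    rw [ENNReal.rpow_ofNat, hsq]
  have e3 : ∀ s, (k s ^ (1 / 2 : ℝ) * f s) ^ (2 : ℝ) = k s * f s ^ 2 := fun s => by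
    rw [ENNReal.rpow_ofNat, mul_pow, hsq]
  rw [e1] at h
  simp only [e2, e3] at h
  calc (∫⁻ s, k s * f s ∂sphereMeasure a) ^ 2
      ≤ ((∫⁻ s, k s ∂sphereMeasure a) ^ (1 / 2 : ℝ) *
          (∫⁻ s, k s * f s ^ 2 ∂sphereMeasure a) ^ (1 / 2 : ℝ)) ^ 2 := by gcongr
    _ = (∫⁻ s, k s ∂sphereMeasure a) * ∫⁻ s, k s * f s ^ 2 ∂sphereMeasure a := by
      rw [mul_pow, hsq, hsq]
    _ ≤ _ := by gcongr; exact lintegral_inv_norm_sub_le ha hr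

lemma lintegral_lintegral_inv_norm_mul_le {f : E3 → ENNReal} (hf : Measurable f) :
    ∫⁻ r, ∫⁻ s, ENNReal.ofReal (‖r - s‖⁻¹) * f s ∂sphereMeasure a ∂sphereMeasure a ≤
      ENNReal.ofReal (4 * Real.pi * a) * ∫⁻ s, f s ∂sphereMeasure a := by
  rw [lintegral_lintegral_swap (by fun_prop), ← lintegral_const_mul _ hf]
  refine lintegral_mono_ae ?_
  filter_upwards [ae_mem_sphere ha] with s hs
  rw [lintegral_mul_const _ (by fun_prop)]
  gcongr
  simp only [norm_sub_rev _ s]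
  exact lintegral_inv_norm_sub_le ha (by simpa using hs)

omit ha in
lemma measurable_enorm_coe (ψ : Lp E3 2 (sphereMeasure a)) : Measurable fun s => ‖ψ s‖ₑ :=
  (Lp.stronglyMeasurable ψ).measurable.enorm

lemma lintegral_inv_norm_mul_sq_lt_top (ψ : Lp E3 2 (sphereMeasure a)) :
    ∫⁻ r, ∫⁻ s, ENNReal.ofReal (‖r - s‖⁻¹) * ‖ψ s‖ₑ ^ 2 ∂sphereMeasure a ∂sphereMeasure a < ⊤ := by
  refine (lintegral_lintegral_inv_norm_mul_le ha ((measurable_enorm_coe ψ).pow_const 2)).trans_lt ?_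
  refine ENNReal.mul_lt_top ENNReal.ofReal_lt_top ?_
  rw [← eLpNorm_two_sq]
  exact ENNReal.pow_lt_top (Lp.eLpNorm_lt_top ψ)

/-- The Oseen kernel is absolutely integrable against square integrable densities. -/
lemma ae_integrable_oseen {η : ℝ} (hη : 0 < η) (ψ : Lp E3 2 (sphereMeasure a)) :
    ∀ᵐ r ∂sphereMeasure a, Integrable (fun s => oseen η (r - s) (ψ s)) (sphereMeasure a) := by
  have hψ := (Lp.stronglyMeasurable ψ).measurable
  have hm := measurable_enorm_coe ψ
  have hfin := ae_lt_top (by fun_prop) (lintegral_inv_norm_mul_sq_lt_top ha ψ).ne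
  filter_upwards [hfin, ae_mem_sphere ha] with r h1 hr
  have h2 := (lintegral_inv_norm_mul_sq_le ha hm (by simpa using hr)).trans_lt
    (ENNReal.mul_lt_top ENNReal.ofReal_lt_top h1)
  have h3 : ∫⁻ s, ENNReal.ofReal (‖r - s‖⁻¹) * ‖ψ s‖ₑ ∂sphereMeasure a < ⊤ := by
    by_contra h
    rw [not_lt_top_iff] at h
    rw [h] at h2
    simp at h2
  have hi : Integrable (fun s => ‖r - s‖⁻¹ * ‖ψ s‖) (sphereMeasure a) := by
    refine ⟨by fun_prop, ?_⟩
    rw [hasFiniteIntegral_iff_ofReal (.of_forall fun s => by positivity)]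
    refine lt_of_eq_of_lt (lintegral_congr fun s => ?_) h3
    rw [ENNReal.ofReal_mul (by positivity), ofReal_norm]
  refine (hi.const_mul (1 / (4 * Real.pi * η))).mono' ?_ (.of_forall fun s => norm_oseen_le hη _ _)
  exact ((measurable_oseen η).comp (f := fun s => (r - s, ψ s)) (by fun_prop)).aestronglyMeasurable

omit ha in
lemma aestronglyMeasurable_integral_oseen (η : ℝ) (ψ : Lp E3 2 (sphereMeasure a)) :
    AEStronglyMeasurable (fun r => ∫ s, oseen η (r - s) (ψ s) ∂sphereMeasure a) (sphereMeasure a) := by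
  have hψ := (Lp.stronglyMeasurable ψ).measurable
  have : StronglyMeasurable fun z : E3 × E3 => oseen η (z.1 - z.2) (ψ z.2) :=
    ((measurable_oseen η).comp (f := fun z : E3 × E3 => (z.1 - z.2, ψ z.2)) (by fun_prop)).stronglyMeasurable
  exact this.integral_prod_right.aestronglyMeasurable

lemma eLpNorm_integral_oseen_le {η : ℝ} (hη : 0 < η) (ψ : Lp E3 2 (sphereMeasure a)) :
    eLpNorm (fun r => ∫ s, oseen η (r - s) (ψ s) ∂sphereMeasure a) 2 (sphereMeasure a) ≤
      ENNReal.ofReal (a / η) * eLpNorm ψ 2 (sphereMeasure a) := by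
  have hm := measurable_enorm_coe ψ
  have hpi := Real.pi_pos
  set c := ENNReal.ofReal (1 / (4 * Real.pi * η)) with hc
  set B := ENNReal.ofReal (4 * Real.pi * a) with hB
  have hcB : c * B = ENNReal.ofReal (a / η) := by
    rw [hc, hB, ← ENNReal.ofReal_mul (by positivity)]
    congr 1
    field_simp
  have h1 : ∀ r, ‖r‖ = a → ‖∫ s, oseen η (r - s) (ψ s) ∂sphereMeasure a‖ₑ ^ 2 ≤
      c ^ 2 * (B * ∫⁻ s, ENNReal.ofReal (‖r - s‖⁻¹) * ‖ψ s‖ₑ ^ 2 ∂sphereMeasure a) := by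
    intro r hr
    have h2 : ‖∫ s, oseen η (r - s) (ψ s) ∂sphereMeasure a‖ₑ ≤
        c * ∫⁻ s, ENNReal.ofReal (‖r - s‖⁻¹) * ‖ψ s‖ₑ ∂sphereMeasure a := by
      refine (enorm_integral_le_lintegral_enorm _).trans ?_
      rw [← lintegral_const_mul _ (by fun_prop)]
      refine lintegral_mono fun s => ?_
      rw [← ofReal_norm, ← ofReal_norm, hc, ← ENNReal.ofReal_mul (by positivity),
        ← ENNReal.ofReal_mul (by positivity)]
      exact ENNReal.ofReal_le_ofReal (norm_oseen_le hη _ _)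
    calc _ ≤ (c * ∫⁻ s, ENNReal.ofReal (‖r - s‖⁻¹) * ‖ψ s‖ₑ ∂sphereMeasure a) ^ 2 := by gcongr
      _ ≤ _ := by
        rw [mul_pow]
        gcongr
        exact lintegral_inv_norm_mul_sq_le ha hm hr
  have h3 : eLpNorm (fun r => ∫ s, oseen η (r - s) (ψ s) ∂sphereMeasure a) 2 (sphereMeasure a) ^ 2 ≤
      (ENNReal.ofReal (a / η) * eLpNorm ψ 2 (sphereMeasure a)) ^ 2 := by
    rw [eLpNorm_two_sq, mul_pow, eLpNorm_two_sq, ← hcB]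
    calc _ ≤ ∫⁻ r, c ^ 2 * (B * ∫⁻ s, ENNReal.ofReal (‖r - s‖⁻¹) * ‖ψ s‖ₑ ^ 2 ∂sphereMeasure a)
          ∂sphereMeasure a := by
          refine lintegral_mono_ae ?_
          filter_upwards [ae_mem_sphere ha] with r hr using h1 r (by simpa using hr)
      _ = c ^ 2 * (B * ∫⁻ r, ∫⁻ s, ENNReal.ofReal (‖r - s‖⁻¹) * ‖ψ s‖ₑ ^ 2 ∂sphereMeasure a
          ∂sphereMeasure a) := by
          rw [lintegral_const_mul _ (by fun_prop), lintegral_const_mul _ (by fun_prop)]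
      _ ≤ c ^ 2 * (B * (B * ∫⁻ s, ‖ψ s‖ₑ ^ 2 ∂sphereMeasure a)) := by
          gcongr
          exact lintegral_lintegral_inv_norm_mul_le ha (hm.pow_const 2)
      _ = _ := by ring
  exact (ENNReal.pow_le_pow_left_iff two_ne_zero).1 h3

/-- The single layer integral operator is bounded on `L²`. -/
theorem exists_stokesL2 {η : ℝ} (hη : 0 < η) :
    ∃ T : Lp E3 2 (sphereMeasure a) →L[ℝ] Lp E3 2 (sphereMeasure a), ∀ ψ, T ψ =ᵐ[sphereMeasure a]
      fun r => ∫ s, oseen η (r - s) (ψ s) ∂sphereMeasure a := by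
  have hmem : ∀ ψ : Lp E3 2 (sphereMeasure a),
      MemLp (fun r => ∫ s, oseen η (r - s) (ψ s) ∂sphereMeasure a) 2 (sphereMeasure a) := fun ψ =>
    ⟨aestronglyMeasurable_integral_oseen η ψ, (eLpNorm_integral_oseen_le ha hη ψ).trans_lt
      (ENNReal.mul_lt_top ENNReal.ofReal_lt_top (Lp.eLpNorm_lt_top ψ))⟩
  let T₀ : Lp E3 2 (sphereMeasure a) →ₗ[ℝ] Lp E3 2 (sphereMeasure a) :=
    { toFun := fun ψ => (hmem ψ).toLp _
      map_add' := fun ψ φ => by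
        refine Lp.ext ?_
        filter_upwards [(hmem (ψ + φ)).coeFn_toLp, Lp.coeFn_add ((hmem ψ).toLp _) ((hmem φ).toLp _),
          (hmem ψ).coeFn_toLp, (hmem φ).coeFn_toLp, ae_integrable_oseen ha hη ψ,
          ae_integrable_oseen ha hη φ] with r e1 e2 e3 e4 i1 i2
        rw [e1, e2, Pi.add_apply, e3, e4, ← integral_add i1 i2]
        refine integral_congr_ae ?_
        filter_upwards [Lp.coeFn_add ψ φ] with s hs
        rw [hs, Pi.add_apply, oseen_add]
      map_smul' := fun c ψ => by
        refine Lp.ext ?_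
        filter_upwards [(hmem (c • ψ)).coeFn_toLp, Lp.coeFn_smul c ((hmem ψ).toLp _),
          (hmem ψ).coeFn_toLp] with r e1 e2 e3
        rw [e1, RingHom.id_apply, e2, Pi.smul_apply, e3, ← integral_smul]
        refine integral_congr_ae ?_
        filter_upwards [Lp.coeFn_smul c ψ] with s hs
        rw [hs, Pi.smul_apply, oseen_smul] }
  refine ⟨T₀.mkContinuous (a / η) fun ψ => ?_, fun ψ => (hmem ψ).coeFn_toLp⟩
  show ‖(hmem ψ).toLp _‖ ≤ _
  rw [Lp.norm_toLp, Lp.norm_def, ← ENNReal.toReal_ofReal (by positivity : 0 ≤ a / η),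
    ← ENNReal.toReal_mul]
  exact ENNReal.toReal_mono (ENNReal.mul_ne_top ENNReal.ofReal_ne_top (Lp.eLpNorm_ne_top ψ))
    (eLpNorm_integral_oseen_le ha hη ψ)

end Schur

end

noncomputable section

/-! ### The single layer operator on solid harmonics -/

open MvPolynomial

section Harmonics

variable {a : ℝ} (ha : 0 < a)
include ha

lemma fderiv_potential_solid {c : ℝ} (hc : 2 * c + 1 ≠ 0) {p : MvPolynomial (Fin 3) ℝ}
    (hp : p ∈ solid c) {z : E3} (hz0 : z ≠ 0) (hz : ‖z‖ < a) (j : Fin 3) :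
    fderiv ℝ (potential a (ev p)) z (stdVec j) =
      4 * Real.pi * a / (2 * c + 1) * ev (pderiv j p) z := by
  have h : potential a (ev p) =ᶠ[𝓝 z] fun z => 4 * Real.pi * a / (2 * c + 1) * ev p z := by
    have h1 : ∀ᶠ w in 𝓝 z, w ≠ 0 := isOpen_ne.mem_nhds hz0
    have h2 : ∀ᶠ w in 𝓝 z, ‖w‖ < a := (isOpen_lt continuous_norm continuous_const).mem_nhds hz
    filter_upwards [h1, h2] with w hw1 hw2 using potential_solid ha hc hp hw1 hw2
  rw [h.fderiv_eq, ((hasFDerivAt_ev p z).const_mul _).fderiv]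
  fin_cases j <;> simp [Fin.sum_univ_three]

lemma fderiv_potential_X_mul {c : ℝ} (hc : 2 * c + 1 ≠ 0) (hc1 : 2 * (c + 1) + 1 ≠ 0)
    (hc2 : 2 * (c - 1) + 1 ≠ 0) {p : MvPolynomial (Fin 3) ℝ}
    (hp : p ∈ solid c) {z : E3} (hz0 : z ≠ 0) (hz : ‖z‖ < a) (i j : Fin 3) :
    fderiv ℝ (potential a (ev (X i * p))) z (stdVec j) =
      4 * Real.pi * a / (2 * (c + 1) + 1) * ev (pderiv j (raise c i p)) z +
      (2 * c + 1)⁻¹ * a ^ 2 * (4 * Real.pi * a / (2 * (c - 1) + 1) * ev (pderiv j (pderiv i p)) z) := by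
  have e : ∀ w ∈ Metric.ball (0 : E3) a, potential a (ev (X i * p)) w =
      potential a (ev (raise c i p)) w + (2 * c + 1)⁻¹ * a ^ 2 * potential a (ev (pderiv i p)) w := by
    intro w hw
    rw [mem_ball_zero_iff] at hw
    rw [potential, potential, potential, ← integral_const_mul, ← integral_add
      (integrable_mul_inv_norm_sub ha (continuous_ev _).continuousOn hw)
      ((integrable_mul_inv_norm_sub ha (continuous_ev _).continuousOn hw).const_mul _)]
    refine integral_sphereMeasure_congr ha fun y hy => ?_
    rw [X_mul_eq c i p, ev_add, ev_smul, ev_mul, ev_rsq, hy]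
    ring
  have h : potential a (ev (X i * p)) =ᶠ[𝓝 z] fun w =>
      potential a (ev (raise c i p)) w + (2 * c + 1)⁻¹ * a ^ 2 * potential a (ev (pderiv i p)) w :=
    (Metric.isOpen_ball.eventually_mem (mem_ball_zero_iff.2 hz)).mono e
  have hd : ∀ q, DifferentiableAt ℝ (potential a (ev q)) z := fun q =>
    (hasFDerivAt_potential ha (continuous_ev q).continuousOn hz).differentiableAt
  have h' : HasFDerivAt (fun w => potential a (ev (raise c i p)) w +
      (2 * c + 1)⁻¹ * a ^ 2 * potential a (ev (pderiv i p)) w) _ z :=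
    (hd _).hasFDerivAt.add ((hd _).hasFDerivAt.const_mul _)
  rw [h.fderiv_eq, h'.fderiv]
  simp only [add_apply, smul_apply, smul_eq_mul]
  rw [fderiv_potential_solid ha hc1 (raise_mem_solid hc hp i) hz0 hz,
    fderiv_potential_solid ha hc2 (pderiv_mem_solid hp i) hz0 hz]

/-- Inside the ball, the kernel `(w ⊗ w) / |w|³` is expressed by gradients of Newton potentials. -/
lemma integral_oseen_apply {η : ℝ} (P : Fin 3 → MvPolynomial (Fin 3) ℝ) {z : E3} (hz : ‖z‖ < a)
    (i : Fin 3) : (∫ s, oseen η (z - s) (vecEv P s) ∂sphereMeasure a) i =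
      1 / (8 * Real.pi * η) * (potential a (ev (P i)) z +
        ∑ j, (fderiv ℝ (potential a (ev (X i * P j))) z (stdVec j) -
          z i * fderiv ℝ (potential a (ev (P j))) z (stdVec j))) := by
  have hk1 := continuousOn_inv_norm_sub hz 1
  have hk3 := continuousOn_inv_norm_sub hz 3
  simp only [pow_one] at hk1
  have hP := (continuous_vecEv P).continuousOn (s := Metric.sphere (0 : E3) a)
  have hcont : ContinuousOn (fun s => oseen η (z - s) (vecEv P s)) (Metric.sphere (0 : E3) a) := by
    unfold oseen
    have hs : ContinuousOn (fun s : E3 => z - s) (Metric.sphere (0 : E3) a) := by fun_prop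
    have hi : ContinuousOn (fun s => (inner ℝ (z - s) (vecEv P s) : ℝ)) (Metric.sphere (0 : E3) a) :=
      hs.inner hP
    exact ((hk1.smul hP).add ((hk3.mul hi).smul hs)).const_smul (1 / (8 * Real.pi * η))
  have h1 : (∫ s, oseen η (z - s) (vecEv P s) ∂sphereMeasure a) i =
      ∫ s, (oseen η (z - s) (vecEv P s)) i ∂sphereMeasure a :=
    ((coord i).integral_comp_comm (integrable_sphereMeasure ha hcont)).symm
  have hi : ∀ q : MvPolynomial (Fin 3) ℝ, ∀ j, Integrable (fun y => ev q y * -(‖z - y‖ ^ 3)⁻¹ *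
      inner ℝ (z - y) (stdVec j)) (sphereMeasure a) := by
    intro q j
    refine integrable_sphereMeasure ha (((continuous_ev q).continuousOn.mul hk3.neg).mul ?_)
    fun_prop
  have hi0 := integrable_mul_inv_norm_sub ha (continuous_ev (P i)).continuousOn hz
  rw [h1]
  simp only [fderiv_potential_apply ha (continuous_ev _).continuousOn hz]
  have h2 : ∀ j, ∫ y, ev (X i * P j) y * -(‖z - y‖ ^ 3)⁻¹ * inner ℝ (z - y) (stdVec j) ∂sphereMeasure a -
      z i * ∫ y, ev (P j) y * -(‖z - y‖ ^ 3)⁻¹ * inner ℝ (z - y) (stdVec j) ∂sphereMeasure a =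
      ∫ y, (ev (X i * P j) y * -(‖z - y‖ ^ 3)⁻¹ * inner ℝ (z - y) (stdVec j) -
        z i * (ev (P j) y * -(‖z - y‖ ^ 3)⁻¹ * inner ℝ (z - y) (stdVec j))) ∂sphereMeasure a := fun j => by
    rw [integral_sub (hi _ j) ((hi _ j).const_mul _), integral_const_mul]
  simp only [h2]
  have hI : ∀ j ∈ Finset.univ, Integrable (fun y => ev (X i * P j) y * -(‖z - y‖ ^ 3)⁻¹ *
      inner ℝ (z - y) (stdVec j) - z i * (ev (P j) y * -(‖z - y‖ ^ 3)⁻¹ * inner ℝ (z - y) (stdVec j)))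
      (sphereMeasure a) := fun j _ => (hi _ j).sub ((hi _ j).const_mul _)
  rw [← integral_finsetSum _ hI, potential, ← integral_add hi0 (integrable_finsetSum _ hI),
    ← integral_const_mul]
  refine integral_sphereMeasure_congr ha fun y hy => ?_
  simp only [oseen, PiLp.smul_apply, PiLp.add_apply, smul_eq_mul, vecEv_apply, ev_mul, ev_X]
  congr 1
  rw [PiLp.inner_apply]
  have h3 : ∀ j, inner ℝ (z - y) (stdVec j) = z j - y j := fun j => by
    simp [EuclideanSpace.inner_single_right]
  simp only [h3, Fin.sum_univ_three]
  simp
  ring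

/-- The single layer operator of the density `P`, for a field `P` of solid harmonics of degree `c`,
is again a field of solid harmonics of degree `c`. -/
def stokesPoly (a η c : ℝ) (P : Fin 3 → MvPolynomial (Fin 3) ℝ) (i : Fin 3) : MvPolynomial (Fin 3) ℝ :=
  (a / (2 * η)) • ((2 * c + 1)⁻¹ • P i + (2 * (c + 1) + 1)⁻¹ • ∑ j, pderiv j (raise c i (P j)) -
    (2 * c + 1)⁻¹ • raise (c - 1) i (∑ j, pderiv j (P j)))

omit ha in
lemma stokesPoly_mem_solid {η c : ℝ} (hc : 2 * c + 1 ≠ 0)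
    (hc2 : 2 * (c - 1) + 1 ≠ 0) {P : Fin 3 → MvPolynomial (Fin 3) ℝ} (hP : ∀ i, P i ∈ solid c)
    (i : Fin 3) : stokesPoly a η c P i ∈ solid c := by
  have h1 : ∑ j, pderiv j (raise c i (P j)) ∈ solid c := by
    refine Submodule.sum_mem _ fun j _ => ?_
    have := pderiv_mem_solid (raise_mem_solid hc (hP j) i) j
    rwa [add_sub_cancel_right] at this
  have h2 : raise (c - 1) i (∑ j, pderiv j (P j)) ∈ solid c := by
    have := raise_mem_solid hc2 (Submodule.sum_mem _ fun j _ => pderiv_mem_solid (hP j) j) i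
      (p := ∑ j, pderiv j (P j))
    rwa [sub_add_cancel] at this
  exact Submodule.smul_mem _ _ (Submodule.sub_mem _ (Submodule.add_mem _ (Submodule.smul_mem _ _ (hP i))
    (Submodule.smul_mem _ _ h1)) (Submodule.smul_mem _ _ h2))

lemma tendsto_integral_oseen_ray {η : ℝ} (hη : 0 < η) {f : E3 → E3} (hf : Continuous f) {x : E3}
    (hx : ‖x‖ = a) :
    Tendsto (fun ρ : ℝ => ∫ s, oseen η (ρ • x - s) (f s) ∂sphereMeasure a) (𝓝[<] 1)
      (𝓝 (∫ s, oseen η (x - s) (f s) ∂sphereMeasure a)) := by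
  obtain ⟨C, hC0, hC⟩ := exists_bound_sphere (a := a) hf.continuousOn
  have hpi := Real.pi_pos
  refine tendsto_integral_filter_of_dominated_convergence
    (fun y => 1 / (4 * Real.pi * η) * (2 * ‖x - y‖⁻¹ * C)) ?_ ?_
    ((((integrable_inv_norm_sub ha hx).const_mul 2).mul_const C).const_mul _) ?_
  · refine .of_forall fun ρ => ?_
    have hfm := hf.measurable
    exact ((measurable_oseen η).comp (f := fun s => (ρ • x - s, f s)) (by fun_prop)).aestronglyMeasurable
  · filter_upwards [eventually_mem_Ioo] with ρ hρ
    filter_upwards [ae_mem_sphere ha, ae_ne ha hx] with y hy hyx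
    have hy' : ‖y‖ = a := by simpa using hy
    refine (norm_oseen_le hη _ _).trans ?_
    have h0 : 0 < ‖x - y‖ := norm_pos_iff.2 (sub_ne_zero.2 hyx.symm)
    have h1 := norm_sub_le_two_mul (hx.trans hy'.symm) hρ
    have h2 : 0 < ‖ρ • x - y‖ := by linarith
    have h3 : ‖ρ • x - y‖⁻¹ ≤ 2 * ‖x - y‖⁻¹ := by
      rw [← div_eq_mul_inv, le_div_iff₀ h0, inv_mul_le_iff₀ h2]
      linarith
    have h4 := hC y hy
    gcongr
  · filter_upwards [ae_ne ha hx] with y hyx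
    have hne : ‖x - y‖ ≠ 0 := norm_ne_zero_iff.2 (sub_ne_zero.2 hyx.symm)
    have ht : Tendsto (fun ρ : ℝ => ρ • x - y) (𝓝[<] 1) (𝓝 (x - y)) := (tendsto_ray x).sub_const y
    have hn := ht.norm
    unfold oseen
    refine Tendsto.const_smul ?_ _
    refine ((hn.inv₀ hne).smul_const _).add ?_
    refine Tendsto.smul ?_ ht
    exact ((hn.pow 3).inv₀ (pow_ne_zero 3 hne)).mul (ht.inner tendsto_const_nhds)

/-- The single layer operator on fields of solid harmonics. -/
theorem integral_oseen_vecEv {η : ℝ} (hη : 0 < η) {c : ℝ} (hc : 2 * c + 1 ≠ 0)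
    (hc1 : 2 * (c + 1) + 1 ≠ 0) (hc2 : 2 * (c - 1) + 1 ≠ 0) {P : Fin 3 → MvPolynomial (Fin 3) ℝ}
    (hP : ∀ i, P i ∈ solid c) {x : E3} (hx : ‖x‖ = a) :
    ∫ s, oseen η (x - s) (vecEv P s) ∂sphereMeasure a = vecEv (stokesPoly a η c P) x := by
  have hx0 : x ≠ 0 := by
    rintro rfl
    rw [norm_zero] at hx
    exact ha.ne hx
  -- the value of the single layer potential inside the ball, as a function continuous up to the sphere
  set V : Fin 3 → E3 → ℝ := fun i z => 1 / (8 * Real.pi * η) *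
    (4 * Real.pi * a / (2 * c + 1) * ev (P i) z + ∑ j,
      (4 * Real.pi * a / (2 * (c + 1) + 1) * ev (pderiv j (raise c i (P j))) z +
      (2 * c + 1)⁻¹ * a ^ 2 * (4 * Real.pi * a / (2 * (c - 1) + 1) * ev (pderiv j (pderiv i (P j))) z) -
      z i * (4 * Real.pi * a / (2 * c + 1) * ev (pderiv j (P j)) z))) with hV
  have hVc : ∀ i, Continuous (V i) := by
    intro i
    have := fun q => continuous_ev q
    fun_prop
  ext i
  have h1 : Tendsto (fun ρ : ℝ => (∫ s, oseen η (ρ • x - s) (vecEv P s) ∂sphereMeasure a) i) (𝓝[<] 1)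
      (𝓝 ((∫ s, oseen η (x - s) (vecEv P s) ∂sphereMeasure a) i)) :=
    ((coord i).continuous.tendsto _).comp (tendsto_integral_oseen_ray ha hη (continuous_vecEv P) hx)
  have h2 : Tendsto (fun ρ : ℝ => V i (ρ • x)) (𝓝[<] 1) (𝓝 (V i x)) :=
    ((hVc i).tendsto x).comp (tendsto_ray x)
  have h3 : V i x = vecEv (stokesPoly a η c P) x i := by
    have hpi := Real.pi_pos
    have hcomm : ∀ j, pderiv j (pderiv i (P j)) = pderiv i (pderiv j (P j)) := fun j => pderiv_comm _ _ _
    simp only [hV, vecEv_apply, stokesPoly, ev_smul, ev_sub, ev_add, hcomm, Fin.sum_univ_three]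
    rw [show raise (c - 1) i (pderiv 0 (P 0) + pderiv 1 (P 1) + pderiv 2 (P 2)) =
      X i * (pderiv 0 (P 0) + pderiv 1 (P 1) + pderiv 2 (P 2)) - (2 * (c - 1) + 1)⁻¹ • (rsq *
        (pderiv i (pderiv 0 (P 0)) + pderiv i (pderiv 1 (P 1)) + pderiv i (pderiv 2 (P 2)))) by
      simp [raise]]
    simp only [ev_smul, ev_sub, ev_add, ev_mul, ev_X, ev_rsq, hx]
    field_simp
    ring
  rw [← h3]
  refine tendsto_nhds_unique h1 (h2.congr' ?_)
  filter_upwards [eventually_mem_Ioo] with ρ hρ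
  have hz := norm_smul_lt ha hx hρ
  have hz0 : ρ • x ≠ 0 := smul_ne_zero hρ.1.ne' hx0
  rw [integral_oseen_apply ha P hz i]
  simp only [fderiv_potential_X_mul ha hc hc1 hc2 (hP _) hz0 hz, fderiv_potential_solid ha hc (hP _) hz0 hz,
    potential_solid ha hc (hP _) hz0 hz, hV]

/-! ### The quadratic form of the single layer operator on solid harmonics -/

/-- The `L²` inner product over the sphere of two polynomial vector fields. -/
def sphInner (a : ℝ) (P Q : Fin 3 → MvPolynomial (Fin 3) ℝ) : ℝ := sphInt a (∑ i, P i * Q i)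

/-- The divergence of a polynomial vector field. -/
def polyDiv (P : Fin 3 → MvPolynomial (Fin 3) ℝ) : MvPolynomial (Fin 3) ℝ := ∑ j, pderiv j (P j)

/-- The form `∑ ∫ ∂_i P_j ∂_j Q_i`. -/
def transposeForm (a : ℝ) (P Q : Fin 3 → MvPolynomial (Fin 3) ℝ) : ℝ :=
  sphInt a (∑ i, ∑ j, pderiv i (P j) * pderiv j (Q i))

omit ha in
lemma polyDiv_mem_solid {c : ℝ} {P : Fin 3 → MvPolynomial (Fin 3) ℝ} (hP : ∀ i, P i ∈ solid c) :
    polyDiv P ∈ solid (c - 1) := Submodule.sum_mem _ fun j _ => pderiv_mem_solid (hP j) j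

/-- The field `raise (c - 1) · h` is, up to a factor, the adjoint of the divergence. -/
lemma sphInner_raise {c : ℝ} {h : MvPolynomial (Fin 3) ℝ} (hh : h ∈ solid (c - 1)) {Q : Fin 3 → MvPolynomial (Fin 3) ℝ}
    (hc : 2 * c + 1 ≠ 0) (hQ : ∀ i, Q i ∈ solid c) :
    sphInner a (fun i => raise (c - 1) i h) Q = (2 * c + 1)⁻¹ * a ^ 2 * sphInt a (h * polyDiv Q) := by
  have e : ∀ i, sphInt a (raise (c - 1) i h * Q i) = (2 * c + 1)⁻¹ * a ^ 2 * sphInt a (pderiv i (Q i) * h) := by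
    intro i
    rw [← sphInt_X_mul_mul ha hc (hQ i) hh i]
    have h1 : X i * Q i * h = raise (c - 1) i h * Q i +
        (2 * (c - 1) + 1)⁻¹ • (rsq * (pderiv i h * Q i)) := by
      simp only [raise, smul_eq_C_mul]
      ring
    rw [h1, sphInt_add ha, sphInt_smul, sphInt_rsq_mul ha,
      sphInt_mul_eq_zero ha (by linarith) (pderiv_mem_solid hh i) (hQ i)]
    ring
  rw [sphInner, sphInt_sum ha, polyDiv, Finset.mul_sum, sphInt_sum ha, Finset.mul_sum]
  exact Finset.sum_congr rfl fun i _ => by rw [e i, mul_comm h]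

lemma sum_sphInt_X_mul {c : ℝ} (hc : 2 * c + 1 ≠ 0) {P Q : Fin 3 → MvPolynomial (Fin 3) ℝ}
    (hP : ∀ i, P i ∈ solid c) (hQ : ∀ i, Q i ∈ solid c) :
    sphInt a (∑ i, ∑ j, X i * P j * pderiv j (Q i)) = (2 * c + 1)⁻¹ * a ^ 2 * transposeForm a P Q := by
  simp only [transposeForm, sphInt_sum ha, Finset.mul_sum]
  exact Finset.sum_congr rfl fun i _ => Finset.sum_congr rfl fun j _ =>
    sphInt_X_mul_mul ha hc (hP j) (pderiv_mem_solid (hQ i) j) i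

omit ha in
lemma transposeForm_comm (P Q : Fin 3 → MvPolynomial (Fin 3) ℝ) :
    transposeForm a P Q = transposeForm a Q P := by
  simp only [transposeForm, Fin.sum_univ_three]
  congr 1
  ring

/-- The bilinear form of the single layer operator on fields of solid harmonics. -/
lemma sphInner_stokesPoly {η : ℝ} {c : ℝ} (hc : 2 * c + 1 ≠ 0)
    (hc1 : 2 * (c + 1) + 1 ≠ 0) {P Q : Fin 3 → MvPolynomial (Fin 3) ℝ}
    (hP : ∀ i, P i ∈ solid c) (hQ : ∀ i, Q i ∈ solid c) :
    sphInner a (stokesPoly a η c P) Q = a / (2 * η) * ((2 * c + 1)⁻¹ * (2 * c + 3)⁻¹) *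
      ((4 * c + 4) * sphInner a P Q - 2 * ((2 * c + 1)⁻¹ * a ^ 2 *
        (sphInt a (polyDiv P * polyDiv Q) + transposeForm a P Q))) := by
  have hD := polyDiv_mem_solid hP
  have h1 : sphInner a (stokesPoly a η c P) Q = a / (2 * η) * ((2 * c + 1)⁻¹ * sphInner a P Q +
      (2 * (c + 1) + 1)⁻¹ * sphInt a (∑ i, (∑ j, pderiv j (raise c i (P j))) * Q i) -
      (2 * c + 1)⁻¹ * sphInner a (fun i => raise (c - 1) i (polyDiv P)) Q) := by
    simp only [sphInner]
    rw [← sphInt_smul, ← sphInt_smul, ← sphInt_smul, ← sphInt_add ha, ← sphInt_sub ha, ← sphInt_smul]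
    congr 1
    simp only [stokesPoly, polyDiv, Fin.sum_univ_three, smul_eq_C_mul]
    ring
  have h2 : ∀ i, ∑ j, pderiv j (raise c i (P j)) = P i + raise (c - 1) i (polyDiv P) +
      ((2 * (c - 1) + 1)⁻¹ - (2 * c + 1)⁻¹) • (rsq * pderiv i (polyDiv P)) -
        (2 * (2 * c + 1)⁻¹) • ∑ j, X j * pderiv i (P j) := by
    intro i
    have hcomm : ∀ j, pderiv j (pderiv i (P j)) = pderiv i (pderiv j (P j)) := fun j => pderiv_comm _ _ _
    simp only [raise, polyDiv, map_sub, pderiv_mul, pderiv_rsq, hcomm,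
      smul_eq_C_mul, map_sum, map_mul, map_ofNat]
    fin_cases i <;> simp [Fin.sum_univ_three, pderiv_X] <;> ring
  have h3 : sphInt a (∑ i, (∑ j, pderiv j (raise c i (P j))) * Q i) =
      sphInner a P Q + sphInner a (fun i => raise (c - 1) i (polyDiv P)) Q -
        (2 * (2 * c + 1)⁻¹) * sphInt a (∑ i, ∑ j, X i * Q j * pderiv j (P i)) := by
    have h0 : sphInt a (∑ i, rsq * (pderiv i (polyDiv P) * Q i)) = 0 := by
      rw [sphInt_sum ha]
      refine Finset.sum_eq_zero fun i _ => ?_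
      rw [sphInt_rsq_mul ha, sphInt_mul_eq_zero ha (by linarith) (pderiv_mem_solid hD i) (hQ i), mul_zero]
    have h4 : ∑ i, (∑ j, pderiv j (raise c i (P j))) * Q i = ∑ i, P i * Q i +
        ∑ i, raise (c - 1) i (polyDiv P) * Q i +
        ((2 * (c - 1) + 1)⁻¹ - (2 * c + 1)⁻¹) • ∑ i, rsq * (pderiv i (polyDiv P) * Q i) -
        (2 * (2 * c + 1)⁻¹) • ∑ i, ∑ j, X i * Q j * pderiv j (P i) := by
      simp only [h2, Fin.sum_univ_three, smul_eq_C_mul]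
      ring
    rw [h4, sphInt_sub ha, sphInt_add ha, sphInt_add ha, sphInt_smul, sphInt_smul, h0]
    simp only [sphInner]
    ring
  rw [h1, h3, sphInner_raise ha hD hc hQ, sum_sphInt_X_mul ha hc hQ hP, transposeForm_comm Q P]
  have h5 : 2 * c + 3 ≠ 0 := by intro h; apply hc1; linarith
  have h6 : 2 * (c + 1) + 1 = 2 * c + 3 := by ring
  rw [h6]
  field_simp
  ring

end Harmonics

end

noncomputable section

open MvPolynomial

/-! ### Bounds of the quadratic form of the single layer operator -/

section FormBounds

variable {a : ℝ} (ha : 0 < a)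
include ha

omit ha in
lemma sphInt_mul_self_nonneg (p : MvPolynomial (Fin 3) ℝ) : 0 ≤ sphInt a (p * p) := by
  refine integral_nonneg fun x => ?_
  simp only [ev_mul, Pi.zero_apply]
  exact mul_self_nonneg _

lemma sphInner_self_nonneg (P : Fin 3 → MvPolynomial (Fin 3) ℝ) : 0 ≤ sphInner a P P := by
  rw [sphInner, sphInt_sum ha]
  exact Finset.sum_nonneg fun i _ => sphInt_mul_self_nonneg _

/-- Green's identity on the sphere for solid harmonics of the same degree. -/
lemma sum_sphInt_pderiv_mul {c : ℝ} (hc : 2 * c + 1 ≠ 0) {p q : MvPolynomial (Fin 3) ℝ}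
    (hp : p ∈ solid c) (hq : q ∈ solid c) :
    a ^ 2 * sphInt a (∑ i, pderiv i p * pderiv i q) = c * (2 * c + 1) * sphInt a (p * q) := by
  have h1 : sphInt a (∑ i, X i * p * pderiv i q) =
      (2 * c + 1)⁻¹ * a ^ 2 * sphInt a (∑ i, pderiv i p * pderiv i q) := by
    rw [sphInt_sum ha, sphInt_sum ha, Finset.mul_sum]
    exact Finset.sum_congr rfl fun i _ => sphInt_X_mul_mul ha hc hp (pderiv_mem_solid hq i) i
  have h2 : ∑ i, X i * p * pderiv i q = c • (p * q) := by
    have : ∑ i, X i * pderiv i q = c • q := (mem_solid.1 hq).1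
    rw [← mul_smul_comm, ← this, Finset.mul_sum]
    exact Finset.sum_congr rfl fun i _ => by ring
  rw [h2, sphInt_smul] at h1
  calc _ = (2 * c + 1) * ((2 * c + 1)⁻¹ * a ^ 2 * sphInt a (∑ i, pderiv i p * pderiv i q)) := by
        rw [← mul_assoc, ← mul_assoc, mul_inv_cancel₀ hc, one_mul]
    _ = _ := by
        rw [← h1]
        ring

/-- Nonnegativity of the squares of `∂ᵢ Pⱼ + ∂ⱼ Pᵢ` and `∂ᵢ Pⱼ - ∂ⱼ Pᵢ` gives the two bounds. -/
lemma abs_transposeForm_le {c : ℝ} (hc : 2 * c + 1 ≠ 0) {P : Fin 3 → MvPolynomial (Fin 3) ℝ}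
    (hP : ∀ i, P i ∈ solid c) :
    a ^ 2 * |transposeForm a P P| ≤ c * (2 * c + 1) * sphInner a P P := by
  have h1 : a ^ 2 * sphInt a (∑ j, ∑ i, pderiv i (P j) * pderiv i (P j)) =
      c * (2 * c + 1) * sphInner a P P := by
    rw [sphInner, sphInt_sum ha, sphInt_sum ha, Finset.mul_sum, Finset.mul_sum]
    exact Finset.sum_congr rfl fun j _ => sum_sphInt_pderiv_mul ha hc (hP j) (hP j)
  have hsq : ∀ s : ℝ, 0 ≤ sphInt a (∑ i, ∑ j, (pderiv i (P j) + s • pderiv j (P i)) *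
      (pderiv i (P j) + s • pderiv j (P i))) := by
    intro s
    rw [sphInt_sum ha]
    refine Finset.sum_nonneg fun i _ => ?_
    rw [sphInt_sum ha]
    exact Finset.sum_nonneg fun j _ => sphInt_mul_self_nonneg _
  have hexp : ∀ s : ℝ, sphInt a (∑ i, ∑ j, (pderiv i (P j) + s • pderiv j (P i)) *
      (pderiv i (P j) + s • pderiv j (P i))) =
      (1 + s ^ 2) * sphInt a (∑ j, ∑ i, pderiv i (P j) * pderiv i (P j)) +
        2 * s * transposeForm a P P := by
    intro s
    rw [transposeForm, ← sphInt_smul, ← sphInt_smul, ← sphInt_add ha]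
    congr 1
    simp only [Fin.sum_univ_three, smul_eq_C_mul, map_add, map_mul, map_pow, map_one, map_ofNat]
    ring
  have e1 := hsq 1
  have e2 := hsq (-1)
  rw [hexp] at e1 e2
  rw [← h1]
  refine mul_le_mul_of_nonneg_left (abs_le.2 ⟨?_, ?_⟩) (sq_nonneg a) <;> linarith

omit ha in
lemma polyDiv_raise {c : ℝ} (hc2 : 2 * (c - 1) + 1 ≠ 0) {h : MvPolynomial (Fin 3) ℝ}
    (hh : h ∈ solid (c - 1)) :
    polyDiv (fun i => raise (c - 1) i h) = (c * (2 * c + 1) / (2 * (c - 1) + 1)) • h := by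
  have h1 : ∑ i, X i * pderiv i h = (c - 1) • h := (mem_solid.1 hh).1
  have h2 : ∑ i, pderiv i (pderiv i h) = 0 := (mem_solid.1 hh).2
  have e : polyDiv (fun i => raise (c - 1) i h) = (3 : ℝ) • h + (∑ i, X i * pderiv i h) -
      (2 * (c - 1) + 1)⁻¹ • ((2 : ℝ) • (∑ i, X i * pderiv i h) + rsq * ∑ i, pderiv i (pderiv i h)) := by
    simp only [polyDiv, raise, map_sub, pderiv_mul, pderiv_rsq, smul_eq_C_mul, Fin.sum_univ_three,
      map_ofNat, pderiv_C, pderiv_X_self]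
    ring
  rw [e, h1, h2, mul_zero, add_zero, smul_smul, smul_smul, ← add_smul, ← sub_smul]
  congr 1
  obtain ⟨e, he⟩ : ∃ e, e = 2 * (c - 1) + 1 := ⟨_, rfl⟩
  rw [← he] at hc2 ⊢
  field_simp
  rw [he]
  ring

/-- The fields `raise (c - 1) · h` are eigenvectors of the transpose form. -/
lemma transposeForm_raise {c : ℝ} (hc : 2 * c + 1 ≠ 0) (hc2 : 2 * (c - 1) + 1 ≠ 0)
    {h : MvPolynomial (Fin 3) ℝ} (hh : h ∈ solid (c - 1)) {Q : Fin 3 → MvPolynomial (Fin 3) ℝ}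
    (hQ : ∀ i, Q i ∈ solid c) :
    (2 * c + 1)⁻¹ * a ^ 2 * transposeForm a (fun i => raise (c - 1) i h) Q =
      (2 * (c - 1) + 1)⁻¹ * sphInner a (fun i => raise (c - 1) i h) Q := by
  have hv : ∀ i, raise (c - 1) i h ∈ solid c := fun i => by
    have := raise_mem_solid hc2 hh i
    rwa [sub_add_cancel] at this
  rw [← sum_sphInt_X_mul ha hc hv hQ]
  have e1 : ∑ i, ∑ j, X i * raise (c - 1) j h * pderiv j (Q i) =
      c • (∑ i, X i * Q i * h) -
        (2 * (c - 1) + 1)⁻¹ • ∑ j, ∑ i, rsq * (X i * pderiv j (Q i) * pderiv j h) := by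
    have hE : ∀ i, ∑ j, X j * pderiv j (Q i) = c • Q i := fun i => (mem_solid.1 (hQ i)).1
    have : c • (∑ i, X i * Q i * h) = ∑ i, X i * h * ∑ j, X j * pderiv j (Q i) := by
      simp only [hE, Finset.smul_sum]
      refine Finset.sum_congr rfl fun i _ => ?_
      rw [mul_smul_comm]
      congr 1
      ring
    rw [this]
    simp only [raise, Fin.sum_univ_three, smul_eq_C_mul]
    ring
  have e2 : sphInt a (∑ i, X i * Q i * h) = (2 * c + 1)⁻¹ * a ^ 2 * sphInt a (h * polyDiv Q) := by
    rw [polyDiv, Finset.mul_sum, sphInt_sum ha, sphInt_sum ha, Finset.mul_sum]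
    exact Finset.sum_congr rfl fun i _ => by rw [sphInt_X_mul_mul ha hc (hQ i) hh, mul_comm h]
  have e3 : sphInt a (∑ j, ∑ i, rsq * (X i * pderiv j (Q i) * pderiv j h)) =
      a ^ 2 * ((c - 1) * sphInt a (h * polyDiv Q)) := by
    have h4 : ∀ i j, sphInt a (X i * pderiv j (Q i) * pderiv j h) =
        (2 * (c - 1) + 1)⁻¹ * a ^ 2 * sphInt a (pderiv j h * pderiv j (pderiv i (Q i))) := fun i j => by
      rw [sphInt_X_mul_mul ha hc2 (pderiv_mem_solid (hQ i) j) (pderiv_mem_solid hh j), pderiv_comm i j,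
        mul_comm (pderiv j h)]
    have h5 := sum_sphInt_pderiv_mul ha hc2 hh (polyDiv_mem_solid hQ)
    have h6 : sphInt a (∑ j, ∑ i, rsq * (X i * pderiv j (Q i) * pderiv j h)) =
        a ^ 2 * ((2 * (c - 1) + 1)⁻¹ * (a ^ 2 * sphInt a (∑ j, pderiv j h * pderiv j (polyDiv Q)))) := by
      simp only [sphInt_sum ha, sphInt_rsq_mul ha, h4, polyDiv, map_sum, Finset.mul_sum]
      exact Finset.sum_congr rfl fun j _ => Finset.sum_congr rfl fun i _ => by ring
    rw [h6, h5]
    field_simp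
  rw [e1, sphInt_sub ha, sphInt_smul, sphInt_smul, e2, e3, sphInner_raise ha hh hc hQ]
  generalize sphInt a (h * polyDiv Q) = y
  obtain ⟨d, hd⟩ : ∃ d, d = 2 * c + 1 := ⟨_, rfl⟩
  obtain ⟨e, he⟩ : ∃ e, e = 2 * (c - 1) + 1 := ⟨_, rfl⟩
  rw [← hd] at hc ⊢
  rw [← he] at hc2 ⊢
  field_simp
  rw [hd, he]
  ring

/-- The reduced quadratic form, which determines the single layer operator on harmonics of degree `c`. -/
def reducedForm (a c : ℝ) (P : Fin 3 → MvPolynomial (Fin 3) ℝ) : ℝ :=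
  (4 * c + 4) * sphInner a P P - 2 * ((2 * c + 1)⁻¹ * a ^ 2 *
    (sphInt a (polyDiv P * polyDiv P) + transposeForm a P P))

/-- The divergence term has the good sign, and the transpose term is bounded by
`abs_transposeForm_le`. -/
lemma reducedForm_le {c : ℝ} (hc0 : 0 ≤ c) {P : Fin 3 → MvPolynomial (Fin 3) ℝ}
    (hP : ∀ i, P i ∈ solid c) : reducedForm a c P ≤ 3 * (2 * c + 3) * sphInner a P P := by
  have hc : 0 < 2 * c + 1 := by linarith
  have h1 := abs_transposeForm_le ha hc.ne' hP
  have h2 := mul_le_mul_of_nonneg_left (neg_le_abs (transposeForm a P P)) (sq_nonneg a)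
  have h3 := sphInt_mul_self_nonneg (a := a) (polyDiv P)
  have h4 := sphInner_self_nonneg ha P
  have h5 : -((2 * c + 1)⁻¹ * a ^ 2 * (sphInt a (polyDiv P * polyDiv P) + transposeForm a P P)) ≤
      c * sphInner a P P := by
    have : (2 * c + 1)⁻¹ * (a ^ 2 * -transposeForm a P P) ≤
        (2 * c + 1)⁻¹ * (c * (2 * c + 1) * sphInner a P P) :=
      mul_le_mul_of_nonneg_left (h2.trans h1) (inv_nonneg.2 hc.le)
    have h6 : (2 * c + 1)⁻¹ * (c * (2 * c + 1) * sphInner a P P) = c * sphInner a P P := by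
      field_simp
    have h7 : 0 ≤ (2 * c + 1)⁻¹ * a ^ 2 * sphInt a (polyDiv P * polyDiv P) := by positivity
    linarith
  unfold reducedForm
  linarith

/-- Subtracting from `P` its projection to the fields `raise (c - 1) · h`, on which the form is known,
bounds the form from below by a multiple of `‖P‖²` and of the norm of the remainder. -/
lemma le_reducedForm {c : ℝ} (hc1 : 1 ≤ c) {P : Fin 3 → MvPolynomial (Fin 3) ℝ}
    (hP : ∀ i, P i ∈ solid c) :
    0 ≤ sphInner a P P - (2 * c - 1) / (c * (2 * c + 1)) *
      ((2 * c + 1)⁻¹ * a ^ 2 * sphInt a (polyDiv P * polyDiv P)) ∧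
    2 * (c - 1) * (2 * c + 3) / (2 * c - 1) * sphInner a P P + (4 * c + 2) / (2 * c - 1) *
      (sphInner a P P - (2 * c - 1) / (c * (2 * c + 1)) *
      ((2 * c + 1)⁻¹ * a ^ 2 * sphInt a (polyDiv P * polyDiv P))) ≤ reducedForm a c P := by
  have hc : 0 < 2 * c + 1 := by linarith
  have hcm : 0 < 2 * c - 1 := by linarith
  have hc2 : 2 * (c - 1) + 1 ≠ 0 := by intro h; linarith
  have hh := polyDiv_mem_solid hP
  set h := polyDiv P with hdef
  have hv : ∀ i, raise (c - 1) i h ∈ solid c := fun i => by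
    have := raise_mem_solid hc2 hh i
    rwa [sub_add_cancel] at this
  set v : Fin 3 → MvPolynomial (Fin 3) ℝ := fun i => raise (c - 1) i h with hvdef
  set s := (2 * c + 1)⁻¹ * a ^ 2 * sphInt a (h * h) with hs
  have hvP : sphInner a v P = s := by rw [hvdef, sphInner_raise ha hh hc.ne' hP, ← hdef]
  have hvv : sphInner a v v = c * (2 * c + 1) / (2 * c - 1) * s := by
    rw [hvdef, sphInner_raise ha hh hc.ne' hv, polyDiv_raise hc2 hh, mul_smul_comm, sphInt_smul, hs]
    rw [show 2 * (c - 1) + 1 = 2 * c - 1 by ring]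
    ring
  have hbP := transposeForm_raise ha hc.ne' hc2 hh hP
  have hbv := transposeForm_raise ha hc.ne' hc2 hh hv
  rw [← hvdef, hvP, show 2 * (c - 1) + 1 = 2 * c - 1 by ring] at hbP
  rw [← hvdef, hvv, show 2 * (c - 1) + 1 = 2 * c - 1 by ring] at hbv
  set t := (2 * c - 1) / (c * (2 * c + 1)) with ht
  set R : Fin 3 → MvPolynomial (Fin 3) ℝ := fun i => P i - t • v i with hR
  have hRs : ∀ i, R i ∈ solid c := fun i => Submodule.sub_mem _ (hP i) (Submodule.smul_mem _ _ (hv i))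
  have hN : sphInner a R R = sphInner a P P - t * s := by
    have : sphInner a R R = sphInner a P P - (2 * t) * sphInner a v P + t ^ 2 * sphInner a v v := by
      simp only [sphInner]
      rw [← sphInt_smul, ← sphInt_smul, ← sphInt_sub ha, ← sphInt_add ha]
      congr 1
      simp only [hR, Fin.sum_univ_three, smul_eq_C_mul, map_mul, map_pow, map_ofNat]
      ring
    rw [this, hvP, hvv, ht]
    field_simp
    ring
  have hB : transposeForm a R R = transposeForm a P P - (2 * t) * transposeForm a v P +
      t ^ 2 * transposeForm a v v := by
    simp only [transposeForm]
    rw [← sphInt_smul, ← sphInt_smul, ← sphInt_sub ha, ← sphInt_add ha]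
    congr 1
    simp only [hR, Fin.sum_univ_three, smul_eq_C_mul, map_mul, map_pow, map_ofNat, map_sub, pderiv_mul,
      pderiv_C]
    ring
  have hRle := abs_transposeForm_le ha hc.ne' hRs
  have hle := mul_le_mul_of_nonneg_left (le_abs_self (transposeForm a R R)) (sq_nonneg a)
  have hb' : (2 * c + 1)⁻¹ * a ^ 2 * transposeForm a R R ≤ c * (sphInner a P P - t * s) := by
    rw [← hN]
    have : (2 * c + 1)⁻¹ * (a ^ 2 * transposeForm a R R) ≤
        (2 * c + 1)⁻¹ * (c * (2 * c + 1) * sphInner a R R) :=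
      mul_le_mul_of_nonneg_left (hle.trans hRle) (inv_nonneg.2 hc.le)
    have h6 : (2 * c + 1)⁻¹ * (c * (2 * c + 1) * sphInner a R R) = c * sphInner a R R := by
      field_simp
    linarith
  have hb'' : (2 * c + 1)⁻¹ * a ^ 2 * transposeForm a R R =
      (2 * c + 1)⁻¹ * a ^ 2 * transposeForm a P P - t * ((2 * c - 1)⁻¹ * s) := by
    rw [hB]
    have e : t ^ 2 * (c * (2 * c + 1) / (2 * c - 1)) = t := by
      rw [ht]
      field_simp
    calc _ = (2 * c + 1)⁻¹ * a ^ 2 * transposeForm a P P -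
          2 * t * ((2 * c + 1)⁻¹ * a ^ 2 * transposeForm a v P) +
          t ^ 2 * ((2 * c + 1)⁻¹ * a ^ 2 * transposeForm a v v) := by ring
      _ = (2 * c + 1)⁻¹ * a ^ 2 * transposeForm a P P - 2 * t * ((2 * c - 1)⁻¹ * s) +
          (t ^ 2 * (c * (2 * c + 1) / (2 * c - 1))) * ((2 * c - 1)⁻¹ * s) := by
        rw [hbP, hbv]
        ring
      _ = _ := by
        rw [e]
        ring
  refine ⟨hN ▸ sphInner_self_nonneg ha R, ?_⟩
  have hfin : reducedForm a c P = (4 * c + 4) * sphInner a P P - 2 * s -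
      2 * ((2 * c + 1)⁻¹ * a ^ 2 * transposeForm a R R) - 2 * (t * ((2 * c - 1)⁻¹ * s)) := by
    rw [hb'', reducedForm, ← hdef, hs]
    ring
  have hst : s = c * (2 * c + 1) / (2 * c - 1) * (t * s) := by
    have e : c * (2 * c + 1) / (2 * c - 1) * t = 1 := by
      rw [ht]
      have : 0 < c * (2 * c + 1) := by positivity
      rw [div_mul_div_comm, mul_comm, div_self (by positivity)]
    rw [← mul_assoc, e, one_mul]
  have h8 : t * ((2 * c - 1)⁻¹ * s) = (2 * c - 1)⁻¹ * (t * s) := by ring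
  rw [hfin, h8]
  generalize t * s = m at hst hb' ⊢
  rw [hst]
  have key : 2 * (c - 1) * (2 * c + 3) / (2 * c - 1) * sphInner a P P + (4 * c + 2) / (2 * c - 1) *
      (sphInner a P P - m) = (4 * c + 4) * sphInner a P P - 2 * (c * (2 * c + 1) / (2 * c - 1) * m) -
      2 * (c * (sphInner a P P - m)) - 2 * ((2 * c - 1)⁻¹ * m) := by
    field_simp
    ring
  rw [key]
  linarith

lemma sphInner_stokesPoly_self {η c : ℝ} (hc0 : 0 ≤ c) {P : Fin 3 → MvPolynomial (Fin 3) ℝ}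
    (hP : ∀ i, P i ∈ solid c) : sphInner a (stokesPoly a η c P) P =
      a / (2 * η) * ((2 * c + 1)⁻¹ * (2 * c + 3)⁻¹) * reducedForm a c P :=
  sphInner_stokesPoly ha (by positivity) (by positivity) hP hP

lemma sphInner_stokesPoly_self_le {η c : ℝ} (hη : 0 < η) (hc0 : 0 ≤ c)
    {P : Fin 3 → MvPolynomial (Fin 3) ℝ} (hP : ∀ i, P i ∈ solid c) :
    sphInner a (stokesPoly a η c P) P ≤ 3 * a / (2 * η) * (2 * c + 1)⁻¹ * sphInner a P P := by
  rw [sphInner_stokesPoly_self ha hc0 hP]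
  calc _ ≤ a / (2 * η) * ((2 * c + 1)⁻¹ * (2 * c + 3)⁻¹) * (3 * (2 * c + 3) * sphInner a P P) :=
        mul_le_mul_of_nonneg_left (reducedForm_le ha hc0 hP) (by positivity)
    _ = _ := by
        have : 2 * c + 3 ≠ 0 := by positivity
        generalize (2 * c + 1)⁻¹ = y
        field_simp

omit ha in
lemma polyDiv_eq_zero_of_mem_solid_zero {P : Fin 3 → MvPolynomial (Fin 3) ℝ}
    (hP : ∀ i, P i ∈ solid 0) : polyDiv P = 0 := by
  have h : ∀ i, P i = C (ev (P i) 0) := fun i => MvPolynomial.funext fun x => by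
    have := ev_eq_of_mem_solid_zero (hP i) (WithLp.toLp 2 x)
    simpa [ev] using this
  rw [polyDiv]
  refine Finset.sum_eq_zero fun i _ => ?_
  rw [h i, pderiv_C]

lemma reducedForm_zero {P : Fin 3 → MvPolynomial (Fin 3) ℝ} (hP : ∀ i, P i ∈ solid 0) :
    reducedForm a 0 P = 4 * sphInner a P P := by
  have h1 := abs_transposeForm_le ha (by norm_num) hP
  have h2 : transposeForm a P P = 0 := by
    have : a ^ 2 * |transposeForm a P P| ≤ 0 := by linarith
    have h3 : |transposeForm a P P| ≤ 0 := nonpos_of_mul_nonpos_right this (by positivity)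
    exact abs_nonpos_iff.1 h3
  rw [reducedForm, h2, polyDiv_eq_zero_of_mem_solid_zero hP, zero_mul]
  simp [sphInt]

lemma sphInner_stokesPoly_self_nonneg {η : ℝ} (hη : 0 < η) (l : ℕ)
    {P : Fin 3 → MvPolynomial (Fin 3) ℝ} (hP : ∀ i, P i ∈ solid l) :
    0 ≤ sphInner a (stokesPoly a η l P) P := by
  rw [sphInner_stokesPoly_self ha (Nat.cast_nonneg l) hP]
  have hN := sphInner_self_nonneg ha P
  refine mul_nonneg (by positivity) ?_
  rcases Nat.eq_zero_or_pos l with rfl | hl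
  · rw [Nat.cast_zero] at hP ⊢
    rw [reducedForm_zero ha hP]
    positivity
  · have hl' : (1 : ℝ) ≤ l := by exact_mod_cast hl
    obtain ⟨h1, h2⟩ := le_reducedForm ha hl' hP
    refine le_trans ?_ h2
    have h3 : 0 ≤ (l : ℝ) - 1 := by linarith
    have h4 : 0 < 2 * (l : ℝ) - 1 := by linarith
    refine add_nonneg (by positivity) (mul_nonneg (by positivity) h1)

/-- The inner product in `L²` of a polynomial vector field with the unit normal field. -/
def normalInner (a : ℝ) (P : Fin 3 → MvPolynomial (Fin 3) ℝ) : ℝ := a⁻¹ * sphInt a (∑ i, X i * P i)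

lemma normalInner_eq {P : Fin 3 → MvPolynomial (Fin 3) ℝ} (hP : ∀ i, P i ∈ solid 1) :
    normalInner a P = a * (2 * 1 + 1)⁻¹ * sphInt a (polyDiv P) := by
  have h : ∀ i, sphInt a (X i * P i) = (2 * 1 + 1)⁻¹ * a ^ 2 * sphInt a (pderiv i (P i)) := fun i => by
    have := sphInt_X_mul_mul ha (by norm_num) (hP i) (q := C 1)
      (by rw [sub_self]; exact C_mem_solid 1) i
    simpa using this
  rw [normalInner, polyDiv, sphInt_sum ha, sphInt_sum ha, Finset.sum_congr rfl fun i _ => h i,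
    ← Finset.mul_sum]
  field_simp

lemma normalInner_eq_zero {c : ℝ} (hc : c ≠ 1) {P : Fin 3 → MvPolynomial (Fin 3) ℝ}
    (hP : ∀ i, P i ∈ solid c) : normalInner a P = 0 := by
  rw [normalInner, sphInt_sum ha, Finset.sum_eq_zero, mul_zero]
  intro i _
  exact sphInt_mul_eq_zero ha hc.symm (X_mem_solid i) (hP i)

/-- The form is coercive up to the direction of the unit normal, which only harmonics of degree one
see. -/
lemma le_sphInner_stokesPoly_self {η : ℝ} (hη : 0 < η) (l : ℕ)
    {P : Fin 3 → MvPolynomial (Fin 3) ℝ} (hP : ∀ i, P i ∈ solid l) :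
    a / (3 * η) * (2 * l + 1 : ℝ)⁻¹ * sphInner a P P ≤ sphInner a (stokesPoly a η l P) P +
      1 / (20 * Real.pi * η * a) * normalInner a P ^ 2 := by
  rw [sphInner_stokesPoly_self ha (Nat.cast_nonneg l) hP]
  have hN := sphInner_self_nonneg ha P
  have hpi := Real.pi_pos
  rcases Nat.lt_trichotomy l 1 with hl | rfl | hl
  · obtain rfl : l = 0 := by omega
    rw [Nat.cast_zero] at hP ⊢
    rw [reducedForm_zero ha hP]
    have h0 : 0 ≤ 1 / (20 * Real.pi * η * a) * normalInner a P ^ 2 := by positivity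
    have h1 : a / (2 * η) * ((2 * 0 + 1)⁻¹ * (2 * 0 + 3)⁻¹) * (4 * sphInner a P P) =
        2 * (a / (3 * η) * (2 * 0 + 1)⁻¹ * sphInner a P P) := by
      field_simp
      norm_num
    have h2 : 0 ≤ a / (3 * η) * (2 * 0 + 1)⁻¹ * sphInner a P P := by positivity
    linarith
  · rw [Nat.cast_one] at hP ⊢
    obtain ⟨h1, h2⟩ := le_reducedForm ha le_rfl hP
    have hh : polyDiv P ∈ solid 0 := by
      have := polyDiv_mem_solid hP
      rwa [sub_self] at this
    have hc : ∀ x, ev (polyDiv P) x = ev (polyDiv P) 0 := ev_eq_of_mem_solid_zero hh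
    set y := ev (polyDiv P) 0 with hy
    have hvol := sphereMeasure_real_univ (a := a)
    have e1 : sphInt a (polyDiv P) = 4 * Real.pi * a ^ 2 * y := by
      simp only [sphInt, hc, integral_const, hvol, smul_eq_mul]
    have e2 : sphInt a (polyDiv P * polyDiv P) = 4 * Real.pi * a ^ 2 * y ^ 2 := by
      simp only [sphInt, ev_mul, hc, integral_const, hvol, smul_eq_mul]
      ring
    rw [normalInner_eq ha hP, e1]
    rw [e2] at h1 h2
    have h3 : a / (2 * η) * ((2 * 1 + 1)⁻¹ * (2 * 1 + 3)⁻¹) * (6 * (sphInner a P P -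
        4 * Real.pi * a ^ 4 * y ^ 2 / 9)) ≤
        a / (2 * η) * ((2 * 1 + 1)⁻¹ * (2 * 1 + 3)⁻¹) * reducedForm a 1 P := by
      refine mul_le_mul_of_nonneg_left ?_ (by positivity)
      refine le_trans (le_of_eq ?_) h2
      ring
    have h4 : a / (2 * η) * ((2 * 1 + 1)⁻¹ * (2 * 1 + 3)⁻¹) * (6 * (sphInner a P P -
        4 * Real.pi * a ^ 4 * y ^ 2 / 9)) + 1 / (20 * Real.pi * η * a) *
        (a * (2 * 1 + 1)⁻¹ * (4 * Real.pi * a ^ 2 * y)) ^ 2 = a / (5 * η) * sphInner a P P := by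
      field_simp
      ring
    have h5 : a / (3 * η) * (2 * 1 + 1)⁻¹ * sphInner a P P ≤ a / (5 * η) * sphInner a P P := by
      refine mul_le_mul_of_nonneg_right ?_ hN
      rw [div_mul_eq_mul_div, div_le_div_iff₀ (by positivity) (by positivity)]
      have : 0 < a * η := by positivity
      linarith
    linarith
  · have hl' : (2 : ℝ) ≤ l := by exact_mod_cast hl
    obtain ⟨h1, h2⟩ := le_reducedForm ha (by linarith) hP
    have h0 : 0 ≤ 1 / (20 * Real.pi * η * a) * normalInner a P ^ 2 := by positivity
    generalize (l : ℝ) = c at *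
    have h4 : 0 < 2 * c - 1 := by linarith
    have h5 : 0 ≤ (4 * c + 2) / (2 * c - 1) * (sphInner a P P - (2 * c - 1) / (c * (2 * c + 1)) *
      ((2 * c + 1)⁻¹ * a ^ 2 * sphInt a (polyDiv P * polyDiv P))) :=
      mul_nonneg (div_nonneg (by linarith) h4.le) h1
    have h6 : 2 * (2 * c + 3) / 3 ≤ 2 * (c - 1) * (2 * c + 3) / (2 * c - 1) := by
      rw [div_le_div_iff₀ (by norm_num) h4]
      nlinarith
    have h7 : 2 * (2 * c + 3) / 3 * sphInner a P P ≤ reducedForm a c P :=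
      (mul_le_mul_of_nonneg_right h6 hN).trans (by linarith)
    have hp : 0 < 2 * c + 3 := by linarith
    have hp' : 0 < 2 * c + 1 := by linarith
    calc _ = a / (2 * η) * ((2 * c + 1)⁻¹ * (2 * c + 3)⁻¹) * (2 * (2 * c + 3) / 3 * sphInner a P P) := by
          generalize (2 * c + 1)⁻¹ = y
          field_simp
      _ ≤ a / (2 * η) * ((2 * c + 1)⁻¹ * (2 * c + 3)⁻¹) * reducedForm a c P :=
          mul_le_mul_of_nonneg_left h7 (by positivity)
      _ ≤ _ := by linarith

end FormBounds

end

noncomputable section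

open MvPolynomial

/-! ### Density of solid harmonics -/

/-- On the sphere, every polynomial coincides with a sum of solid harmonics. -/
lemma exists_solid_sum (a : ℝ) (p : MvPolynomial (Fin 3) ℝ) :
    ∃ h ∈ ⨆ l : ℕ, solid l, ∀ x : E3, ‖x‖ = a → ev p x = ev h x := by
  induction p using MvPolynomial.induction_on with
  | C c =>
    refine ⟨C c, Submodule.mem_iSup_of_mem 0 ?_, fun _ _ => rfl⟩
    rw [Nat.cast_zero]
    exact C_mem_solid c
  | add p q hp hq =>
    obtain ⟨h, hh, e⟩ := hp
    obtain ⟨h', hh', e'⟩ := hq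
    exact ⟨h + h', add_mem hh hh', fun x hx => by rw [ev_add, ev_add, e x hx, e' x hx]⟩
  | mul_X p i hp =>
    obtain ⟨h, hh, e⟩ := hp
    suffices H : ∃ k ∈ ⨆ l : ℕ, solid l, ∀ x : E3, ‖x‖ = a → ev (X i * h) x = ev k x by
      obtain ⟨k, hk, e'⟩ := H
      refine ⟨k, hk, fun x hx => ?_⟩
      rw [← e' x hx, ev_mul, ev_mul, e x hx, mul_comm]
    clear e
    refine Submodule.iSup_induction _ (motive := fun h => ∃ k ∈ ⨆ l : ℕ, solid l,
      ∀ x : E3, ‖x‖ = a → ev (X i * h) x = ev k x) hh ?_ ?_ ?_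
    · intro l q hq
      refine ⟨raise l i q + ((2 * (l : ℝ) + 1)⁻¹ * a ^ 2) • pderiv i q, add_mem ?_ ?_, fun x hx => ?_⟩
      · refine Submodule.mem_iSup_of_mem (l + 1) ?_
        rw [Nat.cast_add, Nat.cast_one]
        exact raise_mem_solid (by positivity) hq i
      · refine Submodule.smul_mem _ _ ?_
        have hd := pderiv_mem_solid hq i
        rcases Nat.eq_zero_or_pos l with rfl | hl
        · rw [Nat.cast_zero] at hq
          have : q = C (ev q 0) := MvPolynomial.funext fun x => by
            have := ev_eq_of_mem_solid_zero hq (WithLp.toLp 2 x)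
            simpa [ev] using this
          rw [this, pderiv_C]
          exact zero_mem _
        · refine Submodule.mem_iSup_of_mem (l - 1) ?_
          rwa [Nat.cast_sub hl, Nat.cast_one]
      · rw [X_mul_eq l i q, ev_add, ev_add, ev_smul, ev_smul, ev_mul, ev_rsq, hx]
        ring
    · exact ⟨0, zero_mem _, fun x _ => by rw [mul_zero]⟩
    · rintro p q ⟨k, hk, e⟩ ⟨k', hk', e'⟩
      exact ⟨k + k', add_mem hk hk', fun x hx => by rw [mul_add, ev_add, ev_add, e x hx, e' x hx]⟩

/-- Polynomials approximate continuous functions uniformly on the sphere. -/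
lemma exists_ev_near (a : ℝ) {g : E3 → ℝ} (hg : Continuous g) {ε : ℝ} (hε : 0 < ε) :
    ∃ p : MvPolynomial (Fin 3) ℝ, ∀ x : E3, ‖x‖ = a → |ev p x - g x| < ε := by
  let Φ : MvPolynomial (Fin 3) ℝ →ₐ[ℝ] C(E3, ℝ) :=
    MvPolynomial.aeval fun i => (⟨fun x => x i, (coord i).continuous⟩ : C(E3, ℝ))
  have hΦ : ∀ p x, Φ p x = ev p x := fun p x => by
    induction p using MvPolynomial.induction_on with
    | C c => simp [Φ]
    | add p q hp hq => simp [hp, hq]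
    | mul_X p i hp =>
      rw [map_mul, ContinuousMap.mul_apply, hp, ev_mul, ev_X]
      simp only [Φ, aeval_X]
      rfl
  have hsep : Φ.range.SeparatesPoints := by
    intro x y hxy
    obtain ⟨i, hi⟩ : ∃ i, x i ≠ y i := by
      by_contra! h
      exact hxy (PiLp.ext h)
    refine ⟨_, ⟨Φ (X i), ⟨X i, rfl⟩, rfl⟩, ?_⟩
    change Φ (X i) x ≠ Φ (X i) y
    rw [hΦ, hΦ, ev_X, ev_X]
    exact hi
  obtain ⟨q, ⟨p, rfl⟩, hp⟩ :=
    ContinuousMap.exists_mem_subalgebra_near_continuous_of_isCompact_of_separatesPoints hsep ⟨g, hg⟩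
      (isCompact_sphere (0 : E3) a) hε
  refine ⟨p, fun x hx => ?_⟩
  have := hp x (by simpa using hx)
  rw [← hΦ]
  exact this

lemma norm_le_two_mul_of_abs_le {v : E3} {ε : ℝ} (hε : 0 ≤ ε) (h : ∀ i, |v i| ≤ ε) :
    ‖v‖ ≤ 2 * ε := by
  have h1 : ‖v‖ ^ 2 ≤ (2 * ε) ^ 2 := by
    rw [EuclideanSpace.real_norm_sq_eq, Fin.sum_univ_three]
    have h3 : ∀ i, v i ^ 2 ≤ ε ^ 2 := fun i => sq_le_sq' (abs_le.1 (h i)).1 (abs_le.1 (h i)).2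
    linarith [h3 0, h3 1, h3 2, sq_nonneg ε]
  exact (abs_le_of_sq_le_sq' h1 (by positivity)).2

variable {a : ℝ} (ha : 0 < a)
include ha

/-- A field orthogonal to all polynomial fields is orthogonal to all continuous fields. -/
lemma integral_inner_eq_zero {φ : E3 → E3} (hφi : Integrable φ (sphereMeasure a))
    (hφ : ∀ P, ∫ x, inner ℝ (vecEv P x) (φ x) ∂sphereMeasure a = 0) {g : E3 → E3}
    (hg : Continuous g) : ∫ x, inner ℝ (g x) (φ x) ∂sphereMeasure a = 0 := by
  by_contra hne
  set I := ∫ x, inner ℝ (g x) (φ x) ∂sphereMeasure a with hI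
  set M := ∫ x, ‖φ x‖ ∂sphereMeasure a with hM
  have hM0 : 0 ≤ M := integral_nonneg fun _ => norm_nonneg _
  have hI0 : 0 < |I| := abs_pos.2 hne
  set ε := |I| / (3 * (M + 1)) with hεdef
  have hε : 0 < ε := by positivity
  choose P hP using fun i : Fin 3 => exists_ev_near a ((coord i).continuous.comp hg) hε
  have hb : ∀ x : E3, ‖x‖ = a → ‖g x - vecEv P x‖ ≤ 2 * ε := by
    intro x hx
    refine norm_le_two_mul_of_abs_le hε.le fun i => ?_
    rw [PiLp.sub_apply, vecEv_apply, abs_sub_comm]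
    exact (hP i x hx).le
  have hint : ∀ {f : E3 → E3}, Continuous f →
      Integrable (fun x => (inner ℝ (f x) (φ x) : ℝ)) (sphereMeasure a) := by
    intro f hf
    obtain ⟨C, hC0, hC⟩ := exists_bound_sphere (a := a) hf.continuousOn
    refine (hφi.norm.const_mul C).mono'
      (hf.aestronglyMeasurable.inner hφi.aestronglyMeasurable) ?_
    filter_upwards [ae_mem_sphere ha] with x hx
    exact (norm_inner_le_norm _ _).trans (mul_le_mul_of_nonneg_right (hC x hx) (norm_nonneg _))
  have h4 : |I| ≤ 2 * ε * M := by
    have : I = ∫ x, inner ℝ (g x - vecEv P x) (φ x) ∂sphereMeasure a := by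
      simp only [inner_sub_left]
      rw [integral_sub (hint hg) (hint (continuous_vecEv P)), hφ P, sub_zero]
    rw [this, ← Real.norm_eq_abs, hM, ← integral_const_mul]
    refine norm_integral_le_of_norm_le (hφi.norm.const_mul _) ?_
    filter_upwards [ae_mem_sphere ha] with x hx
    exact (norm_inner_le_norm _ _).trans
      (mul_le_mul_of_nonneg_right (hb x (by simpa using hx)) (norm_nonneg _))
  have h5 : 3 * (M + 1) * ε = |I| := by
    rw [hεdef]
    field_simp
  nlinarith

/-- Polynomial vector fields are dense in `L²` of the sphere. -/
lemma dense_polyField : Dense {ψ | ∃ P, ψ = toL2 a (polyField a P)} := by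
  let R : (Fin 3 → MvPolynomial (Fin 3) ℝ) →ₗ[ℝ] Lp E3 2 (sphereMeasure a) :=
    { toFun := fun P => toL2 a (polyField a P)
      map_add' := fun P Q => by
        refine Lp.ext ?_
        filter_upwards [toL2_polyField ha (P + Q), toL2_polyField ha P, toL2_polyField ha Q,
          Lp.coeFn_add (toL2 a (polyField a P)) (toL2 a (polyField a Q))] with x h1 h2 h3 h4
        rw [h1, h4, Pi.add_apply, h2, h3]
        ext i
        simp
      map_smul' := fun c P => by
        refine Lp.ext ?_
        filter_upwards [toL2_polyField ha (c • P), toL2_polyField ha P,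
          Lp.coeFn_smul c (toL2 a (polyField a P))] with x h1 h2 h4
        rw [h1, RingHom.id_apply, h4, Pi.smul_apply, h2]
        ext i
        simp }
  have hR : ({ψ | ∃ P, ψ = toL2 a (polyField a P)} : Set (Lp E3 2 (sphereMeasure a))) =
      (LinearMap.range R : Set _) := by
    ext ψ
    exact ⟨fun ⟨P, h⟩ => ⟨P, h.symm⟩, fun ⟨P, h⟩ => ⟨P, h.symm⟩⟩
  rw [hR, Submodule.dense_iff_topologicalClosure_eq_top, Submodule.topologicalClosure_eq_top_iff,
    Submodule.eq_bot_iff]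
  intro φ hφ
  have hφ' : ∀ P, ∫ x, inner ℝ (vecEv P x) (φ x) ∂sphereMeasure a = 0 := fun P => by
    rw [← inner_toL2_polyField ha P φ]
    exact (Submodule.mem_orthogonal _ _).1 hφ _ ⟨P, rfl⟩
  have hφi : Integrable (fun x => φ x) (sphereMeasure a) :=
    (Lp.memLp φ).integrable (by norm_num)
  have key : ∀ g : BoundedContinuousFunction E3 E3,
      inner ℝ (BoundedContinuousFunction.toLp 2 (sphereMeasure a) ℝ g) φ = 0 := by
    intro g
    rw [L2.inner_def, ← integral_inner_eq_zero ha hφi hφ' g.continuous]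
    refine integral_congr_ae ?_
    filter_upwards [BoundedContinuousFunction.coeFn_toLp (p := 2) (𝕜 := ℝ) (sphereMeasure a) g]
      with x hx
    rw [hx]
  have h0 : ∀ ψ : Lp E3 2 (sphereMeasure a), inner ℝ ψ φ = 0 := fun ψ =>
    (BoundedContinuousFunction.toLp_denseRange E3 (sphereMeasure a) ℝ (by norm_num)).induction_on
      (p := fun ψ => inner ℝ ψ φ = 0) ψ (isClosed_eq (by fun_prop) continuous_const) key
  exact inner_self_eq_zero.1 (h0 φ)

/-- A finite sum of vector fields of solid harmonics. -/
def IsHarmonicSum (a : ℝ) (ψ : Lp E3 2 (sphereMeasure a)) (s : Finset ℕ)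
    (P : ℕ → Fin 3 → MvPolynomial (Fin 3) ℝ) : Prop :=
  (∀ (l : ℕ) i, P l i ∈ solid l) ∧ ψ = ∑ l ∈ s, toL2 a (polyField a (P l))

/-- Every polynomial agrees on the sphere with a finite sum of solid harmonics, and polynomial fields
are dense in `L²`. -/
lemma dense_harmonicSum : Dense {ψ | ∃ s P, IsHarmonicSum a ψ s P} := by
  refine (dense_polyField ha).mono ?_
  rintro _ ⟨P, rfl⟩
  choose h hh e using fun i => exists_solid_sum a (P i)
  choose f hf hfs using fun i => (Submodule.mem_iSup_iff_exists_finsupp _ _).1 (hh i)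
  refine ⟨Finset.univ.biUnion fun i => (f i).support, fun l i => f i l, fun l i => hf i l, ?_⟩
  refine Lp.ext ?_
  have hsum : ∀ s : Finset ℕ, (∑ l ∈ s, toL2 a (polyField a fun i => f i l) : Lp E3 2 (sphereMeasure a))
      =ᵐ[sphereMeasure a] fun x => ∑ l ∈ s, vecEv (fun i => f i l) x := by
    intro s
    induction s using Finset.induction_on with
    | empty => 
      filter_upwards [Lp.coeFn_zero E3 2 (sphereMeasure a)] with x hx
      rw [Finset.sum_empty, Finset.sum_empty, hx, Pi.zero_apply]
    | insert l s hl ih =>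
      rw [Finset.sum_insert hl]
      filter_upwards [Lp.coeFn_add (toL2 a (polyField a fun i => f i l))
        (∑ l ∈ s, toL2 a (polyField a fun i => f i l)), ih, toL2_polyField ha fun i => f i l]
        with x h1 h2 h3
      rw [h1, Pi.add_apply, h2, h3, Finset.sum_insert hl]
  filter_upwards [toL2_polyField ha P, hsum (Finset.univ.biUnion fun i => (f i).support),
    ae_mem_sphere ha] with x h1 h2 hx
  rw [h1, h2]
  ext i
  rw [vecEv_apply, e i x (by simpa using hx), ← hfs i, Finsupp.sum, ev_sum]
  have : (∑ l ∈ Finset.univ.biUnion fun i => (f i).support, vecEv (fun i => f i l) x) i =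
      ∑ l ∈ Finset.univ.biUnion fun i => (f i).support, ev (f i l) x := by
    rw [WithLp.ofLp_sum, Finset.sum_apply]
    rfl
  rw [this]
  refine Finset.sum_subset (Finset.subset_biUnion_of_mem (fun i => (f i).support) (Finset.mem_univ i))
    fun l _ hl => ?_
  rw [Finsupp.notMem_support_iff.1 hl, ev_zero]

end

noncomputable section

open MvPolynomial

/-! ### Extension of a form bounded by a weaker norm -/

section Abstract

variable {H X : Type*} [NormedAddCommGroup H] [InnerProductSpace ℝ H] [CompleteSpace H]
  [NormedAddCommGroup X] [InnerProductSpace ℝ X] [CompleteSpace X]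

/-- The orthogonal complement of the range of `J†` is the kernel of `J`. -/
lemma denseRange_adjoint {J : H →L[ℝ] X} (hJ : Function.Injective J) :
    DenseRange (ContinuousLinearMap.adjoint J) := by
  have hd : ((ContinuousLinearMap.adjoint J).range).topologicalClosure = ⊤ := by
    rw [Submodule.topologicalClosure_eq_top_iff, Submodule.eq_bot_iff]
    intro g hg
    apply hJ
    rw [map_zero, ← inner_self_eq_zero (𝕜 := ℝ)]
    have := (Submodule.mem_orthogonal _ _).1 hg (ContinuousLinearMap.adjoint J (J g)) ⟨_, rfl⟩
    rwa [ContinuousLinearMap.adjoint_inner_left] at this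
  exact (Submodule.dense_iff_topologicalClosure_eq_top).2 hd

/-- If the form of a nonnegative symmetric operator `T` on `X` is bounded by the norm of `J† ψ`, then
`T` factors as `J V J†`. -/
theorem exists_factorization {J : H →L[ℝ] X} (hJ : Function.Injective J) {T : X →L[ℝ] X}
    (hsymm : ∀ ψ χ, inner ℝ (T ψ) χ = inner ℝ ψ (T χ)) (hpos : ∀ ψ, 0 ≤ inner ℝ (T ψ) ψ) {C : ℝ}
    (hC : 0 ≤ C) (hle : ∀ ψ, inner ℝ (T ψ) ψ ≤ C * ‖ContinuousLinearMap.adjoint J ψ‖ ^ 2) :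
    ∃ V : H →L[ℝ] H, ∀ ψ, J (V (ContinuousLinearMap.adjoint J ψ)) = T ψ := by
  have hd := denseRange_adjoint hJ
  set e := ContinuousLinearMap.adjoint J with he
  have hcs : ∀ ψ χ, |inner ℝ (T ψ) χ| ≤ C * ‖e ψ‖ * ‖e χ‖ := by
    intro ψ χ
    let B : LinearMap.BilinForm ℝ X := LinearMap.mk₂ ℝ (fun ψ χ => inner ℝ (T ψ) χ)
      (fun a b c => by rw [map_add, inner_add_left]) (fun r a b => by rw [map_smul, real_inner_smul_left]; rfl)
      (fun a b c => by rw [inner_add_right]) (fun r a b => by rw [real_inner_smul_right]; rfl)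
    have h1 : B ψ χ ^ 2 ≤ B ψ ψ * B χ χ := B.apply_sq_le_of_symm hpos
      ⟨fun ψ χ => by
        show inner ℝ (T ψ) χ = inner ℝ (T χ) ψ
        rw [hsymm, real_inner_comm]⟩ ψ χ
    have h2 : inner ℝ (T ψ) χ ^ 2 ≤ (C * ‖e ψ‖ * ‖e χ‖) ^ 2 := by
      refine h1.trans ?_
      calc _ ≤ (C * ‖e ψ‖ ^ 2) * (C * ‖e χ‖ ^ 2) :=
            mul_le_mul (hle ψ) (hle χ) (hpos χ) (by positivity)
        _ = _ := by ring
    exact abs_le_of_sq_le_sq h2 (by positivity)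
  have hex : ∀ ψ, ∃ g : H, J g = T ψ ∧ ‖g‖ ≤ C * ‖e ψ‖ := by
    intro ψ
    let ℓ : X →ₗ[ℝ] ℝ := (innerSL ℝ (T ψ)).toLinearMap
    have hℓ : ∀ χ, ‖ℓ χ‖ ≤ C * ‖e ψ‖ * ‖e.toLinearMap χ‖ := fun χ => hcs ψ χ
    let F : StrongDual ℝ H := ℓ.extendOfNorm e.toLinearMap
    have hF : ∀ χ, F (e χ) = inner ℝ (T ψ) χ := fun χ =>
      LinearMap.extendOfNorm_eq (f := ℓ) (e := e.toLinearMap) hd ⟨_, hℓ⟩ χ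
    refine ⟨(InnerProductSpace.toDual ℝ H).symm F, ?_, ?_⟩
    · refine ext_inner_right ℝ fun χ => ?_
      rw [← hF χ, he, ← ContinuousLinearMap.adjoint_inner_right, InnerProductSpace.toDual_symm_apply]
    · rw [LinearIsometryEquiv.norm_map]
      exact F.opNorm_le_bound (by positivity)
        (LinearMap.norm_extendOfNorm_apply_le (f := ℓ) (e := e.toLinearMap) hd _ hℓ)
  choose g hg hgn using hex
  let G : X →ₗ[ℝ] H :=
    { toFun := g
      map_add' := fun ψ χ => hJ (by rw [map_add, hg, hg, hg, map_add])
      map_smul' := fun c ψ => hJ (by rw [RingHom.id_apply, map_smul, hg, hg, map_smul]) }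
  refine ⟨G.extendOfNorm e.toLinearMap, fun ψ => ?_⟩
  have := LinearMap.extendOfNorm_eq (f := G) (e := e.toLinearMap) hd ⟨C, hgn⟩ ψ
  rw [← hg ψ]
  exact congrArg J this

/-- The middle factor of `T = J V J†` inherits the symmetry of `T`, by density of the range of `J†`. -/
lemma factorization_symm {J : H →L[ℝ] X} (hJ : Function.Injective J) {T : X →L[ℝ] X}
    (hsymm : ∀ ψ χ, inner ℝ (T ψ) χ = inner ℝ ψ (T χ)) {V : H →L[ℝ] H}
    (hV : ∀ ψ, J (V (ContinuousLinearMap.adjoint J ψ)) = T ψ) (g h : H) :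
    inner ℝ (V g) h = inner ℝ g (V h) := by
  refine (denseRange_adjoint hJ).induction_on₂ (p := fun g h => inner ℝ (V g) h = inner ℝ g (V h))
    (isClosed_eq (by fun_prop) (by fun_prop)) (fun ψ χ => ?_) g h
  rw [ContinuousLinearMap.adjoint_inner_right, ContinuousLinearMap.adjoint_inner_left, hV, hV]
  exact hsymm ψ χ

/-- A lower bound for the form of `T` in the norm of `J† ψ` is coercivity of the middle factor,
modulo the direction of `n`. -/
lemma factorization_coercive {J : H →L[ℝ] X} (hJ : Function.Injective J) {T : X →L[ℝ] X} {n : H}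
    {c K : ℝ} (hle : ∀ ψ, c * ‖ContinuousLinearMap.adjoint J ψ‖ ^ 2 ≤
      inner ℝ (T ψ) ψ + K * inner ℝ ψ (J n) ^ 2) {V : H →L[ℝ] H}
    (hV : ∀ ψ, J (V (ContinuousLinearMap.adjoint J ψ)) = T ψ) (g : H) :
    c * ‖g‖ ^ 2 ≤ inner ℝ (V g) g + K * inner ℝ g n ^ 2 := by
  refine (denseRange_adjoint hJ).induction_on (p := fun g => c * ‖g‖ ^ 2 ≤ inner ℝ (V g) g +
    K * inner ℝ g n ^ 2) g (isClosed_le (by fun_prop) (by fun_prop)) fun ψ => ?_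
  rw [ContinuousLinearMap.adjoint_inner_right, ContinuousLinearMap.adjoint_inner_left, hV]
  exact hle ψ

end Abstract

/-! ### The single layer operator of one sphere -/

/-- The inclusion `L² → H^{-1/2}`, with `H^{-1/2}` identified with `H^{1/2}` by the Riesz isomorphism. -/
abbrev rieszL2 (a : ℝ) : Lp E3 2 (sphereMeasure a) →L[ℝ] sobolevHalf a :=
  ContinuousLinearMap.adjoint (toL2 a)

section Form

variable {a : ℝ} (ha : 0 < a)
include ha

lemma inner_polyField_polyField (P Q : Fin 3 → MvPolynomial (Fin 3) ℝ) :
    inner ℝ (toL2 a (polyField a P)) (toL2 a (polyField a Q)) = sphInner a P Q := by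
  rw [inner_toL2_polyField ha, sphInner, sphInt]
  refine integral_congr_ae ?_
  filter_upwards [toL2_polyField ha Q] with x hx
  rw [hx, PiLp.inner_apply, ev_sum]
  refine Finset.sum_congr rfl fun i _ => ?_
  simp [mul_comm]

lemma rieszL2_polyField {l : ℕ} {P : Fin 3 → MvPolynomial (Fin 3) ℝ} (hP : ∀ i, P i ∈ solid l) :
    rieszL2 a (toL2 a (polyField a P)) = (1 + 4 * Real.pi * l / a)⁻¹ • polyField a P := by
  have hpos : 0 < 1 + 4 * Real.pi * l / a := by
    have := Real.pi_pos
    positivity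
  refine ext_inner_right ℝ fun g => ?_
  rw [ContinuousLinearMap.adjoint_inner_left]
  refine Eq.trans ?_ (real_inner_smul_left (polyField a P) g _).symm
  rw [inner_polyField ha (by positivity) hP g, inv_mul_cancel_left₀ hpos.ne']

lemma sphInner_eq_zero {c d : ℝ} (hcd : c ≠ d) {P Q : Fin 3 → MvPolynomial (Fin 3) ℝ}
    (hP : ∀ i, P i ∈ solid c) (hQ : ∀ i, Q i ∈ solid d) : sphInner a P Q = 0 := by
  rw [sphInner, sphInt_sum ha]
  exact Finset.sum_eq_zero fun i _ => sphInt_mul_eq_zero ha hcd (hP i) (hQ i)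

lemma inner_sum_polyField (s : Finset ℕ) {P Q : ℕ → Fin 3 → MvPolynomial (Fin 3) ℝ}
    (hP : ∀ (l : ℕ) i, P l i ∈ solid l) (hQ : ∀ (l : ℕ) i, Q l i ∈ solid l) :
    inner ℝ (∑ l ∈ s, toL2 a (polyField a (P l))) (∑ l ∈ s, toL2 a (polyField a (Q l))) =
      ∑ l ∈ s, sphInner a (P l) (Q l) := by
  rw [sum_inner]
  refine Finset.sum_congr rfl fun l hl => ?_
  rw [inner_sum, Finset.sum_eq_single l]
  · exact inner_polyField_polyField ha _ _
  · intro m _ hm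
    rw [inner_polyField_polyField ha]
    exact sphInner_eq_zero ha (by exact_mod_cast hm.symm) (hP l) (hQ m)
  · exact fun h => absurd hl h

omit ha in
lemma sphInner_comm (P Q : Fin 3 → MvPolynomial (Fin 3) ℝ) : sphInner a P Q = sphInner a Q P := by
  simp only [sphInner, mul_comm]

lemma inner_normalField (P : Fin 3 → MvPolynomial (Fin 3) ℝ) :
    inner ℝ (toL2 a (polyField a P)) (toL2 a (normalField a)) = normalInner a P := by
  rw [inner_toL2_polyField ha, normalInner, sphInt, ← integral_const_mul]
  refine integral_congr_ae ?_
  filter_upwards [toL2_lipField (a := a) (φ := fun r => a⁻¹ • r) ⟨‖a⁻¹‖₊, lipschitzWith_smul a⁻¹⟩]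
    with x hx
  rw [normalField, hx, PiLp.inner_apply, ev_sum, Finset.mul_sum]
  refine Finset.sum_congr rfl fun i _ => ?_
  simp
  ring

variable {η : ℝ} (hη : 0 < η) {T : Lp E3 2 (sphereMeasure a) →L[ℝ] Lp E3 2 (sphereMeasure a)}
  (hT : ∀ ψ, T ψ =ᵐ[sphereMeasure a] fun r => ∫ s, oseen η (r - s) (ψ s) ∂sphereMeasure a)

include hη hT

lemma stokesL2_polyField {l : ℕ} {P : Fin 3 → MvPolynomial (Fin 3) ℝ} (hP : ∀ i, P i ∈ solid l) :
    T (toL2 a (polyField a P)) = toL2 a (polyField a (stokesPoly a η l P)) := by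
  refine Lp.ext ?_
  filter_upwards [hT (toL2 a (polyField a P)), toL2_polyField ha (stokesPoly a η l P),
    ae_mem_sphere ha] with x h1 h2 hx
  have h0 : (2 * ((l : ℝ) - 1) + 1) ≠ 0 := by
    intro h
    have : (2 * l : ℝ) = (1 : ℕ) := by
      push_cast
      linarith
    have h3 : 2 * l = 1 := by exact_mod_cast this
    omega
  rw [h1, h2, ← integral_oseen_vecEv ha hη (by positivity) (by positivity) h0 hP (by simpa using hx)]
  refine integral_congr_ae ?_
  filter_upwards [toL2_polyField ha P] with s hs
  rw [hs]

omit ha hη hT in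
lemma stokesPoly_mem (η : ℝ) (l : ℕ) {P : Fin 3 → MvPolynomial (Fin 3) ℝ} (hP : ∀ i, P i ∈ solid l) (i : Fin 3) :
    stokesPoly a η l P i ∈ solid l := by
  refine stokesPoly_mem_solid (by positivity) ?_ hP i
  intro h
  have : (2 * l : ℝ) = (1 : ℕ) := by
    push_cast
    linarith
  have h3 : 2 * l = 1 := by exact_mod_cast this
  omega

lemma inner_stokesL2_self {ψ : Lp E3 2 (sphereMeasure a)} {s : Finset ℕ}
    {P : ℕ → Fin 3 → MvPolynomial (Fin 3) ℝ} (h : IsHarmonicSum a ψ s P) :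
    inner ℝ (T ψ) ψ = ∑ l ∈ s, sphInner a (stokesPoly a η l (P l)) (P l) := by
  obtain ⟨hP, rfl⟩ := h
  rw [map_sum, Finset.sum_congr rfl fun l _ => stokesL2_polyField ha hη hT (hP l)]
  exact inner_sum_polyField ha s (fun l => stokesPoly_mem η l (hP l)) hP

lemma stokesL2_symm (ψ χ : Lp E3 2 (sphereMeasure a)) : inner ℝ (T ψ) χ = inner ℝ ψ (T χ) := by
  have key : ∀ (l m : ℕ) (P Q : Fin 3 → MvPolynomial (Fin 3) ℝ), (∀ i, P i ∈ solid l) →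
      (∀ i, Q i ∈ solid m) → inner ℝ (T (toL2 a (polyField a P))) (toL2 a (polyField a Q)) =
        inner ℝ (toL2 a (polyField a P)) (T (toL2 a (polyField a Q))) := by
    intro l m P Q hP hQ
    rw [stokesL2_polyField ha hη hT hP, stokesL2_polyField ha hη hT hQ, inner_polyField_polyField ha,
      inner_polyField_polyField ha]
    rcases eq_or_ne l m with rfl | hlm
    · rw [sphInner_comm P, sphInner_stokesPoly ha (by positivity) (by positivity) hP hQ,
        sphInner_stokesPoly ha (by positivity) (by positivity) hQ hP, sphInner_comm Q,
        mul_comm (polyDiv Q), transposeForm_comm Q]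
    · have hlm' : (l : ℝ) ≠ m := by exact_mod_cast hlm
      rw [sphInner_eq_zero ha hlm' (stokesPoly_mem η l hP) hQ,
        sphInner_eq_zero ha hlm' hP (stokesPoly_mem η m hQ)]
  refine (dense_harmonicSum ha).induction (P := fun ψ => inner ℝ (T ψ) χ = inner ℝ ψ (T χ)) ?_
    (isClosed_eq (by fun_prop) (by fun_prop)) ψ
  rintro ψ ⟨s, P, hP, rfl⟩
  refine (dense_harmonicSum ha).induction
    (P := fun χ => inner ℝ (T (∑ l ∈ s, toL2 a (polyField a (P l)))) χ =
      inner ℝ (∑ l ∈ s, toL2 a (polyField a (P l))) (T χ)) ?_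
    (isClosed_eq (by fun_prop) (by fun_prop)) χ
  rintro χ ⟨t, Q, hQ, rfl⟩
  simp only [map_sum, sum_inner, inner_sum]
  exact Finset.sum_congr rfl fun m _ => Finset.sum_congr rfl fun l _ => key _ _ _ _ (hP _) (hQ _)

omit hη hT in
lemma norm_rieszL2_sq {ψ : Lp E3 2 (sphereMeasure a)} {s : Finset ℕ}
    {P : ℕ → Fin 3 → MvPolynomial (Fin 3) ℝ} (h : IsHarmonicSum a ψ s P) :
    ‖rieszL2 a ψ‖ ^ 2 = ∑ l ∈ s, (1 + 4 * Real.pi * l / a)⁻¹ * sphInner a (P l) (P l) := by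
  obtain ⟨hP, rfl⟩ := h
  rw [← real_inner_self_eq_norm_sq, ContinuousLinearMap.adjoint_inner_left, map_sum, map_sum, inner_sum]
  refine Finset.sum_congr rfl fun l hl => ?_
  rw [rieszL2_polyField ha (hP l), map_smul, real_inner_smul_right, sum_inner, Finset.sum_eq_single l,
    inner_polyField_polyField ha]
  · intro m _ hm
    rw [inner_polyField_polyField ha]
    exact sphInner_eq_zero ha (by exact_mod_cast hm) (hP m) (hP l)
  · exact fun h => absurd hl h

omit hη hT in
lemma inner_normalField_sq {ψ : Lp E3 2 (sphereMeasure a)} {s : Finset ℕ}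
    {P : ℕ → Fin 3 → MvPolynomial (Fin 3) ℝ} (h : IsHarmonicSum a ψ s P) :
    inner ℝ ψ (toL2 a (normalField a)) ^ 2 = ∑ l ∈ s, normalInner a (P l) ^ 2 := by
  obtain ⟨hP, rfl⟩ := h
  have h0 : ∀ l : ℕ, l ≠ 1 → normalInner a (P l) = 0 := fun l hl =>
    normalInner_eq_zero ha (by exact_mod_cast hl) (hP l)
  simp only [sum_inner, inner_normalField ha]
  by_cases h1 : 1 ∈ s
  · rw [Finset.sum_eq_single_of_mem 1 h1 fun l _ hl => h0 l hl,
      Finset.sum_eq_single_of_mem 1 h1 fun l _ hl => by rw [h0 l hl, zero_pow two_ne_zero]]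
  · rw [Finset.sum_eq_zero fun l hl => h0 l fun e => h1 (e ▸ hl),
      Finset.sum_eq_zero fun l hl => by
        rw [h0 l fun e => h1 (e ▸ hl), zero_pow two_ne_zero], zero_pow two_ne_zero]

lemma stokesL2_nonneg (ψ : Lp E3 2 (sphereMeasure a)) : 0 ≤ inner ℝ (T ψ) ψ := by
  refine (dense_harmonicSum ha).induction (P := fun ψ => 0 ≤ inner ℝ (T ψ) ψ) ?_
    (isClosed_le (by fun_prop) (by fun_prop)) ψ
  rintro ψ ⟨s, P, h⟩
  rw [inner_stokesL2_self ha hη hT h]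
  exact Finset.sum_nonneg fun l _ => sphInner_stokesPoly_self_nonneg ha hη l (h.1 l)

/-- On harmonics of degree `l` both sides are of order `(2 l + 1)⁻¹ ‖P‖²`: the operator gains one
derivative, as the Riesz map from `H^{-1/2}` to `H^{1/2}` does. -/
lemma stokesL2_le (ψ : Lp E3 2 (sphereMeasure a)) :
    inner ℝ (T ψ) ψ ≤ 3 * a / (2 * η) * (1 + 2 * Real.pi / a) * ‖rieszL2 a ψ‖ ^ 2 := by
  refine (dense_harmonicSum ha).induction
    (P := fun ψ => inner ℝ (T ψ) ψ ≤ 3 * a / (2 * η) * (1 + 2 * Real.pi / a) * ‖rieszL2 a ψ‖ ^ 2) ?_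
    (isClosed_le (by fun_prop) (by fun_prop)) ψ
  rintro ψ ⟨s, P, h⟩
  have hpi := Real.pi_pos
  rw [inner_stokesL2_self ha hη hT h, norm_rieszL2_sq ha h, Finset.mul_sum]
  refine Finset.sum_le_sum fun l _ =>
    (sphInner_stokesPoly_self_le ha hη (Nat.cast_nonneg l) (h.1 l)).trans ?_
  rw [← mul_assoc]
  refine mul_le_mul_of_nonneg_right ?_ (sphInner_self_nonneg ha _)
  rw [mul_assoc]
  refine mul_le_mul_of_nonneg_left ?_ (by positivity)
  have h1 : (1 + 2 * Real.pi / a) * (2 * l + 1) = 1 + 4 * Real.pi * l / a + (2 * l + 2 * Real.pi / a) := by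
    ring
  have h2 : (0 : ℝ) ≤ 2 * l + 2 * Real.pi / a := by positivity
  rw [← div_eq_mul_inv, inv_eq_one_div, div_le_div_iff₀ (by positivity) (by positivity)]
  linarith

/-- The form of the single layer operator controls the `H^{-1/2}` norm. The component along the unit
normal, on which the operator vanishes, has to be added. -/
lemma le_stokesL2 (ψ : Lp E3 2 (sphereMeasure a)) :
    a / (3 * η) * (1 + a / (2 * Real.pi))⁻¹ * ‖rieszL2 a ψ‖ ^ 2 ≤ inner ℝ (T ψ) ψ +
      1 / (20 * Real.pi * η * a) * inner ℝ ψ (toL2 a (normalField a)) ^ 2 := by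
  refine (dense_harmonicSum ha).induction
    (P := fun ψ => a / (3 * η) * (1 + a / (2 * Real.pi))⁻¹ * ‖rieszL2 a ψ‖ ^ 2 ≤ inner ℝ (T ψ) ψ +
      1 / (20 * Real.pi * η * a) * inner ℝ ψ (toL2 a (normalField a)) ^ 2) ?_
    (isClosed_le (by fun_prop) (by fun_prop)) ψ
  rintro ψ ⟨s, P, h⟩
  have hpi := Real.pi_pos
  rw [inner_stokesL2_self ha hη hT h, norm_rieszL2_sq ha h, inner_normalField_sq ha h, Finset.mul_sum,
    Finset.mul_sum, ← Finset.sum_add_distrib]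
  refine Finset.sum_le_sum fun l _ => le_trans ?_ (le_sphInner_stokesPoly_self ha hη l (h.1 l))
  rw [← mul_assoc]
  refine mul_le_mul_of_nonneg_right ?_ (sphInner_self_nonneg ha _)
  rw [mul_assoc, ← mul_inv]
  refine mul_le_mul_of_nonneg_left ?_ (by positivity)
  refine inv_anti₀ (by positivity) ?_
  have h1 : (1 + a / (2 * Real.pi)) * (1 + 4 * Real.pi * l / a) =
      2 * l + 1 + (a / (2 * Real.pi) + 4 * Real.pi * l / a) := by
    field_simp
    ring
  rw [h1]
  have : 0 ≤ a / (2 * Real.pi) + 4 * Real.pi * l / a := by positivity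
  linarith

end Form

/-- The single layer operator of one sphere, with `H^{-1/2}` identified with `H^{1/2}`: it is
symmetric, and coercive up to the direction of the unit normal. -/
theorem exists_stokesHalf {a : ℝ} (ha : 0 < a) {η : ℝ} (hη : 0 < η) :
    ∃ V : sobolevHalf a →L[ℝ] sobolevHalf a,
      (∀ ψ, toL2 a (V (rieszL2 a ψ)) =ᵐ[sphereMeasure a]
        fun r => ∫ s, oseen η (r - s) (ψ s) ∂sphereMeasure a) ∧
      (∀ g h, inner ℝ (V g) h = inner ℝ g (V h)) ∧
      ∃ c > 0, ∃ K : ℝ, ∀ g, c * ‖g‖ ^ 2 ≤ inner ℝ (V g) g + K * inner ℝ g (normalField a) ^ 2 := by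
  obtain ⟨T, hT⟩ := exists_stokesL2 ha hη
  have hpi := Real.pi_pos
  obtain ⟨V, hV⟩ := exists_factorization (toL2_injective a) (stokesL2_symm ha hη hT)
    (stokesL2_nonneg ha hη hT) (by positivity) (stokesL2_le ha hη hT)
  exact ⟨V, fun ψ => by rw [hV]; exact hT ψ,
    factorization_symm (toL2_injective a) (stokesL2_symm ha hη hT) hV, _, by positivity, _,
    factorization_coercive (toL2_injective a) (le_stokesL2 ha hη hT) hV⟩

end

noncomputable section

open MvPolynomial

/-! ### The single layer operator of one sphere as an operator on the dual space -/

/-- The Riesz isomorphism from `H^{-1/2}` to `H^{1/2}`. -/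
def riesz (a : ℝ) : SobolevNegHalf a ≃ₗᵢ[ℝ] sobolevHalf a where
  toFun := (InnerProductSpace.toDual ℝ (sobolevHalf a)).symm
  invFun := InnerProductSpace.toDual ℝ (sobolevHalf a)
  map_add' := map_add _
  map_smul' c f := by
    rw [map_smulₛₗ]
    simp
  left_inv f := by simp
  right_inv g := by simp
  norm_map' f := (InnerProductSpace.toDual ℝ (sobolevHalf a)).symm.norm_map f

@[simp] lemma inner_riesz {a : ℝ} (f : SobolevNegHalf a) (g : sobolevHalf a) :
    inner ℝ (riesz a f) g = f g := InnerProductSpace.toDual_symm_apply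

lemma riesz_densityDual (a : ℝ) (ψ : Lp E3 2 (sphereMeasure a)) :
    riesz a (densityDual a ψ) = rieszL2 a ψ := by
  refine ext_inner_right ℝ fun g => ?_
  rw [inner_riesz, ContinuousLinearMap.adjoint_inner_left]
  rfl

lemma denseRange_densityDual (a : ℝ) : DenseRange (densityDual a) := by
  have hd : DenseRange (rieszL2 a) := denseRange_adjoint (toL2_injective a)
  have hs : DenseRange (riesz a).symm := (riesz a).symm.surjective.denseRange
  have hc : Continuous (riesz a).symm := (riesz a).symm.isometry.continuous
  have e : densityDual a = fun ψ => (riesz a).symm (rieszL2 a ψ) := by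
    funext ψ
    rw [← riesz_densityDual, LinearIsometryEquiv.symm_apply_apply]
  rw [e]
  exact hs.comp hd hc

lemma isSingleLayer_singleLayer {a η : ℝ} {z : E3} (h : ∃ A, IsSingleLayer a η z A) :
    IsSingleLayer a η z (singleLayer a η z) := by
  rw [singleLayer, dif_pos h]
  exact h.choose_spec

lemma constField_eq_polyField {a : ℝ} (ha : 0 < a) (v : E3) :
    constField a v = polyField a fun i => C (v i) := by
  refine sobolev_ext ?_
  filter_upwards [toL2_lipField (a := a) (φ := fun _ => v) ⟨0, LipschitzWith.const v⟩,
    toL2_polyField ha fun i => C (v i)] with x h1 h2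
  rw [constField, h1, h2]
  ext i
  simp

lemma normalField_eq_polyField {a : ℝ} (ha : 0 < a) :
    normalField a = polyField a fun i => a⁻¹ • X i := by
  refine sobolev_ext ?_
  filter_upwards [toL2_lipField (a := a) (φ := fun r => a⁻¹ • r) ⟨‖a⁻¹‖₊, lipschitzWith_smul a⁻¹⟩,
    toL2_polyField ha fun i => a⁻¹ • X i] with x h1 h2
  rw [normalField, h1, h2]
  ext i
  simp

section

variable {a : ℝ} (ha : 0 < a) {η : ℝ} (hη : 0 < η)

include ha hη in
/-- The single layer operator of one sphere exists, is symmetric, and coercive up to the direction of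
the unit normal. -/
theorem singleLayer_zero_spec :
    IsSingleLayer a η 0 (singleLayer a η 0) ∧
    (∀ f g : SobolevNegHalf a, f (singleLayer a η 0 g) = g (singleLayer a η 0 f)) ∧
    ∃ c > 0, ∃ K : ℝ, ∀ f : SobolevNegHalf a, c * ‖f‖ ^ 2 ≤ f (singleLayer a η 0 f) +
      K * f (normalField a) ^ 2 := by
  obtain ⟨V, hV, hsymm, c, hc, K, hle⟩ := exists_stokesHalf ha hη
  let A : SobolevNegHalf a →L[ℝ] sobolevHalf a :=
    V.comp (riesz a).toContinuousLinearEquiv.toContinuousLinearMap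
  have hA : IsSingleLayer a η 0 A := by
    intro ψ
    have : A (densityDual a ψ) = V (rieszL2 a ψ) := congrArg V (riesz_densityDual a ψ)
    rw [this]
    simpa only [zero_add] using hV ψ
  have h := isSingleLayer_singleLayer ⟨A, hA⟩
  have e : ∀ g, singleLayer a η 0 g = V (riesz a g) := fun g => by
    rw [h.unique hA]
    rfl
  have hAf : ∀ f g : SobolevNegHalf a,
      f (singleLayer a η 0 g) = inner ℝ (V (riesz a g)) (riesz a f) := fun f g => by
    rw [e, real_inner_comm]
    exact (inner_riesz _ _).symm
  refine ⟨h, fun f g => ?_, c, hc, K, fun f => ?_⟩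
  · have h1 := hAf f g
    have h2 := hAf g f
    exact h1.trans (((hsymm _ _).trans (real_inner_comm _ _)).trans h2.symm)
  · have h1 := hle (riesz a f)
    have h2 : inner ℝ (riesz a f) (normalField a) = f (normalField a) := inner_riesz _ _
    have h3 : ‖riesz a f‖ = ‖f‖ := (riesz a).norm_map f
    have h4 := hAf f f
    have h5 : c * ‖f‖ ^ 2 = c * ‖riesz a f‖ ^ 2 := congrArg (fun t => c * t ^ 2) h3.symm
    exact (h5.le.trans h1).trans_eq (congrArg₂ (fun s t => s + K * t ^ 2) h4.symm h2)

include ha hη in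
lemma singleLayer_zero_polyField {c : ℝ} (hc : 2 * c + 1 ≠ 0)
    (hc1 : 2 * (c + 1) + 1 ≠ 0) (hc2 : 2 * (c - 1) + 1 ≠ 0) {P : Fin 3 → MvPolynomial (Fin 3) ℝ}
    (hP : ∀ i, P i ∈ solid c) :
    singleLayer a η 0 (densityDual a (toL2 a (polyField a P))) = polyField a (stokesPoly a η c P) := by
  refine sobolev_ext ?_
  filter_upwards [(singleLayer_zero_spec ha hη).1 (toL2 a (polyField a P)),
    toL2_polyField ha (stokesPoly a η c P), ae_mem_sphere ha] with x h1 h2 hx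
  rw [h1, h2, ← integral_oseen_vecEv ha hη hc hc1 hc2 hP (by simpa using hx)]
  simp only [zero_add]
  refine integral_congr_ae ?_
  filter_upwards [toL2_polyField ha P] with s hs
  rw [hs]

include ha hη in
/-- Stokes' law: the constant density generates a constant velocity. -/
lemma singleLayer_zero_constField (v : E3) :
    singleLayer a η 0 (densityDual a (toL2 a (constField a v))) =
      constField a ((2 * a / (3 * η)) • v) := by
  rw [constField_eq_polyField ha, singleLayer_zero_polyField ha hη (c := 0) (by norm_num) (by norm_num)
    (by norm_num) fun i => C_mem_solid _, constField_eq_polyField ha]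
  congr 1
  funext i
  have h : ∀ j, pderiv j (X i * C (v j)) = C (if j = i then v j else 0) := fun j => by
    rw [pderiv_mul, pderiv_C, mul_zero, add_zero]
    by_cases hj : j = i
    · simp [hj]
    · simp [hj, pderiv_X_of_ne (Ne.symm hj)]
  simp only [stokesPoly, raise, pderiv_C, mul_zero, smul_zero, sub_zero, h, Finset.sum_const_zero, map_zero,
    smul_eq_C_mul, ← map_sum, ← map_mul, ← map_add, PiLp.smul_apply, smul_eq_mul]
  congr 1
  rw [Finset.sum_ite_eq' Finset.univ i, if_pos (Finset.mem_univ i)]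
  field_simp
  norm_num [mul_comm]

include ha hη in
/-- The unit normal is in the kernel of the single layer operator. -/
lemma singleLayer_zero_normalDensity : singleLayer a η 0 (normalDensity a) = 0 := by
  have hm : ∀ i, a⁻¹ • X i ∈ solid 1 := fun i => Submodule.smul_mem _ _ (X_mem_solid i)
  rw [normalDensity, normalField_eq_polyField ha, singleLayer_zero_polyField ha hη (c := 1) (by norm_num)
    (by norm_num) (by norm_num) hm]
  have h0 : stokesPoly a η 1 (fun i => a⁻¹ • X i) = fun i => C ((0 : E3) i) := by
    funext i
    have e1 : (∑ j, pderiv j (a⁻¹ • X j) : MvPolynomial (Fin 3) ℝ) = C (3 * a⁻¹) := by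
      simp only [pderiv_mul, pderiv_C, pderiv_X_self, Fin.sum_univ_three, smul_eq_C_mul, map_mul, map_ofNat]
      ring
    have e2 : (∑ j, pderiv j (raise 1 i (a⁻¹ • X j)) : MvPolynomial (Fin 3) ℝ) =
        C (10 / 3 * a⁻¹) * X i := by
      have h10 : (C (10 / 3 * a⁻¹) : MvPolynomial (Fin 3) ℝ) = C a⁻¹ * (4 - 2 * C ((2 * 1 + 1)⁻¹)) := by
        rw [show (10 / 3 * a⁻¹ : ℝ) = a⁻¹ * (4 - 2 * (2 * 1 + 1)⁻¹) by ring, map_mul, map_sub, map_mul,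
          map_ofNat, map_ofNat]
      have h0 : ∀ j, pderiv j (raise 1 i (a⁻¹ • X j)) = C a⁻¹ * (pderiv j (X i) * X j + X i -
          C ((2 * 1 + 1)⁻¹) * (2 * X j * pderiv i (X j))) := fun j => by
        have h1 : pderiv j (pderiv i (X j : MvPolynomial (Fin 3) ℝ)) = 0 := by
          rw [pderiv_comm, pderiv_X_self, pderiv_one]
        simp only [raise, smul_eq_C_mul, pderiv_mul, map_sub, pderiv_C, pderiv_rsq, h1,
          pderiv_X_self, zero_mul, zero_add, mul_zero]
        ring
      simp only [h0, h10]
      fin_cases i <;> simp [Fin.sum_univ_three, pderiv_X] <;> ring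
    have e3 : raise (1 - 1) i (C (3 * a⁻¹)) = C (3 * a⁻¹) * X i := by
      simp [raise, mul_comm]
    rw [stokesPoly, e1, e2, e3]
    simp only [smul_eq_C_mul, ← mul_assoc, ← map_mul, ← add_mul, ← sub_mul, ← map_add, ← map_sub]
    have : a / (2 * η) * ((2 * 1 + 1)⁻¹ + (2 * (1 + 1) + 1)⁻¹ * (10 / 3) - (2 * 1 + 1)⁻¹ * 3) * a⁻¹ = 0 := by
      norm_num
    rw [this]
    simp
  rw [h0, ← constField_eq_polyField ha]
  refine sobolev_ext ?_
  filter_upwards [toL2_lipField (a := a) (φ := fun _ => 0) ⟨0, LipschitzWith.const 0⟩,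
    Lp.coeFn_zero E3 2 (sphereMeasure a)] with x h1 h2
  rw [constField, h1, map_zero, h2]
  rfl

end

end

noncomputable section

/-! ### Operators with regular kernels -/

/-- A kernel on the sphere which, with its first differences in each variable and its mixed second
differences, is bounded by `M`. -/
structure KernelBound (a : ℝ) (k : E3 → E3 → E3) (M : ℝ) : Prop where
  bound : ∀ r s, ‖r‖ = a → ‖s‖ = a → ‖k r s‖ ≤ M
  diff_right : ∀ r s s', ‖r‖ = a → ‖s‖ = a → ‖s'‖ = a → ‖k r s - k r s'‖ ≤ M * ‖s - s'‖
  diff_left : ∀ r r' s, ‖r‖ = a → ‖r'‖ = a → ‖s‖ = a → ‖k r s - k r' s‖ ≤ M * ‖r - r'‖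
  diff_mixed : ∀ r r' s s', ‖r‖ = a → ‖r'‖ = a → ‖s‖ = a → ‖s'‖ = a →
    ‖k r s - k r' s - (k r s' - k r' s')‖ ≤ M * ‖r - r'‖ * ‖s - s'‖

/-- The field whose components are the values of a dual vector on three fields. -/
def pairingVec {a : ℝ} (f : SobolevNegHalf a) (Φ : Fin 3 → sobolevHalf a) : E3 :=
  WithLp.toLp 2 fun i => f (Φ i)

lemma norm_pairingVec_sub_le {a : ℝ} (f : SobolevNegHalf a) {Φ Ψ : Fin 3 → sobolevHalf a} {M : ℝ}
    (hM : 0 ≤ M) (h : ∀ i, ‖Φ i - Ψ i‖ ≤ M) :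
    ‖pairingVec f Φ - pairingVec f Ψ‖ ≤ 2 * (‖f‖ * M) := by
  refine norm_le_two_mul_of_abs_le (by positivity) fun i => ?_
  have : (pairingVec f Φ - pairingVec f Ψ) i = f (Φ i - Ψ i) := by
    rw [map_sub]
    rfl
  rw [this]
  exact (f.le_opNorm _).trans (by gcongr; exact h i)

lemma norm_pairingVec_le {a : ℝ} (f : SobolevNegHalf a) {Φ : Fin 3 → sobolevHalf a} {M : ℝ}
    (hM : 0 ≤ M) (h : ∀ i, ‖Φ i‖ ≤ M) : ‖pairingVec f Φ‖ ≤ 2 * (‖f‖ * M) :=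
  norm_le_two_mul_of_abs_le (by positivity) fun i =>
    (f.le_opNorm (Φ i)).trans (mul_le_mul_of_nonneg_left (h i) (norm_nonneg f))

lemma exists_clm_of_bound {E G : Type*} [NormedAddCommGroup E] [NormedSpace ℝ E]
    [NormedAddCommGroup G] [NormedSpace ℝ G] {F : E → G} {K : ℝ} {p : E → G → Prop}
    (hadd : ∀ f g, F (f + g) = F f + F g) (hsmul : ∀ (c : ℝ) f, F (c • f) = c • F f)
    (hle : ∀ f, ‖F f‖ ≤ K * ‖f‖) (hp : ∀ f, p f (F f)) :
    ∃ A : E →L[ℝ] G, (∀ f, ‖A f‖ ≤ K * ‖f‖) ∧ ∀ f, p f (A f) :=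
  ⟨LinearMap.mkContinuous ⟨⟨F, hadd⟩, hsmul⟩ K hle, hle, hp⟩

/-- Pairing with a bounded and Lipschitz family of fields is an operator from `H^{-1/2}` to `H^{1/2}`. -/
lemma exists_pairingOperator {a : ℝ} (ha : 0 < a) : ∃ C, 0 < C ∧ ∀ (Φ : E3 → Fin 3 → sobolevHalf a) (M : ℝ),
    0 ≤ M → (∀ i r, ‖r‖ = a → ‖Φ r i‖ ≤ M) →
    (∀ i r r', ‖r‖ = a → ‖r'‖ = a → ‖Φ r i - Φ r' i‖ ≤ M * ‖r - r'‖) →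
    ∃ A : SobolevNegHalf a →L[ℝ] sobolevHalf a, (∀ f, ‖A f‖ ≤ C * M * ‖f‖) ∧
      ∀ f, toL2 a (A f) =ᵐ[sphereMeasure a] fun r => pairingVec f (Φ r) := by
  obtain ⟨C, hC, hb⟩ := exists_sobolev_norm_le ha
  refine ⟨4 * C, by positivity, fun Φ M hM hΦn hΦd => ?_⟩
  have hd : ∀ (f : SobolevNegHalf a) r r', ‖r‖ = a → ‖r'‖ = a →
      ‖pairingVec f (Φ r) - pairingVec f (Φ r')‖ ≤ 2 * (‖f‖ * M) * ‖r - r'‖ := fun f r r' hr hr' =>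
    (norm_pairingVec_sub_le f (M := M * ‖r - r'‖) (by positivity) fun i =>
      hΦd i r r' hr hr').trans (le_of_eq (by ring))
  have hlipA : ∀ f : SobolevNegHalf a,
      ∃ K, LipschitzOnWith K (fun r => pairingVec f (Φ r)) (Metric.sphere 0 a) := fun f =>
    ⟨⟨2 * (‖f‖ * M), by positivity⟩, LipschitzOnWith.of_dist_le_mul fun r hr r' hr' => by
      rw [dist_eq_norm, dist_eq_norm]
      exact hd f r r' (by simpa using hr) (by simpa using hr')⟩
  obtain ⟨F, hF⟩ : ∃ F : SobolevNegHalf a → sobolevHalf a, ∀ f,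
      toL2 a (F f) =ᵐ[sphereMeasure a] fun r => pairingVec f (Φ r) :=
    ⟨fun f => sphereField a _ (hlipA f), fun f => toL2_sphereField ha (hlipA f)⟩
  have hadd : ∀ f g, F (f + g) = F f + F g := fun f g => by
    refine sobolev_ext ?_
    rw [map_add]
    filter_upwards [hF (f + g), hF f, hF g, Lp.coeFn_add (toL2 a (F f)) (toL2 a (F g))]
      with r h1 h2 h3 h4
    rw [h1, h4, Pi.add_apply, h2, h3]
    rfl
  have hsmul : ∀ (c : ℝ) f, F (c • f) = c • F f := fun c f => by
    refine sobolev_ext ?_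
    rw [map_smul]
    filter_upwards [hF (c • f), hF f, Lp.coeFn_smul c (toL2 a (F f))] with r h1 h2 h4
    rw [h1, h4, Pi.smul_apply, h2]
    rfl
  have hle : ∀ f, ‖F f‖ ≤ 4 * C * M * ‖f‖ := fun f =>
    (hb (F f) _ (2 * (‖f‖ * M)) (2 * (‖f‖ * M)) (hF f) (by positivity) (by positivity)
      (fun r hr => norm_pairingVec_le f hM fun i => hΦn i r hr)
      (hd f)).trans_eq (by ring)
  exact exists_clm_of_bound
    (p := fun f g => toL2 a g =ᵐ[sphereMeasure a] fun r => pairingVec f (Φ r)) hadd hsmul hle hF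

/-- A regular kernel is a bounded and Lipschitz family of fields of class `H^{1/2}`. -/
lemma exists_kernelField {a : ℝ} (ha : 0 < a) : ∃ C, 0 < C ∧ ∀ (k : Fin 3 → E3 → E3 → E3) (M : ℝ),
    0 ≤ M → (∀ i, KernelBound a (k i) M) → ∃ Φ : E3 → Fin 3 → sobolevHalf a,
      (∀ i r, ‖r‖ = a → toL2 a (Φ r i) =ᵐ[sphereMeasure a] k i r) ∧
      (∀ i r, ‖r‖ = a → ‖Φ r i‖ ≤ C * M) ∧
      ∀ i r r', ‖r‖ = a → ‖r'‖ = a → ‖Φ r i - Φ r' i‖ ≤ C * M * ‖r - r'‖ := by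
  obtain ⟨C, hC, hb⟩ := exists_sobolev_norm_le ha
  refine ⟨2 * C, by positivity, fun k M hM hk => ?_⟩
  have hlip : ∀ i r, ‖r‖ = a → ∃ K, LipschitzOnWith K (k i r) (Metric.sphere 0 a) := fun i r hr =>
    ⟨⟨M, hM⟩, LipschitzOnWith.of_dist_le_mul fun s hs s' hs' => by
      rw [dist_eq_norm, dist_eq_norm]
      exact (hk i).diff_right r s s' hr (by simpa using hs) (by simpa using hs')⟩
  obtain ⟨Φ, hΦ⟩ : ∃ Φ : E3 → Fin 3 → sobolevHalf a, ∀ i r, ‖r‖ = a →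
      toL2 a (Φ r i) =ᵐ[sphereMeasure a] k i r := by
    classical
    refine ⟨fun r i => if h : ‖r‖ = a then sphereField a (k i r) (hlip i r h) else 0, fun i r hr => ?_⟩
    simp only [dif_pos hr]
    exact toL2_sphereField ha _
  have hΦn : ∀ i r, ‖r‖ = a → ‖Φ r i‖ ≤ 2 * C * M := fun i r hr =>
    (hb _ _ M M (hΦ i r hr) hM hM (fun s hs => (hk i).bound r s hr hs)
      (fun s s' hs hs' => (hk i).diff_right r s s' hr hs hs')).trans_eq (by ring)
  have hΦd : ∀ i r r', ‖r‖ = a → ‖r'‖ = a → ‖Φ r i - Φ r' i‖ ≤ 2 * C * M * ‖r - r'‖ := by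
    intro i r r' hr hr'
    have h1 : toL2 a (Φ r i - Φ r' i) =ᵐ[sphereMeasure a] fun s => k i r s - k i r' s := by
      rw [map_sub]
      filter_upwards [Lp.coeFn_sub (toL2 a (Φ r i)) (toL2 a (Φ r' i)), hΦ i r hr, hΦ i r' hr']
        with s e1 e2 e3
      rw [e1, Pi.sub_apply, e2, e3]
    exact (hb _ _ (M * ‖r - r'‖) (M * ‖r - r'‖) h1 (by positivity) (by positivity)
      (fun s hs => (hk i).diff_left r r' s hr hr' hs)
      (fun s s' hs hs' => (hk i).diff_mixed r r' s s' hr hr' hs hs')).trans_eq (by ring)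
  exact ⟨Φ, hΦ, hΦn, hΦd⟩

/-- A regular kernel defines an operator from `H^{-1/2}` to `H^{1/2}`, with norm bounded by the bound
of the kernel. -/
theorem exists_kernelOperator {a : ℝ} (ha : 0 < a) : ∃ C, 0 < C ∧ ∀ (k : Fin 3 → E3 → E3 → E3) (M : ℝ),
    0 ≤ M → (∀ i, KernelBound a (k i) M) → ∃ (Φ : E3 → Fin 3 → sobolevHalf a)
      (A : SobolevNegHalf a →L[ℝ] sobolevHalf a), (∀ f, ‖A f‖ ≤ C * M * ‖f‖) ∧
      (∀ i r, ‖r‖ = a → toL2 a (Φ r i) =ᵐ[sphereMeasure a] k i r) ∧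
      ∀ f, toL2 a (A f) =ᵐ[sphereMeasure a] fun r => pairingVec f (Φ r) := by
  obtain ⟨C, hC, hb⟩ := exists_kernelField ha
  obtain ⟨C', hC', hex⟩ := exists_pairingOperator ha
  refine ⟨C' * C, mul_pos hC' hC, fun k M hM hk => ?_⟩
  obtain ⟨Φ, hΦ, hΦn, hΦd⟩ := hb k M hM hk
  refine (hex Φ (C * M) (mul_nonneg hC.le hM) hΦn hΦd).elim fun A hA => ?_
  exact ⟨Φ, A, fun f => (hA.1 f).trans_eq (by ring), hΦ, hA.2⟩

/-! ### Regularity of the stokeslet away from the origin -/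

lemma contDiffAt_oseen (η : ℝ) (v : E3) {w : E3} (hw : w ≠ 0) {n : WithTop ℕ∞} :
    ContDiffAt ℝ n (fun w => oseen η w v) w := by
  have h1 : ContDiffAt ℝ n (fun w : E3 => ‖w‖) w := contDiffAt_norm ℝ hw
  have h0 : ‖w‖ ≠ 0 := norm_ne_zero_iff.2 hw
  unfold oseen
  refine ContDiffAt.const_smul _ ?_
  have hid : ContDiffAt ℝ n (fun w : E3 => w) w := contDiffAt_id
  exact ((h1.inv h0).smul contDiffAt_const).add
    ((((h1.pow 3).inv (pow_ne_zero 3 h0)).mul (hid.inner ℝ contDiffAt_const)).smul hid)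

lemma oseen_smul_left (η : ℝ) {t : ℝ} (ht : 0 < t) (w v : E3) :
    oseen η (t • w) v = t⁻¹ • oseen η w v := by
  rcases eq_or_ne w 0 with rfl | hw
  · simp [oseen]
  have h0 : ‖w‖ ≠ 0 := norm_ne_zero_iff.2 hw
  unfold oseen
  rw [norm_smul, Real.norm_of_nonneg ht.le, real_inner_smul_left]
  ext i
  simp only [PiLp.smul_apply, PiLp.add_apply, smul_eq_mul]
  field_simp

lemma exists_fderiv_bound {Γ : E3 → E3} (hΓ : ContDiffOn ℝ 2 Γ {0}ᶜ) {K : Set E3} (hK : IsCompact K)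
    (h0 : (0 : E3) ∉ K) :
    ∃ M, 0 ≤ M ∧ ∀ w ∈ K, ‖fderiv ℝ Γ w‖ ≤ M ∧ ‖fderiv ℝ (fderiv ℝ Γ) w‖ ≤ M := by
  have ho : IsOpen ({0}ᶜ : Set E3) := isOpen_compl_singleton
  have hsub : K ⊆ {0}ᶜ := fun w hw => by
    rintro rfl
    exact h0 hw
  have h1 : ContDiffOn ℝ 1 (fderiv ℝ Γ) {0}ᶜ := hΓ.fderiv_of_isOpen ho (by norm_num)
  have h2 : ContinuousOn (fderiv ℝ (fderiv ℝ Γ)) {0}ᶜ := h1.continuousOn_fderiv_of_isOpen ho le_rfl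
  obtain ⟨M₁, hM₁⟩ := hK.exists_bound_of_continuousOn (f := fderiv ℝ Γ) (h1.continuousOn.mono hsub)
  obtain ⟨M₂, hM₂⟩ := hK.exists_bound_of_continuousOn (f := fderiv ℝ (fderiv ℝ Γ)) (h2.mono hsub)
  exact ⟨max 0 (max M₁ M₂), le_max_left _ _, fun w hw =>
    ⟨(hM₁ w hw).trans ((le_max_left _ _).trans (le_max_right _ _)),
      (hM₂ w hw).trans ((le_max_right _ _).trans (le_max_right _ _))⟩⟩

lemma norm_diff_le {Γ : E3 → E3} (hΓ : ContDiffOn ℝ 2 Γ {0}ᶜ) {B : Set E3} (hB : Convex ℝ B)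
    (h0 : (0 : E3) ∉ B) {M : ℝ} (hM : ∀ w ∈ B, ‖fderiv ℝ Γ w‖ ≤ M) {w w' : E3} (hw : w ∈ B)
    (hw' : w' ∈ B) : ‖Γ w - Γ w'‖ ≤ M * ‖w - w'‖ := by
  refine hB.norm_image_sub_le_of_norm_fderiv_le (𝕜 := ℝ) (fun x hx => ?_) hM hw' hw
  have hx0 : x ≠ 0 := fun e => h0 (e ▸ hx)
  exact ((hΓ x hx0).contDiffAt (isOpen_compl_singleton.mem_nhds hx0)).differentiableAt (by norm_num)

/-- The mean value inequality for a mixed second difference. -/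
lemma norm_mixed_diff_le {Γ : E3 → E3} (hΓ : ContDiffOn ℝ 2 Γ {0}ᶜ) {B : Set E3} (hB : Convex ℝ B)
    (h0 : (0 : E3) ∉ B) {M : ℝ} (hM : ∀ w ∈ B, ‖fderiv ℝ (fderiv ℝ Γ) w‖ ≤ M) {w h k : E3}
    (hw : w ∈ B) (hh : w + h ∈ B) (hk : w + k ∈ B) (hhk : w + k + h ∈ B) :
    ‖Γ (w + k + h) - Γ (w + k) - (Γ (w + h) - Γ w)‖ ≤ M * ‖h‖ * ‖k‖ := by
  have ho : IsOpen ({0}ᶜ : Set E3) := isOpen_compl_singleton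
  have h1 : ContDiffOn ℝ 1 (fderiv ℝ Γ) {0}ᶜ := hΓ.fderiv_of_isOpen ho (by norm_num)
  have hd : ∀ x ∈ B, HasFDerivAt Γ (fderiv ℝ Γ x) x := fun x hx => by
    have hx0 : x ≠ 0 := fun e => h0 (e ▸ hx)
    exact (((hΓ x hx0).contDiffAt (ho.mem_nhds hx0)).differentiableAt (by norm_num)).hasFDerivAt
  have hlip : ∀ x ∈ B, ∀ y ∈ B, ‖fderiv ℝ Γ x - fderiv ℝ Γ y‖ ≤ M * ‖x - y‖ := fun x hx y hy => by
    refine hB.norm_image_sub_le_of_norm_fderiv_le (𝕜 := ℝ) (fun x hx => ?_) hM hy hx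
    have hx0 : x ≠ 0 := fun e => h0 (e ▸ hx)
    exact ((h1 x hx0).contDiffAt (ho.mem_nhds hx0)).differentiableAt (by norm_num)
  -- the mean value inequality for the increment `x ↦ Γ (x + h) - Γ x`
  have hS : Convex ℝ (B ∩ (fun x => x + h) ⁻¹' B) := by
    refine hB.inter fun x hx y hy s t hs ht hst => ?_
    have := hB hx hy hs ht hst
    have e : s • x + t • y + h = s • (x + h) + t • (y + h) := by
      rw [smul_add, smul_add, add_add_add_comm, ← add_smul, hst, one_smul]
    show s • x + t • y + h ∈ B
    rw [e]
    exact this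
  have hmv := hS.norm_image_sub_le_of_norm_hasFDerivWithin_le (𝕜 := ℝ) (f := fun x => Γ (x + h) - Γ x)
    (f' := fun x => fderiv ℝ Γ (x + h) - fderiv ℝ Γ x) (C := M * ‖h‖) (x := w) (y := w + k)
    (fun x hx => (((hasFDerivAt_comp_add_right h).2 (hd (x + h) hx.2)).sub (hd x hx.1)).hasFDerivWithinAt)
    (fun x hx => by simpa using hlip (x + h) hx.2 x hx.1) ⟨hw, hh⟩ ⟨hk, hhk⟩
  simpa using hmv

end

noncomputable section

/-! ### The interaction of two distant spheres -/

lemma oseen_symm (η : ℝ) (w v v' : E3) : inner ℝ (oseen η w v) v' = inner ℝ v (oseen η w v') := by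
  simp only [oseen, real_inner_smul_left, real_inner_smul_right, inner_add_left, inner_add_right]
  rw [real_inner_comm w v]
  ring

lemma oseen_neg (η : ℝ) (w v : E3) : oseen η (-w) v = oseen η w v := by
  simp only [oseen, norm_neg, inner_neg_left, mul_neg, neg_smul_neg]

lemma oseen_eq_pairTensor (η : ℝ) (w v : E3) :
    oseen η w v = (1 / (8 * Real.pi * η)) • pairTensor w v := by
  rw [oseen, pairTensor, real_inner_smul_left]
  congr 1
  rcases eq_or_ne w 0 with rfl | hw
  · simp
  have h0 : ‖w‖ ≠ 0 := norm_ne_zero_iff.2 hw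
  ext i
  simp only [PiLp.smul_apply, PiLp.add_apply, smul_eq_mul]
  field_simp

lemma toL2_constField {a : ℝ} (v : E3) : toL2 a (constField a v) =ᵐ[sphereMeasure a] fun _ => v :=
  toL2_lipField _

lemma toL2_normalField {a : ℝ} : toL2 a (normalField a) =ᵐ[sphereMeasure a] fun r => a⁻¹ • r :=
  toL2_lipField _

/-- The constant fields, as a continuous linear map. -/
def constFieldL (a : ℝ) : E3 →L[ℝ] sobolevHalf a :=
  LinearMap.toContinuousLinearMap
    { toFun := constField a
      map_add' := fun v w => by
        refine sobolev_ext ?_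
        rw [map_add]
        filter_upwards [toL2_constField (a := a) (v + w), toL2_constField (a := a) v,
          toL2_constField (a := a) w, Lp.coeFn_add (toL2 a (constField a v)) (toL2 a (constField a w))]
          with r h1 h2 h3 h4
        rw [h1, h4, Pi.add_apply, h2, h3]
      map_smul' := fun c v => by
        refine sobolev_ext ?_
        rw [map_smul]
        filter_upwards [toL2_constField (a := a) (c • v), toL2_constField (a := a) v,
          Lp.coeFn_smul c (toL2 a (constField a v))] with r h1 h2 h4
        rw [h1, RingHom.id_apply, h4, Pi.smul_apply, h2] }

lemma constField_zero {a : ℝ} : constField a 0 = 0 := map_zero (constFieldL a)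

lemma constField_smul {a : ℝ} (c : ℝ) (v : E3) : constField a (c • v) = c • constField a v :=
  map_smul (constFieldL a) c v

lemma constField_sum {a : ℝ} {ι : Type*} (s : Finset ι) (v : ι → E3) :
    constField a (∑ i ∈ s, v i) = ∑ i ∈ s, constField a (v i) :=
  map_sum (constFieldL a) v s

/-- The force is the restriction of a density to the constant fields. -/
lemma apply_constField {a : ℝ} (f : SobolevNegHalf a) (v : E3) :
    f (constField a v) = inner ℝ (force f) v := by
  have h : constField a v = ∑ i, v i • constField a (stdVec i) := by
    conv_lhs => rw [← sum_smul_stdVec v]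
    rw [constField_sum]
    exact Finset.sum_congr rfl fun i _ => constField_smul _ _
  have h2 : f (constField a v) = ∑ i, v i * f (constField a (stdVec i)) :=
    (congrArg f h).trans ((map_sum f _ _).trans (Finset.sum_congr rfl fun i _ => map_smul f _ _))
  rw [h2, PiLp.inner_apply]
  rfl

lemma exists_norm_constField_le (a : ℝ) : ∃ K, 0 ≤ K ∧ ∀ v, ‖constField a v‖ ≤ K * ‖v‖ :=
  ⟨‖constFieldL a‖, (constFieldL a).opNorm_nonneg, fun v => (constFieldL a).le_opNorm v⟩

lemma hasFDerivAt_oseen (η : ℝ) (v : E3) {w : E3} (hw : w ≠ 0) :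
    HasFDerivAt (fun w => oseen η w v) ((1 / (8 * Real.pi * η)) •
      (((-((1 : ℕ) * (‖w‖ ^ (1 + 2))⁻¹) • innerSL ℝ w).smulRight v) +
        (((‖w‖ ^ 3)⁻¹ * inner ℝ w v) • ContinuousLinearMap.id ℝ E3 +
          ((‖w‖ ^ 3)⁻¹ • innerSL ℝ v +
            (inner ℝ w v : ℝ) • (-((3 : ℕ) * (‖w‖ ^ (3 + 2))⁻¹) • innerSL ℝ w)).smulRight w))) w := by
  have h1 := (hasFDerivAt_inv_norm_pow 1 hw).smul_const v
  have h3 := hasFDerivAt_inv_norm_pow 3 hw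
  have hi : HasFDerivAt (fun w : E3 => (inner ℝ w v : ℝ)) (innerSL ℝ v) w := by
    refine ((innerSL ℝ v).hasFDerivAt (x := w)).congr_of_eventuallyEq (.of_forall fun w => ?_)
    exact real_inner_comm _ _
  have h := (h1.add ((h3.mul hi).smul (hasFDerivAt_id w))).const_smul (1 / (8 * Real.pi * η))
  refine h.congr_of_eventuallyEq (.of_forall fun y => ?_)
  simp [oseen]

/-- The stokeslet has no divergence away from its singularity. -/
lemma divergence_oseen (η : ℝ) (v : E3) {w : E3} (hw : w ≠ 0) :
    divergence (fun w => oseen η w v) w = 0 := by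
  rw [divergence, (hasFDerivAt_oseen η v hw).fderiv]
  have h0 : ‖w‖ ≠ 0 := norm_ne_zero_iff.2 hw
  have hsq : ‖w‖ ^ 2 = w 0 ^ 2 + w 1 ^ 2 + w 2 ^ 2 := by
    rw [EuclideanSpace.real_norm_sq_eq, Fin.sum_univ_three]
  have hin : inner ℝ w v = v 0 * w 0 + v 1 * w 1 + v 2 * w 2 := by
    rw [PiLp.inner_apply, Fin.sum_univ_three]
    rfl
  have h5 : (‖w‖ ^ 5)⁻¹ * ‖w‖ ^ 2 = (‖w‖ ^ 3)⁻¹ := by field_simp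
  have hs : ∀ i, inner ℝ w (stdVec i) = w i := fun i => by
    simp [EuclideanSpace.inner_single_right]
  have hs' : ∀ i, inner ℝ v (stdVec i) = v i := fun i => by
    simp [EuclideanSpace.inner_single_right]
  simp only [Fin.sum_univ_three, _root_.smul_apply, _root_.add_apply,
    ContinuousLinearMap.smulRight_apply, innerSL_apply_apply, hs, hs', PiLp.smul_apply, PiLp.add_apply,
    smul_eq_mul, ContinuousLinearMap.id_apply]
  simp only [PiLp.single_apply, if_true]
  rw [← mul_add, ← mul_add]
  refine mul_eq_zero_of_right _ ?_
  rw [hin] 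
  norm_num
  rw [← h5, hsq]
  ring

lemma divergence_comp_const_sub {F : E3 → E3} {p x : E3} (hF : DifferentiableAt ℝ F (p - x)) :
    divergence (fun s => F (p - s)) x = -divergence F (p - x) := by
  have h : HasFDerivAt (fun s => F (p - s)) ((fderiv ℝ F (p - x)).comp (-ContinuousLinearMap.id ℝ E3)) x :=
    hF.hasFDerivAt.comp x ((hasFDerivAt_id x).const_sub p)
  simp only [divergence, h.fderiv]
  simp

/-- The stokeslet has no flux through a sphere that does not enclose its singularity. -/
lemma integral_oseen_flux {a : ℝ} (ha : 0 < a) (η : ℝ) (v : E3) {p : E3} (hp : a < ‖p‖) :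
    ∫ s, inner ℝ (oseen η (p - s) v) s ∂sphereMeasure a = 0 := by
  have hne : ∀ s ∈ Metric.ball (0 : E3) ‖p‖, p - s ≠ 0 := fun s hs h => by
    rw [sub_eq_zero] at h
    simp [h] at hs
  refine integral_flux_eq_zero ha hp (fun s hs => ?_) fun s hs => ?_
  · refine ContDiffAt.contDiffWithinAt ?_
    exact ContDiffAt.comp (g := fun w => oseen η w v) (f := fun s => p - s) s
      (contDiffAt_oseen η v (hne s hs)) (by fun_prop)
  · rw [divergence_comp_const_sub (F := fun w => oseen η w v)
      (hasFDerivAt_oseen η v (hne s hs)).differentiableAt, divergence_oseen η v (hne s hs), neg_zero]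

end

noncomputable section

lemma contDiffOn_oseen (η : ℝ) (v : E3) : ContDiffOn ℝ 2 (fun w => oseen η w v) {0}ᶜ :=
  fun _ hw => (contDiffAt_oseen η v hw).contDiffWithinAt

/-- Bounds for a rescaled difference kernel. -/
lemma kernelBound_rescaled {Γ : E3 → E3} (hΓ : ContDiffOn ℝ 2 Γ {0}ᶜ) {B : Set E3} (hB : Convex ℝ B)
    (h0 : (0 : E3) ∉ B) {M M₀ M' a t : ℝ} {e c : E3} (ht : 0 < t)
    (hM₁ : ∀ w ∈ B, ‖fderiv ℝ Γ w‖ ≤ M) (hM₂ : ∀ w ∈ B, ‖fderiv ℝ (fderiv ℝ Γ) w‖ ≤ M)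
    (hM₀ : ∀ w ∈ B, ‖Γ w - c‖ ≤ M₀)
    (hmem : ∀ r s : E3, ‖r‖ = a → ‖s‖ = a → e + t⁻¹ • (r - s) ∈ B)
    (h₀ : t⁻¹ * M₀ ≤ M') (h₁ : t⁻¹ * (M * t⁻¹) ≤ M') (h₂ : t⁻¹ * (M * t⁻¹ * t⁻¹) ≤ M') :
    KernelBound a (fun r s => t⁻¹ • (Γ (e + t⁻¹ • (r - s)) - c)) M' := by
  have hti : 0 < t⁻¹ := inv_pos.2 ht
  have hn : ∀ v : E3, ‖t⁻¹ • v‖ = t⁻¹ * ‖v‖ := fun v => by rw [norm_smul, Real.norm_of_nonneg hti.le]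
  refine ⟨fun r s hr hs => ?_, fun r s s' hr hs hs' => ?_, fun r r' s hr hr' hs => ?_,
    fun r r' s s' hr hr' hs hs' => ?_⟩
  · rw [hn]
    exact (mul_le_mul_of_nonneg_left (hM₀ _ (hmem r s hr hs)) hti.le).trans h₀
  · have h := norm_diff_le hΓ hB h0 hM₁ (hmem r s hr hs) (hmem r s' hr hs')
    have e1 : e + t⁻¹ • (r - s) - (e + t⁻¹ • (r - s')) = -(t⁻¹ • (s - s')) := by module
    rw [e1, norm_neg, hn] at h
    rw [← smul_sub, hn, sub_sub_sub_cancel_right]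
    calc _ ≤ t⁻¹ * (M * (t⁻¹ * ‖s - s'‖)) := mul_le_mul_of_nonneg_left h hti.le
      _ = t⁻¹ * (M * t⁻¹) * ‖s - s'‖ := by ring
      _ ≤ _ := by gcongr
  · have h := norm_diff_le hΓ hB h0 hM₁ (hmem r s hr hs) (hmem r' s hr' hs)
    have e1 : e + t⁻¹ • (r - s) - (e + t⁻¹ • (r' - s)) = t⁻¹ • (r - r') := by module
    rw [e1, hn] at h
    rw [← smul_sub, hn, sub_sub_sub_cancel_right]
    calc _ ≤ t⁻¹ * (M * (t⁻¹ * ‖r - r'‖)) := mul_le_mul_of_nonneg_left h hti.le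
      _ = t⁻¹ * (M * t⁻¹) * ‖r - r'‖ := by ring
      _ ≤ _ := by gcongr
  · have e1 : e + t⁻¹ • (r' - s') + t⁻¹ • (r - r') = e + t⁻¹ • (r - s') := by module
    have e2 : e + t⁻¹ • (r' - s') + t⁻¹ • (s' - s) = e + t⁻¹ • (r' - s) := by module
    have e3 : e + t⁻¹ • (r' - s') + t⁻¹ • (s' - s) + t⁻¹ • (r - r') = e + t⁻¹ • (r - s) := by module
    have h := norm_mixed_diff_le hΓ hB h0 hM₂ (w := e + t⁻¹ • (r' - s')) (h := t⁻¹ • (r - r'))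
      (k := t⁻¹ • (s' - s)) (hmem _ _ hr' hs') (e1 ▸ hmem _ _ hr hs') (e2 ▸ hmem _ _ hr' hs)
      (e3 ▸ hmem _ _ hr hs)
    rw [e3, e2, e1, hn, hn, norm_sub_rev s' s] at h
    rw [← smul_sub, ← smul_sub, ← smul_sub, hn, sub_sub_sub_cancel_right, sub_sub_sub_cancel_right]
    calc _ ≤ t⁻¹ * (M * (t⁻¹ * ‖r - r'‖) * (t⁻¹ * ‖s - s'‖)) := mul_le_mul_of_nonneg_left h hti.le
      _ = t⁻¹ * (M * t⁻¹ * t⁻¹) * ‖r - r'‖ * ‖s - s'‖ := by ring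
      _ ≤ _ := by gcongr

lemma oseen_rescale (η : ℝ) {t : ℝ} (ht : 0 < t) (e r s v : E3) :
    oseen η (t • e + r - s) v = t⁻¹ • oseen η (e + t⁻¹ • (r - s)) v := by
  rw [← oseen_smul_left η ht, smul_add, smul_inv_smul₀ ht.ne']
  congr 1
  abel

/-- The kernel of the interaction of disjoint spheres is regular. -/
lemma exists_kernelBound_oseen {a : ℝ} (η : ℝ) {z : E3} (hz : 2 * a < ‖z‖) :
    ∃ M, 0 ≤ M ∧ ∀ i, KernelBound a (fun r s => oseen η (z + r - s) (stdVec i)) M := by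
  have h0 : (0 : E3) ∉ Metric.closedBall z (2 * a) := fun h => by
    rw [mem_closedBall_iff_norm, zero_sub, norm_neg] at h
    linarith
  have hK := isCompact_closedBall z (2 * a)
  have key : ∀ i, ∃ M, 0 ≤ M ∧ KernelBound a (fun r s => oseen η (z + r - s) (stdVec i)) M := fun i => by
    obtain ⟨M, hM, hb⟩ := exists_fderiv_bound (contDiffOn_oseen η (stdVec i)) hK h0
    obtain ⟨M₀, hM₀⟩ := hK.exists_bound_of_continuousOn (f := fun w => oseen η w (stdVec i))
      ((contDiffOn_oseen η (stdVec i)).continuousOn.mono fun w hw h => h0 (by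
        rw [mem_singleton_iff] at h; rwa [h] at hw))
    refine ⟨max M M₀, hM.trans (le_max_left _ _), ?_⟩
    have h := kernelBound_rescaled (M' := max M M₀) (a := a) (e := z) (c := 0)
      (contDiffOn_oseen η (stdVec i)) (convex_closedBall z (2 * a))
      h0 one_pos (fun w hw => (hb w hw).1) (fun w hw => (hb w hw).2)
      (fun w hw => by simpa using hM₀ w hw) (fun r s hr hs => by
        rw [inv_one, one_smul, mem_closedBall_iff_norm, add_sub_cancel_left]
        exact (norm_sub_le r s).trans (by rw [hr, hs, two_mul]))
      (by simp) (by simp) (by simp)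
    simpa [add_sub_assoc] using h
  choose M hM hk using key
  refine ⟨∑ i, M i, Finset.sum_nonneg fun i _ => hM i, fun i => ?_⟩
  have hle : M i ≤ ∑ i, M i := Finset.single_le_sum (fun i _ => hM i) (Finset.mem_univ i)
  exact ⟨fun r s hr hs => ((hk i).bound r s hr hs).trans hle,
    fun r s s' hr hs hs' => ((hk i).diff_right r s s' hr hs hs').trans (by gcongr),
    fun r r' s hr hr' hs => ((hk i).diff_left r r' s hr hr' hs).trans (by gcongr),
    fun r r' s s' hr hr' hs hs' => ((hk i).diff_mixed r r' s s' hr hr' hs hs').trans (by gcongr)⟩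

/-- The kernel of the interaction of distant spheres differs from its value at the centres by a
kernel of the order `|z|⁻²`, by homogeneity. -/
lemma exists_kernelBound_oseen_sub {a : ℝ} (ha : 0 < a) (η : ℝ) :
    ∃ C, 0 < C ∧ ∀ z : E3, 4 * a ≤ ‖z‖ → ∀ i, KernelBound a
      (fun r s => oseen η (z + r - s) (stdVec i) - oseen η z (stdVec i)) (C * (‖z‖ ^ 2)⁻¹) := by
  set K : Set E3 := Metric.closedBall 0 2 \ Metric.ball 0 (1 / 2) with hKdef
  have hK : IsCompact K := (isCompact_closedBall _ _).diff Metric.isOpen_ball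
  have h0 : (0 : E3) ∉ K := fun h => h.2 (by simp)
  choose M hM hb using fun i => exists_fderiv_bound (contDiffOn_oseen η (stdVec i)) hK h0
  obtain ⟨L, hL⟩ : ∃ L, L = ∑ i, M i := ⟨_, rfl⟩
  have hL0 : 0 ≤ L := hL ▸ Finset.sum_nonneg fun i _ => hM i
  have hle : ∀ i, M i ≤ L := fun i =>
    hL ▸ Finset.single_le_sum (f := M) (fun i _ => hM i) (Finset.mem_univ i)
  refine ⟨(L + 1) * (1 + 2 * a + 1 / (4 * a)), by positivity, fun z hz i => ?_⟩
  obtain ⟨t, ht⟩ : ∃ t, t = ‖z‖ := ⟨_, rfl⟩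
  rw [← ht] at hz ⊢
  have ht0 : 0 < t := by linarith
  obtain ⟨e, he⟩ : ∃ e, e = t⁻¹ • z := ⟨_, rfl⟩
  have hze : z = t • e := by rw [he, smul_inv_smul₀ ht0.ne']
  have he1 : ‖e‖ = 1 := by
    rw [he, norm_smul, norm_inv, Real.norm_of_nonneg ht0.le, ← ht, inv_mul_cancel₀ ht0.ne']
  have hta : t⁻¹ ≤ 1 / (4 * a) := by
    rw [← one_div]
    gcongr
  have hsub : Metric.closedBall e (2 * a * t⁻¹) ⊆ K := fun w hw => by
    rw [mem_closedBall_iff_norm] at hw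
    have h1 : 2 * a * t⁻¹ ≤ 1 / 2 := by
      calc 2 * a * t⁻¹ ≤ 2 * a * (1 / (4 * a)) := by gcongr
        _ = 1 / 2 := by field_simp; norm_num
    have h2 := norm_le_norm_add_norm_sub' w e
    have h3 := norm_le_norm_add_norm_sub' e w
    rw [he1] at h2 h3
    rw [norm_sub_rev] at h3
    exact ⟨by simp; linarith, by simp; norm_num at h1 ⊢; linarith⟩
  have hB0 : (0 : E3) ∉ Metric.closedBall e (2 * a * t⁻¹) := fun h => h0 (hsub h)
  have hec : e ∈ Metric.closedBall e (2 * a * t⁻¹) := Metric.mem_closedBall_self (by positivity)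
  have hM₁ : ∀ w ∈ Metric.closedBall e (2 * a * t⁻¹),
      ‖fderiv ℝ (fun w => oseen η w (stdVec i)) w‖ ≤ L := fun w hw =>
    ((hb i w (hsub hw)).1).trans (hle i)
  have h := kernelBound_rescaled (M := L) (M₀ := L * (2 * a * t⁻¹)) (a := a) (e := e)
    (c := oseen η e (stdVec i)) (M' := (L + 1) * (1 + 2 * a + 1 / (4 * a)) * (t ^ 2)⁻¹)
    (contDiffOn_oseen η (stdVec i)) (convex_closedBall e (2 * a * t⁻¹)) hB0 ht0 hM₁
    (fun w hw => ((hb i w (hsub hw)).2).trans (hle i))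
    (fun w hw => (norm_diff_le (contDiffOn_oseen η (stdVec i)) (convex_closedBall _ _) hB0 hM₁ hw
      hec).trans (mul_le_mul_of_nonneg_left (by rwa [mem_closedBall_iff_norm] at hw) hL0))
    (fun r s hr hs => by
      rw [mem_closedBall_iff_norm, add_sub_cancel_left, norm_smul, norm_inv, Real.norm_of_nonneg ht0.le,
        mul_comm]
      gcongr
      exact (norm_sub_le r s).trans (by rw [hr, hs, two_mul]))
    (by
      calc t⁻¹ * (L * (2 * a * t⁻¹)) = L * (2 * a) * (t ^ 2)⁻¹ := by ring
        _ ≤ _ := by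
          gcongr
          · linarith
          · have : 0 < 1 / (4 * a) := by positivity
            linarith)
    (by
      calc t⁻¹ * (L * t⁻¹) = L * 1 * (t ^ 2)⁻¹ := by ring
        _ ≤ _ := by
          gcongr
          · linarith
          · have : 0 < 1 / (4 * a) := by positivity
            linarith)
    (by
      calc t⁻¹ * (L * t⁻¹ * t⁻¹) = L * t⁻¹ * (t ^ 2)⁻¹ := by ring
        _ ≤ _ := by
          gcongr
          · linarith
          · linarith)
  have hk : (fun r s => t⁻¹ • (oseen η (e + t⁻¹ • (r - s)) (stdVec i) - oseen η e (stdVec i))) =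
      fun r s => oseen η (z + r - s) (stdVec i) - oseen η z (stdVec i) := by
    funext r s
    rw [hze, oseen_rescale η ht0, oseen_smul_left η ht0, smul_sub]
  rwa [hk] at h

lemma integrable_oseen_sphere {a : ℝ} (ha : 0 < a) {η : ℝ} (hη : 0 < η) {z : E3} (hz : 2 * a < ‖z‖)
    (ψ : Lp E3 2 (sphereMeasure a)) {r : E3} (hr : ‖r‖ = a) :
    Integrable (fun s => oseen η (z + r - s) (ψ s)) (sphereMeasure a) := by
  have hψ : Integrable (fun s => ‖ψ s‖) (sphereMeasure a) :=
    ((Lp.memLp ψ).integrable (by norm_num)).norm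
  have hm := (Lp.stronglyMeasurable ψ).measurable
  refine (hψ.const_mul (1 / (4 * Real.pi * η) * (‖z‖ - 2 * a)⁻¹)).mono'
    ((measurable_oseen η).comp (f := fun s => (z + r - s, ψ s)) (by fun_prop)).aestronglyMeasurable ?_
  filter_upwards [ae_mem_sphere ha] with s hs
  refine (norm_oseen_le hη _ _).trans ?_
  have hd : ‖z‖ - 2 * a ≤ ‖z + r - s‖ := by
    have h1 := norm_sub_le (z + r - s) (r - s)
    have h2 := norm_sub_le r s
    have hs' : ‖s‖ = a := by simpa using hs
    rw [show z + r - s - (r - s) = z by abel] at h1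
    linarith
  have hpos : 0 < ‖z‖ - 2 * a := by linarith
  have hpi := Real.pi_pos
  refine le_of_le_of_eq ?_ (mul_assoc _ (‖z‖ - 2 * a)⁻¹ ‖ψ s‖).symm
  gcongr

/-- The components of an integral against the stokeslet. -/
lemma integral_oseen_inner {a η : ℝ} {z : E3} {ψ : E3 → E3} {r : E3}
    (h : Integrable (fun s => oseen η (z + r - s) (ψ s)) (sphereMeasure a)) (i : Fin 3) :
    (∫ s, oseen η (z + r - s) (ψ s) ∂sphereMeasure a) i =
      ∫ s, inner ℝ (ψ s) (oseen η (z + r - s) (stdVec i)) ∂sphereMeasure a := by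
  have h1 := (coord i).integral_comp_comm h
  refine h1.symm.trans (integral_congr_ae (.of_forall fun s => ?_))
  show (oseen η (z + r - s) (ψ s)) i = _
  beta_reduce
  rw [← oseen_symm, EuclideanSpace.inner_single_right]
  simp

end

noncomputable section

lemma densityDual_apply {a : ℝ} (ψ : Lp E3 2 (sphereMeasure a)) (g : sobolevHalf a) {φ : E3 → E3}
    (h : toL2 a g =ᵐ[sphereMeasure a] φ) :
    densityDual a ψ g = ∫ s, inner ℝ (ψ s) (φ s) ∂sphereMeasure a := by
  refine (L2.inner_def (𝕜 := ℝ) ψ (toL2 a g)).trans (integral_congr_ae ?_)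
  filter_upwards [h] with s hs
  rw [hs]

/-- The interaction of two disjoint spheres, as a pairing with the kernel fields. -/
lemma exists_singleLayer_pairing {a : ℝ} (ha : 0 < a) {η : ℝ} (hη : 0 < η) {z : E3} (hz : 2 * a < ‖z‖) :
    IsSingleLayer a η z (singleLayer a η z) ∧ ∃ Φ : E3 → Fin 3 → sobolevHalf a,
      (∀ i r, ‖r‖ = a →
        toL2 a (Φ r i) =ᵐ[sphereMeasure a] fun s => oseen η (z + r - s) (stdVec i)) ∧
      ∀ f, toL2 a (singleLayer a η z f) =ᵐ[sphereMeasure a] fun r => pairingVec f (Φ r) := by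
  obtain ⟨M, hM, hk⟩ := exists_kernelBound_oseen (a := a) η hz
  obtain ⟨C, -, hC⟩ := exists_kernelOperator ha
  refine (hC (fun i r s => oseen η (z + r - s) (stdVec i)) M hM hk).elim fun Φ h => h.elim fun A hA => ?_
  have hs : IsSingleLayer a η z A := fun ψ => by
    filter_upwards [hA.2.2 (densityDual a ψ), ae_mem_sphere ha] with r h1 hr
    have hr' : ‖r‖ = a := by simpa using hr
    rw [h1]
    ext i
    rw [integral_oseen_inner (integrable_oseen_sphere ha hη hz ψ hr') i]
    exact densityDual_apply ψ (Φ r i) (hA.2.1 i r hr')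
  have hs' := isSingleLayer_singleLayer ⟨A, hs⟩
  have he : singleLayer a η z = A := hs'.unique hs
  refine ⟨hs', Φ, hA.2.1, ?_⟩
  rw [he]
  exact hA.2.2

/-- A field is determined by its values on the sphere, here as a difference with a constant. -/
lemma eq_sub_constField {a : ℝ} (ha : 0 < a) {g h : sobolevHalf a} {φ χ : E3 → E3} {v : E3}
    (hg : toL2 a g =ᵐ[sphereMeasure a] φ) (hh : toL2 a h =ᵐ[sphereMeasure a] χ)
    (H : ∀ r, ‖r‖ = a → φ r = χ r - v) : g = h - constField a v := by
  refine sobolev_ext ?_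
  rw [map_sub]
  filter_upwards [hg, hh, toL2_constField (a := a) v, ae_mem_sphere ha,
    Lp.coeFn_sub (toL2 a h) (toL2 a (constField a v))] with r h1 h2 h3 hr h4
  rw [h1, h4, Pi.sub_apply, h2, h3]
  exact H r (by simpa using hr)

/-- At large distance a density acts on another sphere by its total force, up to an error of the order
`|z|⁻²`. -/
theorem exists_norm_singleLayer_sub_le {a : ℝ} (ha : 0 < a) {η : ℝ} (hη : 0 < η) :
    ∃ C, 0 < C ∧ ∀ z : E3, 4 * a ≤ ‖z‖ → ∀ f : SobolevNegHalf a,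
      ‖singleLayer a η z f - constField a ((1 / (8 * Real.pi * η)) • pairTensor z (force f))‖ ≤
        C * (‖z‖ ^ 2)⁻¹ * ‖f‖ := by
  obtain ⟨C₁, hC₁, hk⟩ := exists_kernelBound_oseen_sub ha η
  obtain ⟨C₂, hC₂, hop⟩ := exists_kernelOperator ha
  refine ⟨C₂ * C₁, mul_pos hC₂ hC₁, fun z hz f => ?_⟩
  obtain ⟨-, Φ, hΦ, hA⟩ := exists_singleLayer_pairing ha hη (z := z) (by linarith)
  refine (hop (fun i r s => oseen η (z + r - s) (stdVec i) - oseen η z (stdVec i))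
    (C₁ * (‖z‖ ^ 2)⁻¹) (by positivity) (hk z hz)).elim fun Ψ h => h.elim fun B hB => ?_
  have hΨ : ∀ i r, ‖r‖ = a → Ψ r i = Φ r i - constField a (oseen η z (stdVec i)) := fun i r hr =>
    eq_sub_constField ha (hB.2.1 i r hr) (hΦ i r hr) fun s _ => rfl
  have hp : ∀ r, ‖r‖ = a → pairingVec f (Ψ r) = pairingVec f (Φ r) - oseen η z (force f) := fun r hr => by
    ext i
    have h1 : f (Ψ r i) = f (Φ r i) - inner ℝ (force f) (oseen η z (stdVec i)) :=
      (congrArg f (hΨ i r hr)).trans ((map_sub f _ _).trans (congrArg _ (apply_constField f _)))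
    refine h1.trans ?_
    rw [← oseen_symm, EuclideanSpace.inner_single_right]
    simp [pairingVec]
  have hBf : B f = singleLayer a η z f - constField a (oseen η z (force f)) :=
    eq_sub_constField ha (hB.2.2 f) (hA f) hp
  have e := congrArg (fun v => ‖singleLayer a η z f - constField a v‖) (oseen_eq_pairTensor η z (force f))
  have h := hB.1 f
  refine (e.symm.trans (congrArg norm hBf.symm)).trans_le (h.trans_eq ?_)
  exact by ring

/-- The velocity created by the unit normal on another sphere vanishes. -/
lemma singleLayer_normalDensity {a : ℝ} (ha : 0 < a) {η : ℝ} (hη : 0 < η) {z : E3} (hz : 2 * a < ‖z‖) :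
    singleLayer a η z (normalDensity a) = 0 := by
  have hs := (exists_singleLayer_pairing ha hη hz).1 (toL2 a (normalField a))
  refine sobolev_ext ?_
  rw [map_zero]
  refine hs.trans ?_
  filter_upwards [Lp.coeFn_zero E3 2 (sphereMeasure a), ae_mem_sphere ha] with r h0 hr
  have hr' : ‖r‖ = a := by simpa using hr
  have hp : a < ‖z + r‖ := by
    have := norm_sub_le (z + r) r
    rw [add_sub_cancel_right, hr'] at this
    linarith
  rw [h0]
  ext i
  rw [integral_oseen_inner (integrable_oseen_sphere ha hη hz _ hr') i]
  have h1 := integral_oseen_flux ha η (stdVec i) hp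
  have h2 : ∫ s, inner ℝ (toL2 a (normalField a) s) (oseen η (z + r - s) (stdVec i)) ∂sphereMeasure a =
      a⁻¹ * ∫ s, inner ℝ (oseen η (z + r - s) (stdVec i)) s ∂sphereMeasure a := by
    rw [← integral_const_mul]
    refine integral_congr_ae ?_
    filter_upwards [toL2_normalField (a := a)] with s hs
    rw [hs, real_inner_smul_left, real_inner_comm]
  rw [h2, h1, mul_zero]
  rfl

lemma integrable_prod_oseen {a : ℝ} (ha : 0 < a) {η : ℝ} (hη : 0 < η) {z : E3} (hz : 2 * a < ‖z‖)
    (ψ : Lp E3 2 (sphereMeasure a)) :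
    Integrable (fun q : E3 × E3 => inner ℝ q.1 (oseen η (z + q.1 - q.2) (ψ q.2)))
      ((sphereMeasure a).prod (sphereMeasure a)) := by
  have hψ : Integrable (fun s => ‖ψ s‖) (sphereMeasure a) :=
    ((Lp.memLp ψ).integrable (by norm_num)).norm
  have hm := (Lp.stronglyMeasurable ψ).measurable
  have ho : Measurable fun q : E3 × E3 => oseen η (z + q.1 - q.2) (ψ q.2) :=
    (measurable_oseen η).comp (f := fun q : E3 × E3 => (z + q.1 - q.2, ψ q.2)) (by fun_prop)
  have hi : Integrable (fun q : E3 × E3 => (1 : ℝ) * ‖ψ q.2‖) ((sphereMeasure a).prod (sphereMeasure a)) :=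
    (integrable_const (1 : ℝ)).mul_prod hψ
  refine (hi.const_mul (a * (1 / (4 * Real.pi * η) * (‖z‖ - 2 * a)⁻¹))).mono'
    (measurable_fst.inner ho).aestronglyMeasurable ?_
  filter_upwards [Measure.quasiMeasurePreserving_fst.ae (ae_mem_sphere ha),
    Measure.quasiMeasurePreserving_snd.ae (ae_mem_sphere ha)] with q h1 h2
  have h1' : ‖q.1‖ = a := by simpa using h1
  have h2' : ‖q.2‖ = a := by simpa using h2
  have hd : ‖z‖ - 2 * a ≤ ‖z + q.1 - q.2‖ := by
    have e1 := norm_sub_le (z + q.1 - q.2) (q.1 - q.2)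
    have e2 := norm_sub_le q.1 q.2
    rw [show z + q.1 - q.2 - (q.1 - q.2) = z by abel] at e1
    linarith
  have hpos : 0 < ‖z‖ - 2 * a := by linarith
  have hpi := Real.pi_pos
  calc ‖inner ℝ q.1 (oseen η (z + q.1 - q.2) (ψ q.2))‖
      ≤ ‖q.1‖ * ‖oseen η (z + q.1 - q.2) (ψ q.2)‖ := norm_inner_le_norm _ _
    _ ≤ a * (1 / (4 * Real.pi * η) * (‖z + q.1 - q.2‖⁻¹ * ‖ψ q.2‖)) := by
        rw [h1']
        gcongr
        exact norm_oseen_le hη _ _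
    _ ≤ a * (1 / (4 * Real.pi * η) * ((‖z‖ - 2 * a)⁻¹ * ‖ψ q.2‖)) := by gcongr
    _ = _ := by ring

/-- The velocity created on another sphere has no flux. -/
lemma normalDensity_singleLayer {a : ℝ} (ha : 0 < a) {η : ℝ} (hη : 0 < η) {z : E3} (hz : 2 * a < ‖z‖)
    (f : SobolevNegHalf a) : normalDensity a (singleLayer a η z f) = 0 := by
  refine (denseRange_densityDual a).induction_on (p := fun f => normalDensity a (singleLayer a η z f) = 0)
    f (isClosed_eq (((normalDensity a).continuous).comp (singleLayer a η z).continuous)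
      continuous_const) fun ψ => ?_
  refine (densityDual_apply _ _ ((exists_singleLayer_pairing ha hη hz).1 ψ)).trans ?_
  have h1 : ∫ r, inner ℝ (toL2 a (normalField a) r)
      (∫ s, oseen η (z + r - s) (ψ s) ∂sphereMeasure a) ∂sphereMeasure a =
      a⁻¹ * ∫ r, ∫ s, inner ℝ r (oseen η (z + r - s) (ψ s)) ∂sphereMeasure a ∂sphereMeasure a := by
    rw [← integral_const_mul]
    refine integral_congr_ae ?_
    filter_upwards [toL2_normalField (a := a), ae_mem_sphere ha] with r hr hr'
    rw [hr, real_inner_smul_left, integral_inner (integrable_oseen_sphere ha hη hz ψ (by simpa using hr'))]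
  rw [h1, integral_integral_swap (integrable_prod_oseen ha hη hz ψ)]
  refine mul_eq_zero_of_right _ (integral_eq_zero_of_ae ?_)
  filter_upwards [ae_mem_sphere ha] with s hs'
  have hs : ‖s‖ = a := by simpa using hs'
  rw [Pi.zero_apply]
  have hp : a < ‖s - z‖ := by
    have := norm_sub_le s (s - z)
    rw [sub_sub_cancel, hs] at this
    linarith
  rw [← integral_oseen_flux ha η (ψ s) hp]
  refine integral_congr_ae (.of_forall fun r => ?_)
  beta_reduce
  rw [real_inner_comm, ← oseen_neg, show -(z + r - s) = s - z - r by abel]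

end

noncomputable section

/-! ### Inversion of the operator of a single ball -/

section Abstract

variable {H : Type*} [NormedAddCommGroup H] [InnerProductSpace ℝ H] [CompleteSpace H]

/-- The Lax–Milgram theorem for an operator from the dual space. -/
lemma exists_inverse_of_coercive (R : StrongDual ℝ H ≃ₗᵢ[ℝ] H) (hR : ∀ f g, inner ℝ (R f) g = f g)
    {T : StrongDual ℝ H →L[ℝ] H} {c : ℝ} (hc : 0 < c) (hT : ∀ f : StrongDual ℝ H, c * ‖f‖ ^ 2 ≤ f (T f)) :
    ∃ W : H →L[ℝ] StrongDual ℝ H, (∀ g, T (W g) = g) ∧ ∀ g, ‖W g‖ ≤ c⁻¹ * ‖g‖ := by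
  let S : H →L[ℝ] H := T.comp (R.symm : H →L[ℝ] StrongDual ℝ H)
  have hS : ∀ u, S u = T (R.symm u) := fun u => rfl
  let B : H →L[ℝ] H →L[ℝ] ℝ := (innerSL ℝ).comp S
  have hB : IsCoercive B := ⟨c, hc, fun u => by
    have h := hT (R.symm u)
    rw [← hR, LinearIsometryEquiv.apply_symm_apply, R.symm.norm_map] at h
    show c * ‖u‖ * ‖u‖ ≤ inner ℝ (S u) u
    rw [hS, real_inner_comm]
    linarith [h, sq ‖u‖]⟩
  have he : ∀ u, hB.continuousLinearEquivOfBilin u = S u := fun u =>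
    ext_inner_right ℝ fun w => hB.continuousLinearEquivOfBilin_apply u w
  let W : H →L[ℝ] StrongDual ℝ H := (R.symm : H →L[ℝ] StrongDual ℝ H).comp
    (hB.continuousLinearEquivOfBilin.symm : H →L[ℝ] H)
  have hTW : ∀ g, T (W g) = g := fun g => by
    have := he (hB.continuousLinearEquivOfBilin.symm g)
    rw [ContinuousLinearEquiv.apply_symm_apply] at this
    exact this.symm
  refine ⟨W, hTW, fun g => ?_⟩
  have h := hT (W g)
  rw [hTW] at h
  have h2 := (le_abs_self _).trans ((W g).le_opNorm g)
  rcases (norm_nonneg (W g)).eq_or_lt with h0 | h0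
  · rw [← h0]
    positivity
  · rw [inv_mul_eq_div, le_div_iff₀ hc]
    have : ‖W g‖ * (‖W g‖ * c) ≤ ‖W g‖ * ‖g‖ := by linarith [sq ‖W g‖]
    exact le_of_mul_le_mul_left this h0

/-- A symmetric operator with `T ν = 0`, coercive up to the functional `f ↦ f n`, is invertible between
the kernels of `f ↦ f n` and of `ν`: the operator `f ↦ T f + K (f n) n` is coercive. -/
theorem exists_inverse_mod_normal (R : StrongDual ℝ H ≃ₗᵢ[ℝ] H) (hR : ∀ f g, inner ℝ (R f) g = f g)
    {T : StrongDual ℝ H →L[ℝ] H} {ν : StrongDual ℝ H} {n : H} (hsymm : ∀ f g : StrongDual ℝ H, f (T g) = g (T f))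
    (hν : T ν = 0) (hνn : ν n ≠ 0) {c K : ℝ} (hc : 0 < c)
    (hT : ∀ f : StrongDual ℝ H, c * ‖f‖ ^ 2 ≤ f (T f) + K * f n ^ 2) :
    ∃ W : H →L[ℝ] StrongDual ℝ H, (∀ g, ‖W g‖ ≤ c⁻¹ * ‖g‖) ∧
      (∀ g, ν g = 0 → W g n = 0 ∧ T (W g) = g) ∧ ∀ f : StrongDual ℝ H, f n = 0 → W (T f) = f := by
  let A : StrongDual ℝ H →L[ℝ] H :=
    T + (ContinuousLinearMap.apply ℝ ℝ n).smulRight (max K 1 • n)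
  have hA : ∀ f : StrongDual ℝ H, A f = T f + f n • (max K 1 • n) := fun f => rfl
  have hflux : ∀ f, ν (T f) = 0 := fun f => by rw [hsymm, hν, map_zero]
  obtain ⟨W, hW, hWn⟩ := exists_inverse_of_coercive R hR (T := A) hc fun f => by
    rw [hA, map_add, map_smul, map_smul, smul_eq_mul, smul_eq_mul]
    have h1 : K * f n ^ 2 ≤ max K 1 * f n ^ 2 := by gcongr; exact le_max_left _ _
    linarith [hT f, show f n * (max K 1 * f n) = max K 1 * f n ^ 2 by ring]
  have hinv : ∀ g, ν g = 0 → W g n = 0 ∧ T (W g) = g := fun g hg => by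
    have h := hW g
    rw [hA] at h
    have h0 := congrArg ν h
    rw [map_add, map_smul, map_smul, hflux, hg, zero_add, smul_eq_mul, smul_eq_mul] at h0
    have hK : max K 1 ≠ 0 := (zero_lt_one.trans_le (le_max_right _ _)).ne'
    have hn : W g n = 0 := by
      rcases mul_eq_zero.1 h0 with h0 | h0
      · exact h0
      · exact absurd h0 (mul_ne_zero hK hνn)
    rw [hn, zero_smul, add_zero] at h
    exact ⟨hn, h⟩
  refine ⟨W, hWn, hinv, fun f hf => ?_⟩
  obtain ⟨h1, h2⟩ := hinv (T f) (hflux f)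
  have h := hT (W (T f) - f)
  rw [map_sub, h2, sub_self, map_zero, sub_apply, h1, hf] at h
  have h3 : ‖W (T f) - f‖ ^ 2 ≤ 0 := by
    have : c * ‖W (T f) - f‖ ^ 2 ≤ 0 := by simpa using h
    by_contra h4
    push Not at h4
    linarith [mul_pos hc h4]
  rw [← sub_eq_zero, ← norm_eq_zero]
  exact pow_eq_zero_iff (two_ne_zero) |>.1 (le_antisymm h3 (sq_nonneg _))

end Abstract

end

noncomputable section

/-! ### Weakly coupled systems -/

section Coupled

variable {E F : Type*} [NormedAddCommGroup E] [NormedSpace ℝ E]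
  [NormedAddCommGroup F] [NormedSpace ℝ F] {N : ℕ}

/-- An operator `T` which is inverted by `W` between the kernels of the functionals `m` and `ν`, with
kernel spanned by `e`, together with couplings `A i j` of norm at most `ε` which vanish on `e` and map
into the kernel of `ν`. -/
structure WeakCoupling (T : E →L[ℝ] F) (W : F →L[ℝ] E) (m : E →L[ℝ] ℝ) (ν : F →L[ℝ] ℝ) (e : E) (w ε : ℝ)
    (A : Fin N → Fin N → E →L[ℝ] F) : Prop where
  w_nonneg : 0 ≤ w
  norm_le : ∀ g, ‖W g‖ ≤ w * ‖g‖
  right_inv : ∀ g, ν g = 0 → m (W g) = 0 ∧ T (W g) = g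
  left_inv : ∀ f, m f = 0 → W (T f) = f
  map_e : T e = 0
  m_e : m e ≠ 0
  flux : ∀ f, ν (T f) = 0
  coupling_norm_le : ∀ i j, i ≠ j → ∀ f, ‖A i j f‖ ≤ ε * ‖f‖
  coupling_e : ∀ i j, i ≠ j → A i j e = 0
  coupling_flux : ∀ i j, i ≠ j → ∀ f, ν (A i j f) = 0
  small : w * (N * ε) ≤ 1 / 2
  ε_nonneg : 0 ≤ ε

/-- The sum of the couplings. -/
def couplingSum (A : Fin N → Fin N → E →L[ℝ] F) (f : Fin N → E) (i : Fin N) : F :=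
  ∑ j ∈ Finset.univ.erase i, A i j (f j)

lemma norm_sum_erase_le {G : Type*} [NormedAddCommGroup G] (i : Fin N) {v : Fin N → G} {b : ℝ}
    (hb : 0 ≤ b) (h : ∀ j, i ≠ j → ‖v j‖ ≤ b) : ‖∑ j ∈ Finset.univ.erase i, v j‖ ≤ N * b := by
  calc _ ≤ ∑ j ∈ Finset.univ.erase i, b := norm_sum_le_of_le _ fun j hj =>
        h j (Finset.ne_of_mem_erase hj).symm
    _ ≤ ∑ j : Fin N, b := Finset.sum_le_sum_of_subset_of_nonneg (Finset.subset_univ _) fun _ _ _ => hb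
    _ = N * b := by simp

namespace WeakCoupling

variable {T : E →L[ℝ] F} {W : F →L[ℝ] E} {m : E →L[ℝ] ℝ} {ν : F →L[ℝ] ℝ} {e : E} {w ε : ℝ}
  {A : Fin N → Fin N → E →L[ℝ] F} (h : WeakCoupling T W m ν e w ε A)

include h

lemma norm_couplingSum_sub_le (f f' : Fin N → E) (i : Fin N) :
    ‖couplingSum A f i - couplingSum A f' i‖ ≤ N * ε * ‖f - f'‖ := by
  have hε := h.ε_nonneg
  have e1 : couplingSum A f i - couplingSum A f' i =
      ∑ j ∈ Finset.univ.erase i, A i j (f j - f' j) := by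
    simp only [couplingSum, ← Finset.sum_sub_distrib, map_sub]
  rw [e1, mul_assoc]
  refine norm_sum_erase_le i (by positivity) fun j hj => (h.coupling_norm_le i j hj _).trans ?_
  gcongr
  exact norm_le_pi_norm (f - f') j

lemma norm_couplingSum_le (f : Fin N → E) (i : Fin N) : ‖couplingSum A f i‖ ≤ N * ε * ‖f‖ := by
  simpa [couplingSum] using h.norm_couplingSum_sub_le f 0 i

lemma flux_couplingSum (f : Fin N → E) (i : Fin N) : ν (couplingSum A f i) = 0 := by
  rw [couplingSum, map_sum]
  exact Finset.sum_eq_zero fun j hj => h.coupling_flux i j (Finset.ne_of_mem_erase hj).symm _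

/-- A solution satisfies the equation of a single component with the couplings on the right hand
side. -/
lemma eq_inverse {f : Fin N → E} {g : Fin N → F} (hf : ∀ i, m (f i) = 0)
    (hfg : ∀ i, T (f i) + couplingSum A f i = g i) (i : Fin N) : f i = W (g i - couplingSum A f i) := by
  rw [← hfg i, add_sub_cancel_right, h.left_inv _ (hf i)]

lemma norm_sub_inverse_le {f : Fin N → E} {g : Fin N → F} (hf : ∀ i, m (f i) = 0)
    (hfg : ∀ i, T (f i) + couplingSum A f i = g i) (i : Fin N) :
    ‖f i - W (g i)‖ ≤ w * (N * ε * ‖f‖) := by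
  have hw := h.w_nonneg
  have e1 : f i - W (g i) = -W (couplingSum A f i) := by
    conv_lhs => rw [h.eq_inverse hf hfg i]
    rw [map_sub]
    abel
  rw [e1, norm_neg]
  exact (h.norm_le _).trans (by gcongr; exact h.norm_couplingSum_le f i)

/-- The couplings cost at most half the norm of the solution, since `w * (N * ε) ≤ 1 / 2`. -/
lemma norm_solution_le {f : Fin N → E} {g : Fin N → F} (hf : ∀ i, m (f i) = 0)
    (hfg : ∀ i, T (f i) + couplingSum A f i = g i) : ‖f‖ ≤ 2 * w * ‖g‖ := by
  have hw := h.w_nonneg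
  have h1 : ‖f‖ ≤ w * ‖g‖ + 1 / 2 * ‖f‖ := by
    refine (pi_norm_le_iff_of_nonneg (by positivity)).2 fun i => ?_
    have h2 := h.norm_sub_inverse_le hf hfg i
    have h3 : ‖W (g i)‖ ≤ w * ‖g‖ := (h.norm_le _).trans (by gcongr; exact norm_le_pi_norm g i)
    have h4 := norm_le_norm_add_norm_sub' (f i) (W (g i))
    have h5 : w * (N * ε * ‖f‖) ≤ 1 / 2 * ‖f‖ := by
      rw [← mul_assoc]
      gcongr
      exact h.small
    linarith
  linarith

/-- The equation is solved by Banach's fixed point theorem. -/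
lemma exists_solution [CompleteSpace E] {g : Fin N → F} (hg : ∀ i, ν (g i) = 0) :
    ∃ f : Fin N → E, (∀ i, m (f i) = 0) ∧ ∀ i, T (f i) + couplingSum A f i = g i := by
  have hw := h.w_nonneg
  let Φ : (Fin N → E) → Fin N → E := fun f i => W (g i - couplingSum A f i)
  have hΦ : ContractingWith (1 / 2) Φ := by
    refine ⟨by rw [← NNReal.coe_lt_coe]; norm_num, LipschitzWith.of_dist_le_mul fun f f' => ?_⟩
    rw [dist_eq_norm, dist_eq_norm]
    refine (pi_norm_le_iff_of_nonneg (by positivity)).2 fun i => ?_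
    have e1 : (Φ f - Φ f') i = W (couplingSum A f' i - couplingSum A f i) := by
      show W _ - W _ = _
      rw [← map_sub, sub_sub_sub_cancel_left]
    rw [e1]
    refine (h.norm_le _).trans ?_
    calc w * ‖couplingSum A f' i - couplingSum A f i‖ ≤ w * (N * ε * ‖f' - f‖) := by
          gcongr
          exact h.norm_couplingSum_sub_le f' f i
      _ = w * (N * ε) * ‖f - f'‖ := by rw [norm_sub_rev]; ring
      _ ≤ 1 / 2 * ‖f - f'‖ := by gcongr; exact h.small
      _ = _ := by norm_num
  obtain ⟨f, hf⟩ : ∃ f, Φ f = f := ⟨_, hΦ.fixedPoint_isFixedPt⟩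
  have h1 : ∀ i, m (f i) = 0 ∧ T (f i) = g i - couplingSum A f i := fun i => by
    have h2 := h.right_inv (g i - couplingSum A f i) (by rw [map_sub, hg, h.flux_couplingSum, sub_zero])
    have h3 : W (g i - couplingSum A f i) = f i := congrFun hf i
    rwa [h3] at h2
  exact ⟨f, fun i => (h1 i).1, fun i => by rw [(h1 i).2, sub_add_cancel]⟩

lemma eq_zero_of_solution {f : Fin N → E} (hf : ∀ i, m (f i) = 0)
    (h0 : ∀ i, T (f i) + couplingSum A f i = 0) : f = 0 := by
  have := h.norm_solution_le (g := 0) hf h0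
  rw [norm_zero, mul_zero] at this
  exact norm_le_zero_iff.1 this

lemma solution_smul_e (c : Fin N → ℝ) (i : Fin N) :
    T (c i • e) + couplingSum A (fun j => c j • e) i = 0 := by
  rw [map_smul, h.map_e, smul_zero, zero_add]
  exact Finset.sum_eq_zero fun j hj => by
    rw [map_smul, h.coupling_e i j (Finset.ne_of_mem_erase hj).symm, smul_zero]

/-- Subtracting multiples of `e` from an element of the kernel leaves a solution in the kernel of `m`,
which vanishes by `eq_zero_of_solution`. -/
lemma solution_eq_zero_iff (f : Fin N → E) :
    (∀ i, T (f i) + couplingSum A f i = 0) ↔ ∀ i, ∃ c : ℝ, f i = c • e := by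
  constructor
  · intro hf i
    set c : Fin N → ℝ := fun j => m (f j) / m e with hc
    have h1 : (fun j => f j - c j • e) = 0 := by
      refine h.eq_zero_of_solution (fun j => ?_) fun j => ?_
      · rw [map_sub, map_smul, smul_eq_mul, hc]
        simp only
        rw [div_mul_cancel₀ _ h.m_e, sub_self]
      · have e1 : couplingSum A (fun j => f j - c j • e) j =
            couplingSum A f j - couplingSum A (fun j => c j • e) j := by
          simp only [couplingSum, ← Finset.sum_sub_distrib, map_sub]
        rw [e1, map_sub, sub_add_sub_comm, hf, h.solution_smul_e, sub_zero]
    exact ⟨c i, sub_eq_zero.1 (congrFun h1 i)⟩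
  · intro hf i
    choose c hc using hf
    obtain rfl : f = fun j => c j • e := funext hc
    exact h.solution_smul_e c i

/-- The inverse to first order in the couplings. -/
lemma norm_solution_sub_le {f : Fin N → E} {g : Fin N → F} (hf : ∀ i, m (f i) = 0)
    (hfg : ∀ i, T (f i) + couplingSum A f i = g i) {S : Fin N → Fin N → E → F} {ε₂ : ℝ}
    (hε₂ : 0 ≤ ε₂) (hS : ∀ i j, i ≠ j → ∀ f, ‖A i j f - S i j f‖ ≤ ε₂ * ‖f‖)
    (hSd : ∀ i j, i ≠ j → ∀ f f', ‖S i j f - S i j f'‖ ≤ ε * ‖f - f'‖) (i : Fin N) :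
    ‖f i - W (g i - ∑ j ∈ Finset.univ.erase i, S i j (W (g j)))‖ ≤
      2 * w ^ 2 * N * (ε₂ + w * N * ε ^ 2) * ‖g‖ := by
  have hw := h.w_nonneg
  have hε := h.ε_nonneg
  have e1 : f i - W (g i - ∑ j ∈ Finset.univ.erase i, S i j (W (g j))) =
      -W (∑ j ∈ Finset.univ.erase i, (A i j (f j) - S i j (W (g j)))) := by
    conv_lhs => rw [h.eq_inverse hf hfg i]
    rw [← map_sub, ← map_neg, Finset.sum_sub_distrib]
    congr 1
    rw [couplingSum]
    abel
  have hn := h.norm_solution_le hf hfg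
  have h2 : ‖∑ j ∈ Finset.univ.erase i, (A i j (f j) - S i j (W (g j)))‖ ≤
      N * ((ε₂ + w * N * ε ^ 2) * (2 * w * ‖g‖)) := by
    refine norm_sum_erase_le i (by positivity) fun j hj => ?_
    have h3 := norm_add_le (A i j (f j) - S i j (f j)) (S i j (f j) - S i j (W (g j)))
    rw [sub_add_sub_cancel] at h3
    have h4 : ‖A i j (f j) - S i j (f j)‖ ≤ ε₂ * (2 * w * ‖g‖) := (hS i j hj _).trans (by
      gcongr
      exact (norm_le_pi_norm f j).trans hn)
    have h5 : ‖S i j (f j) - S i j (W (g j))‖ ≤ ε * (w * (N * ε * (2 * w * ‖g‖))) :=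
      (hSd i j hj _ _).trans (by
        gcongr
        exact (h.norm_sub_inverse_le hf hfg j).trans (by gcongr))
    calc _ ≤ _ := h3.trans (add_le_add h4 h5)
      _ = _ := by ring
  rw [e1, norm_neg]
  calc _ ≤ w * (N * ((ε₂ + w * N * ε ^ 2) * (2 * w * ‖g‖))) := (h.norm_le _).trans (by gcongr)
    _ = _ := by ring

end WeakCoupling

end Coupled

end

noncomputable section

/-! ### The operator of a single ball between fields without flux and normalized densities -/

section SingleBall

variable {a : ℝ} (ha : 0 < a) {η : ℝ} (hη : 0 < η)

include ha in
lemma normalDensity_normalField : normalDensity a (normalField a) = 4 * Real.pi * a ^ 2 := by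
  refine (densityDual_apply _ _ toL2_normalField).trans ?_
  have h : ∫ s, inner ℝ (toL2 a (normalField a) s) (a⁻¹ • s) ∂sphereMeasure a =
      ∫ _, (1 : ℝ) ∂sphereMeasure a := by
    refine integral_congr_ae ?_
    filter_upwards [toL2_normalField (a := a), ae_mem_sphere ha] with s h1 h2
    have hs : ‖s‖ = a := by simpa using h2
    rw [h1, real_inner_self_eq_norm_sq, norm_smul, hs, norm_inv, Real.norm_of_nonneg ha.le,
      inv_mul_cancel₀ ha.ne', one_pow]
  rw [h, integral_const, sphereMeasure_real_univ, smul_eq_mul, mul_one]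

include ha hη in
lemma normalDensity_singleLayer_zero (f : SobolevNegHalf a) :
    normalDensity a (singleLayer a η 0 f) = 0 :=
  ((singleLayer_zero_spec ha hη).2.1 (normalDensity a) f).trans
    ((congrArg f (singleLayer_zero_normalDensity ha hη)).trans (map_zero f))

/-- `W` inverts the operator of a single ball between the fields without flux and the normalized
densities. -/
structure IsBallInverse (a η : ℝ) (W : sobolevHalf a →L[ℝ] SobolevNegHalf a) (w : ℝ) : Prop where
  w_pos : 0 < w
  norm_le : ∀ g, ‖W g‖ ≤ w * ‖g‖
  right_inv : ∀ g, normalDensity a g = 0 → W g (normalField a) = 0 ∧ singleLayer a η 0 (W g) = g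
  left_inv : ∀ f : SobolevNegHalf a, f (normalField a) = 0 → W (singleLayer a η 0 f) = f

include ha hη in
/-- The inverse exists because the single layer operator is coercive modulo its kernel, the normal
density (Lax–Milgram). -/
theorem exists_isBallInverse : ∃ W w, IsBallInverse a η W w := by
  obtain ⟨-, hsymm, c, hc, K, hK⟩ := singleLayer_zero_spec ha hη
  have hn : normalDensity a (normalField a) ≠ 0 := by
    rw [normalDensity_normalField ha]
    positivity
  refine (exists_inverse_mod_normal (riesz a) inner_riesz hsymm
    (singleLayer_zero_normalDensity ha hη) hn hc hK).elim fun W hW => ?_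
  exact ⟨W, c⁻¹, inv_pos.2 hc, hW.1, hW.2.1, hW.2.2⟩

namespace IsBallInverse

variable {W : sobolevHalf a →L[ℝ] SobolevNegHalf a} {w : ℝ} (hW : IsBallInverse a η W w)

include ha hη hW

lemma bijOn : BijOn (singleLayer a η 0) (normalized a) (fluxFree a) :=
  ⟨fun f _ => normalDensity_singleLayer_zero ha hη f,
    fun f hf f' hf' he => (hW.left_inv f hf).symm.trans ((congrArg W he).trans (hW.left_inv f' hf')),
    fun g hg => ⟨W g, (hW.right_inv g hg).1, (hW.right_inv g hg).2⟩⟩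

lemma singleLayerInv_eq {g : sobolevHalf a} (hg : g ∈ fluxFree a) : singleLayerInv a η g = W g := by
  have hb := hW.bijOn ha hη
  have h1 := Function.invFunOn_mem (hb.surjOn hg)
  have h2 := Function.invFunOn_eq (hb.surjOn hg)
  exact hb.injOn h1 (hW.right_inv g hg).1 (h2.trans (hW.right_inv g hg).2.symm)

lemma singleLayer_eq_zero_iff (f : SobolevNegHalf a) :
    singleLayer a η 0 f = 0 ↔ ∃ c : ℝ, f = c • normalDensity a := by
  have hn : normalDensity a (normalField a) ≠ 0 := by
    rw [normalDensity_normalField ha]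
    positivity
  constructor
  · intro h
    obtain ⟨c, hc⟩ : ∃ c, c = f (normalField a) / normalDensity a (normalField a) := ⟨_, rfl⟩
    have h1 : (f - c • normalDensity a) (normalField a) = 0 := by
      rw [sub_apply, smul_apply, hc, smul_eq_mul, div_mul_cancel₀ _ hn, sub_self]
    have h2 : singleLayer a η 0 (f - c • normalDensity a) = 0 := by
      rw [map_sub, map_smul, h, singleLayer_zero_normalDensity ha hη, smul_zero, sub_zero]
    exact ⟨c, sub_eq_zero.1 ((hW.left_inv _ h1).symm.trans ((congrArg W h2).trans (map_zero W)))⟩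
  · rintro ⟨c, rfl⟩
    rw [map_smul, singleLayer_zero_normalDensity ha hη, smul_zero]

end IsBallInverse

end SingleBall

/-! ### The system of distant balls -/

lemma minDist_le {N : ℕ} (x : Fin N → E3) {i j : Fin N} (h : i ≠ j) : minDist x ≤ ‖x i - x j‖ := by
  have hb : BddBelow (range fun p : {p : Fin N × Fin N // p.1 < p.2} => ‖x p.1.1 - x p.1.2‖) :=
    ⟨0, by rintro _ ⟨p, rfl⟩; exact norm_nonneg _⟩
  rcases lt_or_gt_of_ne h with h | h
  · exact ciInf_le hb ⟨(i, j), h⟩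
  · rw [norm_sub_rev]
    exact ciInf_le hb ⟨(j, i), h⟩

lemma stokesOperator_apply {a η : ℝ} {N : ℕ} (x : Fin N → E3) (f : Fin N → SobolevNegHalf a)
    (i : Fin N) : stokesOperator a η x f i =
      singleLayer a η 0 (f i) + couplingSum (fun i j => singleLayer a η (x i - x j)) f i := by
  have h : stokesOperator a η x f i = ∑ j, singleLayer a η (x i - x j) (f j) := by
    rw [stokesOperator, ContinuousLinearMap.pi_apply, _root_.sum_apply]
    rfl
  rw [h, ← Finset.add_sum_erase _ _ (Finset.mem_univ i), sub_self]
  rfl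

lemma pairTensor_sub (z v w : E3) : pairTensor z (v - w) = pairTensor z v - pairTensor z w := by
  simp only [pairTensor, inner_sub_right]
  module

lemma norm_pairTensor_le (z v : E3) : ‖pairTensor z v‖ ≤ 2 * ‖z‖⁻¹ * ‖v‖ := by
  rcases eq_or_ne z 0 with rfl | hz
  · simp [pairTensor]
  have h1 : ‖‖z‖⁻¹ • z‖ = 1 := by
    rw [norm_smul, norm_inv, norm_norm, inv_mul_cancel₀ (norm_ne_zero_iff.2 hz)]
  have h2 : ‖inner ℝ (‖z‖⁻¹ • z) v • (‖z‖⁻¹ • z)‖ ≤ ‖v‖ := by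
    rw [norm_smul, h1, mul_one]
    exact (norm_inner_le_norm _ _).trans (by rw [h1, one_mul])
  rw [pairTensor, norm_smul, one_div, norm_inv, norm_norm]
  calc ‖z‖⁻¹ * ‖v + inner ℝ (‖z‖⁻¹ • z) v • (‖z‖⁻¹ • z)‖ ≤ ‖z‖⁻¹ * (‖v‖ + ‖v‖) := by
        gcongr
        exact (norm_add_le _ _).trans (by gcongr)
    _ = _ := by ring

lemma force_sub {a : ℝ} (f g : SobolevNegHalf a) : force (f - g) = force f - force g := rfl

lemma exists_norm_force_le (a : ℝ) : ∃ K, 0 ≤ K ∧ ∀ f : SobolevNegHalf a, ‖force f‖ ≤ K * ‖f‖ := by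
  obtain ⟨K, hK, hb⟩ := exists_norm_constField_le a
  refine ⟨2 * K, by positivity, fun f => ?_⟩
  refine (norm_pairingVec_le f (Φ := fun k => constField a (EuclideanSpace.single k 1)) hK
    fun i => (hb _).trans ?_).trans (le_of_eq (by ring))
  simp

/-- The leading part of the interaction of two distant balls. -/
def interaction (a η : ℝ) (z : E3) (f : SobolevNegHalf a) : sobolevHalf a :=
  constField a ((1 / (8 * Real.pi * η)) • pairTensor z (force f))

lemma exists_norm_interaction_sub_le (a : ℝ) {η : ℝ} (hη : 0 < η) : ∃ C, 0 ≤ C ∧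
    ∀ z (f f' : SobolevNegHalf a),
      ‖interaction a η z f - interaction a η z f'‖ ≤ C * ‖z‖⁻¹ * ‖f - f'‖ := by
  obtain ⟨K, hK, hb⟩ := exists_norm_constField_le a
  obtain ⟨K', hK', hb'⟩ := exists_norm_force_le a
  have hpi := Real.pi_pos
  refine ⟨K * (1 / (8 * Real.pi * η) * (2 * K')), by positivity, fun z f f' => ?_⟩
  have e1 : interaction a η z f - interaction a η z f' =
      constField a ((1 / (8 * Real.pi * η)) • pairTensor z (force (f - f'))) := by
    rw [force_sub, pairTensor_sub, smul_sub]
    exact (map_sub (constFieldL a) _ _).symm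
  rw [e1]
  refine (hb _).trans ?_
  rw [norm_smul, Real.norm_of_nonneg (by positivity)]
  calc K * (1 / (8 * Real.pi * η) * ‖pairTensor z (force (f - f'))‖)
      ≤ K * (1 / (8 * Real.pi * η) * (2 * ‖z‖⁻¹ * (K' * ‖f - f'‖))) := by
        gcongr
        exact (norm_pairTensor_le z _).trans (by gcongr; exact hb' _)
    _ = _ := by ring

lemma sum_interaction {a η : ℝ} {N : ℕ} (x : Fin N → E3) (f : Fin N → SobolevNegHalf a) (i : Fin N) :
    ∑ j ∈ Finset.univ.erase i, interaction a η (x i - x j) (f j) =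
      constField a ((1 / (8 * Real.pi * η)) •
        ∑ j ∈ Finset.univ.erase i, pairTensor (x i - x j) (force (f j))) := by
  rw [Finset.smul_sum, constField_sum]
  rfl

end

noncomputable section

/-- The pairing of a density with the unit normal. -/
abbrev normalPairing (a : ℝ) : SobolevNegHalf a →L[ℝ] ℝ :=
  ContinuousLinearMap.apply ℝ ℝ (normalField a)

/-- A configuration `x` of balls which are so far apart that their couplings `A (x i - x j)` are weak;
the couplings are given by `S` up to terms of the order `δ(x)⁻²`. -/
structure FarApart {E F : Type*} [NormedAddCommGroup E] [NormedSpace ℝ E]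
    [NormedAddCommGroup F] [NormedSpace ℝ F] (T : E →L[ℝ] F) (W : F →L[ℝ] E) (m : E →L[ℝ] ℝ)
    (ν : F →L[ℝ] ℝ) (e : E) (A : E3 → E →L[ℝ] F) (S : E3 → E → F) (w C : ℝ) {N : ℕ}
    (x : Fin N → E3) : Prop where
  weak : WeakCoupling T W m ν e w (C * (minDist x)⁻¹) fun i j => A (x i - x j)
  approx : ∀ i j, i ≠ j → ∀ f, ‖A (x i - x j) f - S (x i - x j) f‖ ≤ C * (minDist x ^ 2)⁻¹ * ‖f‖
  lipschitz : ∀ i j, i ≠ j → ∀ f f', ‖S (x i - x j) f - S (x i - x j) f'‖ ≤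
    C * (minDist x)⁻¹ * ‖f - f'‖
  one_le : 1 ≤ minDist x

/-- Couplings which decay at infinity are weak at large distances. -/
lemma exists_farApart_of_decay {E F : Type*} [NormedAddCommGroup E] [NormedSpace ℝ E]
    [NormedAddCommGroup F] [NormedSpace ℝ F] {T : E →L[ℝ] F} {W : F →L[ℝ] E} {m : E →L[ℝ] ℝ}
    {ν : F →L[ℝ] ℝ} {e : E} {a w C₁ C₂ : ℝ} (ha : 0 < a) (hw : 0 < w) (hC₁ : 0 ≤ C₁) (hC₂ : 0 ≤ C₂)
    (hle : ∀ g, ‖W g‖ ≤ w * ‖g‖) (hr : ∀ g, ν g = 0 → m (W g) = 0 ∧ T (W g) = g)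
    (hl : ∀ f, m f = 0 → W (T f) = f) (hTe : T e = 0) (hme : m e ≠ 0) (hflux : ∀ f, ν (T f) = 0)
    {A : E3 → E →L[ℝ] F} {S : E3 → E → F} (hS0 : ∀ z, S z 0 = 0)
    (hAS : ∀ z, 4 * a ≤ ‖z‖ → ∀ f, ‖A z f - S z f‖ ≤ C₁ * (‖z‖ ^ 2)⁻¹ * ‖f‖)
    (hS : ∀ z f f', ‖S z f - S z f'‖ ≤ C₂ * ‖z‖⁻¹ * ‖f - f'‖)
    (hAe : ∀ z, 2 * a < ‖z‖ → A z e = 0) (hAν : ∀ z, 2 * a < ‖z‖ → ∀ f, ν (A z f) = 0) (N : ℕ) :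
    ∃ C δ₀ : ℝ, 0 ≤ C ∧ ∀ x : Fin N → E3, δ₀ ≤ minDist x → FarApart T W m ν e A S w C x := by
  refine ⟨C₁ + C₂, 1 + 4 * a + 2 * w * (N * (C₁ + C₂)), by positivity, fun x hx => ?_⟩
  obtain ⟨δ, hδ⟩ : ∃ δ, δ = minDist x := ⟨_, rfl⟩
  have hd : ∀ i j, i ≠ j → δ ≤ ‖x i - x j‖ := fun i j hij => hδ ▸ minDist_le x hij
  rw [← hδ] at hx
  have hN : 0 ≤ 2 * w * (N * (C₁ + C₂)) := by positivity
  have hδ1 : 1 ≤ δ := by linarith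
  have hδ0 : 0 < δ := by linarith
  have hfar : ∀ i j, i ≠ j → 4 * a ≤ ‖x i - x j‖ := fun i j hij => by linarith [hd i j hij]
  have hfar' : ∀ i j, i ≠ j → 2 * a < ‖x i - x j‖ := fun i j hij => by linarith [hfar i j hij]
  have hb₁ : ∀ i j, i ≠ j → ∀ f, ‖A (x i - x j) f - S (x i - x j) f‖ ≤ C₁ * (δ ^ 2)⁻¹ * ‖f‖ :=
    fun i j hij f => (hAS _ (hfar i j hij) f).trans (by gcongr; exact hd i j hij)
  have hb₂ : ∀ i j, i ≠ j → ∀ f f', ‖S (x i - x j) f - S (x i - x j) f'‖ ≤ C₂ * δ⁻¹ * ‖f - f'‖ :=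
    fun i j hij f f' => (hS _ f f').trans (by gcongr; exact hd i j hij)
  have hb₃ : ∀ i j, i ≠ j → ∀ f, ‖A (x i - x j) f‖ ≤ (C₁ + C₂) * δ⁻¹ * ‖f‖ := fun i j hij f => by
    have e2 := hb₂ i j hij f 0
    rw [hS0, sub_zero, sub_zero] at e2
    have e3 : C₁ * (δ ^ 2)⁻¹ * ‖f‖ ≤ C₁ * δ⁻¹ * ‖f‖ := by
      have : (δ ^ 2)⁻¹ ≤ δ⁻¹ := inv_anti₀ hδ0 (by nlinarith)
      gcongr
    have e4 := norm_le_norm_sub_add (A (x i - x j) f) (S (x i - x j) f)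
    linarith [hb₁ i j hij f]
  rw [hδ] at hb₁ hb₂ hb₃ hδ0
  refine ⟨⟨hw.le, hle, hr, hl, hTe, hme, hflux, hb₃, fun i j hij => hAe _ (hfar' i j hij),
    fun i j hij => hAν _ (hfar' i j hij), ?_, by positivity⟩, fun i j hij f => ?_, fun i j hij f f' => ?_, hδ ▸ hδ1⟩
  · rw [show w * (N * ((C₁ + C₂) * (minDist x)⁻¹)) = w * (N * (C₁ + C₂)) / minDist x by ring, div_le_iff₀ hδ0, ← hδ]
    linarith
  · exact (hb₁ i j hij f).trans (by gcongr; linarith)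
  · exact (hb₂ i j hij f f').trans (by gcongr; linarith)

lemma interaction_zero {a η : ℝ} (z : E3) : interaction a η z 0 = 0 := by
  have h : pairTensor z (force (0 : SobolevNegHalf a)) = 0 := by
    rw [show force (0 : SobolevNegHalf a) = 0 from rfl]
    simp [pairTensor]
  rw [interaction, h, smul_zero, constField_zero]

/-! ### Forces and torques -/

section Forces

variable {a : ℝ} (ha : 0 < a) {η : ℝ} (hη : 0 < η)

lemma inner_cross_self (v w : E3) : inner ℝ (cross v w) w = 0 := by
  simp only [PiLp.inner_apply, cross, Fin.sum_univ_three, cross_apply]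
  simp
  ring

lemma inner_cross_left (u v w : E3) : inner ℝ u (cross v w) = inner ℝ (cross u v) w := by
  simp only [PiLp.inner_apply, cross, Fin.sum_univ_three, cross_apply]
  simp
  ring

lemma norm_cross_le (v w : E3) : ‖cross v w‖ ≤ 4 * ‖v‖ * ‖w‖ := by
  have hc : ∀ (u : E3) (i : Fin 3), |u i| ≤ ‖u‖ := fun u i => by
    simpa using PiLp.norm_apply_le u i
  have key : ∀ i j k l : Fin 3, |v i * w j - v k * w l| ≤ 2 * ‖v‖ * ‖w‖ := fun i j k l => by
    refine (abs_sub _ _).trans ?_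
    rw [abs_mul, abs_mul]
    have h1 : |v i| * |w j| ≤ ‖v‖ * ‖w‖ := by gcongr <;> exact hc _ _
    have h2 : |v k| * |w l| ≤ ‖v‖ * ‖w‖ := by gcongr <;> exact hc _ _
    linarith
  refine (norm_le_two_mul_of_abs_le (ε := 2 * ‖v‖ * ‖w‖) (by positivity) fun i => ?_).trans (by linarith)
  simp only [cross, cross_apply]
  fin_cases i
  · exact key 1 2 2 1
  · exact key 2 0 0 2
  · exact key 0 1 1 0

lemma toL2_rigidField (u ω : E3) :
    toL2 a (rigidField a u ω) =ᵐ[sphereMeasure a] fun r => u + cross ω r :=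
  toL2_lipField _

include ha in
lemma integral_inner_sphere (v : E3) : ∫ r, inner ℝ v r ∂sphereMeasure a = 0 := by
  have h := integral_flux_eq_zero (F := fun _ => v) ha (lt_add_one a) contDiffOn_const
    fun x _ => by simp [divergence]
  exact h

/-- The mean of a rigid motion is its translation. -/
lemma densityDual_constField_rigidField (ha : 0 < a) (v u ω : E3) :
    densityDual a (toL2 a (constField a v)) (rigidField a u ω) = 4 * Real.pi * a ^ 2 * inner ℝ v u := by
  refine (densityDual_apply _ _ (toL2_rigidField u ω)).trans ?_
  have h : ∫ s, inner ℝ (toL2 a (constField a v) s) (u + cross ω s) ∂sphereMeasure a =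
      ∫ s, (inner ℝ v u + inner ℝ (cross v ω) s) ∂sphereMeasure a := by
    refine integral_congr_ae ?_
    filter_upwards [toL2_constField (a := a) v] with s h1
    rw [h1, inner_add_right, inner_cross_left]
  rw [h, integral_add (integrable_const _) (integrable_sphereMeasure ha (by fun_prop)),
    integral_inner_sphere ha, integral_const, sphereMeasure_real_univ, smul_eq_mul, add_zero]

/-- Rigid velocities carry no flux through the sphere, so that they lie in the range of the single
layer operator. -/
lemma normalDensity_rigidField (ha : 0 < a) (u ω : E3) : normalDensity a (rigidField a u ω) = 0 := by
  refine (densityDual_apply _ _ (toL2_rigidField u ω)).trans ?_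
  have h : ∫ s, inner ℝ (toL2 a (normalField a) s) (u + cross ω s) ∂sphereMeasure a =
      a⁻¹ * ∫ s, inner ℝ u s ∂sphereMeasure a := by
    rw [← integral_const_mul]
    refine integral_congr_ae ?_
    filter_upwards [toL2_normalField (a := a)] with s h1
    rw [h1, real_inner_smul_left, inner_add_right, real_inner_comm u, real_inner_comm (cross ω s),
      inner_cross_self, add_zero]
  rw [h, integral_inner_sphere ha, mul_zero]

lemma constField_eq_rigidField (u : E3) : constField a u = rigidField a u 0 := by
  refine sobolev_ext ?_
  filter_upwards [toL2_constField (a := a) u, toL2_rigidField (a := a) u 0] with r h1 h2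
  rw [h1, h2]
  simp [cross]

lemma rigidField_eq_add (u ω : E3) : rigidField a u ω = constField a u + rigidField a 0 ω := by
  refine sobolev_ext ?_
  rw [map_add]
  filter_upwards [toL2_constField (a := a) u, toL2_rigidField (a := a) u ω,
    toL2_rigidField (a := a) 0 ω,
    Lp.coeFn_add (toL2 a (constField a u)) (toL2 a (rigidField a 0 ω))] with r h1 h2 h3 h4
  rw [h2, h4, Pi.add_apply, h1, h3, zero_add]

lemma exists_norm_rigidField_le (ha : 0 < a) :
    ∃ K, 0 ≤ K ∧ ∀ u ω : E3, ‖rigidField a u ω‖ ≤ K * (‖u‖ + ‖ω‖) := by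
  obtain ⟨C, hC, hb⟩ := exists_sobolev_norm_le ha
  refine ⟨C * (1 + 4 * a + 4), by positivity, fun u ω => ?_⟩
  refine (hb _ _ (‖u‖ + 4 * ‖ω‖ * a) (4 * ‖ω‖) (toL2_rigidField u ω) (by positivity) (by positivity)
    (fun r hr => ?_) fun r s _ _ => ?_).trans ?_
  · exact (norm_add_le _ _).trans (add_le_add_right ((norm_cross_le ω r).trans_eq (by rw [hr])) _)
  · have e : u + cross ω r - (u + cross ω s) = cross ω (r - s) := by
      simp [cross]
    rw [e]
    exact norm_cross_le ω _
  · refine (mul_le_mul_of_nonneg_left (b := ‖u‖ + 4 * ‖ω‖ * a + 4 * ‖ω‖) ?_ hC.le).trans_eq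
      (mul_assoc _ _ _).symm
    have := mul_nonneg ha.le (norm_nonneg u)
    have := norm_nonneg u
    have := norm_nonneg ω
    linarith

/-- Moving the reference point from `0` to `c` changes the torque by the moment of the total force. -/
lemma torque_eq (c : E3) (f : SobolevNegHalf a) : torque c f = cross c (force f) + torque 0 f := by
  have h : ∀ c k, torque c f k = f (rigidField a (cross (stdVec k) c) (stdVec k)) := fun c k => by
    refine congrArg f (sobolev_ext ?_)
    filter_upwards [toL2_rigidField (a := a) (cross (stdVec k) c) (stdVec k),
      toL2_lipField (a := a) (φ := fun r => cross (stdVec k) (c + r))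
        (by simpa using lipschitz_cross_field 0 (EuclideanSpace.single k 1) c)] with r h1 h2
    rw [h1]
    refine h2.trans ?_
    simp [cross]
  ext k
  have h1 : f (rigidField a (cross (stdVec k) c) (stdVec k)) =
      inner ℝ (force f) (cross (stdVec k) c) + f (rigidField a 0 (stdVec k)) :=
    (congrArg f (rigidField_eq_add _ _)).trans ((map_add f _ _).trans
      (congrArg (· + _) (apply_constField f _)))
  have h2 : torque 0 f k = f (rigidField a 0 (stdVec k)) := by
    rw [h 0 k]
    congr 2
    simp [cross]
  rw [h c k, h1, PiLp.add_apply, h2, real_inner_comm, ← inner_cross_left,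
    EuclideanSpace.inner_single_left]
  simp

lemma exists_norm_torque_zero_le (ha : 0 < a) :
    ∃ K, 0 ≤ K ∧ ∀ f : SobolevNegHalf a, ‖torque 0 f‖ ≤ K * ‖f‖ := by
  obtain ⟨K, hK, hb⟩ := exists_norm_rigidField_le ha
  refine ⟨2 * K, by positivity, fun f => ?_⟩
  have h : ∀ k, lipField a (fun r => cross (EuclideanSpace.single k 1) (0 + r))
      (by simpa using lipschitz_cross_field 0 (EuclideanSpace.single k 1) 0) =
      rigidField a 0 (stdVec k) := fun k => by
    refine sobolev_ext ?_
    filter_upwards [toL2_rigidField (a := a) 0 (stdVec k),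
      toL2_lipField (a := a) (φ := fun r => cross (stdVec k) (0 + r))
        (by simpa using lipschitz_cross_field 0 (EuclideanSpace.single k 1) 0)] with r h1 h2
    rw [h1]
    refine h2.trans ?_
    simp
  refine (norm_pairingVec_le f (Φ := fun k => lipField a (fun r => cross (EuclideanSpace.single k 1) (0 + r))
      (by simpa using lipschitz_cross_field 0 (EuclideanSpace.single k 1) 0)) hK
    fun k => ?_).trans (le_of_eq (by ring))
  rw [h k]
  exact (hb _ _).trans (by simp)

include ha hη in
/-- The force of the density of a field with mean `p`: by the symmetry of the operator of a single
ball it is the pairing of the field with the density of a translation, which is constant. -/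
lemma IsBallInverse.force_eq {W : sobolevHalf a →L[ℝ] SobolevNegHalf a} {w : ℝ}
    (hW : IsBallInverse a η W w) {g : sobolevHalf a} (hg : normalDensity a g = 0) {p : E3}
    (hp : ∀ v, densityDual a (toL2 a (constField a v)) g = 4 * Real.pi * a ^ 2 * inner ℝ v p) :
    force (W g) = (6 * Real.pi * η * a) • p := by
  refine ext_inner_right ℝ fun v => ?_
  have h1 : constField a v =
      (3 * η / (2 * a)) • singleLayer a η 0 (densityDual a (toL2 a (constField a v))) := by
    rw [singleLayer_zero_constField ha hη, constField_smul, smul_smul]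
    have : 3 * η / (2 * a) * (2 * a / (3 * η)) = 1 := by field_simp
    rw [this, one_smul]
  have h2 : W g (constField a v) =
      (3 * η / (2 * a)) * W g (singleLayer a η 0 (densityDual a (toL2 a (constField a v)))) :=
    (congrArg (W g) h1).trans (map_smul (W g) _ _)
  have h3 : W g (singleLayer a η 0 (densityDual a (toL2 a (constField a v)))) =
      densityDual a (toL2 a (constField a v)) g :=
    ((singleLayer_zero_spec ha hη).2.1 _ _).trans (congrArg _ (hW.right_inv g hg).2)
  rw [← apply_constField, h2, h3, hp, real_inner_smul_left, real_inner_comm p v]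
  field_simp
  ring

end Forces

end

noncomputable section

/-! ### Expansions for distant balls -/

lemma pairTensor_smul (z v : E3) (c : ℝ) : pairTensor z (c • v) = c • pairTensor z v := by
  simp only [pairTensor, real_inner_smul_right]
  module

lemma cross_sub (c v w : E3) : cross c (v - w) = cross c v - cross c w := by
  simp [cross]

lemma cross_smul (c v : E3) (t : ℝ) : cross c (t • v) = t • cross c v := by
  simp [cross]

lemma constField_mem_fluxFree {a : ℝ} (ha : 0 < a) (v : E3) : constField a v ∈ fluxFree a := by
  rw [constField_eq_rigidField]
  exact normalDensity_rigidField ha v 0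

/-- Balls which are far apart are weakly coupled. -/
theorem exists_farApart {a : ℝ} (ha : 0 < a) {η : ℝ} (hη : 0 < η) (N : ℕ)
    {W : sobolevHalf a →L[ℝ] SobolevNegHalf a} {w : ℝ} (hW : IsBallInverse a η W w) :
    ∃ C δ₀ : ℝ, 0 ≤ C ∧ ∀ x : Fin N → E3, δ₀ ≤ minDist x →
      FarApart (singleLayer a η 0) W (normalPairing a) (normalDensity a) (normalDensity a)
        (singleLayer a η) (interaction a η) w C x := by
  obtain ⟨C₁, hC₁, h₁⟩ := exists_norm_singleLayer_sub_le ha hη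
  obtain ⟨C₂, hC₂, h₂⟩ := exists_norm_interaction_sub_le a hη
  have hn : normalPairing a (normalDensity a) ≠ 0 := by
    rw [ContinuousLinearMap.apply_apply, normalDensity_normalField ha]
    positivity
  refine exists_farApart_of_decay (T := singleLayer a η 0) (W := W)
    (m := normalPairing a) (ν := normalDensity a) (e := normalDensity a)
    (A := singleLayer a η) (S := interaction a η) (C₁ := C₁) (C₂ := C₂)
    ha hW.w_pos hC₁.le hC₂ ?_ ?_ ?_ ?_ ?_ ?_ ?_ ?_ ?_ ?_ ?_ N
  · exact hW.norm_le
  · exact hW.right_inv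
  · exact hW.left_inv
  · exact singleLayer_zero_normalDensity ha hη
  · exact hn
  · exact normalDensity_singleLayer_zero ha hη
  · exact interaction_zero
  · exact h₁
  · exact h₂
  · exact fun z hz => singleLayer_normalDensity ha hη hz
  · exact fun z hz => normalDensity_singleLayer ha hη hz

lemma stokesOperator_eq_iff {a η : ℝ} {N : ℕ} (x : Fin N → E3) (f : Fin N → SobolevNegHalf a) (g : Fin N → sobolevHalf a) :
    stokesOperator a η x f = g ↔ ∀ i, singleLayer a η 0 (f i) +
      couplingSum (fun i j => singleLayer a η (x i - x j)) f i = g i := by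
  rw [funext_iff]
  exact forall_congr' fun i => by rw [stokesOperator_apply]

section FarApart

variable {a : ℝ} (ha : 0 < a) {η : ℝ} (hη : 0 < η) {W : sobolevHalf a →L[ℝ] SobolevNegHalf a} {w C : ℝ}
  (hW : IsBallInverse a η W w) {N : ℕ} {x : Fin N → E3}
  (hx : FarApart (singleLayer a η 0) W (normalPairing a) (normalDensity a) (normalDensity a)
    (singleLayer a η) (interaction a η) w C x)

include hx

lemma FarApart.norm_stokesOperator_sub_le (f : Fin N → SobolevNegHalf a) (hC : 0 ≤ C) (i : Fin N) :
    ‖stokesOperator a η x f i - (singleLayer a η 0 (f i) +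
      ∑ j ∈ Finset.univ.erase i, interaction a η (x i - x j) (f j))‖ ≤
      N * C * (minDist x ^ 2)⁻¹ * ‖f‖ := by
  rw [stokesOperator_apply, add_sub_add_left_eq_sub, couplingSum, ← Finset.sum_sub_distrib]
  refine (norm_sum_erase_le (b := C * (minDist x ^ 2)⁻¹ * ‖f‖) i (by positivity) fun j hj =>
    (hx.approx i j hj _).trans ?_).trans_eq (by ring)
  exact mul_le_mul_of_nonneg_left (norm_le_pi_norm f j) (by positivity)

lemma FarApart.stokesOperator_eq_zero_iff (f : Fin N → SobolevNegHalf a) :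
    stokesOperator a η x f = 0 ↔ ∀ i, ∃ c : ℝ, f i = c • normalDensity a :=
  (stokesOperator_eq_iff x f 0).trans (hx.weak.solution_eq_zero_iff f)

/-- Injectivity and surjectivity come from the perturbation argument for `WeakCoupling`. -/
lemma FarApart.bijOn : BijOn (stokesOperator a η x) {f | ∀ i, f i ∈ normalized a} {g | ∀ i, g i ∈ fluxFree a} := by
  refine ⟨fun f _ i => ?_, fun f hf f' hf' he => ?_, fun g hg => ?_⟩
  · have h1 := hx.weak.flux (f i)
    have h2 := hx.weak.flux_couplingSum f i
    have h3 : normalDensity a (singleLayer a η 0 (f i) +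
        couplingSum (fun i j => singleLayer a η (x i - x j)) f i) = 0 := by
      rw [map_add, h1, h2, add_zero]
    exact (congrArg (normalDensity a) (stokesOperator_apply x f i)).trans h3
  · have h0 : stokesOperator a η x (f - f') = 0 := by rw [map_sub, he, sub_self]
    refine sub_eq_zero.1 (hx.weak.eq_zero_of_solution (fun i => ?_)
      ((stokesOperator_eq_iff x (f - f') 0).1 h0))
    exact (map_sub (normalPairing a) (f i) (f' i)).trans (by
      rw [show normalPairing a (f i) = 0 from hf i, show normalPairing a (f' i) = 0 from hf' i, sub_zero])
  · obtain ⟨f, h1, h2⟩ := hx.weak.exists_solution hg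
    exact ⟨f, h1, (stokesOperator_eq_iff x f g).2 h2⟩

lemma FarApart.stokesOperatorInv_spec {g : Fin N → sobolevHalf a} (hg : ∀ i, g i ∈ fluxFree a) :
    (∀ i, normalPairing a (stokesOperatorInv a η x g i) = 0) ∧
      ∀ i, singleLayer a η 0 (stokesOperatorInv a η x g i) +
        couplingSum (fun i j => singleLayer a η (x i - x j)) (stokesOperatorInv a η x g) i = g i :=
  ⟨Function.invFunOn_mem (hx.bijOn.surjOn hg),
    (stokesOperator_eq_iff x _ g).1 (Function.invFunOn_eq (hx.bijOn.surjOn hg))⟩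

lemma FarApart.norm_stokesOperatorInv_le {g : Fin N → sobolevHalf a} (hg : ∀ i, g i ∈ fluxFree a) :
    ‖stokesOperatorInv a η x g‖ ≤ 2 * w * ‖g‖ :=
  hx.weak.norm_solution_le (hx.stokesOperatorInv_spec hg).1 (hx.stokesOperatorInv_spec hg).2

/-- The inverse to first order in the interactions: the first iterate of the fixed point equation,
with each coupling replaced by its far field. -/
lemma FarApart.norm_stokesOperatorInv_sub_le (hC : 0 ≤ C) {g : Fin N → sobolevHalf a}
    (hg : ∀ i, g i ∈ fluxFree a) (i : Fin N) :
    ‖stokesOperatorInv a η x g i - W (g i -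
      ∑ j ∈ Finset.univ.erase i, interaction a η (x i - x j) (W (g j)))‖ ≤
      2 * w ^ 2 * N * (C + w * N * C ^ 2) * (minDist x ^ 2)⁻¹ * ‖g‖ := by
  refine (hx.weak.norm_solution_sub_le (hx.stokesOperatorInv_spec hg).1 (hx.stokesOperatorInv_spec hg).2
    (S := fun i j => interaction a η (x i - x j)) (by positivity) hx.approx hx.lipschitz i).trans_eq ?_
  rw [mul_pow, inv_pow]
  ring

end FarApart

end

noncomputable section

section RigidMotions

variable {a : ℝ} (ha : 0 < a) {η : ℝ} (hη : 0 < η) {W : sobolevHalf a →L[ℝ] SobolevNegHalf a} {w : ℝ}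
  (hW : IsBallInverse a η W w) {N : ℕ}

include ha hη hW

lemma IsBallInverse.force_rigidField (u ω : E3) :
    force (W (rigidField a u ω)) = (6 * Real.pi * η * a) • u :=
  hW.force_eq ha hη (normalDensity_rigidField ha u ω) fun v =>
    densityDual_constField_rigidField ha v u ω

/-- The force of the first order approximation of the inverse. -/
lemma IsBallInverse.force_first_order (x : Fin N → E3) (u ω : Fin N → E3) (i : Fin N) :
    force (W (rigidField a (u i) (ω i) -
      ∑ j ∈ Finset.univ.erase i, interaction a η (x i - x j) (W (rigidField a (u j) (ω j))))) =
      (6 * Real.pi * η * a) • (u i - (3 * a / 4) •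
        ∑ j ∈ Finset.univ.erase i, pairTensor (x i - x j) (u j)) := by
  obtain ⟨s, hs⟩ : ∃ s, s = ∑ j ∈ Finset.univ.erase i, pairTensor (x i - x j) (u j) := ⟨_, rfl⟩
  have h1 : ∑ j ∈ Finset.univ.erase i, interaction a η (x i - x j) (W (rigidField a (u j) (ω j))) =
      constField a ((3 * a / 4) • s) := by
    rw [sum_interaction x (fun j => W (rigidField a (u j) (ω j))) i]
    congr 1
    have h2 : ∀ j, pairTensor (x i - x j) (force (W (rigidField a (u j) (ω j)))) =
        (6 * Real.pi * η * a) • pairTensor (x i - x j) (u j) := fun j => by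
      rw [hW.force_rigidField ha hη, pairTensor_smul]
    rw [Finset.sum_congr rfl fun j _ => h2 j, ← Finset.smul_sum, ← hs, smul_smul]
    congr 1
    have := Real.pi_pos
    field_simp
    norm_num
  rw [h1, ← hs]
  have h3 : rigidField a (u i) (ω i) - constField a ((3 * a / 4) • s) =
      rigidField a (u i - (3 * a / 4) • s) (ω i) := by
    rw [rigidField_eq_add, rigidField_eq_add (u i - _)]
    rw [show constField a (u i - (3 * a / 4) • s) = constField a (u i) - constField a ((3 * a / 4) • s) from
      map_sub (constFieldL a) _ _]
    abel
  rw [h3, hW.force_rigidField ha hη]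

end RigidMotions

lemma norm_rigidFields_le {a K : ℝ} {N : ℕ} (hK : 0 ≤ K)
    (hb : ∀ u ω : E3, ‖rigidField a u ω‖ ≤ K * (‖u‖ + ‖ω‖)) (u ω : Fin N → E3) :
    ‖fun j => rigidField a (u j) (ω j)‖ ≤ K * (‖u‖ + ‖ω‖) :=
  (pi_norm_le_iff_of_nonneg (by positivity)).2 fun j => (hb _ _).trans
    (mul_le_mul_of_nonneg_left (add_le_add (norm_le_pi_norm u j) (norm_le_pi_norm ω j)) hK)

section Distant

variable {a : ℝ} (ha : 0 < a) {η : ℝ} (hη : 0 < η) {W : sobolevHalf a →L[ℝ] SobolevNegHalf a} {w C : ℝ}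
  (hW : IsBallInverse a η W w) (hC : 0 ≤ C) (N : ℕ)

include ha hη hW hC

/-- The force on each ball. -/
theorem exists_norm_force_sub_le : ∃ B, 0 ≤ B ∧ ∀ x : Fin N → E3,
    FarApart (singleLayer a η 0) W (normalPairing a) (normalDensity a) (normalDensity a)
      (singleLayer a η) (interaction a η) w C x → ∀ (u ω : Fin N → E3) (i : Fin N),
      ‖force (stokesOperatorInv a η x (fun j => rigidField a (u j) (ω j)) i) -
        (6 * Real.pi * η * a) • (u i - (3 * a / 4) •
          ∑ j ∈ Finset.univ.erase i, pairTensor (x i - x j) (u j))‖ ≤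
        B * (minDist x ^ 2)⁻¹ * (‖u‖ + ‖ω‖) := by
  obtain ⟨K, hK, hb⟩ := exists_norm_rigidField_le ha
  obtain ⟨K', hK', hb'⟩ := exists_norm_force_le a
  have hw := hW.w_pos
  refine ⟨K' * (2 * w ^ 2 * N * (C + w * N * C ^ 2)) * K, by positivity, fun x hx u ω i => ?_⟩
  have hv := norm_rigidFields_le hK hb u ω
  have h1 := hx.norm_stokesOperatorInv_sub_le hC (g := fun j => rigidField a (u j) (ω j))
    (fun j => normalDensity_rigidField ha (u j) (ω j)) i
  have h2 := hb' _ |>.trans (mul_le_mul_of_nonneg_left h1 hK')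
  rw [force_sub] at h2
  have h3 := hW.force_first_order ha hη x u ω i
  refine (congrArg (fun v => ‖force (stokesOperatorInv a η x (fun j => rigidField a (u j) (ω j)) i) - v‖)
    h3).symm.trans_le (h2.trans ?_)
  calc K' * (2 * w ^ 2 * N * (C + w * N * C ^ 2) * (minDist x ^ 2)⁻¹ *
        ‖fun j => rigidField a (u j) (ω j)‖)
      ≤ K' * (2 * w ^ 2 * N * (C + w * N * C ^ 2) * (minDist x ^ 2)⁻¹ * (K * (‖u‖ + ‖ω‖))) := by
        gcongr
    _ = _ := by ring

/-- The total force. -/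
theorem exists_norm_totalForce_sub_le : ∃ B, 0 ≤ B ∧ ∀ x : Fin N → E3,
    FarApart (singleLayer a η 0) W (normalPairing a) (normalDensity a) (normalDensity a)
      (singleLayer a η) (interaction a η) w C x → ∀ u ω : Fin N → E3,
      ‖∑ i, force (stokesOperatorInv a η x (fun j => rigidField a (u j) (ω j)) i) -
        (∑ i, (6 * Real.pi * η * a) • u i - (9 * Real.pi * η * a ^ 2 / 2) •
          ∑ i, ∑ j ∈ Finset.univ.erase i, pairTensor (x i - x j) (u j))‖ ≤
        B * (minDist x ^ 2)⁻¹ * (‖u‖ + ‖ω‖) := by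
  obtain ⟨B, hB, hb⟩ := exists_norm_force_sub_le ha hη hW hC N
  refine ⟨N * B, by positivity, fun x hx u ω => ?_⟩
  obtain ⟨F, hF⟩ : ∃ F : Fin N → E3, F = fun i =>
    force (stokesOperatorInv a η x (fun j => rigidField a (u j) (ω j)) i) := ⟨_, rfl⟩
  obtain ⟨s, hs⟩ : ∃ s : Fin N → E3, s = fun i =>
    ∑ j ∈ Finset.univ.erase i, pairTensor (x i - x j) (u j) := ⟨_, rfl⟩
  have h1 : ∀ i, ‖F i - (6 * Real.pi * η * a) • (u i - (3 * a / 4) • s i)‖ ≤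
      B * (minDist x ^ 2)⁻¹ * (‖u‖ + ‖ω‖) := fun i => by
    rw [hF, hs]
    exact hb x hx u ω i
  have e : ∑ i, F i - (∑ i, (6 * Real.pi * η * a) • u i - (9 * Real.pi * η * a ^ 2 / 2) • ∑ i, s i) =
      ∑ i, (F i - (6 * Real.pi * η * a) • (u i - (3 * a / 4) • s i)) := by
    rw [Finset.sum_sub_distrib, Finset.smul_sum, ← Finset.sum_sub_distrib]
    congr 1
    refine Finset.sum_congr rfl fun i _ => ?_
    module
  have h2 : ‖∑ i, F i - (∑ i, (6 * Real.pi * η * a) • u i -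
      (9 * Real.pi * η * a ^ 2 / 2) • ∑ i, s i)‖ ≤ N * B * (minDist x ^ 2)⁻¹ * (‖u‖ + ‖ω‖) := by
    rw [e]
    refine (norm_sum_le_of_le _ fun i _ => h1 i).trans (le_of_eq ?_)
    simp
    ring
  rw [hF, hs] at h2
  exact h2

/-- The force on each ball is Stokes' drag up to terms of the order `δ⁻¹`. -/
theorem exists_norm_force_sub_drag_le : ∃ B, 0 ≤ B ∧ ∀ x : Fin N → E3,
    FarApart (singleLayer a η 0) W (normalPairing a) (normalDensity a) (normalDensity a)
      (singleLayer a η) (interaction a η) w C x → ∀ (u ω : Fin N → E3) (i : Fin N),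
      ‖force (stokesOperatorInv a η x (fun j => rigidField a (u j) (ω j)) i) -
        (6 * Real.pi * η * a) • u i‖ ≤ B * (minDist x)⁻¹ * (‖u‖ + ‖ω‖) := by
  obtain ⟨B, hB, hb⟩ := exists_norm_force_sub_le ha hη hW hC N
  have hpi := Real.pi_pos
  refine ⟨B + 6 * Real.pi * η * a * (3 * a / 4 * (N * 2)), by positivity, fun x hx u ω i => ?_⟩
  obtain ⟨F, hF⟩ : ∃ F, F = force (stokesOperatorInv a η x (fun j => rigidField a (u j) (ω j)) i) :=
    ⟨_, rfl⟩
  obtain ⟨s, hs⟩ : ∃ s : E3, s = ∑ j ∈ Finset.univ.erase i, pairTensor (x i - x j) (u j) := ⟨_, rfl⟩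
  have h1 := hb x hx u ω i
  have hδ := hx.one_le
  have hδ0 : 0 < minDist x := by linarith
  rw [← hF, ← hs] at h1
  rw [← hF]
  have h2 : ‖s‖ ≤ N * (2 * (minDist x)⁻¹ * (‖u‖ + ‖ω‖)) := by
    rw [hs]
    refine norm_sum_erase_le i (by positivity) fun j hj => (norm_pairTensor_le _ _).trans ?_
    have h3 : ‖u j‖ ≤ ‖u‖ + ‖ω‖ := (norm_le_pi_norm u j).trans (le_add_of_nonneg_right (norm_nonneg ω))
    have h4 := minDist_le x hj
    gcongr
  have h5 : B * (minDist x ^ 2)⁻¹ * (‖u‖ + ‖ω‖) ≤ B * (minDist x)⁻¹ * (‖u‖ + ‖ω‖) := by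
    have : (minDist x ^ 2)⁻¹ ≤ (minDist x)⁻¹ := inv_anti₀ hδ0 (by nlinarith)
    gcongr
  have e : F - (6 * Real.pi * η * a) • u i = F - (6 * Real.pi * η * a) • (u i - (3 * a / 4) • s) -
      (6 * Real.pi * η * a * (3 * a / 4)) • s := by module
  rw [e]
  refine (norm_sub_le _ _).trans ?_
  rw [norm_smul, Real.norm_of_nonneg (by positivity)]
  calc _ ≤ B * (minDist x)⁻¹ * (‖u‖ + ‖ω‖) +
        6 * Real.pi * η * a * (3 * a / 4) * (N * (2 * (minDist x)⁻¹ * (‖u‖ + ‖ω‖))) :=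
        add_le_add (h1.trans h5) (by gcongr)
    _ = _ := by ring

/-- The total torque. -/
theorem exists_norm_totalTorque_sub_le : ∃ B, 0 ≤ B ∧ ∀ x : Fin N → E3,
    FarApart (singleLayer a η 0) W (normalPairing a) (normalDensity a) (normalDensity a)
      (singleLayer a η) (interaction a η) w C x → ∀ u ω : Fin N → E3,
      ‖∑ i, torque (x i) (stokesOperatorInv a η x (fun j => rigidField a (u j) (ω j)) i) -
        (6 * Real.pi * η * a) • ∑ i, cross (x i) (u i)‖ ≤
        B * (1 + ‖x‖ / minDist x) * (‖u‖ + ‖ω‖) := by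
  obtain ⟨B, hB, hb⟩ := exists_norm_force_sub_drag_le ha hη hW hC N
  obtain ⟨K, hK, hk⟩ := exists_norm_rigidField_le ha
  obtain ⟨K', hK', hk'⟩ := exists_norm_torque_zero_le ha
  have hw := hW.w_pos
  refine ⟨N * (4 * B + K' * (2 * w * K)), by positivity, fun x hx u ω => ?_⟩
  have hδ := hx.one_le
  have hδ0 : 0 < minDist x := by linarith
  obtain ⟨f, hf⟩ : ∃ f, f = stokesOperatorInv a η x fun j => rigidField a (u j) (ω j) := ⟨_, rfl⟩
  have hfn : ‖f‖ ≤ 2 * w * (K * (‖u‖ + ‖ω‖)) := by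
    rw [hf]
    exact (hx.norm_stokesOperatorInv_le fun j => normalDensity_rigidField ha (u j) (ω j)).trans
      (mul_le_mul_of_nonneg_left (norm_rigidFields_le hK hk u ω) (by positivity))
  have h1 : ∀ i, ‖force (f i) - (6 * Real.pi * η * a) • u i‖ ≤
      B * (minDist x)⁻¹ * (‖u‖ + ‖ω‖) := fun i => by
    rw [hf]
    exact hb x hx u ω i
  have h2 : ∀ i, ‖torque 0 (f i)‖ ≤ K' * (2 * w * (K * (‖u‖ + ‖ω‖))) := fun i =>
    (hk' _).trans (mul_le_mul_of_nonneg_left ((norm_le_pi_norm f i).trans hfn) hK')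
  rw [← hf]
  have e : ∑ i, torque (x i) (f i) - (6 * Real.pi * η * a) • ∑ i, cross (x i) (u i) =
      ∑ i, (cross (x i) (force (f i) - (6 * Real.pi * η * a) • u i) + torque 0 (f i)) := by
    rw [Finset.smul_sum, ← Finset.sum_sub_distrib]
    refine Finset.sum_congr rfl fun i _ => ?_
    rw [torque_eq, cross_sub, cross_smul]
    abel
  rw [e]
  have h3 : ∀ i, ‖cross (x i) (force (f i) - (6 * Real.pi * η * a) • u i) + torque 0 (f i)‖ ≤
      (4 * B + K' * (2 * w * K)) * (1 + ‖x‖ / minDist x) * (‖u‖ + ‖ω‖) := fun i => by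
    have h4 : ‖cross (x i) (force (f i) - (6 * Real.pi * η * a) • u i)‖ ≤
        4 * ‖x‖ * (B * (minDist x)⁻¹ * (‖u‖ + ‖ω‖)) :=
      (norm_cross_le _ _).trans (by
        gcongr
        · exact norm_le_pi_norm x i
        · exact h1 i)
    have h5 : 0 ≤ 4 * B * (‖u‖ + ‖ω‖) + K' * (2 * w * K) * (‖x‖ / minDist x) * (‖u‖ + ‖ω‖) := by
      positivity
    calc _ ≤ _ := norm_add_le _ _
      _ ≤ 4 * ‖x‖ * (B * (minDist x)⁻¹ * (‖u‖ + ‖ω‖)) + K' * (2 * w * (K * (‖u‖ + ‖ω‖))) :=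
        add_le_add h4 (h2 i)
      _ ≤ 4 * ‖x‖ * (B * (minDist x)⁻¹ * (‖u‖ + ‖ω‖)) + K' * (2 * w * (K * (‖u‖ + ‖ω‖))) +
          (4 * B * (‖u‖ + ‖ω‖) + K' * (2 * w * K) * (‖x‖ / minDist x) * (‖u‖ + ‖ω‖)) :=
        le_add_of_nonneg_right h5
      _ = _ := by rw [div_eq_mul_inv]; ring
  refine (norm_sum_le_of_le _ fun i _ => h3 i).trans (le_of_eq ?_)
  simp
  ring

end Distant

end

noncomputable section

/-- Both forms of the first-order inverse agree: all arguments are free of flux, where `W` is the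
inverse of the single layer operator. -/
lemma IsBallInverse.singleLayerInv_first_order {a : ℝ} (ha : 0 < a) {η : ℝ} (hη : 0 < η)
    {W : sobolevHalf a →L[ℝ] SobolevNegHalf a} {w : ℝ} (hW : IsBallInverse a η W w) {N : ℕ}
    (x : Fin N → E3) {g : Fin N → sobolevHalf a} (hg : ∀ i, g i ∈ fluxFree a) (i : Fin N) :
    singleLayerInv a η (g i - constField a ((1 / (8 * Real.pi * η)) •
        ∑ j ∈ Finset.univ.erase i, pairTensor (x i - x j) (force (singleLayerInv a η (g j))))) =
      W (g i - ∑ j ∈ Finset.univ.erase i, interaction a η (x i - x j) (W (g j))) := by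
  have h1 : ∑ j ∈ Finset.univ.erase i, pairTensor (x i - x j) (force (singleLayerInv a η (g j))) =
      ∑ j ∈ Finset.univ.erase i, pairTensor (x i - x j) (force (W (g j))) :=
    Finset.sum_congr rfl fun j _ =>
      congrArg (fun f => pairTensor (x i - x j) (force f)) (hW.singleLayerInv_eq ha hη (hg j))
  obtain ⟨v, hv⟩ : ∃ v, v = (1 / (8 * Real.pi * η)) •
      ∑ j ∈ Finset.univ.erase i, pairTensor (x i - x j) (force (W (g j))) := ⟨_, rfl⟩
  have h2 : ∑ j ∈ Finset.univ.erase i, interaction a η (x i - x j) (W (g j)) = constField a v :=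
    (sum_interaction x (fun j => W (g j)) i).trans (congrArg (constField a) hv.symm)
  have h3 : g i - constField a v ∈ fluxFree a := by
    have h4 : normalDensity a (g i) = 0 := hg i
    have h5 : normalDensity a (constField a v) = 0 := constField_mem_fluxFree ha v
    exact (map_sub (normalDensity a) _ _).trans (by rw [h4, h5, sub_zero])
  rw [h1, ← hv, h2]
  exact hW.singleLayerInv_eq ha hη h3


theorem exists_inverse_and_farApart {a : ℝ} (ha : 0 < a) {η : ℝ} (hη : 0 < η) (N : ℕ) :
    ∃ W w C δ₀, IsBallInverse a η W w ∧ 0 ≤ C ∧ ∀ x : Fin N → E3, δ₀ ≤ minDist x →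
      FarApart (singleLayer a η 0) W (normalPairing a) (normalDensity a) (normalDensity a)
        (singleLayer a η) (interaction a η) w C x := by
  refine (exists_isBallInverse ha hη).elim fun W h => h.elim fun w hW => ?_
  obtain ⟨C, δ₀, hC, hfar⟩ := exists_farApart ha hη N hW
  exact ⟨W, w, C, δ₀, hW, hC, hfar⟩

end

end ShortcutInstances

end StokesBalls

open StokesBalls
theorem mainTheorem6 (N : ℕ) (hN : 2 ≤ N) (a η : ℝ) (ha : 0 < a) (hη : 0 < η) :
    -- the operators `f ↦ ⟨f, G(z + r - ·)⟩` are well defined and continuous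
    (∀ z : E3, z = 0 ∨ 2 * a < ‖z‖ → IsSingleLayer a η z (singleLayer a η z)) ∧
    -- expansion of `T_x`
    (∃ C δ₀ : ℝ, ∀ x ∈ configurations a N, δ₀ ≤ minDist x →
      ∀ (f : Fin N → SobolevNegHalf a) (i : Fin N),
        ‖stokesOperator a η x f i - (singleLayer a η 0 (f i) +
            constField a ((1 / (8 * Real.pi * η)) •
              ∑ j ∈ Finset.univ.erase i, pairTensor (x i - x j) (force (f j))))‖
          ≤ C * (minDist x ^ 2)⁻¹ * ‖f‖) ∧
    -- the inverse of the operator of a single ball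
    ((∀ f : SobolevNegHalf a, singleLayer a η 0 f = 0 ↔ ∃ c : ℝ, f = c • normalDensity a) ∧
      Set.BijOn (singleLayer a η 0) (normalized a) (fluxFree a)) ∧
    (∃ C δ₀ : ℝ, ∀ x ∈ configurations a N, δ₀ ≤ minDist x →
      -- the inverse of `T_x`
      ((∀ f : Fin N → SobolevNegHalf a, stokesOperator a η x f = 0 ↔
          ∀ i, ∃ c : ℝ, f i = c • normalDensity a) ∧
        Set.BijOn (stokesOperator a η x) {f | ∀ i, f i ∈ normalized a}
          {g | ∀ i, g i ∈ fluxFree a}) ∧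
      -- expansion of the inverse of `T_x`
      (∀ g : Fin N → sobolevHalf a, (∀ i, g i ∈ fluxFree a) → ∀ i : Fin N,
        ‖stokesOperatorInv a η x g i - singleLayerInv a η (g i -
            constField a ((1 / (8 * Real.pi * η)) •
              ∑ j ∈ Finset.univ.erase i,
                pairTensor (x i - x j) (force (singleLayerInv a η (g j)))))‖
          ≤ C * (minDist x ^ 2)⁻¹ * ‖g‖) ∧
      -- expansions of the total force and of the total torque for rigid motions of the balls
      (∀ u ω : Fin N → E3,
        ‖∑ i, force (stokesOperatorInv a η x (fun j => rigidField a (u j) (ω j)) i) -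
            (∑ i, (6 * Real.pi * η * a) • u i -
              (9 * Real.pi * η * a ^ 2 / 2) •
                ∑ i, ∑ j ∈ Finset.univ.erase i, pairTensor (x i - x j) (u j))‖
          ≤ C * (minDist x ^ 2)⁻¹ * (‖u‖ + ‖ω‖) ∧
        ‖∑ i, torque (x i) (stokesOperatorInv a η x (fun j => rigidField a (u j) (ω j)) i) -
            (6 * Real.pi * η * a) • ∑ i, cross (x i) (u i)‖
          ≤ C * (1 + ‖x‖ / minDist x) * (‖u‖ + ‖ω‖))) := by
  refine (exists_inverse_and_farApart ha hη N).elim fun W h => ?_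
  obtain ⟨w, C, δ₀, hW, hC, hfar⟩ := h
  refine ⟨?_, ?_, ?_, ?_⟩
  · rintro z (rfl | hz)
    · exact (singleLayer_zero_spec ha hη).1
    · exact (exists_singleLayer_pairing ha hη hz).1
  · refine ⟨N * C, δ₀, fun x _ hx f i => ?_⟩
    rw [← sum_interaction]
    exact (hfar x hx).norm_stokesOperator_sub_le f hC i
  · exact ⟨hW.singleLayer_eq_zero_iff ha hη, hW.bijOn ha hη⟩
  · refine (exists_norm_totalForce_sub_le ha hη hW hC N).elim fun B₁ h₁ => ?_
    refine (exists_norm_totalTorque_sub_le ha hη hW hC N).elim fun B₂ h₂ => ?_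
    have hw := hW.w_pos
    have hB₃ : 0 ≤ 2 * w ^ 2 * N * (C + w * N * C ^ 2) := by positivity
    refine ⟨B₁ + B₂ + 2 * w ^ 2 * N * (C + w * N * C ^ 2), δ₀, fun x _ hx => ?_⟩
    have hδ := (hfar x hx).one_le
    have hδ0 : 0 ≤ minDist x := by linarith
    have hB₁ := h₁.1
    have hB₂ := h₂.1
    refine ⟨⟨(hfar x hx).stokesOperator_eq_zero_iff, (hfar x hx).bijOn⟩, fun g hg i => ?_,
      fun u ω => ⟨?_, ?_⟩⟩
    · rw [hW.singleLayerInv_first_order ha hη x hg i]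
      refine ((hfar x hx).norm_stokesOperatorInv_sub_le hC hg i).trans ?_
      gcongr
      linarith
    · refine (h₁.2 x (hfar x hx) u ω).trans ?_
      gcongr
      linarith
    · refine (h₂.2 x (hfar x hx) u ω).trans ?_
      gcongr
      linarith
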